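/- **Setting.** A sender ($S$) and a receiver ($R$) with common discount factor $\delta\in[0,1)$ play an infinitely repeated game with public monitoring of all actions. In each period: (i) ex-ante payments are made; (ii) the sender privately observes a state $\theta\in[0,1]$, drawn independently each period from a distribution $F$ with a strictly positive density $f$, sends a message and makes an interim payment; (iii) the receiver makes an interim payment and chooses a decision $d\in\mathbb R$; (iv) ex-post payments are made. In each payment round the sender moves before the receiver, and each player chooses a nonnegative gross transfer to the other player and a nonnegative amount of money to burn. Payoffs from the decision are $u_R(d,\theta)=c((a\theta+b)d-d^2/2)$ and $u_S=u-u_R$ with $u(d,\theta)=\theta d-d^2/2$, where $c\in(0,1]$, $a\in(0,1/c)$, $b\in\mathbb R$; net payments are subtracted. Thus $\rho_R(\theta)=a\theta+b$ is the receiver's preferred and $\rho_{FB}(\theta)=\theta$ the first-best decision. An equilibrium is a pure-strategy perfect Bayesian equilibrium (with measurable, public strategies whose payments and decisions are uniformly bounded over all histories); let $V$ be the set of equilibrium payoff vectors, $\overline v=\sup_V (v_S+v_R)$, $\underline v_i=\inf_V v_i$ and $L=\frac{\delta}{1-\delta}(\overline v-\underline v_S-\underline v_R)\in[0,\infty]$.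 A decision $d$ is enforceable at mean state $x$ if $u_R(\rho_R(x),x)-u_R(d,x)\le L$; $u_*(x)$ is the maximum of $u(d,x)$ over enforceable $d$; the set of extreme states is $X=\{\theta\in[0,1]:\rho_{FB}(\theta)\text{ is not enforceable at }\theta\}$. A relatively open $P\subset[0,1]$ is identified with the monotone message rule that pools each component (maximal interval) of $P$ into one message and separates all other states; $P$ is an *optimal pooling set* if it maximizes $\mathbb E[u_*(m_P(\theta))]$, where $m_P(\theta)$ is the posterior mean of the state induced in state $\theta$. "$P_*=A$" means that $A$ is optimal and is the only optimal pooling set up to the two end states $0,1$. **Proposition 7.** Suppose the receiver is highly responsive, $\rho_R'>2\rho_{FB}'$ (that is, $a>2$), and $\rho_R(\theta_0)=\rho_{FB}(\theta_0)$ for some $\theta_0\in[1/2,1)$. There are $\delta^A,\delta^B\in(0,1)$ with $\delta^A\ge\delta^B$, with equality if and only if $\theta_0=1/2$, such that $X=\emptyset$ if $\delta\in(\delta^A,1)$; $X=[0,\theta^L)$ for some $\theta^L\in(0,1)$ if $\delta\in(\delta^B,\delta^A)$; and $X=[0,\theta^L)\cup(\theta^H,1]$ for some $\theta^L<\theta^H$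 in $(0,1)$ if $\delta\in(0,\delta^B)$. There are $\delta_*^B,\delta_*^C,\delta_*^D\in(0,1)$ with either $\delta^B\le\delta_*^D=\delta_*^C=\delta_*^B<\delta^A$ or $\delta_*^D<\delta_*^C<\delta_*^B=\delta^B$ such that $$P_*=\begin{cases}\emptyset,&\delta\in(\delta^A,1),\\ [0,\theta_*^L)\text{ with }\theta_*^L\in(\theta^L,1),&\delta\in(\delta_*^B,\delta^A),\\ [0,\theta_*^L)\cup(\theta_*^H,1]\text{ with }\theta_*^L<\theta_*^H\text{ in }(\theta^L,\theta^H),&\delta\in(\delta_*^C,\delta_*^B),\\ [0,1],&\delta\in[0,\delta_*^D),\end{cases}$$ while for $\delta\in(\delta_*^D,\delta_*^C)$ an optimal pooling set of the form $[0,\theta_*^M)\cup(\theta_*^M,1]$ with $\theta_*^M\in(0,1)$ exists and, up to the end states, every optimal pooling set has this form. If $\delta_*^C<\delta_*^B<\delta^A$, then also $P_*=[0,\theta_*^L)$ at $\delta=\delta_*^B$. Further, $\theta_*^L$ is strictly decreasing in $\delta$ on $(\delta_*^C,\delta^A)$ and $\theta_*^H$ is strictly increasing in $\delta$ on $(\delta_*^C,\delta_*^B)$.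 If $f$ is bounded (in particular, if it is continuous), then moreover $$\limsup_{\delta'\to\delta}\frac{\theta_*^L(\delta')-\theta_*^L(\delta)}{\delta'-\delta}<0\ \text{ on }(\delta_*^C,\delta^A),\qquad \liminf_{\delta'\to\delta}\frac{\theta_*^H(\delta')-\theta_*^H(\delta)}{\delta'-\delta}>0\ \text{ on }(\delta_*^C,\delta_*^B),$$ so that $d\theta_*^L/d\delta<0$ and $d\theta_*^H/d\delta>0$ wherever these derivatives exist. Finally, if $F$ is uniform and $\theta_0=1/2$, then $\theta_*^M=1/2$ for all $\delta\in(\delta_*^D,\delta_*^C)$, so that the change to complete pooling at $\delta_*^D$ is discontinuous. -/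

import Mathlib

open MeasureTheory ProbabilityTheory Set Filter Topology
open scoped NNReal ENNReal

namespace RelComm

noncomputable section

/-! ### Primitives: quadratic payoffs and the prior -/

/-- The quadratic environment.  The receiver's payoff is `c ((a θ + b) d - d² / 2)`, the joint
payoff is `θ d - d² / 2`, and the state has a strictly positive density `f` on `[0,1]`. -/
structure Environment where
  a : ℝ
  b : ℝ
  c : ℝ
  f : ℝ → ℝ
  c_pos : 0 < c
  c_le_one : c ≤ 1
  a_pos : 0 < a
  a_lt : a < 1 / c
  f_meas : Measurable f
  f_pos : ∀ θ ∈ Icc (0 : ℝ) 1, 0 < f θ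
  f_integral : ∫ θ in Icc (0 : ℝ) 1, f θ = 1

inductive Player
  | sender
  | receiver

variable (E : Environment) (δ : ℝ)

/-- Prior distribution of the state: density `f` on `[0,1]`. -/
def Environment.prior : Measure ℝ :=
  volume.withDensity fun θ => ENNReal.ofReal ((Icc (0 : ℝ) 1).indicator E.f θ)

/-- The receiver's payoff. -/
def Environment.uR (d θ : ℝ) : ℝ := E.c * ((E.a * θ + E.b) * d - d ^ 2 / 2)

/-- The joint payoff. -/
def Environment.u (_ : Environment) (d θ : ℝ) : ℝ := θ * d - d ^ 2 / 2

/-- The sender's payoff. -/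
def Environment.uS (d θ : ℝ) : ℝ := E.u d θ - E.uR d θ

/-- Stage payoff from the decision, by player. -/
def Environment.util : Player → ℝ → ℝ → ℝ
  | .sender => E.uS
  | .receiver => E.uR

/-- The receiver's preferred decision, the maximizer of `d ↦ uR d θ`. -/
def Environment.prefR (θ : ℝ) : ℝ := E.a * θ + E.b

/-- The first-best decision, the maximizer of `d ↦ u d θ`. -/
def Environment.prefFB (_ : Environment) (θ : ℝ) : ℝ := θ

theorem Environment.uR_le_prefR (d θ : ℝ) : E.uR d θ ≤ E.uR (E.prefR θ) θ := by
  have h : E.uR (E.prefR θ) θ - E.uR d θ = E.c * (d - E.prefR θ) ^ 2 / 2 := by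
    simp only [Environment.uR, Environment.prefR]; ring
  have := mul_nonneg E.c_pos.le (sq_nonneg (d - E.prefR θ))
  linarith

theorem Environment.u_le_prefFB (d θ : ℝ) : E.u d θ ≤ E.u (E.prefFB θ) θ := by
  simp only [Environment.u, Environment.prefFB]
  nlinarith [sq_nonneg (d - θ)]

/-- The receiver is highly responsive: `ρ_R' > 2 ρ_FB'`. -/
def Environment.HighlyResponsive : Prop :=
  ∀ θ ∈ Icc (0 : ℝ) 1, 2 * deriv E.prefFB θ < deriv E.prefR θ

/-! ### The repeated game -/

/-- A payment made by one player in one round: a gross transfer to the other player and an amount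
of money burned. -/
abbrev Pay := ℝ≥0 × ℝ≥0

/-- What the sender does in the interim round: a message (a label; it is identified with the set
of states that induce it) and a payment. -/
abbrev Signal := ℝ × Pay

/-- Public record of one period: ex-ante payments (sender, receiver), the sender's signal, the
receiver's interim payment, the decision, ex-post payments (sender, receiver). -/
abbrev Record := (Pay × Pay) × Signal × Pay × ℝ × (Pay × Pay)

/-- Public histories of length `n`. -/
abbrev Hist (n : ℕ) := Fin n → Record

/-- Pure strategies of the sender.  At every public history they are measurable, and actions
are uniformly bounded over histories (the bound depends on the strategy). -/
structure SenderStrategy where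
  exAnte : ∀ n, Hist n → Pay
  signal : ∀ n, Hist n × (Pay × Pay) × ℝ → Signal
  exPost : ∀ n, Hist n × (Pay × Pay) × Signal × Pay × ℝ → Pay
  exAnte_meas : ∀ n, Measurable (exAnte n)
  signal_meas : ∀ n, Measurable (signal n)
  exPost_meas : ∀ n, Measurable (exPost n)
  bounded : ∃ K : ℝ≥0, (∀ n z, exAnte n z ≤ (K, K)) ∧ (∀ n z, (signal n z).2 ≤ (K, K)) ∧
    (∀ n z, exPost n z ≤ (K, K))

/-- Pure strategies of the receiver; in each round the receiver moves after having seen the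
sender's move. -/
structure ReceiverStrategy where
  exAnte : ∀ n, Hist n × Pay → Pay
  interim : ∀ n, Hist n × (Pay × Pay) × Signal → Pay
  decision : ∀ n, Hist n × (Pay × Pay) × Signal × Pay → ℝ
  exPost : ∀ n, Hist n × (Pay × Pay) × Signal × Pay × ℝ × Pay → Pay
  exAnte_meas : ∀ n, Measurable (exAnte n)
  interim_meas : ∀ n, Measurable (interim n)
  decision_meas : ∀ n, Measurable (decision n)
  exPost_meas : ∀ n, Measurable (exPost n)
  bounded : ∃ K : ℝ≥0, (∀ n z, exAnte n z ≤ (K, K)) ∧ (∀ n z, interim n z ≤ (K, K)) ∧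
    (∀ n z, |decision n z| ≤ K) ∧ (∀ n z, exPost n z ≤ (K, K))

/-- A pure strategy profile. -/
structure Profile where
  S : SenderStrategy
  R : ReceiverStrategy

namespace Profile

variable (σ : Profile) {n : ℕ} (h : Hist n)

/-! How the current period is completed under `σ` from each of its decision nodes. -/

/-- The receiver's ex-post payment is still to be made. -/
def fromExPostR (x : Pay × Pay) (s : Signal) (r : Pay) (d : ℝ) (p : Pay) : Record :=
  (x, s, r, d, (p, σ.R.exPost n (h, x, s, r, d, p)))

/-- The decision has just been made. -/
def fromExPostS (x : Pay × Pay) (s : Signal) (r : Pay) (d : ℝ) : Record :=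
  σ.fromExPostR h x s r d (σ.S.exPost n (h, x, s, r, d))

/-- The receiver has just made her interim payment. -/
def fromDecision (x : Pay × Pay) (s : Signal) (r : Pay) : Record :=
  σ.fromExPostS h x s r (σ.R.decision n (h, x, s, r))

/-- The sender has just sent his signal. -/
def fromInterimR (x : Pay × Pay) (s : Signal) : Record :=
  σ.fromDecision h x s (σ.R.interim n (h, x, s))

/-- The sender has just observed the state `θ`. -/
def fromSignal (x : Pay × Pay) (θ : ℝ) : Record :=
  σ.fromInterimR h x (σ.S.signal n (h, x, θ))

/-- The sender has just made his ex-ante payment `p`; the state will be `θ`. -/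
def fromExAnteR (p : Pay) (θ : ℝ) : Record :=
  σ.fromSignal h (p, σ.R.exAnte n (h, p)) θ

/-- The whole period, when the state is `θ`. -/
def period (θ : ℝ) : Record :=
  σ.fromExAnteR h (σ.S.exAnte n h) θ

end Profile

/-- Net transfer of a player in a round in which he or she makes the payment `own` and the other
player makes the payment `other`. -/
def net (own other : Pay) : ℝ := own.1 + own.2 - other.1

/-- Sum of a player's net transfers over the three rounds of a period. -/
def netTotal : Player → Record → ℝ
  | .sender, (x, s, r, _, y) => net x.1 x.2 + net s.2 r + net y.1 y.2
  | .receiver, (x, s, r, _, y) => net x.2 x.1 + net r s.2 + net y.2 y.1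

/-- Stage game payoff. -/
def stagePayoff (i : Player) (θ : ℝ) (r : Record) : ℝ :=
  E.util i r.2.2.2.1 θ - netTotal i r

/-- The history `h` followed by one more period. -/
def extend {n : ℕ} (h : Hist n) (r : Record) : Hist (n + 1) :=
  Fin.snoc (α := fun _ => Record) h r

/-- Expected stage payoff `k` periods after the history `h`, states being independent draws from
the prior. -/
def expStage (σ : Profile) (i : Player) : ℕ → (n : ℕ) → Hist n → ℝ
  | 0, _, h => ∫ θ, stagePayoff E i θ (σ.period h θ) ∂E.prior
  | k + 1, n, h => ∫ θ, expStage σ i k (n + 1) (extend h (σ.period h θ)) ∂E.prior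

/-- Expected average discounted payoff of player `i` from the history `h` on. -/
def value (σ : Profile) (i : Player) {n : ℕ} (h : Hist n) : ℝ :=
  (1 - δ) * ∑' k : ℕ, δ ^ k * expStage E σ i k n h

/-- Payoff of player `i` when the current state is `θ`, the current period is completed as in `r`,
and `σ` is played from the next period on. -/
def nodeValue (σ : Profile) (i : Player) {n : ℕ} (h : Hist n) (θ : ℝ) (r : Record) : ℝ :=
  (1 - δ) * stagePayoff E i θ r + δ * value E δ σ i (extend h r)

/-- The receiver's beliefs about the current state after each signal. -/
abbrev Beliefs := ∀ n, Hist n → Pay × Pay → Kernel Signal ℝ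

/-- Beliefs are probability measures on `[0,1]`; at every public history they are a conditional
distribution of the state given the signal under the prescribed signal rule, and a signal that
this rule sends in some state is believed to come from a state that sends it. -/
structure Consistent (σ : Profile) (β : Beliefs) : Prop where
  prob : ∀ n h x s, IsProbabilityMeasure (β n h x s)
  support : ∀ n h x s, β n h x s (Icc 0 1) = 1
  bayes : ∀ n h x,
    E.prior.map (fun θ => (σ.S.signal n (h, x, θ), θ)) =
      (E.prior.map fun θ => σ.S.signal n (h, x, θ)).compProd (β n h x)
  fiber : ∀ n h x, ∀ θ ∈ Icc (0 : ℝ) 1,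
    β n h x (σ.S.signal n (h, x, θ))
      {θ' | θ' ∈ Icc (0 : ℝ) 1 ∧ σ.S.signal n (h, x, θ') = σ.S.signal n (h, x, θ)} = 1

/-- Pure-strategy perfect Bayesian equilibrium: beliefs are consistent, and at every node, on or
off the path, no strategy of the player who moves there does better than the prescribed one. -/
structure IsPBE (σ : Profile) (β : Beliefs) : Prop where
  consistent : Consistent E σ β
  sender_exAnte : ∀ n (h : Hist n) (S' : SenderStrategy),
    value E δ ⟨S', σ.R⟩ .sender h ≤ value E δ σ .sender h
  receiver_exAnte : ∀ n (h : Hist n) (p : Pay) (R' : ReceiverStrategy),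
    ∫ θ, nodeValue E δ ⟨σ.S, R'⟩ .receiver h θ (Profile.fromExAnteR ⟨σ.S, R'⟩ h p θ) ∂E.prior
      ≤ ∫ θ, nodeValue E δ σ .receiver h θ (σ.fromExAnteR h p θ) ∂E.prior
  sender_signal : ∀ n (h : Hist n) (x : Pay × Pay) (S' : SenderStrategy), ∀ θ ∈ Icc (0 : ℝ) 1,
    nodeValue E δ ⟨S', σ.R⟩ .sender h θ (Profile.fromSignal ⟨S', σ.R⟩ h x θ)
      ≤ nodeValue E δ σ .sender h θ (σ.fromSignal h x θ)
  receiver_interim : ∀ n (h : Hist n) (x : Pay × Pay) (s : Signal) (R' : ReceiverStrategy),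
    ∫ θ, nodeValue E δ ⟨σ.S, R'⟩ .receiver h θ (Profile.fromInterimR ⟨σ.S, R'⟩ h x s) ∂(β n h x s)
      ≤ ∫ θ, nodeValue E δ σ .receiver h θ (σ.fromInterimR h x s) ∂(β n h x s)
  receiver_decision : ∀ n (h : Hist n) (x : Pay × Pay) (s : Signal) (r : Pay)
      (R' : ReceiverStrategy),
    ∫ θ, nodeValue E δ ⟨σ.S, R'⟩ .receiver h θ (Profile.fromDecision ⟨σ.S, R'⟩ h x s r)
        ∂(β n h x s)
      ≤ ∫ θ, nodeValue E δ σ .receiver h θ (σ.fromDecision h x s r) ∂(β n h x s)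
  sender_exPost : ∀ n (h : Hist n) (x : Pay × Pay) (s : Signal) (r : Pay) (d : ℝ)
      (S' : SenderStrategy), ∀ θ ∈ Icc (0 : ℝ) 1,
    nodeValue E δ ⟨S', σ.R⟩ .sender h θ (Profile.fromExPostS ⟨S', σ.R⟩ h x s r d)
      ≤ nodeValue E δ σ .sender h θ (σ.fromExPostS h x s r d)
  receiver_exPost : ∀ n (h : Hist n) (x : Pay × Pay) (s : Signal) (r : Pay) (d : ℝ) (p : Pay)
      (R' : ReceiverStrategy),
    ∫ θ, nodeValue E δ ⟨σ.S, R'⟩ .receiver h θ (Profile.fromExPostR ⟨σ.S, R'⟩ h x s r d p)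
        ∂(β n h x s)
      ≤ ∫ θ, nodeValue E δ σ .receiver h θ (σ.fromExPostR h x s r d p) ∂(β n h x s)

/-- The set `V` of equilibrium payoff vectors `(v_S, v_R)`. -/
def equilibriumPayoffs : Set (ℝ × ℝ) :=
  {v | ∃ σ β, IsPBE E δ σ β ∧
    v = (value E δ σ .sender (Fin.elim0 : Hist 0), value E δ σ .receiver (Fin.elim0 : Hist 0))}

/-- The best equilibrium joint payoff. -/
def bestJoint : EReal := ⨆ v ∈ equilibriumPayoffs E δ, ((v.1 + v.2 : ℝ) : EReal)

/-- The sender's worst equilibrium payoff (`⊥` if there is no lower bound). -/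
def worstSender : EReal := ⨅ v ∈ equilibriumPayoffs E δ, ((v.1 : ℝ) : EReal)

/-- The receiver's worst equilibrium payoff. -/
def worstReceiver : EReal := ⨅ v ∈ equilibriumPayoffs E δ, ((v.2 : ℝ) : EReal)

/-- The discounted surplus `L = δ / (1 - δ) * (v̄ - v_S - v_R)`. -/
def surplus : EReal :=
  ((δ / (1 - δ) : ℝ) : EReal) * (bestJoint E δ - worstSender E δ - worstReceiver E δ)

/-! ### Second-best decisions, extreme states, optimal pooling sets -/

/-- The receiver's temptation to deviate from `d` when the (mean) state is `x`. -/
def Environment.temptation (d x : ℝ) : ℝ := E.uR (E.prefR x) x - E.uR d x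

/-- The decision `d` is enforceable when the (mean) state is `x`. -/
def Enforceable (d x : ℝ) : Prop := (E.temptation d x : EReal) ≤ surplus E δ

/-- The joint payoff under the second-best decision when the posterior mean is `x`: the maximal
joint payoff over enforceable decisions. -/
def uStar (x : ℝ) : ℝ := sSup {y | ∃ d, Enforceable E δ d x ∧ y = E.u d x}

/-- The set `X` of extreme states: the first-best decision is not enforceable. -/
def extremeStates : Set ℝ := {θ | θ ∈ Icc (0 : ℝ) 1 ∧ ¬ Enforceable E δ (E.prefFB θ) θ}

/-- Pooling sets are the (relatively) open subsets of `[0,1]`. -/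
def IsPoolingSet (P : Set ℝ) : Prop := ∃ U : Set ℝ, IsOpen U ∧ P = U ∩ Icc 0 1

/-- The posterior mean in state `θ` under the monotone message rule with pooling set `P`: states
outside `P` are separated, and every component (maximal interval) of `P` is one message. -/
def Environment.postMean (P : Set ℝ) (θ : ℝ) : ℝ :=
  open Classical in
  if θ ∈ P then
    (∫ t in connectedComponentIn P θ, t ∂E.prior) / E.prior.real (connectedComponentIn P θ)
  else θ

/-- Expected joint payoff under the message rule with pooling set `P`. -/
def poolingPayoff (P : Set ℝ) : ℝ := ∫ θ, uStar E δ (E.postMean P θ) ∂E.prior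

/-- `P` is an optimal pooling set. -/
def IsOptimalPooling (P : Set ℝ) : Prop :=
  IsPoolingSet P ∧ ∀ Q, IsPoolingSet Q → poolingPayoff E δ Q ≤ poolingPayoff E δ P

/-- `P` is the optimal pooling set: it is optimal, and every optimal pooling set agrees with it
except possibly at the two (null) end states `0` and `1`. -/
def IsTheOptimalPooling (P : Set ℝ) : Prop :=
  IsOptimalPooling E δ P ∧ ∀ Q, IsOptimalPooling E δ Q → Q ∩ Ioo 0 1 = P ∩ Ioo 0 1

end

end RelComm

namespace RelComm

/-! ### The prior -/

section Prior

variable (E : Environment)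

theorem integrable_density : IntegrableOn E.f (Icc 0 1) := by
  by_contra h
  have := E.f_integral
  rw [integral_undef h] at this
  norm_num at this

instance isProbabilityMeasure_prior : IsProbabilityMeasure E.prior := by
  constructor
  have hnn : 0 ≤ᵐ[volume.restrict (Icc (0:ℝ) 1)] E.f :=
    (ae_restrict_iff' measurableSet_Icc).2 (ae_of_all _ fun x hx => (E.f_pos x hx).le)
  rw [Environment.prior, withDensity_apply _ MeasurableSet.univ, Measure.restrict_univ]
  have : (fun θ => ENNReal.ofReal ((Icc (0 : ℝ) 1).indicator E.f θ))
      = (Icc (0 : ℝ) 1).indicator fun θ => ENNReal.ofReal (E.f θ) := by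
    funext θ
    by_cases h : θ ∈ Icc (0 : ℝ) 1 <;> simp [h]
  rw [this, lintegral_indicator measurableSet_Icc,
    ← ofReal_integral_eq_lintegral_ofReal (integrable_density E) hnn, E.f_integral]
  simp

theorem prior_abs : E.prior ≪ volume := withDensity_absolutelyContinuous _ _

instance nullSingleton_prior : NullSingletonClass E.prior :=
  ⟨fun _ => prior_abs E (measure_singleton _)⟩

theorem density_meas :
    Measurable fun θ => ENNReal.ofReal ((Icc (0 : ℝ) 1).indicator E.f θ) :=
  (E.f_meas.indicator measurableSet_Icc).ennreal_ofReal

theorem prior_compl : E.prior (Icc 0 1)ᶜ = 0 := by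
  rw [Environment.prior, withDensity_apply _ measurableSet_Icc.compl,
    lintegral_eq_zero_iff (density_meas E)]
  refine (ae_restrict_iff' measurableSet_Icc.compl).2 (ae_of_all _ fun x hx => ?_)
  simp [indicator_of_notMem hx]

theorem ae_mem : ∀ᵐ θ ∂E.prior, θ ∈ Icc (0:ℝ) 1 := by
  rw [ae_iff]
  exact prior_compl E

theorem ae_mem_Ioo : ∀ᵐ θ ∂E.prior, θ ∈ Ioo (0:ℝ) 1 := by
  have h0 : ∀ᵐ θ ∂E.prior, θ ≠ 0 := by simp [ae_iff]
  have h1 : ∀ᵐ θ ∂E.prior, θ ≠ 1 := by simp [ae_iff]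
  filter_upwards [ae_mem E, h0, h1] with θ h a b
  exact ⟨lt_of_le_of_ne h.1 (Ne.symm a), lt_of_le_of_ne h.2 b⟩

theorem prior_Icc : E.prior (Icc 0 1) = 1 := by
  rw [prob_compl_eq_zero_iff measurableSet_Icc |>.symm]; exact prior_compl E

theorem prior_Ioo_pos {x y : ℝ} (hx : 0 ≤ x) (hxy : x < y) (hy : y ≤ 1) :
    0 < E.prior (Ioo x y) := by
  rw [pos_iff_ne_zero, Environment.prior, withDensity_apply _ measurableSet_Ioo]
  intro h
  rw [lintegral_eq_zero_iff (density_meas E), Filter.EventuallyEq,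
    ae_restrict_iff' measurableSet_Ioo] at h
  have h2 : ∀ᵐ θ ∂(volume : Measure ℝ), θ ∉ Ioo x y := by
    filter_upwards [h] with θ h hm
    have hI : θ ∈ Icc (0:ℝ) 1 := ⟨hx.trans hm.1.le, hm.2.le.trans hy⟩
    have := h hm
    simp only [indicator_of_mem hI, Pi.zero_apply, ENNReal.ofReal_eq_zero] at this
    exact absurd (E.f_pos θ hI) (not_lt.2 this)
  have h3 : volume (Ioo x y) = 0 := by
    rw [ae_iff] at h2
    simp only [not_not] at h2
    exact h2
  simp at h3; linarith

theorem prior_le_of_bdd {K : ℝ} (hK : ∀ θ ∈ Icc (0:ℝ) 1, E.f θ ≤ K) {x y : ℝ} (hxy : x ≤ y) :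
    E.prior.real (Icc x y) ≤ K * (y - x) := by
  have hK0 : 0 ≤ K := (E.f_pos 0 (by simp)).le.trans (hK 0 (by simp))
  have : E.prior (Icc x y) ≤ ENNReal.ofReal (K * (y - x)) := by
    rw [Environment.prior, withDensity_apply _ measurableSet_Icc]
    calc _ ≤ ∫⁻ _ in Icc x y, ENNReal.ofReal K := by
          refine lintegral_mono fun θ => ENNReal.ofReal_le_ofReal ?_
          by_cases h : θ ∈ Icc (0 : ℝ) 1
          · simpa [h] using hK θ h
          · simpa [h] using hK0
      _ = _ := by rw [setLIntegral_const, Real.volume_Icc, ENNReal.ofReal_mul hK0]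
  rw [Measure.real]
  exact ENNReal.toReal_le_of_le_ofReal (by positivity [sub_nonneg.2 hxy]) this

theorem prior_of_uniform (hf : ∀ θ ∈ Icc (0:ℝ) 1, E.f θ = 1) :
    E.prior = volume.restrict (Icc 0 1) := by
  have : (fun θ => ENNReal.ofReal ((Icc (0 : ℝ) 1).indicator E.f θ))
      = (Icc (0 : ℝ) 1).indicator 1 := by
    funext θ
    by_cases h : θ ∈ Icc (0 : ℝ) 1
    · simp [h, hf θ h]
    · simp [h]
  rw [Environment.prior, this, withDensity_indicator_one measurableSet_Icc]

theorem integrable_of_bdd {g : ℝ → ℝ} (hg : AEStronglyMeasurable g E.prior) {C : ℝ}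
    (hC : ∀ θ ∈ Icc (0:ℝ) 1, |g θ| ≤ C) : Integrable g E.prior :=
  Integrable.of_bound hg C (by filter_upwards [ae_mem E] with θ h using hC θ h)

theorem integrable_of_continuous {g : ℝ → ℝ} (hg : Continuous g) : Integrable g E.prior := by
  obtain ⟨C, hC⟩ := isCompact_Icc.exists_bound_of_continuousOn (s := Icc (0:ℝ) 1) hg.continuousOn
  exact integrable_of_bdd E hg.aestronglyMeasurable hC

/-- The mean of the state conditional on the event `C`. -/
noncomputable def bar (C : Set ℝ) : ℝ := (∫ t in C, t ∂E.prior) / E.prior.real C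

variable {E}

theorem integrable_id' : Integrable (fun t : ℝ => t) E.prior := integrable_of_continuous E continuous_id

theorem real_pos {C : Set ℝ} (h : 0 < E.prior C) : 0 < E.prior.real C :=
  ENNReal.toReal_pos h.ne' (measure_ne_top _ _)

theorem real_mul_bar {C : Set ℝ} (h : 0 < E.prior C) :
    E.prior.real C * bar E C = ∫ t in C, t ∂E.prior := by
  rw [bar, mul_div_cancel₀ _ (real_pos h).ne']

theorem setIntegral_affine {C : Set ℝ} (h : 0 < E.prior C) (k s : ℝ) :
    ∫ t in C, (k + s * t) ∂E.prior = E.prior.real C * (k + s * bar E C) := by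
  rw [integral_add (integrable_const _) (integrable_id'.integrableOn.const_mul _),
    integral_const_mul, ← real_mul_bar h]
  simp; ring

theorem setIntegral_pos_of {C : Set ℝ} (hC : MeasurableSet C) (h : 0 < E.prior C) {g : ℝ → ℝ}
    (hg : Integrable g E.prior) (h0 : ∀ᵐ t ∂E.prior, t ∈ C → 0 < g t) :
    0 < ∫ t in C, g t ∂E.prior := by
  have hr : ∀ᵐ t ∂E.prior.restrict C, 0 < g t := (ae_restrict_iff' hC).2 h0
  rw [integral_pos_iff_support_of_nonneg_ae (hr.mono fun _ h => h.le) hg.integrableOn]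
  have : Function.support g =ᵐ[E.prior.restrict C] (univ : Set ℝ) := by
    filter_upwards [hr] with t ht
    exact propext ⟨fun _ => trivial, fun _ => ht.ne'⟩
  rw [measure_congr this]
  simpa using h

theorem ae_ne (a : ℝ) : ∀ᵐ t ∂E.prior, t ≠ a := by simp [ae_iff]

theorem lt_bar {C : Set ℝ} (hC : MeasurableSet C) (h : 0 < E.prior C) {a : ℝ}
    (ha : ∀ t ∈ C, a ≤ t) : a < bar E C := by
  have := setIntegral_pos_of hC h (g := fun t => -a + 1 * t)
    (integrable_of_continuous E (by fun_prop)) (by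
      filter_upwards [ae_ne (E := E) a] with t ht hm
      have := lt_of_le_of_ne (ha t hm) (Ne.symm ht)
      linarith)
  rw [setIntegral_affine h] at this
  have := pos_of_mul_pos_right this (real_pos h).le
  linarith

theorem bar_lt {C : Set ℝ} (hC : MeasurableSet C) (h : 0 < E.prior C) {a : ℝ}
    (ha : ∀ t ∈ C, t ≤ a) : bar E C < a := by
  have := setIntegral_pos_of hC h (g := fun t => a + (-1) * t)
    (integrable_of_continuous E (by fun_prop)) (by
      filter_upwards [ae_ne (E := E) a] with t ht hm
      have := lt_of_le_of_ne (ha t hm) ht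
      linarith)
  rw [setIntegral_affine h] at this
  have := pos_of_mul_pos_right this (real_pos h).le
  linarith

variable (E) in
/-- The prior mean. -/
noncomputable def mean : ℝ := ∫ t, t ∂E.prior

theorem bar_univ : bar E univ = mean E := by simp [bar, mean]

theorem bar_congr {C D : Set ℝ} (h : C =ᵐ[E.prior] D) : bar E C = bar E D := by
  rw [bar, bar, setIntegral_congr_set h, measureReal_congr h]

theorem Icc_ae_univ : (Icc 0 1 : Set ℝ) =ᵐ[E.prior] univ := by
  filter_upwards [ae_mem E] with θ h
  exact propext ⟨fun _ => trivial, fun _ => h⟩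

theorem bar_Icc : bar E (Icc 0 1) = mean E := by rw [bar_congr Icc_ae_univ, bar_univ]

theorem mean_mem : mean E ∈ Ioo (0:ℝ) 1 := by
  rw [← bar_Icc]
  have : 0 < E.prior (Icc 0 1) := by rw [prior_Icc]; simp
  exact ⟨lt_bar measurableSet_Icc this fun t h => h.1, bar_lt measurableSet_Icc this fun t h => h.2⟩

end Prior

/-! ### Pooling sets and their components -/

section Pooling

variable {E : Environment} {P : Set ℝ}

theorem IsPoolingSet.subset (hP : IsPoolingSet P) : P ⊆ Icc 0 1 := by
  obtain ⟨U, -, rfl⟩ := hP; exact inter_subset_right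

theorem IsPoolingSet.measurableSet (hP : IsPoolingSet P) : MeasurableSet P := by
  obtain ⟨U, h, rfl⟩ := hP; exact h.measurableSet.inter measurableSet_Icc

theorem ordConnected_component (P : Set ℝ) (θ : ℝ) : (connectedComponentIn P θ).OrdConnected :=
  isPreconnected_connectedComponentIn.ordConnected

theorem measurableSet_component (P : Set ℝ) (θ : ℝ) : MeasurableSet (connectedComponentIn P θ) :=
  (ordConnected_component P θ).measurableSet

theorem IsPoolingSet.exists_Ioo (hP : IsPoolingSet P) {θ : ℝ} (h : θ ∈ P) :
    ∃ ε > 0, Ioo (θ - ε) (θ + ε) ∩ Icc 0 1 ⊆ connectedComponentIn P θ := by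
  have hI := hP.subset h
  obtain ⟨U, hU, rfl⟩ := hP
  obtain ⟨ε, hε, hb⟩ := Metric.isOpen_iff.1 hU θ h.1
  rw [Real.ball_eq_Ioo] at hb
  refine ⟨ε, hε, IsPreconnected.subset_connectedComponentIn ?_ ⟨⟨by linarith, by linarith⟩, hI⟩
    (inter_subset_inter_left _ hb)⟩
  exact (ordConnected_Ioo.inter ordConnected_Icc).isPreconnected

theorem IsPoolingSet.component_inter_Ioo (hP : IsPoolingSet P) {θ : ℝ} (h : θ ∈ P) {x y : ℝ}
    (hx : 0 ≤ x) (hy : y ≤ 1) (hθ : θ ∈ Icc x y) (hxy : x < y) :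
    ∃ x' y', x ≤ x' ∧ x' < y' ∧ y' ≤ y ∧ Ioo x' y' ⊆ connectedComponentIn P θ := by
  obtain ⟨ε, hε, hb⟩ := hP.exists_Ioo h
  refine ⟨max x (θ - ε), min y (θ + ε), le_max_left _ _, ?_, min_le_left _ _, fun t ht => hb ?_⟩
  · simp only [max_lt_iff, lt_min_iff]
    refine ⟨⟨hxy, ?_⟩, ?_, ?_⟩ <;> linarith [hθ.1, hθ.2]
  · simp only [mem_Ioo, max_lt_iff, lt_min_iff] at ht
    exact ⟨⟨ht.1.2, ht.2.2⟩, by linarith [ht.1.1], by linarith [ht.2.1]⟩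

theorem IsPoolingSet.component_pos (hP : IsPoolingSet P) {θ : ℝ} (h : θ ∈ P) :
    0 < E.prior (connectedComponentIn P θ) := by
  obtain ⟨x, y, hx, hxy, hy, hs⟩ :=
    hP.component_inter_Ioo h le_rfl le_rfl (hP.subset h) zero_lt_one
  exact (prior_Ioo_pos E hx hxy hy).trans_le (measure_mono hs)

theorem postMean_of_mem {θ : ℝ} (h : θ ∈ P) : E.postMean P θ = bar E (connectedComponentIn P θ) := by
  simp [Environment.postMean, h, bar]

theorem postMean_of_notMem {θ : ℝ} (h : θ ∉ P) : E.postMean P θ = θ := by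
  simp [Environment.postMean, h]

theorem component_eq {θ θ' : ℝ} (h : θ' ∈ connectedComponentIn P θ) :
    connectedComponentIn P θ' = connectedComponentIn P θ :=
  (connectedComponentIn_eq h).symm

theorem postMean_eq_of_mem {θ θ' : ℝ} (h : θ' ∈ connectedComponentIn P θ) :
    E.postMean P θ' = E.postMean P θ := by
  have h1 : θ' ∈ P := connectedComponentIn_subset _ _ h
  have h2 : θ ∈ P := by
    by_contra h2; rw [connectedComponentIn_eq_empty h2] at h; exact h
  rw [postMean_of_mem h1, postMean_of_mem h2, component_eq h]

theorem IsPoolingSet.postMean_le (hP : IsPoolingSet P) {θ t : ℝ} (h : θ ≤ t)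
    (ht : t ∉ connectedComponentIn P θ) : E.postMean P θ ≤ t := by
  by_cases hθ : θ ∈ P
  · rw [postMean_of_mem hθ]
    refine (bar_lt (measurableSet_component P θ) (hP.component_pos hθ) fun s hs => ?_).le
    by_contra hts
    exact ht ((ordConnected_component P θ).out (mem_connectedComponentIn hθ) hs ⟨h, (not_le.1 hts).le⟩)
  · rwa [postMean_of_notMem hθ]

theorem IsPoolingSet.postMean_mono (hP : IsPoolingSet P) : Monotone (E.postMean P) := by
  intro θ θ' hle
  by_cases hc : θ' ∈ connectedComponentIn P θ
  · rw [postMean_eq_of_mem hc]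
  · have h1 : E.postMean P θ ≤ θ' := hP.postMean_le hle hc
    by_cases hθ' : θ' ∈ P
    · rw [postMean_of_mem hθ']
      refine (lt_bar (measurableSet_component P θ') (hP.component_pos hθ') fun s hs => ?_).le
      have hs' : s ∉ connectedComponentIn P θ := fun h => hc <| by
        rw [← component_eq h, component_eq hs]; exact mem_connectedComponentIn hθ'
      refine hP.postMean_le ?_ hs'
      by_contra hlt
      have : θ ∈ connectedComponentIn P θ' :=
        (ordConnected_component P θ').out hs (mem_connectedComponentIn hθ') ⟨(not_le.1 hlt).le, hle⟩
      apply hc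
      rw [component_eq this]; exact mem_connectedComponentIn hθ'
    · rwa [postMean_of_notMem hθ']

theorem IsPoolingSet.postMean_measurable (hP : IsPoolingSet P) : Measurable (E.postMean P) :=
  hP.postMean_mono.measurable

theorem IsPoolingSet.component_subset (hP : IsPoolingSet P) (θ : ℝ) :
    connectedComponentIn P θ ⊆ Icc 0 1 := (connectedComponentIn_subset P θ).trans hP.subset

theorem IsPoolingSet.bar_mem (hP : IsPoolingSet P) {θ : ℝ} (h : θ ∈ P) :
    bar E (connectedComponentIn P θ) ∈ connectedComponentIn P θ := by
  have hm := measurableSet_component P θ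
  have hp := hP.component_pos (E := E) h
  have h1 : ∃ s ∈ connectedComponentIn P θ, s < bar E (connectedComponentIn P θ) := by
    by_contra! hc
    exact lt_irrefl _ (lt_bar hm hp hc)
  have h2 : ∃ s ∈ connectedComponentIn P θ, bar E (connectedComponentIn P θ) < s := by
    by_contra! hc
    exact lt_irrefl _ (bar_lt hm hp hc)
  obtain ⟨s, hs, hs'⟩ := h1
  obtain ⟨r, hr, hr'⟩ := h2
  exact (ordConnected_component P θ).out hs hr ⟨hs'.le, hr'.le⟩

theorem IsPoolingSet.postMean_mem (hP : IsPoolingSet P) {θ : ℝ} (h : θ ∈ Icc (0:ℝ) 1) :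
    E.postMean P θ ∈ Icc (0:ℝ) 1 := by
  by_cases hθ : θ ∈ P
  · rw [postMean_of_mem hθ]; exact hP.component_subset θ (hP.bar_mem hθ)
  · rwa [postMean_of_notMem hθ]

theorem IsPoolingSet.postMean_postMean (hP : IsPoolingSet P) (θ : ℝ) :
    E.postMean P (E.postMean P θ) = E.postMean P θ := by
  by_cases hθ : θ ∈ P
  · refine postMean_eq_of_mem ?_
    rw [postMean_of_mem hθ]; exact hP.bar_mem hθ
  · rw [postMean_of_notMem hθ, postMean_of_notMem hθ]

theorem IsPoolingSet.component_lt (hP : IsPoolingSet P) {θ t : ℝ} (hθ : θ ∈ P) (h : θ < t)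
    (ht : t ∉ P) : E.postMean P θ < t := by
  rw [postMean_of_mem hθ]
  refine bar_lt (measurableSet_component P θ) (hP.component_pos hθ) fun s hs => ?_
  by_contra hts
  exact ht (connectedComponentIn_subset _ _ ((ordConnected_component P θ).out
    (mem_connectedComponentIn hθ) hs ⟨h.le, (not_le.1 hts).le⟩))

theorem IsPoolingSet.lt_component (hP : IsPoolingSet P) {θ t : ℝ} (hθ : θ ∈ P) (h : t < θ)
    (ht : t ∉ P) : t < E.postMean P θ := by
  rw [postMean_of_mem hθ]
  refine lt_bar (measurableSet_component P θ) (hP.component_pos hθ) fun s hs => ?_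
  by_contra hts
  exact ht (connectedComponentIn_subset _ _ ((ordConnected_component P θ).out
    hs (mem_connectedComponentIn hθ) ⟨(not_le.1 hts).le, h.le⟩))

/-- If the posterior mean is almost everywhere constant on an interval, the interval is pooled. -/
theorem IsPoolingSet.Ioo_subset (hP : IsPoolingSet P) {x y m : ℝ} (hx : 0 ≤ x) (hy : y ≤ 1)
    (h : ∀ᵐ θ ∂E.prior, θ ∈ Ioo x y → E.postMean P θ = m) : Ioo x y ⊆ P := by
  have key : ∀ r s, x ≤ r → r < s → s ≤ y → ∃ t ∈ Ioo r s, E.postMean P t = m := by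
    intro r s hr hrs hs
    by_contra! hc
    have h0 : E.prior (Ioo r s) = 0 := by
      rw [← nonpos_iff_eq_zero, ← (ae_iff.1 h)]
      exact measure_mono fun t ht => by
        simp only [mem_ofPred_eq, Classical.not_imp]
        exact ⟨⟨by linarith [ht.1], by linarith [ht.2]⟩, hc t ht⟩
    exact (prior_Ioo_pos E (hx.trans hr) hrs (hs.trans hy)).ne' h0
  intro t ht
  by_contra htP
  obtain ⟨t1, ht1, e1⟩ := key x t le_rfl ht.1 ht.2.le
  obtain ⟨t2, ht2, e2⟩ := key t y ht.1.le ht.2 le_rfl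
  have a1 := hP.postMean_mono (E := E) ht1.2.le
  have a2 := hP.postMean_mono (E := E) ht2.1.le
  have e3 : E.postMean P t = m := le_antisymm (a2.trans e2.le) (e1.ge.trans a1)
  rw [postMean_of_notMem htP] at e3
  by_cases h1 : t1 ∈ P
  · have := hP.component_lt (E := E) h1 ht1.2 htP
    linarith
  · rw [postMean_of_notMem h1] at e1; linarith [ht1.2]

theorem countable_components (hP : IsPoolingSet P) :
    {C | ∃ θ ∈ P, C = connectedComponentIn P θ}.Countable := by
  have h : {C | ∃ θ ∈ P, C = connectedComponentIn P θ} ⊆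
      (fun q : ℚ => connectedComponentIn P (q : ℝ)) '' univ := by
    rintro C ⟨θ, hθ, rfl⟩
    obtain ⟨x, y, hx, hxy, hy, hs⟩ :=
      hP.component_inter_Ioo hθ le_rfl le_rfl (hP.subset hθ) zero_lt_one
    obtain ⟨q, h1, h2⟩ := exists_rat_btwn hxy
    exact ⟨q, trivial, component_eq (hs ⟨h1, h2⟩)⟩
  exact (countable_univ.image _).mono h

theorem hasSum_components (hP : IsPoolingSet P) {g : ℝ → ℝ} (hg : Integrable g E.prior) :
    HasSum (fun C : {C | ∃ θ ∈ P, C = connectedComponentIn P θ} => ∫ t in (C : Set ℝ), g t ∂E.prior)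
      (∫ t in P, g t ∂E.prior) := by
  have := (countable_components hP).to_subtype
  have hU : P = ⋃ C : {C | ∃ θ ∈ P, C = connectedComponentIn P θ}, (C : Set ℝ) := by
    ext t; constructor
    · intro ht
      exact mem_iUnion.2 ⟨⟨_, t, ht, rfl⟩, mem_connectedComponentIn ht⟩
    · intro ht
      obtain ⟨⟨_, θ, hθ, rfl⟩, h⟩ := mem_iUnion.1 ht
      exact connectedComponentIn_subset _ _ h
  have hI : ∫ t in P, g t ∂E.prior = ∫ t in ⋃ C : {C | ∃ θ ∈ P, C = connectedComponentIn P θ},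
      (C : Set ℝ), g t ∂E.prior := congrArg (fun S => ∫ t in S, g t ∂E.prior) hU
  rw [hI]
  refine hasSum_integral_iUnion ?_ ?_ hg.integrableOn
  · rintro ⟨_, θ, hθ, rfl⟩; exact measurableSet_component P θ
  · rintro ⟨_, θ, hθ, rfl⟩ ⟨_, θ', hθ', rfl⟩ hne
    rw [Function.onFun, Set.disjoint_left]
    intro t ht ht'
    exact hne (Subtype.ext ((component_eq ht).symm.trans (component_eq ht')))

theorem integral_nonneg_of_components (hP : IsPoolingSet P) {g : ℝ → ℝ} (hg : Integrable g E.prior)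
    (h1 : ∀ᵐ θ ∂E.prior, θ ∉ P → 0 ≤ g θ)
    (h2 : ∀ θ ∈ P, 0 ≤ ∫ t in connectedComponentIn P θ, g t ∂E.prior) : 0 ≤ ∫ t, g t ∂E.prior := by
  rw [← integral_add_compl hP.measurableSet hg]
  have a := (hasSum_components hP hg).nonneg (by rintro ⟨_, θ, hθ, rfl⟩; exact h2 θ hθ)
  have b : 0 ≤ ∫ t in Pᶜ, g t ∂E.prior :=
    setIntegral_nonneg_ae hP.measurableSet.compl (by filter_upwards [h1] with t h using h)
  linarith

theorem eq_zero_of_components (hP : IsPoolingSet P) {g : ℝ → ℝ} (hg : Integrable g E.prior)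
    (h1 : ∀ᵐ θ ∂E.prior, θ ∉ P → 0 ≤ g θ)
    (h2 : ∀ θ ∈ P, 0 ≤ ∫ t in connectedComponentIn P θ, g t ∂E.prior)
    (h0 : ∫ t, g t ∂E.prior ≤ 0) :
    (∀ᵐ θ ∂E.prior, θ ∉ P → g θ = 0) ∧
      ∀ θ ∈ P, ∫ t in connectedComponentIn P θ, g t ∂E.prior = 0 := by
  rw [← integral_add_compl hP.measurableSet hg] at h0
  have hs := hasSum_components hP hg
  have hn : ∀ C : {C | ∃ θ ∈ P, C = connectedComponentIn P θ},
      0 ≤ ∫ t in (C : Set ℝ), g t ∂E.prior := by rintro ⟨_, θ, hθ, rfl⟩; exact h2 θ hθ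
  have a := hs.nonneg hn
  have h1' : ∀ᵐ θ ∂E.prior.restrict Pᶜ, 0 ≤ g θ :=
    (ae_restrict_iff' hP.measurableSet.compl).2 (by filter_upwards [h1] with t h using h)
  have b : 0 ≤ ∫ t in Pᶜ, g t ∂E.prior := integral_nonneg_of_ae h1'
  constructor
  · have : ∫ t in Pᶜ, g t ∂E.prior = 0 := by linarith
    rw [integral_eq_zero_iff_of_nonneg_ae h1' hg.integrableOn] at this
    exact (ae_restrict_iff' hP.measurableSet.compl).1 this
  · intro θ hθ
    have := le_hasSum hs ⟨_, θ, hθ, rfl⟩ fun C _ => hn C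
    have := h2 θ hθ
    simp only at *
    linarith

/-- Value of a pooling set for a general value function of the posterior mean. -/
noncomputable def poolVal (E : Environment) (w : ℝ → ℝ) (P : Set ℝ) : ℝ := ∫ θ, w (E.postMean P θ) ∂E.prior

theorem integrable_comp_postMean (hP : IsPoolingSet P) {w : ℝ → ℝ} (hw : Continuous w) :
    Integrable (fun θ => w (E.postMean P θ)) E.prior := by
  obtain ⟨C, hC⟩ := isCompact_Icc.exists_bound_of_continuousOn (s := Icc (0:ℝ) 1) hw.continuousOn
  exact integrable_of_bdd E (hw.measurable.comp hP.postMean_measurable).aestronglyMeasurable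
    fun θ h => hC _ (hP.postMean_mem h)

theorem setIntegral_component (P : Set ℝ) (w : ℝ → ℝ) {θ : ℝ} (h : θ ∈ P) :
    ∫ t in connectedComponentIn P θ, w (E.postMean P t) ∂E.prior
      = E.prior.real (connectedComponentIn P θ) * w (bar E (connectedComponentIn P θ)) := by
  rw [setIntegral_congr_fun (g := fun _ => w (bar E (connectedComponentIn P θ)))
    (measurableSet_component P θ) fun t ht => by
      simp only [postMean_eq_of_mem ht, postMean_of_mem h]]
  simp

theorem poolVal_le (hP : IsPoolingSet P) {w p : ℝ → ℝ} (hw : Continuous w)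
    (hp : Integrable p E.prior) (h1 : ∀ θ ∈ Icc (0:ℝ) 1, θ ∉ P → w θ ≤ p θ)
    (h2 : ∀ θ ∈ P, E.prior.real (connectedComponentIn P θ) * w (bar E (connectedComponentIn P θ))
      ≤ ∫ t in connectedComponentIn P θ, p t ∂E.prior) : poolVal E w P ≤ ∫ θ, p θ ∂E.prior := by
  have hi := integrable_comp_postMean (E := E) hP hw
  have := integral_nonneg_of_components hP (hp.sub hi) (by
      filter_upwards [ae_mem E] with θ h hn
      simpa [postMean_of_notMem hn] using h1 θ h hn) (fun θ hθ => by
      simp only [Pi.sub_apply]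
      rw [integral_sub hp.integrableOn hi.integrableOn, setIntegral_component P w hθ]
      linarith [h2 θ hθ])
  simp only [Pi.sub_apply] at this
  rw [integral_sub hp hi] at this
  rw [poolVal]; linarith

theorem eq_of_poolVal_eq (hP : IsPoolingSet P) {w p : ℝ → ℝ} (hw : Continuous w)
    (hp : Integrable p E.prior) (h1 : ∀ θ ∈ Icc (0:ℝ) 1, θ ∉ P → w θ ≤ p θ)
    (h2 : ∀ θ ∈ P, E.prior.real (connectedComponentIn P θ) * w (bar E (connectedComponentIn P θ))
      ≤ ∫ t in connectedComponentIn P θ, p t ∂E.prior) (h0 : ∫ θ, p θ ∂E.prior ≤ poolVal E w P) :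
    (∀ᵐ θ ∂E.prior, θ ∉ P → w θ = p θ) ∧ ∀ θ ∈ P,
      E.prior.real (connectedComponentIn P θ) * w (bar E (connectedComponentIn P θ))
      = ∫ t in connectedComponentIn P θ, p t ∂E.prior := by
  have hi := integrable_comp_postMean (E := E) hP hw
  have hc : ∀ θ ∈ P, ∫ t in connectedComponentIn P θ, (p - fun θ => w (E.postMean P θ)) t ∂E.prior
      = (∫ t in connectedComponentIn P θ, p t ∂E.prior) -
      E.prior.real (connectedComponentIn P θ) * w (bar E (connectedComponentIn P θ)) := fun θ hθ => by
    simp only [Pi.sub_apply]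
    rw [integral_sub hp.integrableOn hi.integrableOn, setIntegral_component P w hθ]
  obtain ⟨a, b⟩ := eq_zero_of_components hP (hp.sub hi) (by
      filter_upwards [ae_mem E] with θ h hn
      simpa [postMean_of_notMem hn] using h1 θ h hn) (fun θ hθ => by
      rw [hc θ hθ]; linarith [h2 θ hθ]) (by
      simp only [Pi.sub_apply]; rw [integral_sub hp hi]; rw [poolVal] at h0; linarith)
  refine ⟨?_, fun θ hθ => ?_⟩
  · filter_upwards [a] with θ h hn
    have := h hn
    simp only [Pi.sub_apply, postMean_of_notMem hn] at this
    linarith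
  · have := b θ hθ
    rw [hc θ hθ] at this; linarith

end Pooling

/-! ### The second-best joint payoff and its tangents -/

section SecondBest

variable (N θ₀ lam : ℝ)

/-- Second-best joint payoff at posterior mean `x`: the first best is lost outside
`[θ₀ - lam, θ₀ + lam]`. -/
noncomputable def sbVal (x : ℝ) : ℝ := x ^ 2 / 2 - N ^ 2 / 2 * (max (|x - θ₀| - lam) 0) ^ 2

/-- Derivative of `sbVal`. -/
noncomputable def sbSlope (x : ℝ) : ℝ :=
  x + N ^ 2 * max (θ₀ - lam - x) 0 - N ^ 2 * max (x - (θ₀ + lam)) 0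

/-- Tangent line of `sbVal` at `m`. -/
noncomputable def sbTan (m x : ℝ) : ℝ := sbVal N θ₀ lam m + sbSlope N θ₀ lam m * (x - m)

variable {N θ₀ lam}

theorem continuous_sbVal : Continuous (sbVal N θ₀ lam) := by unfold sbVal; fun_prop

theorem continuous_sbTan (m : ℝ) : Continuous (sbTan N θ₀ lam m) := by unfold sbTan; fun_prop

theorem sbTan_self (m : ℝ) : sbTan N θ₀ lam m m = sbVal N θ₀ lam m := by simp [sbTan]

theorem sbVal_le (x : ℝ) : sbVal N θ₀ lam x ≤ x ^ 2 / 2 := by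
  unfold sbVal
  have : 0 ≤ N ^ 2 / 2 * (max (|x - θ₀| - lam) 0) ^ 2 := by positivity
  linarith

theorem sbVal_low (hl : 0 ≤ lam) {x : ℝ} (hx : x ≤ θ₀ - lam) :
    sbVal N θ₀ lam x = x ^ 2 / 2 - N ^ 2 / 2 * (θ₀ - lam - x) ^ 2 := by
  rw [sbVal, abs_of_nonpos (by linarith), max_eq_left (by linarith)]; ring

theorem sbVal_high (hl : 0 ≤ lam) {x : ℝ} (hx : θ₀ + lam ≤ x) :
    sbVal N θ₀ lam x = x ^ 2 / 2 - N ^ 2 / 2 * (x - (θ₀ + lam)) ^ 2 := by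
  rw [sbVal, abs_of_nonneg (by linarith), max_eq_left (by linarith)]; ring

theorem sbVal_mid {x : ℝ} (h1 : θ₀ - lam ≤ x) (h2 : x ≤ θ₀ + lam) :
    sbVal N θ₀ lam x = x ^ 2 / 2 := by
  rw [sbVal, max_eq_right]
  · ring
  · have : |x - θ₀| ≤ lam := abs_le.2 ⟨by linarith, by linarith⟩
    linarith

theorem sbSlope_low (hl : 0 ≤ lam) {m : ℝ} (hm : m ≤ θ₀ - lam) :
    sbSlope N θ₀ lam m = m + N ^ 2 * (θ₀ - lam - m) := by
  rw [sbSlope, max_eq_left (by linarith), max_eq_right (a := m - _) (by linarith)]; ring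

theorem sbSlope_high (hl : 0 ≤ lam) {m : ℝ} (hm : θ₀ + lam ≤ m) :
    sbSlope N θ₀ lam m = m - N ^ 2 * (m - (θ₀ + lam)) := by
  rw [sbSlope, max_eq_right (a := θ₀ - lam - m) (by linarith), max_eq_left (by linarith)]; ring

theorem sbSlope_mid {m : ℝ} (h1 : θ₀ - lam ≤ m) (h2 : m ≤ θ₀ + lam) :
    sbSlope N θ₀ lam m = m := by
  rw [sbSlope, max_eq_right (by linarith), max_eq_right (by linarith)]; ring

theorem sbTan_low (hl : 0 ≤ lam) {m : ℝ} (hm : m ≤ θ₀ - lam) (x : ℝ) :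
    2 * sbTan N θ₀ lam m x =
      x ^ 2 + (N ^ 2 - 1) * (x - m) ^ 2 - N ^ 2 * (x - (θ₀ - lam)) ^ 2 := by
  rw [sbTan, sbVal_low hl hm, sbSlope_low hl hm]; ring

theorem sbTan_high (hl : 0 ≤ lam) {m : ℝ} (hm : θ₀ + lam ≤ m) (x : ℝ) :
    2 * sbTan N θ₀ lam m x =
      x ^ 2 + (N ^ 2 - 1) * (x - m) ^ 2 - N ^ 2 * (x - (θ₀ + lam)) ^ 2 := by
  rw [sbTan, sbVal_high hl hm, sbSlope_high hl hm]; ring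

theorem sbTan_mid {m : ℝ} (h1 : θ₀ - lam ≤ m) (h2 : m ≤ θ₀ + lam) (x : ℝ) :
    2 * sbTan N θ₀ lam m x = x ^ 2 - (x - m) ^ 2 := by
  rw [sbTan, sbVal_mid h1 h2, sbSlope_mid h1 h2]; ring

/-- `sbVal` is a `C^{1,1}` function. -/
theorem sbTan_sub_le (hl : 0 ≤ lam) (m x : ℝ) :
    sbTan N θ₀ lam m x - N ^ 2 / 2 * (x - m) ^ 2 ≤ sbVal N θ₀ lam x := by
  have hN := sq_nonneg N
  have hd : ∀ y ∈ Icc (θ₀ - lam) (θ₀ + lam),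
      x ^ 2 / 2 - N ^ 2 / 2 * (x - y) ^ 2 ≤ sbVal N θ₀ lam x := by
    intro y hy
    rcases le_total x (θ₀ - lam) with h | h
    · rw [sbVal_low hl h]
      have : (θ₀ - lam - x) ^ 2 ≤ (x - y) ^ 2 := by nlinarith [hy.1]
      nlinarith
    rcases le_total (θ₀ + lam) x with h' | h'
    · rw [sbVal_high hl h']
      have : (x - (θ₀ + lam)) ^ 2 ≤ (x - y) ^ 2 := by nlinarith [hy.2]
      nlinarith
    · rw [sbVal_mid h h']; nlinarith [mul_nonneg hN (sq_nonneg (x - y))]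
  rcases le_total m (θ₀ - lam) with h | h
  · have := sbTan_low (N := N) hl h x
    have := hd (θ₀ - lam) ⟨le_rfl, by linarith⟩
    nlinarith [sq_nonneg (x - m)]
  rcases le_total (θ₀ + lam) m with h' | h'
  · have := sbTan_high (N := N) hl h' x
    have := hd (θ₀ + lam) ⟨by linarith, le_rfl⟩
    nlinarith [sq_nonneg (x - m)]
  · have := sbTan_mid (N := N) h h' x
    have := hd m ⟨h, h'⟩
    nlinarith [sq_nonneg (x - m)]

theorem lt_sbTan_low (hN : 1 < N) (hl : 0 ≤ lam) {m x : ℝ} (hm : m ≤ θ₀ - lam) (hx : x ≤ θ₀ - lam)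
    (hne : x ≠ m) : sbVal N θ₀ lam x < sbTan N θ₀ lam m x := by
  have h1 := sbTan_low (N := N) hl hm x
  rw [sbVal_low hl hx]
  have : 0 < (N ^ 2 - 1) * (x - m) ^ 2 := by
    have := sub_ne_zero.2 hne
    have : 0 < N ^ 2 - 1 := by nlinarith
    positivity
  nlinarith

theorem lt_sbTan_high (hN : 1 < N) (hl : 0 ≤ lam) {m x : ℝ} (hm : θ₀ + lam ≤ m) (hx : θ₀ + lam ≤ x)
    (hne : x ≠ m) : sbVal N θ₀ lam x < sbTan N θ₀ lam m x := by
  have h1 := sbTan_high (N := N) hl hm x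
  rw [sbVal_high hl hx]
  have : 0 < (N ^ 2 - 1) * (x - m) ^ 2 := by
    have := sub_ne_zero.2 hne
    have : 0 < N ^ 2 - 1 := by nlinarith
    positivity
  nlinarith

variable {γ : ℝ}

theorem sq_half_lt_sbTan_low (hN : 1 < N) (hl : 0 ≤ lam) (hγ : γ ^ 2 * N ^ 2 = N ^ 2 - 1) {m x : ℝ}
    (hm : m ≤ θ₀ - lam) (hx : θ₀ - lam ≤ x) (h : x - (θ₀ - lam) < γ * (x - m)) :
    x ^ 2 / 2 < sbTan N θ₀ lam m x := by
  have h1 := sbTan_low (N := N) hl hm x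
  have h2 : (x - (θ₀ - lam)) ^ 2 < (γ * (x - m)) ^ 2 := by nlinarith
  have h3 : N ^ 2 * (x - (θ₀ - lam)) ^ 2 < N ^ 2 * (γ * (x - m)) ^ 2 := by
    have : 0 < N ^ 2 := by positivity
    nlinarith
  have h4 : N ^ 2 * (γ * (x - m)) ^ 2 = (N ^ 2 - 1) * (x - m) ^ 2 := by rw [← hγ]; ring
  linarith

theorem sbTan_low_eq_sq_half (hl : 0 ≤ lam) (hγ : γ ^ 2 * N ^ 2 = N ^ 2 - 1) {m x : ℝ}
    (hm : m ≤ θ₀ - lam) (h : x - (θ₀ - lam) = γ * (x - m)) : sbTan N θ₀ lam m x = x ^ 2 / 2 := by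
  have h1 := sbTan_low (N := N) hl hm x
  have h4 : N ^ 2 * (γ * (x - m)) ^ 2 = (N ^ 2 - 1) * (x - m) ^ 2 := by rw [← hγ]; ring
  rw [h] at h1
  linarith

theorem sq_half_lt_sbTan_high (hN : 1 < N) (hl : 0 ≤ lam) (hγ : γ ^ 2 * N ^ 2 = N ^ 2 - 1)
    {m x : ℝ} (hm : θ₀ + lam ≤ m) (hx : x ≤ θ₀ + lam) (h : θ₀ + lam - x < γ * (m - x)) :
    x ^ 2 / 2 < sbTan N θ₀ lam m x := by
  have h1 := sbTan_high (N := N) hl hm x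
  have h2 : (θ₀ + lam - x) ^ 2 < (γ * (m - x)) ^ 2 := by nlinarith
  have h3 : N ^ 2 * (θ₀ + lam - x) ^ 2 < N ^ 2 * (γ * (m - x)) ^ 2 := by
    have : 0 < N ^ 2 := by positivity
    nlinarith
  have h4 : N ^ 2 * (γ * (m - x)) ^ 2 = (N ^ 2 - 1) * (x - m) ^ 2 := by rw [← hγ]; ring
  have h5 : (θ₀ + lam - x) ^ 2 = (x - (θ₀ + lam)) ^ 2 := by ring
  rw [h5] at h3
  linarith

theorem sbTan_high_eq_sq_half (hl : 0 ≤ lam) (hγ : γ ^ 2 * N ^ 2 = N ^ 2 - 1) {m x : ℝ}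
    (hm : θ₀ + lam ≤ m) (h : θ₀ + lam - x = γ * (m - x)) : sbTan N θ₀ lam m x = x ^ 2 / 2 := by
  have h1 := sbTan_high (N := N) hl hm x
  have h4 : N ^ 2 * (γ * (m - x)) ^ 2 = (N ^ 2 - 1) * (x - m) ^ 2 := by rw [← hγ]; ring
  have h5 : (x - (θ₀ + lam)) ^ 2 = (γ * (m - x)) ^ 2 := by rw [← h]; ring
  rw [h5] at h1
  linarith

/-- The lower tangent lies strictly above `sbVal` on the lower pool. -/
theorem lt_sbTan_of_lower (hN : 1 < N) (hl : 0 ≤ lam) (hγ1 : γ < 1)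
    (hγ : γ ^ 2 * N ^ 2 = N ^ 2 - 1) {m t x : ℝ} (hm : m ≤ θ₀ - lam)
    (ht : t - (θ₀ - lam) ≤ γ * (t - m)) (hx : x < t) (hne : x ≠ m) :
    sbVal N θ₀ lam x < sbTan N θ₀ lam m x := by
  rcases le_total x (θ₀ - lam) with h | h
  · exact lt_sbTan_low hN hl hm h hne
  · exact (sbVal_le x).trans_lt (sq_half_lt_sbTan_low hN hl hγ hm h (by nlinarith))

theorem lt_sbTan_of_upper (hN : 1 < N) (hl : 0 ≤ lam) (hγ1 : γ < 1)
    (hγ : γ ^ 2 * N ^ 2 = N ^ 2 - 1) {m t x : ℝ} (hm : θ₀ + lam ≤ m)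
    (ht : θ₀ + lam - t ≤ γ * (m - t)) (hx : t < x) (hne : x ≠ m) :
    sbVal N θ₀ lam x < sbTan N θ₀ lam m x := by
  rcases le_total (θ₀ + lam) x with h | h
  · exact lt_sbTan_high hN hl hm h hne
  · exact (sbVal_le x).trans_lt (sq_half_lt_sbTan_high hN hl hγ hm h (by nlinarith))

theorem le_of_forall_lt_left {f g : ℝ → ℝ} (hf : Continuous f) (hg : Continuous g) {t m : ℝ}
    (h : ∀ x, x < t → x ≠ m → f x < g x) {x : ℝ} (hx : x ≤ t) : f x ≤ g x := by
  refine le_of_tendsto_of_tendsto (b := 𝓝[<] x) (hf.continuousWithinAt) (hg.continuousWithinAt) ?_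
  have h1 : ∀ᶠ y in 𝓝[<] x, y ≠ m := by
    rcases eq_or_ne x m with rfl | hne
    · filter_upwards [self_mem_nhdsWithin] with y hy using ne_of_lt hy
    · exact nhdsWithin_le_nhds (isOpen_ne.mem_nhds hne)
  filter_upwards [self_mem_nhdsWithin, h1] with y hy hym
  exact (h y (lt_of_lt_of_le hy hx) hym).le

theorem le_of_forall_lt_right {f g : ℝ → ℝ} (hf : Continuous f) (hg : Continuous g) {t m : ℝ}
    (h : ∀ x, t < x → x ≠ m → f x < g x) {x : ℝ} (hx : t ≤ x) : f x ≤ g x := by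
  refine le_of_tendsto_of_tendsto (b := 𝓝[>] x) (hf.continuousWithinAt) (hg.continuousWithinAt) ?_
  have h1 : ∀ᶠ y in 𝓝[>] x, y ≠ m := by
    rcases eq_or_ne x m with rfl | hne
    · filter_upwards [self_mem_nhdsWithin] with y hy using ne_of_gt hy
    · exact nhdsWithin_le_nhds (isOpen_ne.mem_nhds hne)
  filter_upwards [self_mem_nhdsWithin, h1] with y hy hym
  exact (h y (lt_of_le_of_lt hx hy) hym).le

end SecondBest

/-! ### Values of pooling intervals -/

section Intervals

variable {E : Environment}

variable (E) in
/-- Contribution of a pooled interval to the value. -/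
noncomputable def pv (w : ℝ → ℝ) (x y : ℝ) : ℝ := E.prior.real (Ioo x y) * w (bar E (Ioo x y))

theorem pv_self (w : ℝ → ℝ) (x : ℝ) : pv E w x x = 0 := by simp [pv]

theorem bar_Ioo_mem {x y : ℝ} (hx : 0 ≤ x) (hxy : x < y) (hy : y ≤ 1) :
    bar E (Ioo x y) ∈ Ioo x y :=
  ⟨lt_bar measurableSet_Ioo (prior_Ioo_pos E hx hxy hy) fun _ h => h.1.le,
    bar_lt measurableSet_Ioo (prior_Ioo_pos E hx hxy hy) fun _ h => h.2.le⟩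

theorem Ico_zero_ae (t : ℝ) : (Ico 0 t : Set ℝ) =ᵐ[E.prior] Ioo 0 t := Ioo_ae_eq_Ico.symm

theorem Ioc_one_ae (t : ℝ) : (Ioc t 1 : Set ℝ) =ᵐ[E.prior] Ioo t 1 := Ioo_ae_eq_Ioc.symm

theorem integral_split {g : ℝ → ℝ} (hg : Integrable g E.prior) {t s : ℝ} (h0 : 0 ≤ t) (hts : t ≤ s)
    (h1 : s ≤ 1) : ∫ θ, g θ ∂E.prior = ∫ θ in Ioo 0 t, g θ ∂E.prior +
      ∫ θ in Ioo t s, g θ ∂E.prior + ∫ θ in Ioo s 1, g θ ∂E.prior := by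
  rw [← setIntegral_congr_set (Ico_zero_ae t), ← setIntegral_congr_set (Ioc_one_ae s),
    setIntegral_congr_set (Ioo_ae_eq_Icc (μ := E.prior) (a := t) (b := s)),
    ← setIntegral_union _ measurableSet_Icc hg.integrableOn hg.integrableOn,
    Ico_union_Icc_eq_Icc h0 hts,
    ← setIntegral_union _ measurableSet_Ioc hg.integrableOn hg.integrableOn,
    Icc_union_Ioc_eq_Icc (h0.trans hts) h1, setIntegral_congr_set Icc_ae_univ, setIntegral_univ]
  · rw [disjoint_left]; intro a h h'; exact absurd h.2 (not_le.2 h'.1)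
  · rw [disjoint_left]; intro a h h'; exact absurd h.2 (not_lt.2 h'.1)

theorem isPoolingSet_two {t s : ℝ} (hs : 0 ≤ s) (ht : t ≤ 1) : IsPoolingSet (Ico 0 t ∪ Ioc s 1) := by
  refine ⟨Iio t ∪ Ioi s, isOpen_Iio.union isOpen_Ioi, ?_⟩
  ext x
  simp only [mem_union, mem_Ico, mem_Ioc, mem_inter_iff, mem_Iio, mem_Ioi, mem_Icc]
  constructor
  · rintro (h | h)
    · exact ⟨Or.inl h.2, h.1, by linarith⟩
    · exact ⟨Or.inr h.1, by linarith, h.2⟩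
  · rintro ⟨h | h, h0, h1⟩
    · exact Or.inl ⟨h0, h⟩
    · exact Or.inr ⟨h, h1⟩

theorem isPoolingSet_Icc : IsPoolingSet (Icc 0 1) := ⟨univ, isOpen_univ, by simp⟩

theorem isPoolingSet_empty : IsPoolingSet ∅ := ⟨∅, isOpen_empty, by simp⟩

theorem component_two_left {t s : ℝ} (hts : t ≤ s) {θ : ℝ} (h : θ ∈ Ico 0 t) :
    connectedComponentIn (Ico 0 t ∪ Ioc s 1) θ = Ico 0 t := by
  refine Subset.antisymm (fun x hx => ?_)
    (IsPreconnected.subset_connectedComponentIn isPreconnected_Ico h subset_union_left)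
  rcases connectedComponentIn_subset _ _ hx with hx' | hx'
  · exact hx'
  · exfalso
    have : t ∈ connectedComponentIn (Ico 0 t ∪ Ioc s 1) θ :=
      (ordConnected_component _ θ).out (mem_connectedComponentIn (Or.inl h)) hx
        ⟨h.2.le, hts.trans hx'.1.le⟩
    rcases connectedComponentIn_subset _ _ this with h' | h'
    · exact lt_irrefl _ h'.2
    · exact absurd h'.1 (not_lt.2 hts)

theorem component_two_right {t s : ℝ} (hts : t ≤ s) {θ : ℝ} (h : θ ∈ Ioc s 1) :
    connectedComponentIn (Ico 0 t ∪ Ioc s 1) θ = Ioc s 1 := by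
  refine Subset.antisymm (fun x hx => ?_)
    (IsPreconnected.subset_connectedComponentIn isPreconnected_Ioc h subset_union_right)
  rcases connectedComponentIn_subset _ _ hx with hx' | hx'
  · exfalso
    have : s ∈ connectedComponentIn (Ico 0 t ∪ Ioc s 1) θ :=
      (ordConnected_component _ θ).out hx (mem_connectedComponentIn (Or.inr h))
        ⟨hx'.2.le.trans hts, h.1.le⟩
    rcases connectedComponentIn_subset _ _ this with h' | h'
    · exact absurd h'.2 (not_lt.2 hts)
    · exact lt_irrefl _ h'.1
  · exact hx'

theorem poolVal_two {w : ℝ → ℝ} (hw : Continuous w) {t s : ℝ} (h0 : 0 ≤ t) (hts : t ≤ s)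
    (h1 : s ≤ 1) : poolVal E w (Ico 0 t ∪ Ioc s 1) =
      pv E w 0 t + ∫ θ in Ioo t s, w θ ∂E.prior + pv E w s 1 := by
  have hP := isPoolingSet_two (h0.trans hts) (hts.trans h1)
  rw [poolVal, integral_split (integrable_comp_postMean hP hw) h0 hts h1]
  congr 1
  · congr 1
    · rw [setIntegral_congr_fun (g := fun _ => w (bar E (Ioo 0 t))) measurableSet_Ioo]
      · simp [pv]
      · intro θ h
        have h' : θ ∈ Ico 0 t := ⟨h.1.le, h.2⟩
        have hm : θ ∈ Ico 0 t ∪ Ioc s 1 := Or.inl h'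
        change w (E.postMean _ θ) = _
        rw [postMean_of_mem hm, component_two_left hts h', bar_congr (Ico_zero_ae t)]
    · refine setIntegral_congr_fun measurableSet_Ioo fun θ h => ?_
      rw [postMean_of_notMem]
      rintro (h' | h')
      · linarith [h.1, h'.2]
      · linarith [h.2, h'.1]
  · rw [setIntegral_congr_fun (g := fun _ => w (bar E (Ioo s 1))) measurableSet_Ioo]
    · simp [pv]
    · intro θ h
      have h' : θ ∈ Ioc s 1 := ⟨h.1, h.2.le⟩
      have hm : θ ∈ Ico 0 t ∪ Ioc s 1 := Or.inr h'
      change w (E.postMean _ θ) = _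
      rw [postMean_of_mem hm, component_two_right hts h', bar_congr (Ioc_one_ae s)]

theorem poolVal_full (w : ℝ → ℝ) : poolVal E w (Icc 0 1) = w (mean E) := by
  have : ∀ᵐ θ ∂E.prior, w (E.postMean (Icc 0 1) θ) = w (mean E) := by
    filter_upwards [ae_mem E] with θ h
    rw [postMean_of_mem h, isPreconnected_Icc.connectedComponentIn h, bar_Icc]
  rw [poolVal, integral_congr_ae this]; simp

theorem poolVal_empty (w : ℝ → ℝ) : poolVal E w ∅ = ∫ θ, w θ ∂E.prior := by
  simp [poolVal, postMean_of_notMem]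

theorem setIntegral_sbTan {N θ₀ lam m : ℝ} {C : Set ℝ} (h : 0 < E.prior C) :
    ∫ t in C, sbTan N θ₀ lam m t ∂E.prior = E.prior.real C * sbTan N θ₀ lam m (bar E C) := by
  have := setIntegral_affine h (sbVal N θ₀ lam m - sbSlope N θ₀ lam m * m) (sbSlope N θ₀ lam m)
  rw [show sbTan N θ₀ lam m (bar E C) = sbVal N θ₀ lam m - sbSlope N θ₀ lam m * m +
    sbSlope N θ₀ lam m * bar E C by rw [sbTan]; ring, ← this]
  congr 1; funext t; rw [sbTan]; ring

theorem pv_eq_setIntegral {N θ₀ lam x y : ℝ} (hx : 0 ≤ x) (hxy : x ≤ y) (hy : y ≤ 1) :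
    pv E (sbVal N θ₀ lam) x y = ∫ t in Ioo x y, sbTan N θ₀ lam (bar E (Ioo x y)) t ∂E.prior := by
  rcases hxy.eq_or_lt with rfl | hlt
  · simp [pv]
  · rw [setIntegral_sbTan (prior_Ioo_pos E hx hlt hy), sbTan_self, pv]

variable (E) in
/-- `P` is the unique optimal pooling set for the value function `w`. -/
def IsUniqueOpt (w : ℝ → ℝ) (P : Set ℝ) : Prop :=
  IsPoolingSet P ∧ (∀ Q, IsPoolingSet Q → poolVal E w Q ≤ poolVal E w P) ∧
    ∀ Q, IsPoolingSet Q → poolVal E w P ≤ poolVal E w Q → Q ∩ Ioo 0 1 = P ∩ Ioo 0 1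

/-- A strict supporting line argument on one component. -/
theorem component_lt_of_line (P : Set ℝ) {θ : ℝ} {p l : ℝ → ℝ} (hp : Integrable p E.prior) (hl : Integrable l E.prior)
    (hle : ∀ x ∈ connectedComponentIn P θ, l x ≤ p x)
    {x y m : ℝ} (hx : 0 ≤ x) (hxy : x < y) (hy : y ≤ 1) (hs : Ioo x y ⊆ connectedComponentIn P θ)
    (hlt : ∀ z ∈ Ioo x y, z ≠ m → l z < p z) :
    ∫ t in connectedComponentIn P θ, l t ∂E.prior < ∫ t in connectedComponentIn P θ, p t ∂E.prior := by
  have h1 : 0 < ∫ t in Ioo x y, (p - l) t ∂E.prior :=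
    setIntegral_pos_of measurableSet_Ioo (prior_Ioo_pos E hx hxy hy) (hp.sub hl) (by
      filter_upwards [ae_ne (E := E) m] with t ht hm
      have := hlt t hm ht
      simp only [Pi.sub_apply]; linarith)
  have h2 : ∫ t in Ioo x y, (p - l) t ∂E.prior ≤ ∫ t in connectedComponentIn P θ, (p - l) t ∂E.prior := by
    refine setIntegral_mono_set (hp.sub hl).integrableOn ?_ (LE.le.eventuallyLE hs)
    refine (ae_restrict_iff' (measurableSet_component P θ)).2 (ae_of_all _ fun t ht => ?_)
    have := hle t ht
    simp only [Pi.zero_apply, Pi.sub_apply]; linarith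
  simp only [Pi.sub_apply] at h1 h2
  rw [integral_sub hp.integrableOn hl.integrableOn (μ := E.prior.restrict (connectedComponentIn P θ))] at h2
  linarith

/-- Where the upper bound of the value is attained only at `m`, everything is pooled at `m`. -/
theorem Ioo_subset_of_touch {P : Set ℝ} (hP : IsPoolingSet P) {w p : ℝ → ℝ} {x y m : ℝ}
    (hx : 0 ≤ x) (hy : y ≤ 1) (h1 : ∀ᵐ θ ∂E.prior, θ ∉ P → w θ = p θ)
    (h2 : ∀ θ ∈ P, θ ∈ Ioo x y → w (E.postMean P θ) = p (E.postMean P θ))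
    (hxP : x = 0 ∨ x ∉ P) (hyP : y = 1 ∨ y ∉ P)
    (hlt : ∀ z, x < z → z < y → z ≠ m → w z < p z) : Ioo x y ⊆ P := by
  refine hP.Ioo_subset (E := E) (m := m) hx hy ?_
  filter_upwards [h1, ae_ne (E := E) m] with θ h1 hne hθ
  by_cases hP' : θ ∈ P
  · by_contra hcon
    refine (hlt _ ?_ ?_ hcon).ne (h2 θ hP' hθ)
    · rcases hxP with rfl | h
      · rw [postMean_of_mem hP']
        exact lt_bar (measurableSet_component P θ) (hP.component_pos hP')
          fun t ht => (hP.component_subset θ ht).1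
      · exact hP.lt_component hP' hθ.1 h
    · rcases hyP with rfl | h
      · rw [postMean_of_mem hP']
        exact bar_lt (measurableSet_component P θ) (hP.component_pos hP')
          fun t ht => (hP.component_subset θ ht).2
      · exact hP.component_lt hP' hθ.2 h
  · exact absurd (h1 hP') (hlt θ hθ.1 hθ.2 hne).ne

theorem inter_Ioo_eq_two {P : Set ℝ} {t s : ℝ}
    (ha : Ioo 0 t ⊆ P) (hb : Ioo s 1 ⊆ P) (hc : ∀ z ∈ Ioo (0:ℝ) 1, t ≤ z → z ≤ s → z ∉ P) :
    P ∩ Ioo 0 1 = (Ico 0 t ∪ Ioc s 1) ∩ Ioo 0 1 := by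
  ext z
  constructor
  · rintro ⟨hz, hI⟩
    refine ⟨?_, hI⟩
    by_cases h : t ≤ z
    · right
      refine ⟨?_, hI.2.le⟩
      by_contra h'
      exact hc z hI h (not_lt.1 h') hz
    · left; exact ⟨hI.1.le, not_le.1 h⟩
  · rintro ⟨hz | hz, hI⟩
    · exact ⟨ha ⟨hI.1, hz.2⟩, hI⟩
    · exact ⟨hb ⟨hz.1, hI.2⟩, hI⟩

end Intervals

/-! ### Optimal pooling when the price function is convex -/

section Verification

variable {E : Environment}

theorem setIntegral_line {C : Set ℝ} (h : 0 < E.prior C) (v σ t : ℝ) :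
    ∫ x in C, (v + σ * (x - t)) ∂E.prior = E.prior.real C * (v + σ * (bar E C - t)) := by
  have := setIntegral_affine h (v - σ * t) σ
  rw [show v + σ * (bar E C - t) = v - σ * t + σ * bar E C by ring, ← this]
  congr 1; funext x; ring

/-- The convex price function that is `x ^ 2 / 2` between `t` and `s` and affine outside. -/
noncomputable def price (t s σ τ x : ℝ) : ℝ :=
  if x < t then t ^ 2 / 2 + σ * (x - t) else if x ≤ s then x ^ 2 / 2 else s ^ 2 / 2 + τ * (x - s)

/-- Supporting line of the price function at `b`. -/
noncomputable def priceLine (t s σ τ b x : ℝ) : ℝ :=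
  if b < t then t ^ 2 / 2 + σ * (x - t) else if b ≤ s then b ^ 2 / 2 + b * (x - b)
    else s ^ 2 / 2 + τ * (x - s)

theorem priceLine_le {t s σ τ : ℝ} (hσ : σ ≤ t) (hts : t ≤ s) (hτ : s ≤ τ) (b x : ℝ) :
    priceLine t s σ τ b x ≤ price t s σ τ x := by
  unfold priceLine price
  split_ifs <;> (try simp only [not_lt, not_le] at *) <;> nlinarith [sq_nonneg (x - b)]

theorem priceLine_lt {t s σ τ : ℝ} (hσ : σ ≤ t) (hτ : s ≤ τ) {b x : ℝ}
    (hx : x ∈ Ioo t s) (hne : x ≠ b) : priceLine t s σ τ b x < price t s σ τ x := by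
  unfold priceLine price
  have h1 := hx.1
  have h2 := hx.2
  have h3 : 0 < (x - b) ^ 2 := by have := sub_ne_zero.2 hne; positivity
  rw [if_neg (not_lt.2 h1.le), if_pos h2.le]
  split_ifs <;> (try simp only [not_lt, not_le] at *) <;> nlinarith

theorem priceLine_self (t s σ τ b : ℝ) : priceLine t s σ τ b b = price t s σ τ b := by
  unfold priceLine price
  split_ifs <;> ring

theorem measurable_price (t s σ τ : ℝ) : Measurable (price t s σ τ) := by
  unfold price
  refine Measurable.ite measurableSet_Iio (by fun_prop) (Measurable.ite measurableSet_Iic (by fun_prop) (by fun_prop))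

theorem integrable_price {t s σ τ : ℝ} : Integrable (price t s σ τ) E.prior := by
  refine integrable_of_bdd E (measurable_price t s σ τ).aestronglyMeasurable
    (C := t ^ 2 / 2 + |σ| * (1 + |t|) + (1 / 2) + (s ^ 2 / 2 + |τ| * (1 + |s|))) fun x hx => ?_
  have hx1 : |x - t| ≤ 1 + |t| := (abs_sub _ _).trans (by rw [abs_of_nonneg hx.1]; linarith [hx.2])
  have hx2 : |x - s| ≤ 1 + |s| := (abs_sub _ _).trans (by rw [abs_of_nonneg hx.1]; linarith [hx.2])
  have a1 : |σ * (x - t)| ≤ |σ| * (1 + |t|) := by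
    rw [abs_mul]; exact mul_le_mul_of_nonneg_left hx1 (abs_nonneg _)
  have a2 : |τ * (x - s)| ≤ |τ| * (1 + |s|) := by
    rw [abs_mul]; exact mul_le_mul_of_nonneg_left hx2 (abs_nonneg _)
  have b1 : 0 ≤ |σ| * (1 + |t|) := by positivity
  have b2 : 0 ≤ |τ| * (1 + |s|) := by positivity
  have c1 := abs_le.1 a1
  have c2 := abs_le.1 a2
  have d1 := sq_nonneg t
  have d2 := sq_nonneg s
  unfold price
  rw [abs_le]
  split_ifs
  · constructor <;> linarith
  · have := hx.1; have := hx.2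
    constructor <;> nlinarith
  · constructor <;> linarith

theorem continuous_priceLine (t s σ τ b : ℝ) : Continuous (priceLine t s σ τ b) := by
  unfold priceLine
  split_ifs <;> fun_prop

theorem setIntegral_priceLine {t s σ τ b : ℝ} {C : Set ℝ} (h : 0 < E.prior C) :
    ∫ x in C, priceLine t s σ τ b x ∂E.prior = E.prior.real C * priceLine t s σ τ b (bar E C) := by
  unfold priceLine
  split_ifs
  · exact setIntegral_line h _ _ _
  · exact setIntegral_line h _ _ _
  · exact setIntegral_line h _ _ _

/-- Verification: two end pools with separation in between. -/
theorem isUniqueOpt_two {w : ℝ → ℝ} (hw : Continuous w) {t s σ τ : ℝ} (h0 : 0 < t) (hts : t < s)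
    (h1 : s ≤ 1) (hσ : σ ≤ t) (hτ : s ≤ τ) (hmid : ∀ x, t ≤ x → x ≤ s → w x = x ^ 2 / 2)
    (hlo : ∀ x, 0 ≤ x → x < t → x ≠ bar E (Ioo 0 t) → w x < t ^ 2 / 2 + σ * (x - t))
    (hlo' : w (bar E (Ioo 0 t)) = t ^ 2 / 2 + σ * (bar E (Ioo 0 t) - t))
    (hhi : ∀ x, s < x → x ≤ 1 → x ≠ bar E (Ioo s 1) → w x < s ^ 2 / 2 + τ * (x - s))
    (hhi' : s < 1 → w (bar E (Ioo s 1)) = s ^ 2 / 2 + τ * (bar E (Ioo s 1) - s)) :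
    IsUniqueOpt E w (Ico 0 t ∪ Ioc s 1) := by
  have hval : poolVal E w (Ico 0 t ∪ Ioc s 1) = ∫ x, price t s σ τ x ∂E.prior := by
    rw [poolVal_two hw h0.le hts.le h1, integral_split integrable_price h0.le hts.le h1]
    congr 1
    · congr 1
      · rw [setIntegral_congr_fun (g := fun x => t ^ 2 / 2 + σ * (x - t)) measurableSet_Ioo fun x hx => by
          simp [price, hx.2], setIntegral_line (prior_Ioo_pos E le_rfl h0 (hts.le.trans h1)), pv, hlo']
      · refine setIntegral_congr_fun measurableSet_Ioo fun x hx => ?_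
        simp [price, hx.1.le, hx.2.le, hmid x hx.1.le hx.2.le]
    · rcases h1.eq_or_lt with rfl | h1
      · simp [pv]
      · rw [setIntegral_congr_fun (g := fun x => s ^ 2 / 2 + τ * (x - s)) measurableSet_Ioo fun x hx => by
          simp [price, not_lt.2 (hts.trans hx.1).le, not_le.2 hx.1],
          setIntegral_line (prior_Ioo_pos E (h0.le.trans hts.le) h1 le_rfl), pv, hhi' h1]
  have hwp : ∀ x, 0 ≤ x → x ≤ 1 → w x ≤ price t s σ τ x := by
    intro x hx0 hx1
    unfold price
    split_ifs with ha hb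
    · by_cases he : x = bar E (Ioo 0 t)
      · rw [he]; exact hlo'.le
      · exact (hlo x hx0 ha he).le
    · exact (hmid x (not_lt.1 ha) hb).le
    · push Not at ha hb
      by_cases he : x = bar E (Ioo s 1)
      · rw [he]; exact (hhi' (hb.trans_le hx1)).le
      · exact (hhi x hb hx1 he).le
  have hcomp : ∀ Q, IsPoolingSet Q → ∀ θ ∈ Q,
      E.prior.real (connectedComponentIn Q θ) * price t s σ τ (bar E (connectedComponentIn Q θ))
        ≤ ∫ x in connectedComponentIn Q θ, price t s σ τ x ∂E.prior := by
    intro Q hQ θ hθ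
    have hp := hQ.component_pos (E := E) hθ
    rw [← priceLine_self, ← setIntegral_priceLine hp]
    exact setIntegral_mono_on (integrable_of_continuous E (continuous_priceLine _ _ _ _ _)).integrableOn
      integrable_price.integrableOn (measurableSet_component Q θ) fun x _ => priceLine_le hσ hts.le hτ _ _
  have hcomp' : ∀ Q, IsPoolingSet Q → ∀ θ ∈ Q,
      E.prior.real (connectedComponentIn Q θ) * w (bar E (connectedComponentIn Q θ))
        ≤ ∫ x in connectedComponentIn Q θ, price t s σ τ x ∂E.prior := by
    intro Q hQ θ hθ
    refine le_trans ?_ (hcomp Q hQ θ hθ)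
    have := hQ.component_subset θ (hQ.bar_mem (E := E) hθ)
    exact mul_le_mul_of_nonneg_left (hwp _ this.1 this.2) measureReal_nonneg
  refine ⟨isPoolingSet_two (h0.le.trans hts.le) (hts.le.trans h1), fun Q hQ => ?_, fun Q hQ hle => ?_⟩
  · rw [hval]
    exact poolVal_le hQ hw integrable_price (fun θ hθ _ => hwp θ hθ.1 hθ.2) (hcomp' Q hQ)
  · rw [hval] at hle
    obtain ⟨e1, e2⟩ := eq_of_poolVal_eq hQ hw integrable_price (fun θ hθ _ => hwp θ hθ.1 hθ.2)
      (hcomp' Q hQ) hle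
    have e3 : ∀ θ ∈ Q, w (bar E (connectedComponentIn Q θ)) =
        price t s σ τ (bar E (connectedComponentIn Q θ)) := by
      intro θ hθ
      have hp := real_pos (hQ.component_pos (E := E) hθ)
      have := hQ.component_subset θ (hQ.bar_mem (E := E) hθ)
      refine le_antisymm (hwp _ this.1 this.2) ?_
      have h3 := e2 θ hθ
      have h4 := hcomp Q hQ θ hθ
      rw [← h3] at h4
      exact le_of_mul_le_mul_left h4 hp
    have hmiss : ∀ θ ∈ Icc t s, θ ∉ Q := by
      intro θ hθ hQθ
      obtain ⟨x, y, hx, hxy, hy, hs⟩ := hQ.component_inter_Ioo hQθ h0.le h1 hθ hts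
      have hp := hQ.component_pos (E := E) hQθ
      have hlt := component_lt_of_line (E := E) Q (θ := θ) integrable_price
        (integrable_of_continuous E (continuous_priceLine t s σ τ (bar E (connectedComponentIn Q θ))))
        (fun x _ => priceLine_le hσ hts.le hτ _ x) (m := bar E (connectedComponentIn Q θ))
        (h0.le.trans hx) hxy (hy.trans h1) hs
        (fun z hz hne => priceLine_lt hσ hτ ⟨hx.trans_lt hz.1, hz.2.trans_le hy⟩ hne)
      rw [setIntegral_priceLine hp, priceLine_self, ← e3 θ hQθ, e2 θ hQθ] at hlt
      exact lt_irrefl _ hlt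
    have e4 : ∀ θ ∈ Q, w (E.postMean Q θ) = price t s σ τ (E.postMean Q θ) := fun θ hθ => by
      rw [postMean_of_mem hθ]; exact e3 θ hθ
    have hlow : Ioo 0 t ⊆ Q := by
      refine Ioo_subset_of_touch hQ (w := w) (p := price t s σ τ) (m := bar E (Ioo 0 t)) le_rfl
        (hts.le.trans h1) e1 (fun θ hθ _ => e4 θ hθ)
        (Or.inl rfl) (Or.inr (hmiss t ⟨le_rfl, hts.le⟩)) fun z h1 h2 hne => ?_
      rw [price, if_pos h2]; exact hlo z h1.le h2 hne
    have hhigh : Ioo s 1 ⊆ Q := by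
      refine Ioo_subset_of_touch hQ (w := w) (p := price t s σ τ) (m := bar E (Ioo s 1))
        (h0.le.trans hts.le) le_rfl e1 (fun θ hθ _ => e4 θ hθ)
        (Or.inr (hmiss s ⟨hts.le, le_rfl⟩)) (Or.inl rfl) fun z h1 h2 hne => ?_
      rw [price, if_neg (not_lt.2 (hts.trans h1).le), if_neg (not_le.2 h1)]
      exact hhi z h1 h2.le hne
    exact inter_Ioo_eq_two hlow hhigh fun z _ ha hb => hmiss z ⟨ha, hb⟩

/-- Verification: full separation. -/
theorem isUniqueOpt_empty {w : ℝ → ℝ} (hw : Continuous w)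
    (h : ∀ x ∈ Icc (0:ℝ) 1, w x = x ^ 2 / 2) : IsUniqueOpt E w ∅ := by
  have hval : poolVal E w ∅ = ∫ x, price 0 1 0 1 x ∂E.prior := by
    rw [poolVal_empty]
    refine integral_congr_ae ?_
    filter_upwards [ae_mem E] with x hx
    rw [h x hx, price, if_neg (not_lt.2 hx.1), if_pos hx.2]
  have hwp : ∀ x ∈ Icc (0:ℝ) 1, w x = price 0 1 0 1 x := fun x hx => by
    rw [h x hx, price, if_neg (not_lt.2 hx.1), if_pos hx.2]
  have hcomp : ∀ Q, IsPoolingSet Q → ∀ θ ∈ Q,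
      E.prior.real (connectedComponentIn Q θ) * w (bar E (connectedComponentIn Q θ))
        < ∫ x in connectedComponentIn Q θ, price 0 1 0 1 x ∂E.prior := by
    intro Q hQ θ hθ
    obtain ⟨x, y, hx, hxy, hy, hs⟩ :=
      hQ.component_inter_Ioo hθ le_rfl le_rfl (hQ.subset hθ) zero_lt_one
    rw [hwp _ (hQ.component_subset θ (hQ.bar_mem hθ)), ← priceLine_self,
      ← setIntegral_priceLine (hQ.component_pos hθ)]
    exact component_lt_of_line Q integrable_price
      (integrable_of_continuous E (continuous_priceLine _ _ _ _ _))
      (fun x _ => priceLine_le le_rfl zero_le_one le_rfl _ x) hx hxy hy hs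
      (fun z hz hne => priceLine_lt le_rfl le_rfl ⟨hx.trans_lt hz.1, hz.2.trans_le hy⟩ hne)
  refine ⟨isPoolingSet_empty, fun Q hQ => ?_, fun Q hQ hle => ?_⟩
  · rw [hval]
    exact poolVal_le hQ hw integrable_price (fun θ hθ _ => (hwp θ hθ).le) fun θ hθ => (hcomp Q hQ θ hθ).le
  · rw [hval] at hle
    obtain ⟨-, e2⟩ := eq_of_poolVal_eq hQ hw integrable_price (fun θ hθ _ => (hwp θ hθ).le)
      (fun θ hθ => (hcomp Q hQ θ hθ).le) hle
    have : Q = ∅ := by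
      by_contra hne
      obtain ⟨θ, hθ⟩ := nonempty_iff_ne_empty.2 hne
      exact (hcomp Q hQ θ hθ).ne (e2 θ hθ)
    rw [this]

/-- Verification: complete pooling. -/
theorem isUniqueOpt_full {w : ℝ → ℝ} (hw : Continuous w) {k : ℝ}
    (h : ∀ x ∈ Ioo (0:ℝ) 1, x ≠ mean E → w x < w (mean E) + k * (x - mean E)) :
    IsUniqueOpt E w (Icc 0 1) := by
  have hval : poolVal E w (Icc 0 1) = ∫ x, (w (mean E) + k * (x - mean E)) ∂E.prior := by
    rw [poolVal_full, ← setIntegral_univ, setIntegral_line (by simp), bar_univ]; simp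
  have hint : Integrable (fun x => w (mean E) + k * (x - mean E)) E.prior :=
    integrable_of_continuous E (by fun_prop)
  have hwp' : ∀ x ∈ Ioo (0:ℝ) 1, w x ≤ w (mean E) + k * (x - mean E) := by
    intro x hx
    by_cases he : x = mean E
    · subst he; simp
    · exact (h x hx he).le
  have hwp : ∀ x ∈ Icc (0:ℝ) 1, w x ≤ w (mean E) + k * (x - mean E) := by
    have hc : Icc (0:ℝ) 1 ⊆ closure (Ioo 0 1) := by rw [closure_Ioo zero_ne_one]
    intro x hx
    exact closure_minimal (s := Ioo (0:ℝ) 1) (t := {x | w x ≤ w (mean E) + k * (x - mean E)}) hwp'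
      (isClosed_le hw (by fun_prop)) (hc hx)
  have hcomp : ∀ Q, IsPoolingSet Q → ∀ θ ∈ Q,
      E.prior.real (connectedComponentIn Q θ) * w (bar E (connectedComponentIn Q θ))
        ≤ ∫ x in connectedComponentIn Q θ, (w (mean E) + k * (x - mean E)) ∂E.prior := by
    intro Q hQ θ hθ
    rw [setIntegral_line (hQ.component_pos hθ)]
    exact mul_le_mul_of_nonneg_left (hwp _ (hQ.component_subset θ (hQ.bar_mem hθ))) measureReal_nonneg
  refine ⟨isPoolingSet_Icc, fun Q hQ => ?_, fun Q hQ hle => ?_⟩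
  · rw [hval]
    exact poolVal_le hQ hw hint (fun θ hθ _ => hwp θ hθ) (hcomp Q hQ)
  · rw [hval] at hle
    obtain ⟨e1, e2⟩ := eq_of_poolVal_eq hQ hw hint (fun θ hθ _ => hwp θ hθ) (hcomp Q hQ) hle
    have hs : Ioo 0 1 ⊆ Q := by
      refine Ioo_subset_of_touch hQ (m := mean E) le_rfl le_rfl e1 (fun θ hθ _ => ?_) (Or.inl rfl)
        (Or.inl rfl) fun z h1 h2 hne => h z ⟨h1, h2⟩ hne
      have := e2 θ hθ
      rw [setIntegral_line (hQ.component_pos hθ)] at this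
      rw [postMean_of_mem hθ]
      exact mul_left_cancel₀ (real_pos (hQ.component_pos (E := E) hθ)).ne' this
    rw [inter_eq_self_of_subset_right hs, inter_eq_self_of_subset_right Ioo_subset_Icc_self]

end Verification

/-! ### Boundaries of the end pools -/

section Boundaries

variable {E : Environment}

variable (E) in
/-- Distribution function of the prior. -/
noncomputable def cdf₀ (y : ℝ) : ℝ := ∫ _ in (0:ℝ)..y, (1:ℝ) ∂E.prior

variable (E) in
/-- Partial first moment of the prior. -/
noncomputable def mom₀ (y : ℝ) : ℝ := ∫ t in (0:ℝ)..y, t ∂E.prior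

theorem continuous_cdf₀ : Continuous (cdf₀ E) :=
  intervalIntegral.continuous_primitive (fun _ _ =>
    (integrable_const (1:ℝ)).intervalIntegrable) 0

theorem continuous_mom₀ : Continuous (mom₀ E) :=
  intervalIntegral.continuous_primitive (fun _ _ => integrable_id'.intervalIntegrable) 0

theorem mass_Ioo {x y : ℝ} (hxy : x ≤ y) : E.prior.real (Ioo x y) = cdf₀ E y - cdf₀ E x := by
  rw [cdf₀, cdf₀, intervalIntegral.integral_interval_sub_left
    (integrable_const (1:ℝ)).intervalIntegrable (integrable_const (1:ℝ)).intervalIntegrable,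
    intervalIntegral.integral_of_le hxy, ← setIntegral_congr_set (Ioo_ae_eq_Ioc)]
  simp

theorem moment_Ioo {x y : ℝ} (hxy : x ≤ y) : ∫ t in Ioo x y, t ∂E.prior = mom₀ E y - mom₀ E x := by
  rw [mom₀, mom₀, intervalIntegral.integral_interval_sub_left
    integrable_id'.intervalIntegrable integrable_id'.intervalIntegrable,
    intervalIntegral.integral_of_le hxy, ← setIntegral_congr_set (Ioo_ae_eq_Ioc)]

theorem mass_split {x y z : ℝ} (hxy : x ≤ y) (hyz : y ≤ z) :
    E.prior.real (Ioo x z) = E.prior.real (Ioo x y) + E.prior.real (Ioo y z) := by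
  rw [mass_Ioo hxy, mass_Ioo hyz, mass_Ioo (hxy.trans hyz)]; ring

theorem mass_pos {x y : ℝ} (hx : 0 ≤ x) (hxy : x < y) (hy : y ≤ 1) :
    0 < E.prior.real (Ioo x y) := real_pos (prior_Ioo_pos E hx hxy hy)

theorem mass_mul_bar (x y : ℝ) :
    E.prior.real (Ioo x y) * bar E (Ioo x y) = ∫ t in Ioo x y, t ∂E.prior := by
  by_cases h : E.prior (Ioo x y) = 0
  · rw [setIntegral_measure_zero _ h]; simp [Measure.real, h]
  · exact real_mul_bar (pos_iff_ne_zero.2 h)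

theorem bar_split {x y z : ℝ} (hxy : x ≤ y) (hyz : y ≤ z) :
    E.prior.real (Ioo x z) * bar E (Ioo x z) =
      E.prior.real (Ioo x y) * bar E (Ioo x y) + E.prior.real (Ioo y z) * bar E (Ioo y z) := by
  rw [mass_mul_bar, mass_mul_bar, mass_mul_bar, moment_Ioo hxy, moment_Ioo hyz,
    moment_Ioo (hxy.trans hyz)]; ring

theorem bar_lt_bar_left {x y z : ℝ} (hx : 0 ≤ x) (hxy : x < y) (hyz : y < z) (hz : z ≤ 1) :
    bar E (Ioo x y) < bar E (Ioo x z) := by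
  have h1 := bar_Ioo_mem (E := E) hx hxy (hyz.le.trans hz)
  have h2 := bar_Ioo_mem (E := E) (hx.trans hxy.le) hyz hz
  have h3 := bar_split (E := E) hxy.le hyz.le
  have h4 := mass_pos (E := E) hx hxy (hyz.le.trans hz)
  have h5 := mass_pos (E := E) (hx.trans hxy.le) hyz hz
  have h6 := mass_split (E := E) hxy.le hyz.le
  have : bar E (Ioo x y) < bar E (Ioo y z) := h1.2.trans h2.1
  rw [h6] at h3
  by_contra hcon
  nlinarith

theorem bar_lt_bar_right {x y z : ℝ} (hx : 0 ≤ x) (hxy : x < y) (hyz : y < z) (hz : z ≤ 1) :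
    bar E (Ioo x z) < bar E (Ioo y z) := by
  have h1 := bar_Ioo_mem (E := E) hx hxy (hyz.le.trans hz)
  have h2 := bar_Ioo_mem (E := E) (hx.trans hxy.le) hyz hz
  have h3 := bar_split (E := E) hxy.le hyz.le
  have h4 := mass_pos (E := E) hx hxy (hyz.le.trans hz)
  have h5 := mass_pos (E := E) (hx.trans hxy.le) hyz hz
  have h6 := mass_split (E := E) hxy.le hyz.le
  have : bar E (Ioo x y) < bar E (Ioo y z) := h1.2.trans h2.1
  rw [h6] at h3
  by_contra hcon
  nlinarith

theorem bar_Ioo_01 : bar E (Ioo 0 1) = mean E := by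
  rw [← bar_Icc]; exact bar_congr Ioo_ae_eq_Icc

theorem mass_Ioo_01 : E.prior.real (Ioo 0 1) = 1 := by
  rw [measureReal_congr (Ioo_ae_eq_Icc (μ := E.prior)), Measure.real, prior_Icc]; simp

variable (E) in
/-- Lower extreme-state cutoff at which the lower pool ends at `t`. -/
noncomputable def loCut (γ t : ℝ) : ℝ := (1 - γ) * t + γ * bar E (Ioo 0 t)

variable (E) in
/-- Upper extreme-state cutoff at which the upper pool starts at `t`. -/
noncomputable def hiCut (γ t : ℝ) : ℝ := (1 - γ) * t + γ * (if t < 1 then bar E (Ioo t 1) else 1)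

theorem bar_empty : bar E ∅ = 0 := by simp [bar]

theorem loCut_zero (γ : ℝ) : loCut E γ 0 = 0 := by simp [loCut, bar_empty]

theorem loCut_one (γ : ℝ) : loCut E γ 1 = (1 - γ) + γ * mean E := by simp [loCut, bar_Ioo_01]

theorem hiCut_one (γ : ℝ) : hiCut E γ 1 = 1 := by simp [hiCut]

theorem hiCut_zero (γ : ℝ) : hiCut E γ 0 = γ * mean E := by simp [hiCut, bar_Ioo_01]

theorem loCut_strictMono {γ : ℝ} (h0 : 0 < γ) (h1 : γ < 1) : StrictMonoOn (loCut E γ) (Icc 0 1) := by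
  intro s hs t ht hst
  have : bar E (Ioo 0 s) ≤ bar E (Ioo 0 t) := by
    rcases hs.1.eq_or_lt with rfl | h
    · simpa [bar_empty] using (bar_Ioo_mem (E := E) le_rfl hst ht.2).1.le
    · exact (bar_lt_bar_left le_rfl h hst ht.2).le
  unfold loCut
  nlinarith

theorem hiCut_strictMono {γ : ℝ} (h0 : 0 < γ) (h1 : γ < 1) : StrictMonoOn (hiCut E γ) (Icc 0 1) := by
  intro s hs t ht hst
  have : bar E (Ioo s 1) ≤ (if t < 1 then bar E (Ioo t 1) else 1) := by
    split_ifs with h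
    · exact (bar_lt_bar_right hs.1 hst h le_rfl).le
    · exact (bar_Ioo_mem (E := E) hs.1 (hst.trans_le ht.2) le_rfl).2.le
  unfold hiCut
  rw [if_pos (hst.trans_le ht.2)]
  nlinarith

theorem bar_eq_div {x y : ℝ} (hxy : x ≤ y) :
    bar E (Ioo x y) = (mom₀ E y - mom₀ E x) / (cdf₀ E y - cdf₀ E x) := by
  rw [bar, moment_Ioo hxy, mass_Ioo hxy]

theorem loCut_continuousOn (γ : ℝ) : ContinuousOn (loCut E γ) (Icc 0 1) := by
  have key : ContinuousOn (fun t => bar E (Ioo 0 t)) (Icc 0 1) := by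
    intro t ht
    rcases ht.1.eq_or_lt with rfl | h
    · have h1 : Tendsto (fun t : ℝ => t) (𝓝[Icc 0 1] 0) (𝓝 0) := nhdsWithin_le_nhds
      rw [ContinuousWithinAt]
      simp only [Ioo_self, bar_empty]
      refine tendsto_of_tendsto_of_tendsto_of_le_of_le' tendsto_const_nhds h1 ?_ ?_
      · filter_upwards [self_mem_nhdsWithin] with s hs
        rcases hs.1.eq_or_lt with rfl | h
        · simp [bar_empty]
        · exact (bar_Ioo_mem le_rfl h hs.2).1.le
      · filter_upwards [self_mem_nhdsWithin] with s hs
        rcases hs.1.eq_or_lt with rfl | h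
        · simp [bar_empty]
        · exact (bar_Ioo_mem le_rfl h hs.2).2.le
    · have h2 : ContinuousAt (fun t => (mom₀ E t - mom₀ E 0) / (cdf₀ E t - cdf₀ E 0)) t := by
        refine (continuous_mom₀.continuousAt.sub continuousAt_const).div
          (continuous_cdf₀.continuousAt.sub continuousAt_const) ?_
        rw [← mass_Ioo h.le]; exact (mass_pos le_rfl h ht.2).ne'
      refine h2.continuousWithinAt.congr (fun s hs => bar_eq_div hs.1) (bar_eq_div h.le)
  unfold loCut
  exact (continuousOn_const.mul continuousOn_id).add (continuousOn_const.mul key)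

theorem hiCut_continuousOn (γ : ℝ) : ContinuousOn (hiCut E γ) (Icc 0 1) := by
  have key : ContinuousOn (fun t => if t < 1 then bar E (Ioo t 1) else 1) (Icc 0 1) := by
    intro t ht
    rcases ht.2.eq_or_lt with rfl | h
    · have h1 : Tendsto (fun t : ℝ => t) (𝓝[Icc 0 1] 1) (𝓝 1) := nhdsWithin_le_nhds
      rw [ContinuousWithinAt]
      simp only [lt_irrefl, if_false]
      refine tendsto_of_tendsto_of_tendsto_of_le_of_le' h1 tendsto_const_nhds ?_ ?_
      · filter_upwards [self_mem_nhdsWithin] with s hs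
        split_ifs with h
        · exact (bar_Ioo_mem hs.1 h le_rfl).1.le
        · exact hs.2
      · filter_upwards [self_mem_nhdsWithin] with s hs
        split_ifs with h
        · exact (bar_Ioo_mem hs.1 h le_rfl).2.le
        · exact le_rfl
    · have h2 : ContinuousAt (fun t => (mom₀ E 1 - mom₀ E t) / (cdf₀ E 1 - cdf₀ E t)) t := by
        refine (continuousAt_const.sub continuous_mom₀.continuousAt).div
          (continuousAt_const.sub continuous_cdf₀.continuousAt) ?_
        rw [← mass_Ioo h.le]; exact (mass_pos ht.1 h le_rfl).ne'
      refine ContinuousAt.continuousWithinAt (h2.congr ?_)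
      filter_upwards [Iio_mem_nhds h] with s hs
      rw [if_pos (mem_Iio.1 hs), bar_eq_div (le_of_lt hs)]
  unfold hiCut
  exact (continuousOn_const.mul continuousOn_id).add (continuousOn_const.mul key)

theorem loCut_lt {γ t : ℝ} (h0 : 0 < γ) (ht : 0 < t) (ht1 : t ≤ 1) : loCut E γ t < t := by
  have := (bar_Ioo_mem (E := E) le_rfl ht ht1).2
  unfold loCut; nlinarith

theorem bar_lt_loCut {γ t : ℝ} (h1 : γ < 1) (ht : 0 < t) (ht1 : t ≤ 1) :
    bar E (Ioo 0 t) < loCut E γ t := by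
  have := (bar_Ioo_mem (E := E) le_rfl ht ht1).2
  unfold loCut; nlinarith

theorem lt_hiCut {γ t : ℝ} (h0 : 0 < γ) (ht : 0 ≤ t) (ht1 : t < 1) : t < hiCut E γ t := by
  have := (bar_Ioo_mem (E := E) ht ht1 le_rfl).1
  unfold hiCut; rw [if_pos ht1]; nlinarith

theorem hiCut_lt_bar {γ t : ℝ} (h1 : γ < 1) (ht : 0 ≤ t) (ht1 : t < 1) :
    hiCut E γ t < bar E (Ioo t 1) := by
  have := (bar_Ioo_mem (E := E) ht ht1 le_rfl).1
  unfold hiCut; rw [if_pos ht1]; nlinarith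

theorem loCut_lipschitz {K : ℝ} (hK : ∀ θ ∈ Icc (0:ℝ) 1, E.f θ ≤ K) {γ t₀ s t : ℝ} (hγ0 : 0 < γ)
    (hγ1 : γ < 1) (h0 : 0 < t₀) (hs : t₀ ≤ s) (hst : s ≤ t) (ht : t ≤ 1) :
    loCut E γ t - loCut E γ s ≤ (1 + K / E.prior.real (Ioo 0 t₀)) * (t - s) := by
  rcases hst.eq_or_lt with rfl | hlt
  · simp
  have hs0 : 0 < s := h0.trans_le hs
  have m1 := mass_pos (E := E) le_rfl h0 ((hs.trans hst).trans ht)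
  have m2 : E.prior.real (Ioo 0 t₀) ≤ E.prior.real (Ioo 0 t) := by
    rw [mass_split h0.le (hs.trans hst)]; linarith [measureReal_nonneg (μ := E.prior) (s := Ioo t₀ t)]
  have m3 := mass_pos (E := E) hs0.le hlt ht
  have m4 : E.prior.real (Ioo s t) ≤ K * (t - s) := by
    rw [measureReal_congr (Ioo_ae_eq_Icc (μ := E.prior))]; exact prior_le_of_bdd E hK hst
  have b1 := bar_Ioo_mem (E := E) le_rfl hs0 (hst.trans ht)
  have b2 := bar_Ioo_mem (E := E) hs0.le hlt ht
  have e1 := bar_split (E := E) hs0.le hst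
  have e2 := mass_split (E := E) hs0.le hst
  have hb := bar_lt_bar_left (E := E) le_rfl hs0 hlt ht
  have e3 : E.prior.real (Ioo 0 t) * (bar E (Ioo 0 t) - bar E (Ioo 0 s)) ≤ K * (t - s) := by
    have : E.prior.real (Ioo 0 t) * (bar E (Ioo 0 t) - bar E (Ioo 0 s)) =
        E.prior.real (Ioo s t) * (bar E (Ioo s t) - bar E (Ioo 0 s)) := by
      rw [mul_sub, e1, e2]; ring
    rw [this]
    nlinarith [b1.1, b2.2]
  have e4 : bar E (Ioo 0 t) - bar E (Ioo 0 s) ≤ K / E.prior.real (Ioo 0 t₀) * (t - s) := by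
    rw [div_mul_eq_mul_div, le_div_iff₀ m1]
    nlinarith
  unfold loCut
  nlinarith

theorem hiCut_lipschitz {K : ℝ} (hK : ∀ θ ∈ Icc (0:ℝ) 1, E.f θ ≤ K) {γ t₁ s t : ℝ} (hγ0 : 0 < γ)
    (hγ1 : γ < 1) (h1 : t₁ < 1) (hs : 0 ≤ s) (hst : s ≤ t) (ht : t ≤ t₁) :
    hiCut E γ t - hiCut E γ s ≤ (1 + K / E.prior.real (Ioo t₁ 1)) * (t - s) := by
  rcases hst.eq_or_lt with rfl | hlt
  · simp
  have ht1 : t < 1 := ht.trans_lt h1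
  have m1 := mass_pos (E := E) (hs.trans (hst.trans ht)) h1 le_rfl
  have m2 : E.prior.real (Ioo t₁ 1) ≤ E.prior.real (Ioo s 1) := by
    rw [mass_split (hst.trans ht) h1.le]; linarith [measureReal_nonneg (μ := E.prior) (s := Ioo s t₁)]
  have m3 := mass_pos (E := E) hs hlt ht1.le
  have m4 : E.prior.real (Ioo s t) ≤ K * (t - s) := by
    rw [measureReal_congr (Ioo_ae_eq_Icc (μ := E.prior))]; exact prior_le_of_bdd E hK hst
  have b1 := bar_Ioo_mem (E := E) (hs.trans hst) ht1 le_rfl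
  have b2 := bar_Ioo_mem (E := E) hs hlt ht1.le
  have e1 := bar_split (E := E) hst ht1.le
  have e2 := mass_split (E := E) hst ht1.le
  have hb := bar_lt_bar_right (E := E) hs hlt ht1 le_rfl
  have e3 : E.prior.real (Ioo s 1) * (bar E (Ioo t 1) - bar E (Ioo s 1)) ≤ K * (t - s) := by
    have : E.prior.real (Ioo s 1) * (bar E (Ioo t 1) - bar E (Ioo s 1)) =
        E.prior.real (Ioo s t) * (bar E (Ioo t 1) - bar E (Ioo s t)) := by
      rw [mul_sub, e1, e2]; ring
    rw [this]
    nlinarith [b1.2, b2.1]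
  have e4 : bar E (Ioo t 1) - bar E (Ioo s 1) ≤ K / E.prior.real (Ioo t₁ 1) * (t - s) := by
    rw [div_mul_eq_mul_div, le_div_iff₀ m1]
    nlinarith
  unfold hiCut
  rw [if_pos ht1, if_pos (hlt.trans ht1)]
  nlinarith

variable {N θ₀ lam γ : ℝ}

theorem isUniqueOpt_sbVal_empty (hl : θ₀ ≤ lam) (h0 : 1 / 2 ≤ θ₀) :
    IsUniqueOpt E (sbVal N θ₀ lam) ∅ :=
  isUniqueOpt_empty continuous_sbVal fun x hx =>
    sbVal_mid (by linarith [hx.1]) (by linarith [hx.2])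

theorem isUniqueOpt_sbVal_full (hN : 1 < N) (hl : 0 ≤ lam) (hγ1 : γ < 1)
    (hγ : γ ^ 2 * N ^ 2 = N ^ 2 - 1) (h : loCut E γ 1 ≤ θ₀ - lam) :
    IsUniqueOpt E (sbVal N θ₀ lam) (Icc 0 1) := by
  rw [loCut_one] at h
  have hμ := mean_mem (E := E)
  refine isUniqueOpt_full continuous_sbVal (k := sbSlope N θ₀ lam (mean E)) fun x hx hne => ?_
  exact lt_sbTan_of_lower hN hl hγ1 hγ (t := 1) (by nlinarith [hμ.2]) (by linarith) hx.2 hne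

theorem slope_aux (hN : 1 < N) (hγ0 : 0 < γ) (hγ : γ ^ 2 * N ^ 2 = N ^ 2 - 1) :
    N ^ 2 * (1 - γ) < 1 := by
  have h1 : N ^ 2 * (1 - γ) * (1 + γ) = 1 := by linear_combination -hγ
  have : 0 < N ^ 2 := by positivity
  nlinarith

/-- The three-interval (or two-interval, if `s = 1`) optimum. -/
theorem isUniqueOpt_sbVal_two (hN : 1 < N) (hl : 0 ≤ lam) (hγ0 : 0 < γ) (hγ1 : γ < 1)
    (hγ : γ ^ 2 * N ^ 2 = N ^ 2 - 1) {t s : ℝ} (h0 : 0 < t) (hts : t < s) (h1 : s ≤ 1)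
    (ht : loCut E γ t = θ₀ - lam) (hs : s < 1 → hiCut E γ s = θ₀ + lam)
    (hs' : s = 1 → 1 ≤ θ₀ + lam) :
    IsUniqueOpt E (sbVal N θ₀ lam) (Ico 0 t ∪ Ioc s 1) := by
  have ht1 : t ≤ 1 := hts.le.trans h1
  have hsh : s ≤ θ₀ + lam := by
    rcases h1.eq_or_lt with h | h
    · rw [h]; exact hs' h
    · rw [← hs h]; exact (lt_hiCut hγ0 (h0.trans hts).le h).le
  have hm : bar E (Ioo 0 t) ≤ θ₀ - lam := ht ▸ (bar_lt_loCut hγ1 h0 ht1).le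
  have hteq : t - (θ₀ - lam) = γ * (t - bar E (Ioo 0 t)) := by rw [← ht, loCut]; ring
  have hbm := bar_Ioo_mem (E := E) le_rfl h0 ht1
  have hline : ∀ x, t ^ 2 / 2 + sbSlope N θ₀ lam (bar E (Ioo 0 t)) * (x - t) =
      sbTan N θ₀ lam (bar E (Ioo 0 t)) x := by
    intro x
    rw [← sbTan_low_eq_sq_half hl hγ hm hteq, sbTan, sbTan]; ring
  have hsl := slope_aux hN hγ0 hγ
  have hσ : sbSlope N θ₀ lam (bar E (Ioo 0 t)) ≤ t := by
    rw [sbSlope_low hl hm, show θ₀ - lam - bar E (Ioo 0 t) = (1 - γ) * (t - bar E (Ioo 0 t)) by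
      linear_combination -hteq]
    nlinarith [hbm.2]
  have hmid : ∀ x, t ≤ x → x ≤ s → sbVal N θ₀ lam x = x ^ 2 / 2 := fun x hx hx' =>
    sbVal_mid (by rw [← ht]; linarith [loCut_lt (E := E) hγ0 h0 ht1]) (hx'.trans hsh)
  rcases h1.eq_or_lt with rfl | hs1
  · refine isUniqueOpt_two continuous_sbVal h0 hts h1 hσ le_rfl hmid (fun x _ hx hne => ?_) ?_
      (fun x hx hx1 => absurd hx1 (not_le.2 hx)) (fun h => absurd h (lt_irrefl _))
    · rw [hline]; exact lt_sbTan_of_lower hN hl hγ1 hγ hm hteq.le hx hne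
    · rw [hline, sbTan_self]
  · have hs0 : 0 ≤ s := (h0.trans hts).le
    have hseq := hs hs1
    have hM : θ₀ + lam ≤ bar E (Ioo s 1) := hseq ▸ (hiCut_lt_bar hγ1 hs0 hs1).le
    have hseq' : θ₀ + lam - s = γ * (bar E (Ioo s 1) - s) := by
      rw [← hseq, hiCut, if_pos hs1]; ring
    have hbM := bar_Ioo_mem (E := E) hs0 hs1 le_rfl
    have hline' : ∀ x, s ^ 2 / 2 + sbSlope N θ₀ lam (bar E (Ioo s 1)) * (x - s) =
        sbTan N θ₀ lam (bar E (Ioo s 1)) x := by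
      intro x
      rw [← sbTan_high_eq_sq_half hl hγ hM hseq', sbTan, sbTan]; ring
    have hτ : s ≤ sbSlope N θ₀ lam (bar E (Ioo s 1)) := by
      rw [sbSlope_high hl hM, show bar E (Ioo s 1) - (θ₀ + lam) = (1 - γ) * (bar E (Ioo s 1) - s) by
        linear_combination -hseq']
      nlinarith [hbM.1]
    refine isUniqueOpt_two continuous_sbVal h0 hts h1 hσ hτ hmid (fun x _ hx hne => ?_) ?_
      (fun x hx _ hne => ?_) (fun _ => ?_)
    · rw [hline]; exact lt_sbTan_of_lower hN hl hγ1 hγ hm hteq.le hx hne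
    · rw [hline, sbTan_self]
    · rw [hline']; exact lt_sbTan_of_upper hN hl hγ1 hγ hM hseq'.le hx hne
    · rw [hline', sbTan_self]

end Boundaries

/-! ### Moving the boundary between two pools, and merging pools -/

section Merging

variable {E : Environment} {N θ₀ lam γ : ℝ}

theorem abs_moment_sub_le {x x' : ℝ} (hx : x ∈ Icc (0:ℝ) 1) (hx' : x' ∈ Icc (0:ℝ) 1) :
    |mom₀ E x' - mom₀ E x - x * (cdf₀ E x' - cdf₀ E x)| ≤ |x' - x| * |cdf₀ E x' - cdf₀ E x| := by
  rcases lt_trichotomy x x' with h | h | h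
  · have hb := bar_Ioo_mem (E := E) hx.1 h hx'.2
    have hp := mass_pos (E := E) hx.1 h hx'.2
    have hm := mass_mul_bar (E := E) x x'
    rw [moment_Ioo h.le] at hm
    rw [← mass_Ioo h.le, ← hm, show E.prior.real (Ioo x x') * bar E (Ioo x x') -
      x * E.prior.real (Ioo x x') = (bar E (Ioo x x') - x) * E.prior.real (Ioo x x') by ring, abs_mul]
    refine mul_le_mul_of_nonneg_right ?_ (abs_nonneg _)
    rw [abs_of_pos (by linarith [hb.1]), abs_of_pos (by linarith)]; linarith [hb.2]
  · subst h; simp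
  · have hb := bar_Ioo_mem (E := E) hx'.1 h hx.2
    have hp := mass_pos (E := E) hx'.1 h hx.2
    have hm := mass_mul_bar (E := E) x' x
    rw [moment_Ioo h.le] at hm
    have h1 : cdf₀ E x' - cdf₀ E x = - E.prior.real (Ioo x' x) := by rw [mass_Ioo h.le]; ring
    have h2 : mom₀ E x' - mom₀ E x = - (E.prior.real (Ioo x' x) * bar E (Ioo x' x)) := by
      rw [hm]; ring
    rw [h1, h2, show -(E.prior.real (Ioo x' x) * bar E (Ioo x' x)) - x * -E.prior.real (Ioo x' x)
      = (x - bar E (Ioo x' x)) * E.prior.real (Ioo x' x) by ring, abs_mul, abs_neg]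
    refine mul_le_mul_of_nonneg_right ?_ (abs_nonneg _)
    rw [abs_of_pos (by linarith [hb.2]), abs_of_neg (by linarith)]; linarith [hb.1]

/-- Lower bound for the value of a pooled interval by the tangent at any point. -/
theorem pv_ge_tan (hl : 0 ≤ lam) {a b m : ℝ} (ha : 0 ≤ a) (hab : a < b) (hb : b ≤ 1) :
    sbVal N θ₀ lam m * (cdf₀ E b - cdf₀ E a) +
      sbSlope N θ₀ lam m * (mom₀ E b - mom₀ E a - m * (cdf₀ E b - cdf₀ E a)) -
      N ^ 2 / 2 * (mom₀ E b - mom₀ E a - m * (cdf₀ E b - cdf₀ E a)) ^ 2 / (cdf₀ E b - cdf₀ E a)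
      ≤ pv E (sbVal N θ₀ lam) a b := by
  have hp := mass_pos (E := E) ha hab hb
  have hm := mass_mul_bar (E := E) a b
  rw [moment_Ioo hab.le] at hm
  have h := sbTan_sub_le (N := N) (θ₀ := θ₀) hl m (bar E (Ioo a b))
  rw [pv, ← mass_Ioo hab.le, ← hm]
  set p := E.prior.real (Ioo a b)
  set z := bar E (Ioo a b)
  have h2 : N ^ 2 / 2 * (p * z - m * p) ^ 2 / p = p * (N ^ 2 / 2 * (z - m) ^ 2) := by
    field_simp
  rw [h2]
  have h3 := mul_le_mul_of_nonneg_left h hp.le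
  rw [sbTan] at h3
  nlinarith

theorem pv_eq_tan {a b : ℝ} (hab : a ≤ b) : pv E (sbVal N θ₀ lam) a b =
    sbVal N θ₀ lam (bar E (Ioo a b)) * (cdf₀ E b - cdf₀ E a) ∧
    mom₀ E b - mom₀ E a - bar E (Ioo a b) * (cdf₀ E b - cdf₀ E a) = 0 := by
  have hm := mass_mul_bar (E := E) a b
  rw [moment_Ioo hab] at hm
  rw [pv, ← mass_Ioo hab]
  exact ⟨by ring, by linarith⟩

theorem exists_better_boundary (hl : 0 ≤ lam) {a x b : ℝ} (ha : 0 ≤ a) (hax : a < x) (hxb : x < b)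
    (hb : b ≤ 1) (hne : sbTan N θ₀ lam (bar E (Ioo a x)) x ≠ sbTan N θ₀ lam (bar E (Ioo x b)) x)
    {ε : ℝ} (hε : 0 < ε) : ∃ x' ∈ Ioo (x - ε) (x + ε), pv E (sbVal N θ₀ lam) a x +
      pv E (sbVal N θ₀ lam) x b < pv E (sbVal N θ₀ lam) a x' + pv E (sbVal N θ₀ lam) x' b := by
  set m1 := bar E (Ioo a x)
  set m2 := bar E (Ioo x b)
  set M := cdf₀ E
  set B := mom₀ E
  obtain ⟨e1, z1⟩ := pv_eq_tan (E := E) (N := N) (θ₀ := θ₀) (lam := lam) hax.le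
  obtain ⟨e2, z2⟩ := pv_eq_tan (E := E) (N := N) (θ₀ := θ₀) (lam := lam) hxb.le
  have p1 : 0 < M x - M a := by
    have := mass_pos (E := E) ha hax (hxb.le.trans hb); rwa [mass_Ioo hax.le] at this
  have p2 : 0 < M b - M x := by
    have := mass_pos (E := E) (ha.trans hax.le) hxb hb; rwa [mass_Ioo hxb.le] at this
  have hx01 : x ∈ Icc (0:ℝ) 1 := ⟨ha.trans hax.le, hxb.le.trans hb⟩
  have hm1 : m1 ∈ Icc (0:ℝ) 1 := by
    have := bar_Ioo_mem (E := E) ha hax (hxb.le.trans hb); exact ⟨by linarith [this.1], by linarith [this.2]⟩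
  have hm2 : m2 ∈ Icc (0:ℝ) 1 := by
    have := bar_Ioo_mem (E := E) (ha.trans hax.le) hxb hb; exact ⟨by linarith [this.1], by linarith [this.2]⟩
  set D := sbTan N θ₀ lam m1 x - sbTan N θ₀ lam m2 x with hD
  have hD0 : D ≠ 0 := sub_ne_zero.2 hne
  set s := sbSlope N θ₀ lam m1 - sbSlope N θ₀ lam m2 with hs
  set c := N ^ 2 / 2 * (4 * (2 / (M x - M a)) + 4 * (2 / (M b - M x))) with hc
  -- the error term is eventually small
  have hcont : Tendsto (fun x' => |s| * |x' - x| + c * |M x' - M x|) (𝓝 x) (𝓝 0) := by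
    have : Continuous fun x' => |s| * |x' - x| + c * |M x' - M x| := by
      have := continuous_cdf₀ (E := E)
      fun_prop
    have h := this.tendsto x
    simpa using h
  have ev1 : ∀ᶠ x' in 𝓝 x, |s| * |x' - x| + c * |M x' - M x| < |D| :=
    hcont.eventually (gt_mem_nhds (abs_pos.2 hD0))
  have hMc : Tendsto M (𝓝 x) (𝓝 (M x)) := (continuous_cdf₀ (E := E)).tendsto x
  have ev2 : ∀ᶠ x' in 𝓝 x, M x' - M a > (M x - M a) / 2 := by
    filter_upwards [hMc.eventually (lt_mem_nhds (show M x - (M x - M a) / 2 < M x by linarith))] with y hy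
    linarith
  have ev3 : ∀ᶠ x' in 𝓝 x, M b - M x' > (M b - M x) / 2 := by
    filter_upwards [hMc.eventually (gt_mem_nhds (show M x < M x + (M b - M x) / 2 by linarith))] with y hy
    linarith
  have ev4 : ∀ᶠ x' in 𝓝 x, x' ∈ Ioo (x - ε) (x + ε) ∧ x' ∈ Ioo a b := by
    filter_upwards [Ioo_mem_nhds (show x - ε < x by linarith) (show x < x + ε by linarith),
      Ioo_mem_nhds hax hxb] with y h1 h2 using ⟨h1, h2⟩
  have ev := ((ev1.and ev2).and (ev3.and ev4))
  have key : ∀ x', (((|s| * |x' - x| + c * |M x' - M x| < |D| ∧ M x' - M a > (M x - M a) / 2) ∧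
      (M b - M x' > (M b - M x) / 2 ∧ x' ∈ Ioo (x - ε) (x + ε) ∧ x' ∈ Ioo a b))) →
      0 < D * (M x' - M x) → pv E (sbVal N θ₀ lam) a x +
      pv E (sbVal N θ₀ lam) x b < pv E (sbVal N θ₀ lam) a x' + pv E (sbVal N θ₀ lam) x' b := by
    rintro x' ⟨⟨h1, h2⟩, h3, -, h5⟩ hpos
    have hx'01 : x' ∈ Icc (0:ℝ) 1 := ⟨ha.trans h5.1.le, h5.2.le.trans hb⟩
    have g1 := pv_ge_tan (E := E) (N := N) (θ₀ := θ₀) (m := m1) hl ha h5.1 (h5.2.le.trans hb)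
    have g2 := pv_ge_tan (E := E) (N := N) (θ₀ := θ₀) (m := m2) hl (ha.trans h5.1.le) h5.2 hb
    have hab := abs_moment_sub_le (E := E) hx01 hx'01
    set Δ := M x' - M x with hΔ
    set e := B x' - B x - x * Δ with he
    have hx1 : |x' - x| ≤ 1 := abs_le.2 ⟨by linarith [hx'01.1, hx01.2], by linarith [hx'01.2, hx01.1]⟩
    have hq : ∀ m ∈ Icc (0:ℝ) 1, (e + (x - m) * Δ) ^ 2 ≤ 4 * Δ ^ 2 := by
      intro m hm
      have : |e + (x - m) * Δ| ≤ 2 * |Δ| := by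
        refine (abs_add_le _ _).trans ?_
        rw [abs_mul]
        have : |x - m| ≤ 1 := abs_le.2 ⟨by linarith [hm.2, hx01.1], by linarith [hm.1, hx01.2]⟩
        nlinarith [abs_nonneg Δ]
      calc _ = |e + (x - m) * Δ| ^ 2 := (sq_abs _).symm
        _ ≤ (2 * |Δ|) ^ 2 := by gcongr
        _ = _ := by rw [mul_pow, sq_abs]; ring
    have hN := sq_nonneg N
    have i1 : B x' - B a - m1 * (M x' - M a) = e + (x - m1) * Δ := by rw [he, hΔ]; linarith
    have i2 : B b - B x' - m2 * (M b - M x') = -(e + (x - m2) * Δ) := by rw [he, hΔ]; linarith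
    have r1 : N ^ 2 / 2 * (e + (x - m1) * Δ) ^ 2 / (M x' - M a) ≤
        N ^ 2 / 2 * (4 * (2 / (M x - M a))) * Δ ^ 2 := by
      rw [div_le_iff₀ (by linarith)]
      have : 1 ≤ 2 / (M x - M a) * (M x' - M a) := by
        rw [div_mul_eq_mul_div, le_div_iff₀ p1]; linarith
      have h0 := hq m1 hm1
      have h6 : 0 ≤ N ^ 2 / 2 * (4 * Δ ^ 2) := by positivity
      calc _ ≤ N ^ 2 / 2 * (4 * Δ ^ 2) := by gcongr
        _ ≤ N ^ 2 / 2 * (4 * Δ ^ 2) * (2 / (M x - M a) * (M x' - M a)) := le_mul_of_one_le_right h6 this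
        _ = _ := by ring
    have r2 : N ^ 2 / 2 * (-(e + (x - m2) * Δ)) ^ 2 / (M b - M x') ≤
        N ^ 2 / 2 * (4 * (2 / (M b - M x))) * Δ ^ 2 := by
      rw [div_le_iff₀ (by linarith), neg_sq]
      have : 1 ≤ 2 / (M b - M x) * (M b - M x') := by
        rw [div_mul_eq_mul_div, le_div_iff₀ p2]; linarith
      have h0 := hq m2 hm2
      have h6 : 0 ≤ N ^ 2 / 2 * (4 * Δ ^ 2) := by positivity
      calc _ ≤ N ^ 2 / 2 * (4 * Δ ^ 2) := by gcongr
        _ ≤ N ^ 2 / 2 * (4 * Δ ^ 2) * (2 / (M b - M x) * (M b - M x')) := le_mul_of_one_le_right h6 this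
        _ = _ := by ring
    rw [i1] at g1
    rw [i2] at g2
    have hDD : |D| * |Δ| = D * Δ := by rw [← abs_mul, abs_of_pos hpos]
    have hΔ0 : 0 < |Δ| := by
      rcases eq_or_ne Δ 0 with h | h
      · rw [h] at hpos; simp at hpos
      · exact abs_pos.2 h
    have hse : -(|s| * (|x' - x| * |Δ|)) ≤ s * e := by
      have : |s * e| ≤ |s| * (|x' - x| * |Δ|) := by
        rw [abs_mul]; exact mul_le_mul_of_nonneg_left hab (abs_nonneg _)
      exact (abs_le.1 this).1
    have hsum : c * Δ ^ 2 = N ^ 2 / 2 * (4 * (2 / (M x - M a))) * Δ ^ 2 +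
        N ^ 2 / 2 * (4 * (2 / (M b - M x))) * Δ ^ 2 := by rw [hc]; ring
    have hΔsq : Δ ^ 2 = |Δ| * |Δ| := by rw [← sq_abs]; ring
    have hfin : (|s| * |x' - x| + c * |Δ|) * |Δ| < |D| * |Δ| := mul_lt_mul_of_pos_right h1 hΔ0
    have hmain : sbVal N θ₀ lam m1 * (M x' - M a) + sbSlope N θ₀ lam m1 * (e + (x - m1) * Δ) +
        (sbVal N θ₀ lam m2 * (M b - M x') + sbSlope N θ₀ lam m2 * -(e + (x - m2) * Δ)) =
        sbVal N θ₀ lam m1 * (M x - M a) + sbVal N θ₀ lam m2 * (M b - M x) + D * Δ + s * e := by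
      rw [hD, hs, sbTan, sbTan, hΔ]; ring
    have hcΔ : c * Δ ^ 2 = c * |Δ| * |Δ| := by rw [hΔsq]; ring
    have hfin' : |s| * (|x' - x| * |Δ|) + c * |Δ| * |Δ| < |D| * |Δ| := by
      refine lt_of_eq_of_lt ?_ hfin; ring
    refine lt_of_eq_of_lt (b := sbVal N θ₀ lam m1 * (M x - M a) + sbVal N θ₀ lam m2 * (M b - M x))
      (by rw [e1, e2]) ?_
    generalize pv E (sbVal N θ₀ lam) a x' = v1 at g1 ⊢
    generalize pv E (sbVal N θ₀ lam) x' b = v2 at g2 ⊢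
    clear_value Δ e c s D
    linarith
  rcases lt_or_gt_of_ne hD0 with hneg | hpos
  · obtain ⟨x', hx', hlt⟩ := ((ev.filter_mono nhdsWithin_le_nhds).and
      (self_mem_nhdsWithin (s := Iio x))).exists
    refine ⟨x', hx'.2.2.1, key x' hx' ?_⟩
    have := mass_pos (E := E) (ha.trans hx'.2.2.2.1.le) hlt hx01.2
    rw [mass_Ioo (le_of_lt hlt)] at this
    exact mul_pos_of_neg_of_neg hneg (by linarith)
  · obtain ⟨x', hx', hlt⟩ := ((ev.filter_mono nhdsWithin_le_nhds).and
      (self_mem_nhdsWithin (s := Ioi x))).exists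
    refine ⟨x', hx'.2.2.1, key x' hx' ?_⟩
    have := mass_pos (E := E) hx01.1 hlt (hx'.2.2.2.2.le.trans hb)
    rw [mass_Ioo (le_of_lt hlt)] at this
    exact mul_pos hpos (by linarith)

/-- Merging pools improves if the merged mean lies strictly above the chord. -/
theorem merge_lt {w : ℝ → ℝ} {a x b k v : ℝ} (ha : 0 ≤ a) (hax : a < x) (hxb : x < b) (hb : b ≤ 1)
    (h1 : w (bar E (Ioo a x)) ≤ v + k * bar E (Ioo a x))
    (h2 : w (bar E (Ioo x b)) ≤ v + k * bar E (Ioo x b))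
    (h3 : v + k * bar E (Ioo a b) < w (bar E (Ioo a b))) :
    pv E w a x + pv E w x b < pv E w a b := by
  have s1 := mass_split (E := E) hax.le hxb.le
  have s2 := bar_split (E := E) hax.le hxb.le
  have p1 := mass_pos (E := E) ha hax (hxb.le.trans hb)
  have p2 := mass_pos (E := E) (ha.trans hax.le) hxb hb
  have p3 := mass_pos (E := E) ha (hax.trans hxb) hb
  unfold pv
  have a1 := mul_le_mul_of_nonneg_left h1 p1.le
  have a2 := mul_le_mul_of_nonneg_left h2 p2.le
  have a3 := mul_lt_mul_of_pos_left h3 p3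
  have a4 : E.prior.real (Ioo a b) * (v + k * bar E (Ioo a b)) =
      E.prior.real (Ioo a x) * (v + k * bar E (Ioo a x)) +
      E.prior.real (Ioo x b) * (v + k * bar E (Ioo x b)) := by
    linear_combination v * s1 + k * s2
  linarith

/-- Merging pools improves if both means lie strictly below the tangent at the merged mean. -/
theorem merge_lt_of_tan {w : ℝ → ℝ} {a x b k : ℝ} (ha : 0 ≤ a) (hax : a < x) (hxb : x < b)
    (hb : b ≤ 1)
    (h1 : w (bar E (Ioo a x)) < w (bar E (Ioo a b)) + k * (bar E (Ioo a x) - bar E (Ioo a b)))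
    (h2 : w (bar E (Ioo x b)) < w (bar E (Ioo a b)) + k * (bar E (Ioo x b) - bar E (Ioo a b))) :
    pv E w a x + pv E w x b < pv E w a b := by
  have s1 := mass_split (E := E) hax.le hxb.le
  have s2 := bar_split (E := E) hax.le hxb.le
  have p1 := mass_pos (E := E) ha hax (hxb.le.trans hb)
  have p2 := mass_pos (E := E) (ha.trans hax.le) hxb hb
  unfold pv
  have a1 := mul_lt_mul_of_pos_left h1 p1
  have a2 := mul_lt_mul_of_pos_left h2 p2
  have a4 : E.prior.real (Ioo a b) * w (bar E (Ioo a b)) =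
      E.prior.real (Ioo a x) * (w (bar E (Ioo a b)) + k * (bar E (Ioo a x) - bar E (Ioo a b))) +
      E.prior.real (Ioo x b) * (w (bar E (Ioo a b)) + k * (bar E (Ioo x b) - bar E (Ioo a b))) := by
    linear_combination (w (bar E (Ioo a b)) - k * bar E (Ioo a b)) * s1 + k * s2
  linarith

theorem merge_lt_low (hN : 1 < N) (hl : 0 ≤ lam) {a x b : ℝ} (ha : 0 ≤ a) (hax : a < x) (hxb : x < b)
    (hb : b ≤ 1) (hm : bar E (Ioo x b) ≤ θ₀ - lam) : pv E (sbVal N θ₀ lam) a x +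
      pv E (sbVal N θ₀ lam) x b < pv E (sbVal N θ₀ lam) a b := by
  have h1 := bar_lt_bar_left (E := E) ha hax hxb hb
  have h2 := bar_lt_bar_right (E := E) ha hax hxb hb
  exact merge_lt_of_tan ha hax hxb hb
    (lt_sbTan_low hN hl (by linarith) (by linarith) h1.ne)
    (lt_sbTan_low hN hl (by linarith) (by linarith) h2.ne')

theorem merge_lt_high (hN : 1 < N) (hl : 0 ≤ lam) {a x b : ℝ} (ha : 0 ≤ a) (hax : a < x) (hxb : x < b)
    (hb : b ≤ 1) (hm : θ₀ + lam ≤ bar E (Ioo a x)) : pv E (sbVal N θ₀ lam) a x +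
      pv E (sbVal N θ₀ lam) x b < pv E (sbVal N θ₀ lam) a b := by
  have h1 := bar_lt_bar_left (E := E) ha hax hxb hb
  have h2 := bar_lt_bar_right (E := E) ha hax hxb hb
  exact merge_lt_of_tan ha hax hxb hb
    (lt_sbTan_high hN hl (by linarith) (by linarith) h1.ne)
    (lt_sbTan_high hN hl (by linarith) (by linarith) h2.ne')

/-- A pool whose mean is extreme next to a pool whose mean is not: if the tangents agree at the
boundary, merging improves. -/
theorem merge_lt_pair_low (hN : 1 < N) (hl : 0 ≤ lam) {a x b : ℝ} (ha : 0 ≤ a) (hax : a < x)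
    (hxb : x < b) (hb : b ≤ 1) (hm1 : bar E (Ioo a x) ≤ θ₀ - lam) (hm2 : θ₀ - lam < bar E (Ioo x b))
    (hm2' : bar E (Ioo x b) ≤ θ₀ + lam)
    (hx : θ₀ - lam ≤ x → sbVal N θ₀ lam x ≤ sbTan N θ₀ lam (bar E (Ioo a x)) x)
    (heq : sbTan N θ₀ lam (bar E (Ioo a x)) x = sbTan N θ₀ lam (bar E (Ioo x b)) x) :
    pv E (sbVal N θ₀ lam) a x + pv E (sbVal N θ₀ lam) x b < pv E (sbVal N θ₀ lam) a b := by
  have b1 := bar_Ioo_mem (E := E) ha hax (hxb.le.trans hb)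
  have b2 := bar_Ioo_mem (E := E) (ha.trans hax.le) hxb hb
  have c1 := bar_lt_bar_left (E := E) ha hax hxb hb
  have c2 := bar_lt_bar_right (E := E) ha hax hxb hb
  set m1 := bar E (Ioo a x)
  set m2 := bar E (Ioo x b)
  set z := bar E (Ioo a b)
  have hT2 : ∀ y, θ₀ - lam ≤ y → y < m2 → sbTan N θ₀ lam m2 y < sbVal N θ₀ lam y := by
    intro y hy hy2
    have := sbTan_mid (N := N) hm2.le hm2' y
    rw [sbVal_mid hy (hy2.le.trans hm2')]
    have : 0 < (y - m2) ^ 2 := by have := (sub_neg.2 hy2).ne; positivity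
    linarith
  have hσ : sbSlope N θ₀ lam m2 ≤ sbSlope N θ₀ lam m1 := by
    by_contra! hlt
    rcases le_or_gt (θ₀ - lam) x with h | h
    · have h1 := hT2 x h b2.1
      have h2 := hx h
      linarith
    · have h1 := hT2 (θ₀ - lam) le_rfl hm2
      have h2 : sbVal N θ₀ lam (θ₀ - lam) ≤ sbTan N θ₀ lam m1 (θ₀ - lam) :=
        (lt_sbTan_low hN hl hm1 le_rfl (by linarith [b1.2])).le
      have h3 : sbTan N θ₀ lam m1 (θ₀ - lam) =
          sbTan N θ₀ lam m1 x + sbSlope N θ₀ lam m1 * (θ₀ - lam - x) := by simp only [sbTan]; ring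
      have h4 : sbTan N θ₀ lam m2 (θ₀ - lam) =
          sbTan N θ₀ lam m2 x + sbSlope N θ₀ lam m2 * (θ₀ - lam - x) := by simp only [sbTan]; ring
      nlinarith
  have hm12 : 0 < m2 - m1 := by linarith [b1.2, b2.1]
  obtain ⟨κ, hκ⟩ : ∃ κ, κ * (m2 - m1) = sbVal N θ₀ lam m2 - sbVal N θ₀ lam m1 :=
    ⟨_, div_mul_cancel₀ _ hm12.ne'⟩
  have hκ2 : κ * (m2 - m1) = sbSlope N θ₀ lam m1 * (x - m1) + sbSlope N θ₀ lam m2 * (m2 - x) := by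
    rw [hκ]; simp only [sbTan] at heq; linarith
  have hκσ : sbSlope N θ₀ lam m2 ≤ κ := by
    by_contra! hcon
    nlinarith [b1.2, b2.1]
  have hchord : ∀ y, θ₀ - lam ≤ y → y < m2 →
      sbVal N θ₀ lam m1 + κ * (y - m1) < sbVal N θ₀ lam y := by
    intro y hy hy2
    refine lt_of_le_of_lt ?_ (hT2 y hy hy2)
    rw [sbTan]
    nlinarith
  refine merge_lt (v := sbVal N θ₀ lam m1 - κ * m1) (k := κ) ha hax hxb hb ?_ ?_ ?_
  · change sbVal N θ₀ lam m1 ≤ _ + κ * m1; linarith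
  · change sbVal N θ₀ lam m2 ≤ _ + κ * m2; linarith
  · change _ + κ * z < sbVal N θ₀ lam z
    rcases le_or_gt (θ₀ - lam) z with h | h
    · have := hchord z h c2; linarith
    · have h1 := hchord (θ₀ - lam) le_rfl hm2
      rw [sbVal_low hl h.le]
      rw [sbVal_low hl hm1] at *
      rw [sbVal_low hl le_rfl] at h1
      set u := θ₀ - lam
      have h2 : 0 ≤ (N ^ 2 - 1) * ((z - m1) * (u - z)) := by
        have : 0 ≤ N ^ 2 - 1 := by nlinarith
        have := mul_pos (sub_pos.2 c1) (sub_pos.2 h)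
        positivity
      have h3 : 0 < u - m1 := by linarith
      -- interpolate between `m1` and `u`
      have h4 : (u - m1) * (z ^ 2 / 2 - N ^ 2 / 2 * (u - z) ^ 2 - (m1 ^ 2 / 2 - N ^ 2 / 2 * (u - m1) ^ 2
          + κ * (z - m1))) = (z - m1) * (u ^ 2 / 2 - N ^ 2 / 2 * (u - u) ^ 2 - (m1 ^ 2 / 2 -
          N ^ 2 / 2 * (u - m1) ^ 2 + κ * (u - m1))) + (u - m1) * ((N ^ 2 - 1) * ((z - m1) * (u - z))) / 2 := by
        ring
      have h5 : 0 < (z - m1) * (u ^ 2 / 2 - N ^ 2 / 2 * (u - u) ^ 2 - (m1 ^ 2 / 2 -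
          N ^ 2 / 2 * (u - m1) ^ 2 + κ * (u - m1))) := mul_pos (sub_pos.2 c1) (sub_pos.2 h1)
      have h6 : 0 < (u - m1) * (z ^ 2 / 2 - N ^ 2 / 2 * (u - z) ^ 2 - (m1 ^ 2 / 2 -
          N ^ 2 / 2 * (u - m1) ^ 2 + κ * (z - m1))) := by
        rw [h4]; have := mul_nonneg h3.le h2; linarith
      have := pos_of_mul_pos_right h6 h3.le
      linarith

end Merging

/-! ### Optimal pooling when the whole state space is pooled -/

section Adjacent

variable {E : Environment} {N θ₀ lam γ : ℝ}

theorem continuousOn_pv {w : ℝ → ℝ} (hw : Continuous w) :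
    ContinuousOn (fun q : ℝ × ℝ => pv E w q.1 q.2) {q | 0 ≤ q.1 ∧ q.1 ≤ q.2 ∧ q.2 ≤ 1} := by
  obtain ⟨C, hC⟩ := isCompact_Icc.exists_bound_of_continuousOn (s := Icc (0:ℝ) 1) hw.continuousOn
  have hM := continuous_cdf₀ (E := E)
  have hB := continuous_mom₀ (E := E)
  rintro ⟨x, y⟩ ⟨hx, hxy, hy⟩
  simp only at hx hxy hy
  rcases hxy.eq_or_lt with rfl | hlt
  · rw [ContinuousWithinAt]
    simp only [pv_self]
    have h1 : Tendsto (fun q : ℝ × ℝ => (cdf₀ E q.2 - cdf₀ E q.1) * C)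
        (𝓝[{q | 0 ≤ q.1 ∧ q.1 ≤ q.2 ∧ q.2 ≤ 1}] (x, x)) (𝓝 0) := by
      have : Continuous fun q : ℝ × ℝ => (cdf₀ E q.2 - cdf₀ E q.1) * C := by fun_prop
      have h := this.tendsto (x, x)
      simp only [sub_self, zero_mul] at h
      exact h.mono_left nhdsWithin_le_nhds
    refine squeeze_zero_norm' ?_ h1
    filter_upwards [self_mem_nhdsWithin] with q hq
    rcases hq.2.1.eq_or_lt with h | h
    · rw [h]; simp [pv_self]
    · have hb := bar_Ioo_mem (E := E) hq.1 h hq.2.2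
      rw [pv, norm_mul, ← mass_Ioo h.le, Real.norm_of_nonneg measureReal_nonneg]
      exact mul_le_mul_of_nonneg_left (hC _ ⟨by linarith [hb.1, hq.1], by linarith [hb.2, hq.2.2]⟩)
        measureReal_nonneg
  · have h1 : ContinuousAt (fun q : ℝ × ℝ => (cdf₀ E q.2 - cdf₀ E q.1) *
        w ((mom₀ E q.2 - mom₀ E q.1) / (cdf₀ E q.2 - cdf₀ E q.1))) (x, y) := by
      have h0 : cdf₀ E y - cdf₀ E x ≠ 0 := by
        rw [← mass_Ioo hlt.le]; exact (mass_pos hx hlt hy).ne'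
      refine ContinuousAt.mul (by fun_prop) (hw.continuousAt.comp
        (ContinuousAt.div (by fun_prop) (by fun_prop) h0))
    refine h1.continuousWithinAt.congr (fun q hq => ?_) ?_
    · rw [pv, mass_Ioo hq.2.1, bar_eq_div hq.2.1]
    · rw [pv, mass_Ioo hxy, bar_eq_div hxy]

theorem IsPoolingSet.exists_component_lt {P : Set ℝ} (hP : IsPoolingSet P) {z : ℝ} (hz : z ∈ P)
    (h0 : 0 < z) : ∃ c ∈ connectedComponentIn P z, c < z := by
  obtain ⟨ε, hε, hb⟩ := hP.exists_Ioo hz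
  have h : max (z - ε / 2) (z / 2) < z := max_lt (by linarith) (by linarith)
  exact ⟨_, hb ⟨⟨lt_of_lt_of_le (by linarith) (le_max_left _ _), by linarith⟩,
    le_trans (by linarith) (le_max_right _ _), h.le.trans (hP.subset hz).2⟩, h⟩

theorem IsPoolingSet.exists_component_gt {P : Set ℝ} (hP : IsPoolingSet P) {z : ℝ} (hz : z ∈ P)
    (h1 : z < 1) : ∃ c ∈ connectedComponentIn P z, z < c := by
  obtain ⟨ε, hε, hb⟩ := hP.exists_Ioo hz
  have h : z < min (z + ε / 2) ((z + 1) / 2) := lt_min (by linarith) (by linarith)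
  exact ⟨_, hb ⟨⟨by linarith, lt_of_le_of_lt (min_le_left _ _) (by linarith)⟩,
    (hP.subset hz).1.trans h.le, le_trans (min_le_right _ _) (by linarith)⟩, h⟩

theorem IsPoolingSet.exists_endpoints {P : Set ℝ} (hP : IsPoolingSet P) {r : ℝ}
    (hr : r ∈ Ioo (0:ℝ) 1) (hrP : r ∈ P) : ∃ x y, 0 ≤ x ∧ x < r ∧ r < y ∧ y ≤ 1 ∧
      Ioo x y ⊆ connectedComponentIn P r ∧ connectedComponentIn P r ⊆ Icc x y ∧
      (x = 0 ∨ x ∉ P) ∧ (y = 1 ∨ y ∉ P) := by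
  set C := connectedComponentIn P r
  have hC : C ⊆ Icc 0 1 := hP.component_subset r
  have hrC : r ∈ C := mem_connectedComponentIn hrP
  have hbb : BddBelow C := ⟨0, fun t ht => (hC ht).1⟩
  have hba : BddAbove C := ⟨1, fun t ht => (hC ht).2⟩
  obtain ⟨c1, hc1, hc1r⟩ := hP.exists_component_lt hrP hr.1
  obtain ⟨c2, hc2, hc2r⟩ := hP.exists_component_gt hrP hr.2
  have ho := ordConnected_component P r
  refine ⟨sInf C, sSup C, le_csInf ⟨r, hrC⟩ fun t ht => (hC ht).1, (csInf_le hbb hc1).trans_lt hc1r,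
    hc2r.trans_le (le_csSup hba hc2), csSup_le ⟨r, hrC⟩ fun t ht => (hC ht).2, ?_,
    fun t ht => ⟨csInf_le hbb ht, le_csSup hba ht⟩, ?_, ?_⟩
  · intro z hz
    obtain ⟨d1, hd1, h1⟩ := exists_lt_of_csInf_lt (s := C) ⟨r, hrC⟩ hz.1
    obtain ⟨d2, hd2, h2⟩ := exists_lt_of_lt_csSup ⟨r, hrC⟩ hz.2
    exact ho.out hd1 hd2 ⟨h1.le, h2.le⟩
  · by_contra! ⟨hne, hx⟩
    obtain ⟨e, he, hb⟩ := hP.exists_Ioo hx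
    obtain ⟨d, hd, h1⟩ := exists_lt_of_csInf_lt (s := C) ⟨r, hrC⟩ (show sInf C < sInf C + e by linarith)
    obtain ⟨c, hc, hlt⟩ := hP.exists_component_lt hx ((hP.subset hx).1.lt_of_ne' hne)
    rw [← component_eq (hb ⟨⟨by linarith [csInf_le hbb hd], h1⟩, hC hd⟩), component_eq hd] at hc
    exact (csInf_le hbb hc).not_gt hlt
  · by_contra! ⟨hne, hx⟩
    obtain ⟨e, he, hb⟩ := hP.exists_Ioo hx
    obtain ⟨d, hd, h1⟩ := exists_lt_of_lt_csSup (s := C) ⟨r, hrC⟩ (show sSup C - e < sSup C by linarith)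
    obtain ⟨c, hc, hlt⟩ := hP.exists_component_gt hx ((hP.subset hx).2.lt_of_ne hne)
    rw [← component_eq (hb ⟨⟨h1, by linarith [le_csSup hba hd]⟩, hC hd⟩), component_eq hd] at hc
    exact (le_csSup hba hc).not_gt hlt

variable (E) in
/-- Mean of the upper pool `(y, 1]`. -/
noncomputable def upMean (y : ℝ) : ℝ := if y < 1 then bar E (Ioo y 1) else 1

/-- Standing assumptions: the tangent at the lower (upper) pool's mean dominates below (above) `r`. -/
structure Splits (E : Environment) (N θ₀ lam γ r : ℝ) : Prop where
  hN : 1 < N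
  hl : 0 ≤ lam
  hγ0 : 0 < γ
  hγ1 : γ < 1
  hγ : γ ^ 2 * N ^ 2 = N ^ 2 - 1
  hr : r ∈ Ioo (0:ℝ) 1
  low : loCut E γ r ≤ θ₀ - lam
  high : θ₀ + lam ≤ hiCut E γ r

namespace Splits

variable {r : ℝ} (H : Splits E N θ₀ lam γ r)
include H

theorem lower {x : ℝ} (hx0 : 0 ≤ x) (hx : x ≤ r) :
    bar E (Ioo 0 x) ≤ θ₀ - lam ∧ (0 < x → bar E (Ioo 0 x) < θ₀ - lam) ∧
      ∀ z, z < x → z ≠ bar E (Ioo 0 x) →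
      sbVal N θ₀ lam z < sbTan N θ₀ lam (bar E (Ioo 0 x)) z := by
  have hmono : loCut E γ x ≤ θ₀ - lam :=
    ((loCut_strictMono H.hγ0 H.hγ1).monotoneOn ⟨hx0, hx.trans H.hr.2.le⟩ ⟨H.hr.1.le, H.hr.2.le⟩ hx).trans H.low
  have h2 : 0 < x → bar E (Ioo 0 x) < θ₀ - lam := fun h =>
    (bar_lt_loCut H.hγ1 h (hx.trans H.hr.2.le)).trans_le hmono
  have h1 : bar E (Ioo 0 x) ≤ θ₀ - lam := by
    rcases hx0.eq_or_lt with rfl | h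
    · simpa [loCut, bar_empty] using hmono
    · exact (h2 h).le
  refine ⟨h1, h2, fun z hz hne => ?_⟩
  refine lt_sbTan_of_lower H.hN H.hl H.hγ1 H.hγ h1 (t := x) ?_ hz hne
  unfold loCut at hmono
  linarith

theorem upper {y : ℝ} (hy : r ≤ y) (hy1 : y ≤ 1) :
    θ₀ + lam ≤ upMean E y ∧ ∀ z, y < z → z ≠ upMean E y →
      sbVal N θ₀ lam z < sbTan N θ₀ lam (upMean E y) z := by
  have hmono : θ₀ + lam ≤ hiCut E γ y :=
    H.high.trans ((hiCut_strictMono H.hγ0 H.hγ1).monotoneOn ⟨H.hr.1.le, H.hr.2.le⟩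
      ⟨H.hr.1.le.trans hy, hy1⟩ hy)
  have h1 : θ₀ + lam ≤ upMean E y := by
    unfold upMean
    split_ifs with h
    · exact hmono.trans (hiCut_lt_bar H.hγ1 (H.hr.1.le.trans hy) h).le
    · have : y = 1 := le_antisymm hy1 (not_lt.1 h)
      subst this; simpa [hiCut] using hmono
  refine ⟨h1, fun z hz hne => ?_⟩
  refine lt_sbTan_of_upper H.hN H.hl H.hγ1 H.hγ h1 (t := y) ?_ hz hne
  unfold hiCut at hmono
  unfold upMean
  linarith

theorem lower_le {x z : ℝ} (hx0 : 0 ≤ x) (hx : x ≤ r) (hz : z ≤ x) :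
    sbVal N θ₀ lam z ≤ sbTan N θ₀ lam (bar E (Ioo 0 x)) z :=
  le_of_forall_lt_left continuous_sbVal (continuous_sbTan _) (H.lower hx0 hx).2.2 hz

theorem upper_le {y z : ℝ} (hy : r ≤ y) (hy1 : y ≤ 1) (hz : y ≤ z) :
    sbVal N θ₀ lam z ≤ sbTan N θ₀ lam (upMean E y) z :=
  le_of_forall_lt_right continuous_sbVal (continuous_sbTan _) (H.upper hy hy1).2 hz

theorem pv_upper {y : ℝ} (hy0 : 0 ≤ y) (hy1 : y ≤ 1) : pv E (sbVal N θ₀ lam) y 1 =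
    ∫ t in Ioo y 1, sbTan N θ₀ lam (upMean E y) t ∂E.prior := by
  have := H.hN
  rw [pv_eq_setIntegral hy0 hy1 le_rfl]
  rcases hy1.eq_or_lt with rfl | h
  · simp
  · rw [upMean, if_pos h]

/-- The value of any pooling set is bounded by that of the three intervals obtained by pooling
everything on either side of `x` and `y`, if nothing straddles `x` or `y`. -/
theorem value_le {P C : Set ℝ} (hP : IsPoolingSet P) {x y : ℝ} (hx0 : 0 ≤ x) (hxr : x ≤ r)
    (hry : r ≤ y) (hy1 : y ≤ 1) (hC : C ⊆ Icc x y) (hC' : Ioo x y ⊆ C)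
    (hxP : x = 0 ∨ x ∉ P) (hyP : y = 1 ∨ y ∉ P) (hCP : C ⊆ P)
    (hcomp : ∀ θ ∈ C, connectedComponentIn P θ = C)
    (hdich : ∀ θ ∈ P, θ ∉ C → (∀ z ∈ connectedComponentIn P θ, z ≤ x) ∨
      ∀ z ∈ connectedComponentIn P θ, y ≤ z) :
    poolVal E (sbVal N θ₀ lam) P ≤ pv E (sbVal N θ₀ lam) 0 x + pv E (sbVal N θ₀ lam) x y +
        pv E (sbVal N θ₀ lam) y 1 ∧
      (pv E (sbVal N θ₀ lam) 0 x + pv E (sbVal N θ₀ lam) x y + pv E (sbVal N θ₀ lam) y 1 ≤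
        poolVal E (sbVal N θ₀ lam) P → Ioo 0 x ⊆ P ∧ Ioo y 1 ⊆ P) := by
  classical
  set w := sbVal N θ₀ lam
  set T1 := sbTan N θ₀ lam (bar E (Ioo 0 x))
  set T3 := sbTan N θ₀ lam (upMean E y)
  have hxy : x ≤ y := hxr.trans hry
  set p : ℝ → ℝ := fun z => if z ∈ Ioo x y then w (bar E (Ioo x y)) else if z ≤ x then T1 z else T3 z
    with hp
  have hT1c : Continuous T1 := continuous_sbTan _
  have hT3c : Continuous T3 := continuous_sbTan _
  have hpm : Measurable p := Measurable.ite measurableSet_Ioo measurable_const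
    (Measurable.ite measurableSet_Iic hT1c.measurable hT3c.measurable)
  obtain ⟨C1, hC1⟩ := isCompact_Icc.exists_bound_of_continuousOn (s := Icc (0:ℝ) 1) hT1c.continuousOn
  obtain ⟨C3, hC3⟩ := isCompact_Icc.exists_bound_of_continuousOn (s := Icc (0:ℝ) 1) hT3c.continuousOn
  have hpi : Integrable p E.prior := by
    refine integrable_of_bdd E hpm.aestronglyMeasurable
      (C := |w (bar E (Ioo x y))| + |C1| + |C3|) fun z hz => ?_
    have a0 := abs_nonneg (w (bar E (Ioo x y)))
    have a1 := abs_nonneg C1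
    have a3 := abs_nonneg C3
    simp only [hp]
    split_ifs
    · linarith
    · have := hC1 z hz; rw [Real.norm_eq_abs] at this; linarith [le_abs_self C1]
    · have := hC3 z hz; rw [Real.norm_eq_abs] at this; linarith [le_abs_self C3]
  have hval : ∫ z, p z ∂E.prior = pv E w 0 x + pv E w x y + pv E w y 1 := by
    rw [integral_split hpi hx0 hxy hy1]
    congr 1
    · congr 1
      · rw [pv_eq_setIntegral le_rfl hx0 (hxy.trans hy1)]
        refine setIntegral_congr_fun measurableSet_Ioo fun z hz => ?_
        simp only [hp]
        rw [if_neg (fun h => absurd h.1 (not_lt.2 hz.2.le)), if_pos hz.2.le]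
      · rw [setIntegral_congr_fun (g := fun _ => w (bar E (Ioo x y))) measurableSet_Ioo fun z hz => by
          simp only [hp]; rw [if_pos hz]]
        simp [pv]
    · rw [H.pv_upper (hx0.trans hxy) hy1]
      refine setIntegral_congr_fun measurableSet_Ioo fun z hz => ?_
      simp only [hp]
      rw [if_neg (fun h => absurd h.2 (not_lt.2 hz.1.le)), if_neg (not_le.2 (hxy.trans_lt hz.1))]
  have h1 : ∀ θ ∈ Icc (0:ℝ) 1, θ ∉ P → w θ ≤ p θ := by
    intro θ hθ hθP
    simp only [hp]
    split_ifs with ha hb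
    · exact absurd (hCP (hC' ha)) hθP
    · exact H.lower_le hx0 hxr hb
    · refine H.upper_le hry hy1 ?_
      by_contra! hlt; exact ha ⟨not_le.1 hb, hlt⟩
  have hcase : ∀ θ ∈ P, θ ∉ C →
      ((∀ z ∈ connectedComponentIn P θ, z ≤ x) ∧ ∫ t in connectedComponentIn P θ, p t ∂E.prior =
        E.prior.real (connectedComponentIn P θ) * T1 (bar E (connectedComponentIn P θ))) ∨
      ((∀ z ∈ connectedComponentIn P θ, y ≤ z) ∧ ∫ t in connectedComponentIn P θ, p t ∂E.prior =
        E.prior.real (connectedComponentIn P θ) * T3 (bar E (connectedComponentIn P θ))) := by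
    intro θ hθ hθC
    have hpos := hP.component_pos (E := E) hθ
    rcases hdich θ hθ hθC with h | h
    · left
      refine ⟨h, ?_⟩
      rw [← setIntegral_sbTan hpos]
      refine setIntegral_congr_fun (measurableSet_component P θ) fun z hz => ?_
      simp only [hp]
      rw [if_neg (fun h' => absurd h'.1 (not_lt.2 (h z hz))), if_pos (h z hz)]
    · right
      refine ⟨h, ?_⟩
      rw [← setIntegral_sbTan hpos]
      refine setIntegral_congr_ae (measurableSet_component P θ) ?_
      filter_upwards [ae_ne (E := E) x] with z hne hz
      have hz' := h z hz
      simp only [hp]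
      rw [if_neg (fun h' => absurd h'.2 (not_lt.2 hz')), if_neg]
      intro hzx
      exact hne (le_antisymm hzx (hxy.trans hz'))
  have h2 : ∀ θ ∈ P, E.prior.real (connectedComponentIn P θ) * w (bar E (connectedComponentIn P θ))
      ≤ ∫ t in connectedComponentIn P θ, p t ∂E.prior := by
    intro θ hθ
    by_cases hθC : θ ∈ C
    · have hCeq := hcomp θ hθC
      have hCae : C =ᵐ[E.prior] Ioo x y := by
        have a1 : Ioo x y ≤ᵐ[E.prior] C := LE.le.eventuallyLE hC'
        have a2 : C ≤ᵐ[E.prior] Icc x y := LE.le.eventuallyLE hC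
        exact (a2.trans Ioo_ae_eq_Icc.symm.le).antisymm a1
      rw [hCeq, setIntegral_congr_set hCae, bar_congr hCae, measureReal_congr hCae,
        setIntegral_congr_fun (g := fun _ => w (bar E (Ioo x y))) measurableSet_Ioo fun z hz => by
          simp only [hp]; rw [if_pos hz]]
      simp
    · have hmem := hP.bar_mem (E := E) hθ
      rcases hcase θ hθ hθC with ⟨h, he⟩ | ⟨h, he⟩
      · rw [he]
        exact mul_le_mul_of_nonneg_left (H.lower_le hx0 hxr (h _ hmem)) measureReal_nonneg
      · rw [he]
        exact mul_le_mul_of_nonneg_left (H.upper_le hry hy1 (h _ hmem)) measureReal_nonneg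
  refine ⟨?_, fun hle => ?_⟩
  · rw [← hval]; exact poolVal_le hP continuous_sbVal hpi h1 h2
  · rw [← hval] at hle
    obtain ⟨e1, e2⟩ := eq_of_poolVal_eq hP continuous_sbVal hpi h1 h2 hle
    constructor
    · rcases hxP with h | hxP
      · rw [h]; simp
      refine Ioo_subset_of_touch hP (w := w) (p := p) (m := bar E (Ioo 0 x)) le_rfl (hxy.trans hy1) e1
        (fun θ hθ hθx => ?_) (Or.inl rfl) (Or.inr hxP) fun z h1 h2 hne => ?_
      · have hθC : θ ∉ C := fun h => absurd (hC h).1 (not_le.2 hθx.2)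
        have hpos := real_pos (hP.component_pos (E := E) hθ)
        have hmem := hP.bar_mem (E := E) hθ
        rw [postMean_of_mem hθ]
        rcases hcase θ hθ hθC with ⟨h, he⟩ | ⟨h, he⟩
        · have := e2 θ hθ
          rw [he] at this
          refine (mul_left_cancel₀ hpos.ne' this).trans ?_
          simp only [hp]
          rw [if_neg (fun h' => absurd h'.1 (not_lt.2 (h _ hmem))), if_pos (h _ hmem)]
        · exact absurd (h θ (mem_connectedComponentIn hθ)) (not_le.2 (hθx.2.trans_le hxy))
      · simp only [hp]
        rw [if_neg (fun h' => absurd h'.1 (not_lt.2 h2.le)), if_pos h2.le]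
        exact (H.lower hx0 hxr).2.2 z h2 hne
    · rcases hyP with h | hyP
      · rw [h]; simp
      refine Ioo_subset_of_touch hP (w := w) (p := p) (m := upMean E y) (hx0.trans hxy) le_rfl e1
        (fun θ hθ hθx => ?_) (Or.inr hyP) (Or.inl rfl) fun z h1 h2 hne => ?_
      · have hθC : θ ∉ C := fun h => absurd (hC h).2 (not_le.2 hθx.1)
        have hpos := real_pos (hP.component_pos (E := E) hθ)
        have hmem := hP.bar_mem (E := E) hθ
        have hmem' := (hP.component_subset θ) (mem_connectedComponentIn hθ)
        rw [postMean_of_mem hθ]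
        rcases hcase θ hθ hθC with ⟨h, he⟩ | ⟨h, he⟩
        · exact absurd (h θ (mem_connectedComponentIn hθ)) (not_le.2 (hxy.trans_lt hθx.1))
        · have := e2 θ hθ
          rw [he] at this
          refine (mul_left_cancel₀ hpos.ne' this).trans ?_
          have hne : x < bar E (connectedComponentIn P θ) := by
            by_contra! hcon
            have := h _ hmem
            have hyx : x = y := le_antisymm hxy (this.trans hcon)
            exact hyP (connectedComponentIn_subset _ _ ((le_antisymm this (hyx ▸ hcon)) ▸ hmem))
          simp only [hp]
          rw [if_neg (fun h' => absurd h'.2 (not_lt.2 (h _ hmem))), if_neg (not_le.2 hne)]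
      · simp only [hp]
        rw [if_neg (fun h' => absurd h'.2 (not_lt.2 h1.le)), if_neg (not_le.2 (hxy.trans_lt h1))]
        exact (H.upper hry hy1).2 z h1 hne

theorem pv_add_le {a x b m : ℝ} (ha : 0 ≤ a) (hax : a ≤ x) (hxb : x ≤ b) (hb : b ≤ 1)
    (hm : m = bar E (Ioo a b)) (hT : ∀ z ∈ Icc a b, sbVal N θ₀ lam z ≤ sbTan N θ₀ lam m z) :
    pv E (sbVal N θ₀ lam) a x + pv E (sbVal N θ₀ lam) x b ≤ pv E (sbVal N θ₀ lam) a b := by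
  have := H.hN
  rcases hax.eq_or_lt with rfl | hax'
  · simp [pv_self]
  rcases hxb.eq_or_lt with rfl | hxb'
  · simp [pv_self]
  have ha1 : a ≤ 1 := (hax.trans hxb).trans hb
  have p1 := mass_pos (E := E) ha hax' (hxb.trans hb)
  have p2 := mass_pos (E := E) (ha.trans hax) hxb' hb
  have b1 := bar_Ioo_mem (E := E) ha hax' (hxb.trans hb)
  have b2 := bar_Ioo_mem (E := E) (ha.trans hax) hxb' hb
  have s1 := mass_split (E := E) hax hxb
  have s2 := bar_split (E := E) hax hxb
  have e1 := mul_le_mul_of_nonneg_left (hT (bar E (Ioo a x)) ⟨b1.1.le, b1.2.le.trans hxb⟩) p1.le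
  have e2 := mul_le_mul_of_nonneg_left (hT (bar E (Ioo x b)) ⟨hax.trans b2.1.le, b2.2.le⟩) p2.le
  simp only [pv, sbTan, ← hm] at *
  linear_combination e1 + e2 - (sbVal N θ₀ lam m - sbSlope N θ₀ lam m * m) * s1 - sbSlope N θ₀ lam m * s2

theorem exists_better_split {x y : ℝ} (hx : 0 < x) (hxr : x < r) (hry : r < y) (hy : y < 1) :
    ∃ x' y', (x' ∈ Icc 0 r ∧ y' ∈ Icc r 1) ∧
      pv E (sbVal N θ₀ lam) 0 x + pv E (sbVal N θ₀ lam) x y + pv E (sbVal N θ₀ lam) y 1 <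
      pv E (sbVal N θ₀ lam) 0 x' + pv E (sbVal N θ₀ lam) x' y' + pv E (sbVal N θ₀ lam) y' 1 := by
  have hr := H.hr
  have hxy := hxr.trans hry
  rcases le_or_gt (bar E (Ioo x y)) (θ₀ - lam) with h | h
  · have := merge_lt_low (E := E) H.hN H.hl le_rfl hx hxy hy.le h
    refine ⟨0, y, ⟨⟨le_rfl, hr.1.le⟩, hry.le, hy.le⟩, ?_⟩
    rw [pv_self]; linarith
  rcases le_or_gt (θ₀ + lam) (bar E (Ioo x y)) with h' | h'
  · have := merge_lt_high (E := E) H.hN H.hl hx.le hxy hy le_rfl h'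
    refine ⟨x, 1, ⟨⟨hx.le, hxr.le⟩, hr.2.le, le_rfl⟩, ?_⟩
    rw [pv_self]; linarith
  by_cases heq : sbTan N θ₀ lam (bar E (Ioo 0 x)) x = sbTan N θ₀ lam (bar E (Ioo x y)) x
  · have := merge_lt_pair_low (E := E) H.hN H.hl le_rfl hx hxy hy.le (H.lower hx.le hxr.le).1 h h'.le
      (fun _ => H.lower_le hx.le hxr.le le_rfl) heq
    refine ⟨0, y, ⟨⟨le_rfl, hr.1.le⟩, hry.le, hy.le⟩, ?_⟩
    rw [pv_self]; linarith
  · obtain ⟨x', hx', hlt⟩ := exists_better_boundary (E := E) H.hl le_rfl hx hxy hy.le heq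
      (ε := min x (r - x)) (lt_min hx (by linarith))
    have e1 := min_le_left x (r - x)
    have e2 := min_le_right x (r - x)
    exact ⟨x', y, ⟨⟨by linarith [hx'.1], by linarith [hx'.2]⟩, hry.le, hy.le⟩, by linarith⟩

theorem exists_bound {P : Set ℝ} (hP : IsPoolingSet P) : ∃ x y, (x ∈ Icc 0 r ∧ y ∈ Icc r 1) ∧
    poolVal E (sbVal N θ₀ lam) P ≤ pv E (sbVal N θ₀ lam) 0 x + pv E (sbVal N θ₀ lam) x y +
      pv E (sbVal N θ₀ lam) y 1 ∧
    (pv E (sbVal N θ₀ lam) 0 x + pv E (sbVal N θ₀ lam) x y + pv E (sbVal N θ₀ lam) y 1 ≤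
      poolVal E (sbVal N θ₀ lam) P → (x < r → r < y → x = 0 ∨ y = 1) →
      P ∩ Ioo 0 1 = Ioo 0 1 ∨ ∃ s ∈ Ioo (0:ℝ) 1, P ∩ Ioo 0 1 = (Ico 0 s ∪ Ioc s 1) ∩ Ioo 0 1) := by
  have hr := H.hr
  by_cases hrP : r ∈ P
  · obtain ⟨x, y, hx, hxr, hry, hy, hC', hC, hxP, hyP⟩ := hP.exists_endpoints hr hrP
    have hCP : connectedComponentIn P r ⊆ P := connectedComponentIn_subset _ _
    have hcomp : ∀ θ ∈ connectedComponentIn P r, connectedComponentIn P θ = connectedComponentIn P r :=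
      fun θ hθ => component_eq hθ
    have hrC := mem_connectedComponentIn hrP
    have hvl := H.value_le hP hx hxr.le hry.le hy hC hC' hxP hyP hCP hcomp fun θ hθ hθC => by
      have hno : ∀ z ∈ connectedComponentIn P θ, z ∉ connectedComponentIn P r := by
        intro z hz hzr
        have e : connectedComponentIn P θ = connectedComponentIn P r :=
          (component_eq hz).symm.trans (hcomp z hzr)
        exact hθC (e ▸ mem_connectedComponentIn hθ)
      have ho := ordConnected_component P θ
      have hθm := mem_connectedComponentIn hθ
      have hrno : r ∉ connectedComponentIn P θ := fun h => hno r h hrC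
      rcases lt_trichotomy θ r with h | h | h
      · left
        intro z hz
        have hzr : z < r := by
          by_contra! hcon; exact hrno (ho.out hθm hz ⟨h.le, hcon⟩)
        by_contra! hcon
        exact hno z hz (hC' ⟨hcon, hzr.trans hry⟩)
      · exact absurd (h ▸ hrC) hθC
      · right
        intro z hz
        have hzr : r < z := by
          by_contra! hcon; exact hrno (ho.out hz hθm ⟨hcon, h.le⟩)
        by_contra! hcon
        exact hno z hz (hC' ⟨hxr.trans hzr, hcon⟩)
    refine ⟨x, y, ⟨⟨hx, hxr.le⟩, hry.le, hy⟩, hvl.1, fun hle hor => ?_⟩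
    obtain ⟨ha, hb⟩ := hvl.2 hle
    have hc : Ioo x y ⊆ P := hC'.trans hCP
    rcases hor hxr hry with h | h
    · rw [h] at hc
      rcases hy.eq_or_lt with hy1 | hy1
      · left; rw [hy1] at hc; exact inter_eq_self_of_subset_right hc
      · replace hyP := hyP.resolve_left hy1.ne
        refine Or.inr ⟨y, ⟨hr.1.trans hry, hy1⟩, inter_Ioo_eq_two hc hb fun z _ h1 h2 => ?_⟩
        rwa [le_antisymm h2 h1]
    · rw [h] at hc
      rcases hx.eq_or_lt with hx1 | hx1
      · left; rw [← hx1] at hc; exact inter_eq_self_of_subset_right hc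
      · replace hxP := hxP.resolve_left hx1.ne'
        refine Or.inr ⟨x, ⟨hx1, hxr.trans hr.2⟩, inter_Ioo_eq_two ha hc fun z _ h1 h2 => ?_⟩
        rwa [le_antisymm h2 h1]
  · have hvl := H.value_le (C := ∅) hP hr.1.le le_rfl le_rfl hr.2.le (empty_subset _) (by simp)
      (Or.inr hrP) (Or.inr hrP) (empty_subset _) (by simp) fun θ hθ _ => by
      have ho := ordConnected_component P θ
      have hθm := mem_connectedComponentIn hθ
      have hrno : r ∉ connectedComponentIn P θ := fun h => hrP (connectedComponentIn_subset _ _ h)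
      rcases le_total θ r with h | h
      · left
        intro z hz
        by_contra! hcon; exact hrno (ho.out hθm hz ⟨h, hcon.le⟩)
      · right
        intro z hz
        by_contra! hcon; exact hrno (ho.out hz hθm ⟨hcon.le, h⟩)
    refine ⟨r, r, ⟨⟨hr.1.le, le_rfl⟩, le_rfl, hr.2.le⟩, hvl.1, fun hle _ => ?_⟩
    obtain ⟨ha, hb⟩ := hvl.2 hle
    refine Or.inr ⟨r, hr, inter_Ioo_eq_two ha hb fun z _ h1 h2 => ?_⟩
    rwa [le_antisymm h2 h1]

theorem exists_max : ∃ V, (∀ x ∈ Icc 0 r, ∀ y ∈ Icc r 1, pv E (sbVal N θ₀ lam) 0 x +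
      pv E (sbVal N θ₀ lam) x y + pv E (sbVal N θ₀ lam) y 1 ≤ V) ∧
    (∀ x ∈ Icc 0 r, ∀ y ∈ Icc r 1, x < r → r < y → V ≤ pv E (sbVal N θ₀ lam) 0 x +
      pv E (sbVal N θ₀ lam) x y + pv E (sbVal N θ₀ lam) y 1 → x = 0 ∨ y = 1) ∧
    ∃ t ∈ Icc (0:ℝ) 1, V ≤ pv E (sbVal N θ₀ lam) 0 t + pv E (sbVal N θ₀ lam) t 1 := by
  have hr := H.hr
  have hwc : Continuous (sbVal N θ₀ lam) := continuous_sbVal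
  have hcont : ContinuousOn (fun q : ℝ × ℝ => pv E (sbVal N θ₀ lam) 0 q.1 +
      pv E (sbVal N θ₀ lam) q.1 q.2 + pv E (sbVal N θ₀ lam) q.2 1) (Icc 0 r ×ˢ Icc r 1) := by
    have hpv := continuousOn_pv (E := E) hwc
    refine (ContinuousOn.add ?_ ?_).add ?_
    · exact hpv.comp (f := fun q : ℝ × ℝ => ((0:ℝ), q.1)) (by fun_prop) fun q hq =>
        ⟨le_rfl, hq.1.1, hq.1.2.trans hr.2.le⟩
    · exact hpv.comp (f := fun q : ℝ × ℝ => (q.1, q.2)) (by fun_prop) fun q hq =>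
        ⟨hq.1.1, hq.1.2.trans hq.2.1, hq.2.2⟩
    · exact hpv.comp (f := fun q : ℝ × ℝ => (q.2, (1:ℝ))) (by fun_prop) fun q hq =>
        ⟨hr.1.le.trans hq.2.1, hq.2.2, le_rfl⟩
  have hne : (Icc 0 r ×ˢ Icc r 1).Nonempty :=
    ⟨(r, r), mk_mem_prod (right_mem_Icc.2 hr.1.le) (left_mem_Icc.2 hr.2.le)⟩
  obtain ⟨q, hq, hmax⟩ := (isCompact_Icc.prod isCompact_Icc).exists_isMaxOn hne hcont
  obtain ⟨x0, y0⟩ := q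
  obtain ⟨hx0, hy0⟩ := mem_prod.1 hq
  have hmax' : ∀ x ∈ Icc 0 r, ∀ y ∈ Icc r 1, pv E (sbVal N θ₀ lam) 0 x +
      pv E (sbVal N θ₀ lam) x y + pv E (sbVal N θ₀ lam) y 1 ≤ pv E (sbVal N θ₀ lam) 0 x0 +
      pv E (sbVal N θ₀ lam) x0 y0 + pv E (sbVal N θ₀ lam) y0 1 :=
    fun x hx y hy => isMaxOn_iff.1 hmax (x, y) (mk_mem_prod hx hy)
  simp only at hx0 hy0
  clear hmax hcont
  have hint : ∀ x ∈ Icc 0 r, ∀ y ∈ Icc r 1, x < r → r < y →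
      pv E (sbVal N θ₀ lam) 0 x0 + pv E (sbVal N θ₀ lam) x0 y0 + pv E (sbVal N θ₀ lam) y0 1 ≤
      pv E (sbVal N θ₀ lam) 0 x + pv E (sbVal N θ₀ lam) x y + pv E (sbVal N θ₀ lam) y 1 →
      x = 0 ∨ y = 1 := by
    intro x hx y hy hxr hry hle
    by_contra! hcon
    obtain ⟨x', y', ⟨hx', hy'⟩, hlt⟩ := H.exists_better_split (lt_of_le_of_ne hx.1 hcon.1.symm) hxr hry
      (lt_of_le_of_ne hy.2 hcon.2)
    linarith [hmax' x' hx' y' hy']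
  refine ⟨_, hmax', hint, ?_⟩
  have hx0' : x0 ≤ r := hx0.2
  have hy0' : r ≤ y0 := hy0.1
  rcases hx0'.eq_or_lt with h | h
  · refine ⟨r, ⟨hr.1.le, hr.2.le⟩, ?_⟩
    have := H.pv_add_le (m := upMean E r) hr.1.le hy0' hy0.2 le_rfl (by rw [upMean, if_pos hr.2])
      fun z hz => H.upper_le le_rfl hr.2.le hz.1
    rw [h]; linarith
  rcases hy0'.eq_or_lt with h' | h'
  · refine ⟨r, ⟨hr.1.le, hr.2.le⟩, ?_⟩
    have := H.pv_add_le (m := bar E (Ioo 0 r)) le_rfl hx0.1 hx0' hr.2.le rfl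
      fun z hz => H.lower_le hr.1.le le_rfl hz.2
    rw [← h']; linarith
  rcases hint x0 hx0 y0 hy0 h h' le_rfl with h0 | h1
  · refine ⟨y0, ⟨hr.1.le.trans hy0.1, hy0.2⟩, ?_⟩
    rw [h0, pv_self]; linarith
  · refine ⟨x0, ⟨hx0.1, hx0.2.trans hr.2.le⟩, ?_⟩
    rw [h1, pv_self]; linarith

/-- If the tangent conditions hold on both sides of `r`, only complete pooling and two adjacent
pools can be optimal. -/
theorem exists_optimal : ∃ t ∈ Icc (0:ℝ) 1,
    (∀ P, IsPoolingSet P → poolVal E (sbVal N θ₀ lam) P ≤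
      pv E (sbVal N θ₀ lam) 0 t + pv E (sbVal N θ₀ lam) t 1) ∧
    ∀ P, IsPoolingSet P → pv E (sbVal N θ₀ lam) 0 t + pv E (sbVal N θ₀ lam) t 1 ≤
        poolVal E (sbVal N θ₀ lam) P →
      P ∩ Ioo 0 1 = Ioo 0 1 ∨ ∃ s ∈ Ioo (0:ℝ) 1, P ∩ Ioo 0 1 = (Ico 0 s ∪ Ioc s 1) ∩ Ioo 0 1 := by
  obtain ⟨V, hmax, hint, t, ht, hVt⟩ := H.exists_max
  refine ⟨t, ht, fun P hP => ?_, fun P hP hle => ?_⟩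
  · obtain ⟨x, y, ⟨hx, hy⟩, h1, -⟩ := H.exists_bound hP
    exact h1.trans ((hmax x hx y hy).trans hVt)
  · obtain ⟨x, y, ⟨hx, hy⟩, h1, h2⟩ := H.exists_bound hP
    exact h2 ((hmax x hx y hy).trans (hVt.trans hle)) fun hxr hry =>
      hint x hx y hy hxr hry (hVt.trans (hle.trans h1))

end Splits

end Adjacent

/-! ### Complete pooling against two adjacent pools -/

section FullPooling

variable {E : Environment} {N θ₀ lam γ : ℝ}

theorem component_inter_subset {P Q : Set ℝ}
    (h : P ∩ Ioo 0 1 = Q ∩ Ioo 0 1) {θ : ℝ} (hθ : θ ∈ P ∩ Ioo 0 1) :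
    connectedComponentIn P θ ∩ Ioo 0 1 ⊆ connectedComponentIn Q θ := by
  have ho : (connectedComponentIn P θ ∩ Ioo 0 1).OrdConnected :=
    (ordConnected_component P θ).inter ordConnected_Ioo
  refine ho.isPreconnected.subset_connectedComponentIn ⟨mem_connectedComponentIn hθ.1, hθ.2⟩ ?_
  intro z hz
  exact (h.subset ⟨connectedComponentIn_subset _ _ hz.1, hz.2⟩).1

theorem poolVal_congr {P Q : Set ℝ}
    (h : P ∩ Ioo 0 1 = Q ∩ Ioo 0 1) (w : ℝ → ℝ) : poolVal E w P = poolVal E w Q := by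
  unfold poolVal
  refine integral_congr_ae ?_
  filter_upwards [ae_mem_Ioo E] with θ hθ
  by_cases hP' : θ ∈ P
  · have hQ' : θ ∈ Q := (h.subset ⟨hP', hθ⟩).1
    have e : connectedComponentIn P θ ∩ Ioo 0 1 = connectedComponentIn Q θ ∩ Ioo 0 1 :=
      Subset.antisymm (fun z hz => ⟨component_inter_subset h ⟨hP', hθ⟩ hz, hz.2⟩)
        fun z hz => ⟨component_inter_subset h.symm ⟨hQ', hθ⟩ hz, hz.2⟩
    rw [postMean_of_mem hP', postMean_of_mem hQ']
    congr 1
    refine bar_congr ?_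
    filter_upwards [ae_mem_Ioo E] with z hz
    have := Set.ext_iff.1 e z
    simp only [mem_inter_iff, hz, and_true] at this
    exact propext this
  · have hQ' : θ ∉ Q := fun h' => hP' (h.symm.subset ⟨h', hθ⟩).1
    rw [postMean_of_notMem hP', postMean_of_notMem hQ']

theorem pv_full (w : ℝ → ℝ) : pv E w 0 1 = w (mean E) := by
  rw [pv, mass_Ioo_01, bar_Ioo_01, one_mul]

theorem poolVal_two_adjacent {w : ℝ → ℝ} (hw : Continuous w) {t : ℝ} (h0 : 0 ≤ t) (h1 : t ≤ 1) :
    poolVal E w (Ico 0 t ∪ Ioc t 1) = pv E w 0 t + pv E w t 1 := by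
  rw [poolVal_two hw h0 le_rfl h1]; simp

/-- Complete pooling is at least as good as any two adjacent pools. -/
def FullBeatsTwo (E : Environment) (w : ℝ → ℝ) : Prop :=
  ∀ t ∈ Ioo (0:ℝ) 1, pv E w 0 t + pv E w t 1 ≤ w (mean E)

theorem Splits.isUniqueOpt_full {r : ℝ} (H : Splits E N θ₀ lam γ r)
    (hF : ∀ t ∈ Ioo (0:ℝ) 1, pv E (sbVal N θ₀ lam) 0 t + pv E (sbVal N θ₀ lam) t 1 <
      sbVal N θ₀ lam (mean E)) : IsUniqueOpt E (sbVal N θ₀ lam) (Icc 0 1) := by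
  obtain ⟨t, ht, h1, h2⟩ := H.exists_optimal
  have hle : pv E (sbVal N θ₀ lam) 0 t + pv E (sbVal N θ₀ lam) t 1 ≤ sbVal N θ₀ lam (mean E) := by
    rcases ht.1.eq_or_lt with h | h
    · rw [← h, pv_self, pv_full, zero_add]
    rcases ht.2.eq_or_lt with h' | h'
    · rw [h', pv_self, pv_full, add_zero]
    exact (hF t ⟨h, h'⟩).le
  have hI : Icc (0:ℝ) 1 ∩ Ioo 0 1 = Ioo 0 1 := inter_eq_self_of_subset_right Ioo_subset_Icc_self
  refine ⟨isPoolingSet_Icc, fun Q hQ => ?_, fun Q hQ hle' => ?_⟩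
  · rw [poolVal_full]; exact (h1 Q hQ).trans hle
  · rw [poolVal_full] at hle'
    rw [hI]
    rcases h2 Q hQ (hle.trans hle') with h | ⟨s, hs, h⟩
    · exact h
    · rw [poolVal_congr h,
        poolVal_two_adjacent continuous_sbVal hs.1.le hs.2.le] at hle'
      exact absurd (hF s hs) (not_lt.2 hle')

theorem Splits.two_adjacent_optimal {r : ℝ} (H : Splits E N θ₀ lam γ r)
    (hF : ¬ FullBeatsTwo E (sbVal N θ₀ lam)) :
    (∃ s ∈ Ioo (0:ℝ) 1, ∀ Q, IsPoolingSet Q → poolVal E (sbVal N θ₀ lam) Q ≤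
      poolVal E (sbVal N θ₀ lam) (Ico 0 s ∪ Ioc s 1)) ∧
    ∀ P, IsPoolingSet P → (∀ Q, IsPoolingSet Q → poolVal E (sbVal N θ₀ lam) Q ≤
      poolVal E (sbVal N θ₀ lam) P) → ∃ s ∈ Ioo (0:ℝ) 1,
        P ∩ Ioo 0 1 = (Ico 0 s ∪ Ioc s 1) ∩ Ioo 0 1 := by
  obtain ⟨t, ht, h1, h2⟩ := H.exists_optimal
  unfold FullBeatsTwo at hF
  push Not at hF
  obtain ⟨u, hu, hlt⟩ := hF
  have hu' := h1 _ (isPoolingSet_two hu.1.le hu.2.le)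
  rw [poolVal_two_adjacent continuous_sbVal hu.1.le hu.2.le] at hu'
  have ht0 : t ∈ Ioo (0:ℝ) 1 := by
    refine ⟨lt_of_le_of_ne ht.1 fun h => ?_, lt_of_le_of_ne ht.2 fun h => ?_⟩
    · rw [← h, pv_self, pv_full] at hu'; linarith
    · rw [h, pv_self, pv_full] at hu'; linarith
  have hval := poolVal_two_adjacent (E := E) (w := sbVal N θ₀ lam) continuous_sbVal ht.1 ht.2
  refine ⟨⟨t, ht0, fun Q hQ => ?_⟩, fun P hP hopt => ?_⟩
  · rw [hval]; exact h1 Q hQ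
  · have := hopt _ (isPoolingSet_two (t := t) (s := t) ht.1 ht.2)
    rw [hval] at this
    rcases h2 P hP this with h | h
    · have e : P ∩ Ioo 0 1 = Icc (0:ℝ) 1 ∩ Ioo 0 1 := by
        rw [h, inter_eq_self_of_subset_right Ioo_subset_Icc_self]
      have hPu := hopt _ (isPoolingSet_two (t := u) (s := u) hu.1.le hu.2.le)
      rw [poolVal_congr e, poolVal_full,
        poolVal_two_adjacent continuous_sbVal hu.1.le hu.2.le] at hPu
      linarith
    · exact h

/-- Change in the enforcement loss when the radius rises from `l1` to `l2`. -/
noncomputable def gain (θ₀ l1 l2 x : ℝ) : ℝ :=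
  (max (|x - θ₀| - l1) 0) ^ 2 - (max (|x - θ₀| - l2) 0) ^ 2

theorem sbVal_sub_eq_gain (N θ₀ l1 l2 x : ℝ) :
    sbVal N θ₀ l2 x - sbVal N θ₀ l1 x = N ^ 2 / 2 * gain θ₀ l1 l2 x := by
  unfold sbVal gain; ring

theorem gain_nonneg {θ₀ l1 l2 : ℝ} (h : l1 ≤ l2) (x : ℝ) : 0 ≤ gain θ₀ l1 l2 x := by
  unfold gain
  rw [sub_nonneg]
  exact pow_le_pow_left₀ (le_max_right _ _) (max_le_max (by linarith) le_rfl) 2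

theorem gain_pos {θ₀ l1 l2 x : ℝ} (h : l1 < l2) (hx : l1 < |x - θ₀|) : 0 < gain θ₀ l1 l2 x := by
  unfold gain
  rw [sub_pos, max_eq_left (a := |x - θ₀| - l1) (by linarith)]
  exact pow_lt_pow_left₀ (max_lt (by linarith) (by linarith)) (le_max_right _ _) two_ne_zero

theorem line_le_gain {θ₀ l1 l2 s z : ℝ} (h0 : 0 ≤ s) (hs : s ≤ l2 - l1) {x : ℝ}
    (hz : z ≤ |x - θ₀|) : 2 * s * (z - l1) - s ^ 2 ≤ gain θ₀ l1 l2 x := by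
  unfold gain
  set r := |x - θ₀|
  have h1 : 2 * s * (z - l1) ≤ 2 * s * (r - l1) := by gcongr
  rcases le_or_gt r l1 with h | h
  · rw [max_eq_right (by linarith), max_eq_right (by linarith)]
    nlinarith
  rcases le_or_gt r l2 with h' | h'
  · rw [max_eq_left (by linarith), max_eq_right (by linarith)]
    nlinarith [sq_nonneg (r - l1 - s)]
  · rw [max_eq_left (by linarith), max_eq_left (by linarith)]
    nlinarith [mul_nonneg (sub_nonneg.2 hs) (show (0:ℝ) ≤ r - l2 by linarith),
      sq_nonneg (l2 - l1 - s)]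

theorem exists_line_eq_gain {θ₀ l1 l2 x : ℝ} (h : l1 < l2) (hx : l1 < |x - θ₀|) :
    ∃ s, 0 < s ∧ s ≤ l2 - l1 ∧ gain θ₀ l1 l2 x = 2 * s * (|x - θ₀| - l1) - s ^ 2 := by
  unfold gain
  rcases le_or_gt |x - θ₀| l2 with h' | h'
  · refine ⟨|x - θ₀| - l1, by linarith, by linarith, ?_⟩
    rw [max_eq_left (by linarith), max_eq_right (by linarith)]; ring
  · refine ⟨l2 - l1, by linarith, le_rfl, ?_⟩
    rw [max_eq_left (by linarith), max_eq_left (by linarith)]; ring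

/-- Strict Jensen inequality for `gain`, except where it is affine. -/
theorem gain_jensen {θ₀ l1 l2 m1 m2 μ p1 p2 : ℝ} (h0 : 0 ≤ l1) (h : l1 < l2) (hp1 : 0 < p1)
    (hp2 : 0 < p2) (hp : p1 + p2 = 1) (hμ : p1 * m1 + p2 * m2 = μ)
    (hlow : θ₀ - l1 < m2) (hhigh : m1 < θ₀ + l1) (hmid : m1 < θ₀ - l1 ∨ θ₀ + l1 < m2) :
    gain θ₀ l1 l2 μ < p1 * gain θ₀ l1 l2 m1 + p2 * gain θ₀ l1 l2 m2 := by
  have n1 := gain_nonneg (θ₀ := θ₀) h.le m1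
  have n2 := gain_nonneg (θ₀ := θ₀) h.le m2
  rcases lt_or_ge μ (θ₀ - l1) with hc | hc
  · have ha : |μ - θ₀| = θ₀ - μ := by rw [abs_of_neg (by linarith)]; ring
    obtain ⟨s, hs0, hs, he⟩ := exists_line_eq_gain (x := μ) (θ₀ := θ₀) h (by rw [ha]; linarith)
    rw [ha] at he
    have a1 := line_le_gain (z := θ₀ - m1) hs0.le hs (x := m1) (θ₀ := θ₀) (by
      rw [abs_sub_comm]; exact le_abs_self _)
    have a2 : 2 * s * ((θ₀ - m2) - l1) - s ^ 2 < gain θ₀ l1 l2 m2 := by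
      have : s * ((θ₀ - m2) - l1) < 0 := mul_neg_of_pos_of_neg hs0 (by linarith)
      have := sq_nonneg s
      linarith
    have b1 := mul_le_mul_of_nonneg_left a1 hp1.le
    have b2 := mul_lt_mul_of_pos_left a2 hp2
    rw [he]
    have : 2 * s * (θ₀ - μ - l1) - s ^ 2 = p1 * (2 * s * ((θ₀ - m1) - l1) - s ^ 2) +
        p2 * (2 * s * ((θ₀ - m2) - l1) - s ^ 2) := by
      rw [← hμ]; linear_combination (-2 * s * (θ₀ - l1) + s ^ 2) * hp
    linarith
  rcases lt_or_ge (θ₀ + l1) μ with hc' | hc'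
  · have ha : |μ - θ₀| = μ - θ₀ := abs_of_pos (by linarith)
    obtain ⟨s, hs0, hs, he⟩ := exists_line_eq_gain (x := μ) (θ₀ := θ₀) h (by rw [ha]; linarith)
    rw [ha] at he
    have a1 := line_le_gain (z := m2 - θ₀) hs0.le hs (x := m2) (θ₀ := θ₀) (le_abs_self _)
    have a2 : 2 * s * ((m1 - θ₀) - l1) - s ^ 2 < gain θ₀ l1 l2 m1 := by
      have : s * ((m1 - θ₀) - l1) < 0 := mul_neg_of_pos_of_neg hs0 (by linarith)
      have := sq_nonneg s
      linarith
    have b1 := mul_le_mul_of_nonneg_left a1 hp2.le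
    have b2 := mul_lt_mul_of_pos_left a2 hp1
    rw [he]
    have : 2 * s * (μ - θ₀ - l1) - s ^ 2 = p1 * (2 * s * ((m1 - θ₀) - l1) - s ^ 2) +
        p2 * (2 * s * ((m2 - θ₀) - l1) - s ^ 2) := by
      rw [← hμ]; linear_combination (2 * s * (θ₀ + l1) + s ^ 2) * hp
    linarith
  · have hz : gain θ₀ l1 l2 μ = 0 := by
      have : |μ - θ₀| ≤ l1 := abs_le.2 ⟨by linarith, by linarith⟩
      unfold gain
      rw [max_eq_right (by linarith), max_eq_right (by linarith)]; ring
    rw [hz]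
    rcases hmid with hm | hm
    · have := gain_pos (θ₀ := θ₀) (x := m1) h (by rw [abs_of_neg (by linarith)]; linarith)
      have := mul_pos hp1 this
      have := mul_nonneg hp2.le n2
      linarith
    · have := gain_pos (θ₀ := θ₀) (x := m2) h (by rw [abs_of_pos (by linarith)]; linarith)
      have := mul_pos hp2 this
      have := mul_nonneg hp1.le n1
      linarith

theorem two_facts {t : ℝ} (ht : t ∈ Ioo (0:ℝ) 1) :
    0 < E.prior.real (Ioo 0 t) ∧ 0 < E.prior.real (Ioo t 1) ∧
    E.prior.real (Ioo 0 t) + E.prior.real (Ioo t 1) = 1 ∧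
    E.prior.real (Ioo 0 t) * bar E (Ioo 0 t) + E.prior.real (Ioo t 1) * bar E (Ioo t 1) = mean E ∧
    bar E (Ioo 0 t) < mean E ∧ mean E < bar E (Ioo t 1) ∧ bar E (Ioo 0 t) < t ∧ t < bar E (Ioo t 1) := by
  have h1 := mass_split (E := E) ht.1.le ht.2.le
  have h2 := bar_split (E := E) ht.1.le ht.2.le
  have h3 := bar_lt_bar_left (E := E) le_rfl ht.1 ht.2 le_rfl
  have h4 := bar_lt_bar_right (E := E) le_rfl ht.1 ht.2 le_rfl
  rw [mass_Ioo_01] at h1 h2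
  rw [bar_Ioo_01] at h2 h3 h4
  exact ⟨mass_pos le_rfl ht.1 ht.2.le, mass_pos ht.1.le ht.2 le_rfl, h1.symm, by linarith, h3, h4,
    (bar_Ioo_mem le_rfl ht.1 ht.2.le).2, (bar_Ioo_mem ht.1.le ht.2 le_rfl).1⟩

/-- If complete pooling weakly beats two adjacent pools, then it does so strictly for all smaller
radii. -/
theorem FullBeatsTwo.lt_of_lt (hN : 1 < N) {l1 l2 : ℝ} (hF : FullBeatsTwo E (sbVal N θ₀ l2))
    (h0 : 0 ≤ l1) (h : l1 < l2) {t : ℝ} (ht : t ∈ Ioo (0:ℝ) 1) :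
    pv E (sbVal N θ₀ l1) 0 t + pv E (sbVal N θ₀ l1) t 1 < sbVal N θ₀ l1 (mean E) := by
  obtain ⟨p1, p2, hp, hm, h1, h2, -, -⟩ := two_facts (E := E) ht
  have hle := hF t ht
  rcases le_or_gt (bar E (Ioo t 1)) (θ₀ - l1) with hc | hc
  · have := merge_lt_low (E := E) hN h0 le_rfl ht.1 ht.2 le_rfl hc
    rwa [pv_full] at this
  rcases le_or_gt (θ₀ + l1) (bar E (Ioo 0 t)) with hc' | hc'
  · have := merge_lt_high (E := E) hN h0 le_rfl ht.1 ht.2 le_rfl hc'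
    rwa [pv_full] at this
  by_cases hmid : bar E (Ioo 0 t) < θ₀ - l1 ∨ θ₀ + l1 < bar E (Ioo t 1)
  · have hj := gain_jensen h0 h p1 p2 hp hm hc hc' hmid
    have e0 := sbVal_sub_eq_gain N θ₀ l1 l2 (mean E)
    have e1 := sbVal_sub_eq_gain N θ₀ l1 l2 (bar E (Ioo 0 t))
    have e2 := sbVal_sub_eq_gain N θ₀ l1 l2 (bar E (Ioo t 1))
    have hN2 : 0 < N ^ 2 / 2 := by positivity
    have := mul_lt_mul_of_pos_left hj hN2
    simp only [pv] at hle ⊢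
    rw [eq_add_of_sub_eq e0, eq_add_of_sub_eq e1, eq_add_of_sub_eq e2] at hle
    nlinarith
  · push Not at hmid
    exfalso
    simp only [pv] at hle
    rw [sbVal_mid (by linarith) (by linarith), sbVal_mid (by linarith) (by linarith),
      sbVal_mid (by linarith) (by linarith), ← hm] at hle
    have : 0 < E.prior.real (Ioo 0 t) * E.prior.real (Ioo t 1) *
        (bar E (Ioo t 1) - bar E (Ioo 0 t)) ^ 2 := by
      have : 0 < bar E (Ioo t 1) - bar E (Ioo 0 t) := by linarith
      positivity
    have hp' : E.prior.real (Ioo t 1) = 1 - E.prior.real (Ioo 0 t) := by linarith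
    rw [hp'] at hle this
    nlinarith

end FullPooling

/-! ### The threshold for complete pooling -/

section Thresholds

variable {E : Environment} {N θ₀ lam γ : ℝ}

theorem gain_le_add (θ₀ : ℝ) {l : ℝ} (hl : 0 < l) (x y : ℝ) :
    gain θ₀ 0 l x ≤ gain θ₀ 0 l y + 2 * l * |x - y| := by
  have hy := gain_nonneg (θ₀ := θ₀) hl.le y
  have hxy := abs_nonneg (x - y)
  rcases (abs_nonneg (x - θ₀)).eq_or_lt with h | h
  · have : gain θ₀ 0 l x = 0 := by
      unfold gain
      rw [← h, max_eq_left (by linarith), max_eq_right (by linarith)]; ring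
    rw [this]; positivity
  · obtain ⟨s, hs0, hs, he⟩ := exists_line_eq_gain hl h
    have := line_le_gain hs0.le hs (le_refl |y - θ₀|)
    have h3 : |x - θ₀| - |y - θ₀| ≤ |x - y| := by
      have := abs_sub_abs_le_abs_sub (x - θ₀) (y - θ₀)
      rwa [sub_sub_sub_cancel_right] at this
    have h4 : s * (|x - θ₀| - |y - θ₀|) ≤ l * |x - y| :=
      (mul_le_mul_of_nonneg_left h3 hs0.le).trans (mul_le_mul_of_nonneg_right (by linarith) hxy)
    rw [he]; linarith

theorem exists_fullBeatsTwo (hN : 1 < N) : ∃ l > 0, FullBeatsTwo E (sbVal N θ₀ l) := by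
  have hh : (1/2:ℝ) ∈ Ioo (0:ℝ) 1 := by norm_num
  obtain ⟨-, -, -, -, a1, a2, -, -⟩ := two_facts (E := E) hh
  set d := min (mean E - bar E (Ioo 0 (1/2))) (bar E (Ioo (1/2) 1) - mean E) with hd
  have hd0 : 0 < d := lt_min (by linarith) (by linarith)
  have hgap : ∀ t ∈ Ioo (0:ℝ) 1, d ≤ bar E (Ioo t 1) - bar E (Ioo 0 t) := by
    intro t ht
    obtain ⟨-, -, -, -, b1, b2, -, -⟩ := two_facts (E := E) ht
    rcases lt_trichotomy t (1/2) with h | h | h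
    · have := bar_lt_bar_left (E := E) le_rfl ht.1 h (by norm_num)
      have := min_le_left (mean E - bar E (Ioo 0 (1/2))) (bar E (Ioo (1/2) 1) - mean E)
      linarith
    · have := min_le_left (mean E - bar E (Ioo 0 (1/2))) (bar E (Ioo (1/2) 1) - mean E)
      rw [h]; linarith
    · have := bar_lt_bar_right (E := E) (by norm_num) h ht.2 le_rfl
      have := min_le_right (mean E - bar E (Ioo 0 (1/2))) (bar E (Ioo (1/2) 1) - mean E)
      linarith
  clear_value d
  have hN1 : 0 < N ^ 2 - 1 := by nlinarith
  have hN0 : 0 < N ^ 2 := by linarith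
  refine ⟨(N ^ 2 - 1) * d / (4 * N ^ 2), by positivity, fun t ht => ?_⟩
  set l := (N ^ 2 - 1) * d / (4 * N ^ 2) with hl
  have hl0 : 0 < l := by positivity
  have hl' : 4 * N ^ 2 * l = (N ^ 2 - 1) * d := by rw [hl]; field_simp
  clear_value l
  have hg := hgap t ht
  obtain ⟨p1, p2, hp, hm, h1, h2, -, -⟩ := two_facts (E := E) ht
  have e0 := sbVal_sub_eq_gain N θ₀ 0 l (mean E)
  have e1 := sbVal_sub_eq_gain N θ₀ 0 l (bar E (Ioo 0 t))
  have e2 := sbVal_sub_eq_gain N θ₀ 0 l (bar E (Ioo t 1))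
  have hz : ∀ x, sbVal N θ₀ 0 x = x ^ 2 / 2 - N ^ 2 / 2 * (x - θ₀) ^ 2 := by
    intro x; unfold sbVal; rw [sub_zero, max_eq_left (abs_nonneg _), sq_abs]
  rw [hz] at e0 e1 e2
  have g1 := gain_le_add θ₀ hl0 (bar E (Ioo 0 t)) (mean E)
  have g2 := gain_le_add θ₀ hl0 (bar E (Ioo t 1)) (mean E)
  rw [abs_of_neg (by linarith)] at g1
  rw [abs_of_pos (by linarith)] at g2
  simp only [pv]
  rw [eq_add_of_sub_eq e0, eq_add_of_sub_eq e1, eq_add_of_sub_eq e2]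
  set q1 := E.prior.real (Ioo 0 t)
  set q2 := E.prior.real (Ioo t 1)
  set m1 := bar E (Ioo 0 t)
  set m2 := bar E (Ioo t 1)
  clear_value q1 q2 m1 m2
  have hq2 : q2 = 1 - q1 := by linarith
  have b1 := mul_le_mul_of_nonneg_left g1 p1.le
  have b2 := mul_le_mul_of_nonneg_left g2 p2.le
  have hsum : q1 * gain θ₀ 0 l m1 + q2 * gain θ₀ 0 l m2 - gain θ₀ 0 l (mean E) ≤
      4 * l * (q1 * q2 * (m2 - m1)) := by
    rw [← hm] at b1 b2 ⊢
    subst hq2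
    linear_combination b1 + b2
  have hb3 : 4 * N ^ 2 * l * (q1 * q2 * (m2 - m1)) ≤
      (N ^ 2 - 1) * (m2 - m1) * (q1 * q2 * (m2 - m1)) := by
    have : 0 < m2 - m1 := by linarith
    rw [hl']; gcongr
  have b4 := mul_le_mul_of_nonneg_left hsum (show 0 ≤ N ^ 2 / 2 by positivity)
  rw [← hm] at b4 ⊢
  subst hq2
  linear_combination b4 + (1/2) * hb3

/-- Where the two cutoff conditions hold with equality at the same state, separating at that state
is strictly better than complete pooling. -/
theorem lt_two_adjacent {r : ℝ} (H : Splits E N θ₀ lam γ r) (h1 : loCut E γ r = θ₀ - lam)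
    (h2 : hiCut E γ r = θ₀ + lam) : sbVal N θ₀ lam (mean E) <
      pv E (sbVal N θ₀ lam) 0 r + pv E (sbVal N θ₀ lam) r 1 := by
  obtain ⟨p1, p2, hp, hm, a1, a2, a3, a4⟩ := two_facts (E := E) H.hr
  have hl := H.lower H.hr.1.le le_rfl
  have hu := H.upper le_rfl H.hr.2.le
  have hlle : ∀ z, z ≤ r → _ := fun z hz => H.lower_le (x := r) (z := z) H.hr.1.le le_rfl hz
  have hule : ∀ z, r ≤ z → _ := fun z hz => H.upper_le (y := r) (z := z) le_rfl H.hr.2.le hz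
  rw [upMean, if_pos H.hr.2] at hu
  simp only [upMean, if_pos H.hr.2] at hule
  rw [loCut] at h1
  rw [hiCut, if_pos H.hr.2] at h2
  simp only [pv]
  have t1 := sbTan_low_eq_sq_half (x := r) H.hl H.hγ hl.1 (by linarith)
  have t2 := sbTan_high_eq_sq_half (x := r) H.hl H.hγ hu.1 (by linarith)
  have s1 := sbSlope_low (N := N) H.hl hl.1
  have s2 := sbSlope_high (N := N) H.hl hu.1
  have hg : N ^ 2 * (1 - γ) < 1 := slope_aux H.hN H.hγ0 H.hγ
  set q1 := E.prior.real (Ioo 0 r)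
  set q2 := E.prior.real (Ioo r 1)
  set m1 := bar E (Ioo 0 r)
  set m2 := bar E (Ioo r 1)
  set μ := mean E
  have k1 : sbSlope N θ₀ lam m1 < r := by
    rw [s1, ← h1]
    have := mul_lt_mul_of_pos_right hg (sub_pos.2 a3)
    linarith
  have k2 : r < sbSlope N θ₀ lam m2 := by
    rw [s2, ← h2]
    have := mul_lt_mul_of_pos_right hg (sub_pos.2 a4)
    linarith
  clear_value q1 q2 m1 m2 μ
  have line1 : ∀ z, sbTan N θ₀ lam m1 z = r ^ 2 / 2 + sbSlope N θ₀ lam m1 * (z - r) := by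
    intro z; rw [← t1]; unfold sbTan; ring
  have line2 : ∀ z, sbTan N θ₀ lam m2 z = r ^ 2 / 2 + sbSlope N θ₀ lam m2 * (z - r) := by
    intro z; rw [← t2]; unfold sbTan; ring
  have w1 := line1 m1
  have w2 := line2 m2
  rw [sbTan_self] at w1 w2
  rw [w1, w2]
  rcases le_total μ r with h | h
  · refine (hlle μ h).trans_lt ?_
    rw [line1, ← hm]
    have : 0 < q2 * ((sbSlope N θ₀ lam m2 - sbSlope N θ₀ lam m1) * (m2 - r)) :=
      mul_pos p2 (mul_pos (by linarith) (by linarith))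
    have hq : q1 = 1 - q2 := by linarith
    subst hq
    linarith
  · refine (hule μ h).trans_lt ?_
    rw [line2, ← hm]
    have : 0 < q1 * ((sbSlope N θ₀ lam m2 - sbSlope N θ₀ lam m1) * (r - m1)) :=
      mul_pos p1 (mul_pos (by linarith) (by linarith))
    have hq : q2 = 1 - q1 := by linarith
    subst hq
    linarith

theorem continuous_sbVal_radius (N θ₀ x : ℝ) : Continuous fun l => sbVal N θ₀ l x := by
  unfold sbVal; fun_prop

theorem exists_full_threshold (hN : 1 < N) (hγ0 : 0 < γ) (hγ1 : γ < 1)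
    (hγ : γ ^ 2 * N ^ 2 = N ^ 2 - 1) {r lC : ℝ} (hr : r ∈ Ioo (0:ℝ) 1) (hl : 0 < lC)
    (h1 : loCut E γ r = θ₀ - lC) (h2 : hiCut E γ r = θ₀ + lC) :
    ∃ lD ∈ Ioo 0 lC, (∀ l ∈ Ico 0 lD, IsUniqueOpt E (sbVal N θ₀ l) (Icc 0 1)) ∧
      ∀ l ∈ Ioo lD lC, ¬ FullBeatsTwo E (sbVal N θ₀ l) := by
  have HS : ∀ l ∈ Icc 0 lC, Splits E N θ₀ l γ r := fun l hl' =>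
    ⟨hN, hl'.1, hγ0, hγ1, hγ, hr, by rw [h1]; linarith [hl'.2], by rw [h2]; linarith [hl'.2]⟩
  obtain ⟨e, he, hF⟩ := exists_fullBeatsTwo (E := E) (θ₀ := θ₀) hN
  have hlt := lt_two_adjacent (HS lC ⟨hl.le, le_rfl⟩) h1 h2
  have hcont : Continuous fun l => pv E (sbVal N θ₀ l) 0 r + pv E (sbVal N θ₀ l) r 1 -
      sbVal N θ₀ l (mean E) := by
    unfold pv
    have := continuous_sbVal_radius N θ₀
    fun_prop
  have hev := (hcont.tendsto lC).eventually (lt_mem_nhds (sub_pos.2 hlt))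
  obtain ⟨η, hη, hball⟩ := Metric.eventually_nhds_iff.1 hev
  have hnF : ∀ l, lC - η < l → l ≤ lC → ¬ FullBeatsTwo E (sbVal N θ₀ l) := by
    intro l ha hb hF'
    have := @hball l (by rw [Real.dist_eq, abs_lt]; constructor <;> linarith)
    linarith [hF' r hr]
  have hup : ∀ l, FullBeatsTwo E (sbVal N θ₀ l) → l ≤ lC - η := by
    intro l hF'
    by_contra! hcon
    rcases le_or_gt l lC with h | h
    · exact hnF l hcon h hF'
    · exact hnF lC (by linarith) le_rfl fun t ht => (hF'.lt_of_lt hN hl.le h ht).le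
  have hbdd : BddAbove {l | FullBeatsTwo E (sbVal N θ₀ l)} := ⟨lC - η, fun l h => hup l h⟩
  have hsup : sSup {l | FullBeatsTwo E (sbVal N θ₀ l)} ≤ lC - η := csSup_le ⟨e, hF⟩ fun l h => hup l h
  have hlow : e ≤ sSup {l | FullBeatsTwo E (sbVal N θ₀ l)} := le_csSup hbdd hF
  refine ⟨sSup {l | FullBeatsTwo E (sbVal N θ₀ l)}, ⟨by linarith, by linarith⟩, fun l hl' => ?_,
    fun l hl' hF' => absurd (le_csSup hbdd hF') (not_le.2 hl'.1)⟩
  obtain ⟨l', hF', hll⟩ := exists_lt_of_lt_csSup ⟨e, hF⟩ hl'.2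
  exact (HS l ⟨hl'.1, by linarith [hl'.2]⟩).isUniqueOpt_full fun t ht =>
    FullBeatsTwo.lt_of_lt hN hF' hl'.1 hll ht

/-- The cutoffs cross exactly once when complete pooling is not optimal at the radius at which the
high states cease to be extreme. -/
theorem exists_cut_eq (hγ0 : 0 < γ) (hγ1 : γ < 1) (h0 : 1 / 2 ≤ θ₀)
    (h1 : 2 * θ₀ - 1 < loCut E γ 1) : ∃ r ∈ Ioo (0:ℝ) 1, loCut E γ r + hiCut E γ r = 2 * θ₀ := by
  have hc : ContinuousOn (fun t => loCut E γ t + hiCut E γ t) (Icc 0 1) :=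
    (loCut_continuousOn γ).add (hiCut_continuousOn γ)
  have hμ := mean_mem (E := E)
  have h := intermediate_value_Ioo zero_le_one hc
  have hm : 2 * θ₀ ∈ Ioo (loCut E γ 0 + hiCut E γ 0) (loCut E γ 1 + hiCut E γ 1) := by
    rw [loCut_zero, hiCut_zero, hiCut_one]
    constructor
    · nlinarith [hμ.1, hμ.2]
    · linarith
  obtain ⟨r, hr, he⟩ := h hm
  exact ⟨r, hr, he⟩

theorem exists_loCut_eq {r y : ℝ} (hr : r ∈ Ioc (0:ℝ) 1) (h0 : 0 < y)
    (h1 : y < loCut E γ r) : ∃ t ∈ Ioo 0 r, loCut E γ t = y := by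
  have h := intermediate_value_Ioo hr.1.le ((loCut_continuousOn (E := E) γ).mono (Icc_subset_Icc_right hr.2))
  obtain ⟨t, ht, he⟩ := h (show y ∈ Ioo (loCut E γ 0) (loCut E γ r) from ⟨by rwa [loCut_zero], h1⟩)
  exact ⟨t, ht, he⟩

theorem exists_hiCut_eq {r y : ℝ} (hr : r ∈ Ico (0:ℝ) 1) (h0 : hiCut E γ r < y)
    (h1 : y < 1) : ∃ t ∈ Ioo r 1, hiCut E γ t = y := by
  have h := intermediate_value_Ioo hr.2.le ((hiCut_continuousOn (E := E) γ).mono (Icc_subset_Icc_left hr.1))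
  obtain ⟨t, ht, he⟩ := h (show y ∈ Ioo (hiCut E γ r) (hiCut E γ 1) from ⟨h0, by rwa [hiCut_one]⟩)
  exact ⟨t, ht, he⟩

end Thresholds

/-! ### The symmetric uniform case -/

section Uniform

variable {E : Environment} {N lam γ : ℝ}

theorem uniform_mass (hf : ∀ θ ∈ Icc (0:ℝ) 1, E.f θ = 1) {x y : ℝ} (hx : 0 ≤ x) (hxy : x ≤ y)
    (hy : y ≤ 1) : E.prior.real (Ioo x y) = y - x := by
  rw [prior_of_uniform E hf, Measure.real, Measure.restrict_apply measurableSet_Ioo,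
    inter_eq_self_of_subset_left (Ioo_subset_Icc_self.trans (Icc_subset_Icc hx hy)), Real.volume_Ioo,
    ENNReal.toReal_ofReal (by linarith)]

theorem uniform_bar (hf : ∀ θ ∈ Icc (0:ℝ) 1, E.f θ = 1) {x y : ℝ} (hx : 0 ≤ x) (hxy : x < y)
    (hy : y ≤ 1) : bar E (Ioo x y) = (x + y) / 2 := by
  have h := mass_mul_bar (E := E) x y
  rw [uniform_mass hf hx hxy.le hy, prior_of_uniform E hf,
    Measure.restrict_restrict measurableSet_Ioo,
    inter_eq_self_of_subset_left (Ioo_subset_Icc_self.trans (Icc_subset_Icc hx hy)),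
    ← integral_Ioc_eq_integral_Ioo, ← intervalIntegral.integral_of_le hxy.le, integral_id] at h
  have : y - x ≠ 0 := by linarith
  field_simp
  apply mul_left_cancel₀ this
  linear_combination 2 * h

theorem uniform_mean (hf : ∀ θ ∈ Icc (0:ℝ) 1, E.f θ = 1) : mean E = 1 / 2 := by
  rw [← bar_Ioo_01, uniform_bar hf le_rfl one_pos le_rfl]; norm_num

theorem uniform_pv (hf : ∀ θ ∈ Icc (0:ℝ) 1, E.f θ = 1) (w : ℝ → ℝ) {t : ℝ} (ht : t ∈ Ioo (0:ℝ) 1) :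
    pv E w 0 t + pv E w t 1 = t * w (t / 2) + (1 - t) * w ((1 + t) / 2) := by
  rw [pv, pv, uniform_mass hf le_rfl ht.1.le ht.2.le, uniform_mass hf ht.1.le ht.2.le le_rfl,
    uniform_bar hf le_rfl ht.1 ht.2.le, uniform_bar hf ht.1.le ht.2 le_rfl, sub_zero, zero_add,
    add_comm t 1]

theorem sbVal_reflect (N lam x : ℝ) :
    sbVal N (1/2) lam (1 - x) = sbVal N (1/2) lam x + (1 - 2 * x) / 2 := by
  unfold sbVal
  rw [show 1 - x - 1 / 2 = -(x - 1/2) by ring, abs_neg]; ring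

theorem uniform_cut (hf : ∀ θ ∈ Icc (0:ℝ) 1, E.f θ = 1) :
    loCut E γ (1/2) + hiCut E γ (1/2) = 1 := by
  rw [loCut, hiCut, if_pos (by norm_num), uniform_bar hf le_rfl (by norm_num) (by norm_num),
    uniform_bar hf (by norm_num) (by norm_num) le_rfl]
  ring

/-- In the symmetric uniform case, two adjacent pools that beat complete pooling are optimal only
if they meet in the middle. -/
theorem uniform_two_adjacent (hf : ∀ θ ∈ Icc (0:ℝ) 1, E.f θ = 1)
    (H : Splits E N (1/2) lam γ (1/2)) (hl : 0 < lam)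
    (hF : ¬ FullBeatsTwo E (sbVal N (1/2) lam)) {t : ℝ} (ht : t ∈ Ioo (0:ℝ) 1)
    (hopt : ∀ s ∈ Ioo (0:ℝ) 1, pv E (sbVal N (1/2) lam) 0 s + pv E (sbVal N (1/2) lam) s 1 ≤
      pv E (sbVal N (1/2) lam) 0 t + pv E (sbVal N (1/2) lam) t 1) : t = 1 / 2 := by
  have hN := H.hN
  unfold FullBeatsTwo at hF
  push Not at hF
  obtain ⟨u, hu, hlt⟩ := hF
  have hmean := uniform_mean hf
  have hhalf : (1/2:ℝ) ∈ Ioo (0:ℝ) 1 := by norm_num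
  have key : ∀ t ∈ Ioo (0:ℝ) 1, (∀ s ∈ Ioo (0:ℝ) 1, pv E (sbVal N (1/2) lam) 0 s +
      pv E (sbVal N (1/2) lam) s 1 ≤ pv E (sbVal N (1/2) lam) 0 t + pv E (sbVal N (1/2) lam) t 1) →
      1 / 2 ≤ t := by
    intro t ht hopt
    by_contra! hcon
    have hlo := H.lower ht.1.le hcon.le
    have hm1 := hlo.1
    rw [uniform_bar hf le_rfl ht.1 ht.2.le] at hm1
    have hbest := hlt.trans_le (hopt u hu)
    rw [hmean] at hbest
    rcases le_or_gt (1/2 + lam) ((1 + t) / 2) with h | h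
    · have hlo2 := (H.lower hhalf.1.le le_rfl).1
      have hhi2 := (H.upper le_rfl hhalf.2.le).1
      rw [uniform_bar hf le_rfl hhalf.1 hhalf.2.le] at hlo2
      rw [upMean, if_pos hhalf.2, uniform_bar hf hhalf.1.le hhalf.2 le_rfl] at hhi2
      have h3 := hopt _ hhalf
      rw [uniform_pv hf _ ht] at h3 hbest
      rw [uniform_pv hf _ hhalf] at h3
      rw [sbVal_low hl.le (x := t/2) (by linarith), sbVal_high hl.le (x := (1+t)/2) (by linarith)]
        at h3 hbest
      rw [sbVal_low hl.le (x := 1/2/2) (by linarith), sbVal_high hl.le (x := (1+1/2)/2) (by linarith)] at h3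
      rw [sbVal_mid (by linarith) (by linarith)] at hbest
      have hb2 : 0 < t * (1 - t) * (2 * lam * N ^ 2 - (N ^ 2 - 1) / 4) - N ^ 2 * lam ^ 2 := by
        linear_combination 2 * hbest
      have hpos : 0 < 2 * lam * N ^ 2 - (N ^ 2 - 1) / 4 := by
        by_contra! hneg
        have h5 : t * (1 - t) * (2 * lam * N ^ 2 - (N ^ 2 - 1) / 4) ≤ 0 :=
          mul_nonpos_of_nonneg_of_nonpos (mul_nonneg ht.1.le (by linarith [ht.2])) hneg
        have : 0 ≤ N ^ 2 * lam ^ 2 := by positivity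
        linarith
      have h6 : 0 < (1/2 - t) ^ 2 * (2 * lam * N ^ 2 - (N ^ 2 - 1) / 4) := by
        have : 0 < 1/2 - t := by linarith
        positivity
      have h7 : (1/2 - t) ^ 2 * (2 * lam * N ^ 2 - (N ^ 2 - 1) / 4) ≤ 0 := by
        linear_combination 2 * h3
      linarith
    · have hm2 := uniform_bar hf ht.1.le ht.2 le_rfl
      by_cases heq : sbTan N (1/2) lam (bar E (Ioo 0 t)) t = sbTan N (1/2) lam (bar E (Ioo t 1)) t
      · have := merge_lt_pair_low (E := E) H.hN H.hl le_rfl ht.1 ht.2 le_rfl hlo.1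
          (by rw [hm2]; linarith [ht.1]) (by rw [hm2]; linarith)
          (fun _ => H.lower_le ht.1.le hcon.le le_rfl) heq
        rw [pv_full, hmean] at this
        linarith
      · obtain ⟨x', hx', hlt'⟩ := exists_better_boundary (E := E) H.hl le_rfl ht.1 ht.2 le_rfl heq
          (ε := min t (1 - t)) (lt_min ht.1 (by linarith [ht.2]))
        have e1 := min_le_left t (1 - t)
        have e2 := min_le_right t (1 - t)
        linarith [hopt x' ⟨by linarith [hx'.1], by linarith [hx'.2]⟩]
  refine le_antisymm ?_ (key t ht hopt)
  have hrefl : ∀ s ∈ Ioo (0:ℝ) 1, pv E (sbVal N (1/2) lam) 0 (1 - s) +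
      pv E (sbVal N (1/2) lam) (1 - s) 1 =
      pv E (sbVal N (1/2) lam) 0 s + pv E (sbVal N (1/2) lam) s 1 := by
    intro s hs
    rw [uniform_pv hf _ hs, uniform_pv hf _ (t := 1 - s) ⟨by linarith [hs.2], by linarith [hs.1]⟩,
      show (1 - s) / 2 = 1 - (1 + s) / 2 by ring, show (1 + (1 - s)) / 2 = 1 - s / 2 by ring,
      sbVal_reflect, sbVal_reflect]
    ring
  have := key (1 - t) ⟨by linarith [ht.2], by linarith [ht.1]⟩ fun s hs => by
    rw [hrefl t ht]; exact hopt s hs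
  linarith

end Uniform

/-! ### Optimal pooling as a function of the radius -/

/-- The optimal pooling sets for the value functions `sbVal N θ₀ l`, by the radius `l`. -/
structure Regimes (E : Environment) (N θ₀ lB lC lD : ℝ) (tL tH : ℝ → ℝ) : Prop where
  order : (1 - θ₀ ≤ lD ∧ lD = lC ∧ lC = lB ∧ lB < θ₀) ∨ (lD < lC ∧ lC < lB ∧ lB = 1 - θ₀)
  pos : 0 < lD
  lt : lB ≤ θ₀
  empty : ∀ l, θ₀ ≤ l → IsUniqueOpt E (sbVal N θ₀ l) ∅
  low : ∀ l ∈ Ioo lB θ₀, tL l ∈ Ioo (θ₀ - l) 1 ∧ IsUniqueOpt E (sbVal N θ₀ l) (Ico 0 (tL l))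
  low_end : lC < lB → lB < θ₀ → IsUniqueOpt E (sbVal N θ₀ lB) (Ico 0 (tL lB))
  both : ∀ l ∈ Ioo lC lB, tL l ∈ Ioo (θ₀ - l) (θ₀ + l) ∧ tH l ∈ Ioo (θ₀ - l) (θ₀ + l) ∧
    tL l < tH l ∧ IsUniqueOpt E (sbVal N θ₀ l) (Ico 0 (tL l) ∪ Ioc (tH l) 1)
  adjacent : ∀ l ∈ Ioo lD lC, (∃ s ∈ Ioo (0:ℝ) 1, ∀ Q, IsPoolingSet Q →
      poolVal E (sbVal N θ₀ l) Q ≤ poolVal E (sbVal N θ₀ l) (Ico 0 s ∪ Ioc s 1)) ∧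
    ∀ P, IsPoolingSet P → (∀ Q, IsPoolingSet Q → poolVal E (sbVal N θ₀ l) Q ≤
      poolVal E (sbVal N θ₀ l) P) → ∃ s ∈ Ioo (0:ℝ) 1,
        P ∩ Ioo 0 1 = (Ico 0 s ∪ Ioc s 1) ∩ Ioo 0 1
  full : ∀ l ∈ Ico 0 lD, IsUniqueOpt E (sbVal N θ₀ l) (Icc 0 1)
  low_anti : ∀ l₁ l₂, lC < l₁ → l₁ < l₂ → l₂ < θ₀ → tL l₂ < tL l₁
  high_mono : ∀ l₁ l₂, lC < l₁ → l₁ < l₂ → l₂ < lB → tH l₁ < tH l₂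
  low_slope : (∃ K, ∀ θ ∈ Icc (0:ℝ) 1, E.f θ ≤ K) → ∀ l ∈ Ioo lC θ₀, ∃ k > 0, ∀ l₁ l₂, lC < l₁ →
    l₁ < l₂ → l₂ ≤ l → k * (l₂ - l₁) ≤ tL l₁ - tL l₂
  high_slope : (∃ K, ∀ θ ∈ Icc (0:ℝ) 1, E.f θ ≤ K) → ∀ l ∈ Ioo lC lB, ∃ k > 0, ∀ l₁ l₂, lC < l₁ →
    l₁ < l₂ → l₂ ≤ l → k * (l₂ - l₁) ≤ tH l₂ - tH l₁
  uniform : (∀ θ ∈ Icc (0:ℝ) 1, E.f θ = 1) → θ₀ = 1 / 2 → ∀ l ∈ Ioo lD lC, ∀ s ∈ Ioo (0:ℝ) 1,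
    (∀ Q, IsPoolingSet Q → poolVal E (sbVal N θ₀ l) Q ≤
      poolVal E (sbVal N θ₀ l) (Ico 0 s ∪ Ioc s 1)) → s = 1 / 2

section Regimes

variable {E : Environment} {N θ₀ γ : ℝ}

theorem exists_lowCut (θ₀ : ℝ) {r : ℝ} (hr : r ∈ Ioc (0:ℝ) 1) : ∃ tL : ℝ → ℝ,
    ∀ l, θ₀ - loCut E γ r < l → l < θ₀ → tL l ∈ Ioo 0 r ∧ loCut E γ (tL l) = θ₀ - l := by
  have : ∀ l, ∃ t, θ₀ - loCut E γ r < l → l < θ₀ → t ∈ Ioo 0 r ∧ loCut E γ t = θ₀ - l := by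
    intro l
    by_cases h : θ₀ - loCut E γ r < l ∧ l < θ₀
    · obtain ⟨t, ht, he⟩ := exists_loCut_eq (E := E) (γ := γ) hr (y := θ₀ - l) (by linarith [h.2])
        (by linarith [h.1])
      exact ⟨t, fun _ _ => ⟨ht, he⟩⟩
    · exact ⟨0, fun h1 h2 => absurd ⟨h1, h2⟩ h⟩
  choose tL h using this
  exact ⟨tL, h⟩

theorem lowCut_anti (hγ0 : 0 < γ) (hγ1 : γ < 1) {r lC : ℝ} {tL : ℝ → ℝ} (hr : r ∈ Ioc (0:ℝ) 1)
    (h : ∀ l, lC < l → l < θ₀ → tL l ∈ Ioo 0 r ∧ loCut E γ (tL l) = θ₀ - l) :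
    ∀ l₁ l₂, lC < l₁ → l₁ < l₂ → l₂ < θ₀ → tL l₂ < tL l₁ := by
  intro l₁ l₂ h1 h12 h2
  obtain ⟨m1, e1⟩ := h l₁ h1 (h12.trans h2)
  obtain ⟨m2, e2⟩ := h l₂ (h1.trans h12) h2
  rw [← (loCut_strictMono (E := E) hγ0 hγ1).lt_iff_lt ⟨m2.1.le, m2.2.le.trans hr.2⟩
    ⟨m1.1.le, m1.2.le.trans hr.2⟩, e1, e2]
  linarith

theorem lowCut_slope (hγ0 : 0 < γ) (hγ1 : γ < 1) {r lC : ℝ} {tL : ℝ → ℝ} (hr : r ∈ Ioc (0:ℝ) 1)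
    (h : ∀ l, lC < l → l < θ₀ → tL l ∈ Ioo 0 r ∧ loCut E γ (tL l) = θ₀ - l)
    (hf : ∃ K, ∀ θ ∈ Icc (0:ℝ) 1, E.f θ ≤ K) : ∀ l ∈ Ioo lC θ₀, ∃ k > 0, ∀ l₁ l₂, lC < l₁ →
    l₁ < l₂ → l₂ ≤ l → k * (l₂ - l₁) ≤ tL l₁ - tL l₂ := by
  obtain ⟨K, hK⟩ := hf
  have hK0 : 0 < K := (E.f_pos 0 (by simp)).trans_le (hK 0 (by simp))
  intro l hl
  obtain ⟨m, -⟩ := h l hl.1 hl.2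
  have hp := mass_pos (E := E) le_rfl m.1 (m.2.le.trans hr.2)
  set c := 1 + K / E.prior.real (Ioo 0 (tL l)) with hc
  have hc0 : 0 < c := by positivity
  refine ⟨c⁻¹, inv_pos.2 hc0, fun l₁ l₂ h1 h12 h2 => ?_⟩
  obtain ⟨m1, e1⟩ := h l₁ h1 (by linarith [hl.2])
  obtain ⟨m2, e2⟩ := h l₂ (h1.trans h12) (by linarith [hl.2])
  have hlt := lowCut_anti hγ0 hγ1 hr h l₁ l₂ h1 h12 (by linarith [hl.2])
  have hle : tL l ≤ tL l₂ := by
    rcases h2.eq_or_lt with h' | h'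
    · rw [h']
    · exact (lowCut_anti hγ0 hγ1 hr h l₂ l (h1.trans h12) h' hl.2).le
  have := loCut_lipschitz hK hγ0 hγ1 m.1 hle hlt.le (m1.2.le.trans hr.2)
  rw [e1, e2, ← hc] at this
  rw [inv_mul_le_iff₀ hc0]
  linarith

theorem exists_highCut (θ₀ : ℝ) {r : ℝ} (hr : r ∈ Ico (0:ℝ) 1) : ∃ tH : ℝ → ℝ,
    ∀ l, hiCut E γ r - θ₀ < l → l < 1 - θ₀ → tH l ∈ Ioo r 1 ∧ hiCut E γ (tH l) = θ₀ + l := by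
  have : ∀ l, ∃ t, hiCut E γ r - θ₀ < l → l < 1 - θ₀ → t ∈ Ioo r 1 ∧ hiCut E γ t = θ₀ + l := by
    intro l
    by_cases h : hiCut E γ r - θ₀ < l ∧ l < 1 - θ₀
    · obtain ⟨t, ht, he⟩ := exists_hiCut_eq (E := E) (γ := γ) hr (y := θ₀ + l) (by linarith [h.1])
        (by linarith [h.2])
      exact ⟨t, fun _ _ => ⟨ht, he⟩⟩
    · exact ⟨0, fun h1 h2 => absurd ⟨h1, h2⟩ h⟩
  choose tH h using this
  exact ⟨tH, h⟩

theorem highCut_mono (hγ0 : 0 < γ) (hγ1 : γ < 1) {r lC lB : ℝ} {tH : ℝ → ℝ} (hr : r ∈ Ico (0:ℝ) 1)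
    (h : ∀ l, lC < l → l < lB → tH l ∈ Ioo r 1 ∧ hiCut E γ (tH l) = θ₀ + l) :
    ∀ l₁ l₂, lC < l₁ → l₁ < l₂ → l₂ < lB → tH l₁ < tH l₂ := by
  intro l₁ l₂ h1 h12 h2
  obtain ⟨m1, e1⟩ := h l₁ h1 (h12.trans h2)
  obtain ⟨m2, e2⟩ := h l₂ (h1.trans h12) h2
  rw [← (hiCut_strictMono (E := E) hγ0 hγ1).lt_iff_lt ⟨hr.1.trans m1.1.le, m1.2.le⟩
    ⟨hr.1.trans m2.1.le, m2.2.le⟩, e1, e2]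
  linarith

theorem highCut_slope (hγ0 : 0 < γ) (hγ1 : γ < 1) {r lC lB : ℝ} {tH : ℝ → ℝ} (hr : r ∈ Ico (0:ℝ) 1)
    (h : ∀ l, lC < l → l < lB → tH l ∈ Ioo r 1 ∧ hiCut E γ (tH l) = θ₀ + l)
    (hf : ∃ K, ∀ θ ∈ Icc (0:ℝ) 1, E.f θ ≤ K) : ∀ l ∈ Ioo lC lB, ∃ k > 0, ∀ l₁ l₂, lC < l₁ →
    l₁ < l₂ → l₂ ≤ l → k * (l₂ - l₁) ≤ tH l₂ - tH l₁ := by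
  obtain ⟨K, hK⟩ := hf
  have hK0 : 0 < K := (E.f_pos 0 (by simp)).trans_le (hK 0 (by simp))
  intro l hl
  obtain ⟨m, -⟩ := h l hl.1 hl.2
  have hp := mass_pos (E := E) (hr.1.trans m.1.le) m.2 le_rfl
  set c := 1 + K / E.prior.real (Ioo (tH l) 1) with hc
  have hc0 : 0 < c := by positivity
  refine ⟨c⁻¹, inv_pos.2 hc0, fun l₁ l₂ h1 h12 h2 => ?_⟩
  obtain ⟨m1, e1⟩ := h l₁ h1 (by linarith [hl.2])
  obtain ⟨m2, e2⟩ := h l₂ (h1.trans h12) (by linarith [hl.2])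
  have hlt := highCut_mono hγ0 hγ1 hr h l₁ l₂ h1 h12 (by linarith [hl.2])
  have hle : tH l₂ ≤ tH l := by
    rcases h2.eq_or_lt with h' | h'
    · rw [h']
    · exact (highCut_mono hγ0 hγ1 hr h l₂ l (h1.trans h12) h' hl.2).le
  have := hiCut_lipschitz hK hγ0 hγ1 m.2 (hr.1.trans m1.1.le) hlt.le hle
  rw [e1, e2, ← hc] at this
  rw [inv_mul_le_iff₀ hc0]
  linarith

theorem exists_regimes (hN : 1 < N) (h0 : θ₀ ∈ Ico (1 / 2 : ℝ) 1) :
    ∃ lB lC lD tL tH, Regimes E N θ₀ lB lC lD tL tH := by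
  obtain ⟨γ, hγ0, hγ1, hγ⟩ : ∃ γ : ℝ, 0 < γ ∧ γ < 1 ∧ γ ^ 2 * N ^ 2 = N ^ 2 - 1 := by
    have hN1 : 0 < N ^ 2 - 1 := by nlinarith
    have hN2 : 0 < N ^ 2 := by linarith
    have hs : √((N ^ 2 - 1) / N ^ 2) ^ 2 = (N ^ 2 - 1) / N ^ 2 := Real.sq_sqrt (by positivity)
    have hpos : 0 < √((N ^ 2 - 1) / N ^ 2) := Real.sqrt_pos.2 (by positivity)
    refine ⟨√((N ^ 2 - 1) / N ^ 2), hpos, ?_, by rw [hs]; field_simp⟩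
    have : √((N ^ 2 - 1) / N ^ 2) ^ 2 < 1 := by rw [hs, div_lt_one hN2]; linarith
    by_contra! hcon
    nlinarith
  have hμ := mean_mem (E := E)
  have hlo1 : loCut E γ 1 < 1 := by
    rw [loCut_one]
    have := mul_lt_mul_of_pos_left hμ.2 hγ0
    linarith
  have hlo0 : 0 < loCut E γ 1 := by
    rw [loCut_one]
    have := mul_pos hγ0 hμ.1
    linarith
  rcases le_or_gt (loCut E γ 1) (2 * θ₀ - 1) with hc | hc
  · have h11 : (1:ℝ) ∈ Ioc (0:ℝ) 1 := by norm_num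
    obtain ⟨tL, hL⟩ := exists_lowCut (E := E) (γ := γ) θ₀ h11
    refine ⟨θ₀ - loCut E γ 1, θ₀ - loCut E γ 1, θ₀ - loCut E γ 1, tL, fun _ => 0,
      Or.inl ⟨by linarith, rfl, rfl, by linarith⟩, by linarith [h0.2], by linarith,
      fun l hl => isUniqueOpt_sbVal_empty hl h0.1, fun l hl => ?_, fun h => absurd h (lt_irrefl _),
      fun l hl => absurd (hl.1.trans hl.2) (lt_irrefl _),
      fun l hl => absurd (hl.1.trans hl.2) (lt_irrefl _),
      fun l hl => isUniqueOpt_sbVal_full hN hl.1 hγ1 hγ (by linarith [hl.2]),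
      lowCut_anti hγ0 hγ1 h11 hL, fun l₁ l₂ h1 h12 h2 => absurd (h1.trans (h12.trans h2)) (lt_irrefl _),
      fun hf => lowCut_slope hγ0 hγ1 h11 hL hf, fun _ l hl => absurd (hl.1.trans hl.2) (lt_irrefl _),
      fun _ _ l hl => absurd (hl.1.trans hl.2) (lt_irrefl _)⟩
    obtain ⟨m, e⟩ := hL l hl.1 hl.2
    have := isUniqueOpt_sbVal_two (lam := l) (θ₀ := θ₀) (E := E) hN (by linarith [hl.1, h0.2]) hγ0 hγ1 hγ m.1 m.2 le_rfl e
      (fun h => absurd h (lt_irrefl _)) (fun _ => by linarith [hl.1])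
    rw [Ioc_self, union_empty] at this
    exact ⟨⟨by rw [← e]; exact loCut_lt hγ0 m.1 m.2.le, m.2⟩, this⟩
  · obtain ⟨r, hr, he⟩ := exists_cut_eq (E := E) hγ0 hγ1 h0.1 hc
    have hr1 : r ∈ Ioc (0:ℝ) 1 := ⟨hr.1, hr.2.le⟩
    have hr2 : r ∈ Ico (0:ℝ) 1 := ⟨hr.1.le, hr.2⟩
    have hlor : 0 < loCut E γ r := by
      rw [← loCut_zero (E := E) γ]
      exact loCut_strictMono hγ0 hγ1 ⟨le_rfl, zero_le_one⟩ ⟨hr.1.le, hr.2.le⟩ hr.1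
    have hhir : hiCut E γ r < 1 := by
      rw [← hiCut_one (E := E) γ]
      exact hiCut_strictMono hγ0 hγ1 ⟨hr.1.le, hr.2.le⟩ ⟨zero_le_one, le_rfl⟩ hr.2
    have hlh : loCut E γ r < hiCut E γ r :=
      (loCut_lt hγ0 hr.1 hr.2.le).trans (lt_hiCut hγ0 hr.1.le hr.2)
    obtain ⟨tL, hL⟩ := exists_lowCut (E := E) (γ := γ) θ₀ hr1
    obtain ⟨tH, hH⟩ := exists_highCut (E := E) (γ := γ) θ₀ hr2
    have hlC : hiCut E γ r - θ₀ = θ₀ - loCut E γ r := by linarith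
    rw [hlC] at hH
    have hCpos : 0 < θ₀ - loCut E γ r := by linarith
    obtain ⟨lD, hD, hDfull, hDF⟩ := exists_full_threshold hN hγ0 hγ1 hγ hr hCpos
      (by ring) (show hiCut E γ r = θ₀ + (θ₀ - loCut E γ r) by linarith)
    have HS : ∀ l ∈ Ioo lD (θ₀ - loCut E γ r), Splits E N θ₀ l γ r := fun l hl =>
      ⟨hN, (hD.1.trans hl.1).le, hγ0, hγ1, hγ, hr, by linarith [hl.2], by linarith [hl.2]⟩
    have hlowopt : ∀ l, 1 - θ₀ ≤ l → θ₀ - loCut E γ r < l → l < θ₀ → tL l ∈ Ioo (θ₀ - l) 1 ∧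
        IsUniqueOpt E (sbVal N θ₀ l) (Ico 0 (tL l)) := by
      intro l h1 h2 h3
      obtain ⟨m, e⟩ := hL l h2 h3
      have := isUniqueOpt_sbVal_two (lam := l) (θ₀ := θ₀) (E := E) hN (by linarith) hγ0 hγ1 hγ m.1 (m.2.trans hr.2) le_rfl e
        (fun h => absurd h (lt_irrefl _)) (fun _ => by linarith)
      rw [Ioc_self, union_empty] at this
      exact ⟨⟨by rw [← e]; exact loCut_lt hγ0 m.1 (m.2.le.trans hr.2.le), m.2.trans hr.2⟩, this⟩
    refine ⟨1 - θ₀, θ₀ - loCut E γ r, lD, tL, tH, Or.inr ⟨hD.2, by linarith, rfl⟩, hD.1,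
      by linarith [h0.1], fun l hl => isUniqueOpt_sbVal_empty hl h0.1,
      fun l hl => hlowopt l hl.1.le (by linarith [hl.1]) hl.2,
      fun h1 h2 => (hlowopt _ le_rfl h1 h2).2, fun l hl => ?_,
      fun l hl => (HS l hl).two_adjacent_optimal (hDF l hl), hDfull,
      lowCut_anti hγ0 hγ1 hr1 hL, highCut_mono hγ0 hγ1 hr2 hH,
      fun hf => lowCut_slope hγ0 hγ1 hr1 hL hf, fun hf => highCut_slope hγ0 hγ1 hr2 hH hf, ?_⟩
    · obtain ⟨m, e⟩ := hL l hl.1 (by linarith [hl.2, h0.1])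
      obtain ⟨m', e'⟩ := hH l hl.1 hl.2
      have h1 : tL l < tH l := m.2.trans m'.1
      have h2 : θ₀ - l < tL l := by rw [← e]; exact loCut_lt hγ0 m.1 (m.2.le.trans hr.2.le)
      have h3 : tH l < θ₀ + l := by rw [← e']; exact lt_hiCut hγ0 (hr.1.le.trans m'.1.le) m'.2
      exact ⟨⟨h2, h1.trans h3⟩, ⟨h2.trans h1, h3⟩, h1, isUniqueOpt_sbVal_two hN (by linarith [hl.1])
        hγ0 hγ1 hγ m.1 h1 m'.2.le e (fun _ => e') fun h => absurd h m'.2.ne⟩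
    · rintro hf rfl l hl s hs hopt
      have hrh : r = 1 / 2 := by
        have hu := uniform_cut (γ := γ) hf
        have hm : StrictMonoOn (fun t => loCut E γ t + hiCut E γ t) (Icc 0 1) :=
          fun x hx y hy h => add_lt_add (loCut_strictMono hγ0 hγ1 hx hy h) (hiCut_strictMono hγ0 hγ1 hx hy h)
        refine hm.injOn ⟨hr.1.le, hr.2.le⟩ (by norm_num) ?_
        simp only [he, hu]; norm_num
      subst hrh
      refine uniform_two_adjacent hf (HS l hl) (hD.1.trans hl.1) (hDF l hl) hs fun u hu => ?_
      have := hopt _ (isPoolingSet_two (t := u) (s := u) hu.1.le hu.2.le)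
      rwa [poolVal_two_adjacent continuous_sbVal hu.1.le hu.2.le,
        poolVal_two_adjacent continuous_sbVal hs.1.le hs.2.le] at this

end Regimes

/-! ### Elasticity of the feasible surplus -/

section Algebra

theorem high_area_pos {N q x μ : ℝ} (hN : 1 < N) (hq0 : 0 < q) (hq1 : q < 1) (hx0 : 0 ≤ x)
    (hx : x ≤ q * (1 - 2 * μ)) (hμ0 : 0 < μ) (hμ : μ ≤ 1 / 2) :
    0 < 4 * (N + 1) * (1 - μ) * (μ * (N - q) - x) + (2 * q * (1 - μ) + N - x) * (N + x) +
      (N * (1 - 2 * μ) + x) ^ 2 := by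
  have h0 : 0 < 4 * (N + 1) * (1 - μ) * (μ * (N - q)) + (2 * q * (1 - μ) + N) * N +
      (N * (1 - 2 * μ)) ^ 2 := by
    have : 0 < N - q := by linarith
    have : 0 < 1 - μ := by linarith
    positivity
  set X := q * (1 - 2 * μ) with hX
  have h1 : 0 < 4 * (N + 1) * (1 - μ) * (μ * (N - q) - X) + (2 * q * (1 - μ) + N - X) * (N + X) +
      (N * (1 - 2 * μ) + X) ^ 2 := by
    have f0 : 0 < 2 * (N ^ 2 - 1 + (1 - q) ^ 2) := by nlinarith [sq_nonneg (1 - q)]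
    have f1 : 0 < (N + 1) * (N - q) + (N + q) * N := by
      have : 0 < N - q := by linarith
      positivity
    have f2 : 0 ≤ 4 * (N + q) * (1 - q) * (μ * (1 / 2 - μ)) := by
      have : 0 < 1 - q := by linarith
      have : 0 ≤ 1 / 2 - μ := by linarith
      positivity
    have e0 := mul_nonneg (show 0 ≤ 1 - 2 * μ by linarith) f0.le
    have e1 := mul_pos (show 0 < 2 * μ by linarith) f1
    rw [hX]
    linear_combination e0 + e1 + f2
  rcases le_or_gt 0 (-4 * (N + 1) * (1 - μ) + 2 * q * (1 - μ) + 2 * N * (1 - 2 * μ)) with hg | hg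
  · have := mul_nonneg hg hx0
    linear_combination h0 + this
  · have := mul_nonneg_of_nonpos_of_nonpos hg.le (sub_nonpos.2 hx)
    linear_combination h1 + this

/-- The sender's worst payoff and the joint payoff react to the enforcement radius in such a way
that the elasticity of the surplus is below two. -/
theorem elasticity_low {α D ℓ C k : ℝ} (hα : 0 ≤ α) (hD : 0 ≤ D) (hℓ : 0 < ℓ) (hC : 0 < C) (hk : α ≤ k) :
    0 < (D ^ 2 - (max (D - ℓ) 0) ^ 2) - ℓ * max (α - ℓ) 0 + 2 * C + k * ℓ := by
  have h1 : (max (D - ℓ) 0) ^ 2 ≤ D ^ 2 :=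
    pow_le_pow_left₀ (le_max_right _ _) (max_le (by linarith) hD) 2
  have h2 : max (α - ℓ) 0 ≤ α := max_le (by linarith) hα
  have h3 := mul_le_mul_of_nonneg_left (h2.trans hk) hℓ.le
  linarith

theorem elasticity_high {N q x μ α β D ℓ Cl Ch kl kh : ℝ} (hN : 1 < N) (hq0 : 0 < q) (hq1 : q < 1)
    (hα : α = (N + x) / 2) (hβ : β = (N - x) / 2) (hx0 : 0 ≤ x) (hμ0 : 0 < μ) (hℓ : 0 < ℓ)
    (hD : α - N * μ ≤ D) (hD0 : 0 ≤ D) (hDα : D ≤ α)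
    (hkl : kl = q * μ + α) (hkh : kh = q * (1 - μ) + β) (hCl : 0 < Cl)
    (hCh : (N + 1) * (1 - μ) * (μ * (N - q) - x) / 2 ≤ Ch)
    (hmax : kl * ℓ + Cl ≤ kh * ℓ + Ch) :
    0 < (D ^ 2 - (max (D - ℓ) 0) ^ 2) - ℓ * max (α - ℓ) 0 + 2 * Ch + kh * ℓ := by
  have hα0 : 0 ≤ α := by rw [hα]; linarith
  rcases le_or_gt kh kl with hk | hk
  · have h1 := elasticity_low (k := kl) hα0 hD0 hℓ hCl (by rw [hkl]; nlinarith)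
    have := mul_le_mul_of_nonneg_right hk hℓ.le
    linarith
  have hxX : x ≤ q * (1 - 2 * μ) := by rw [hkl, hkh, hα, hβ] at hk; linarith
  have hμ : μ ≤ 1 / 2 := by
    by_contra! hcon
    have : q * (1 - 2 * μ) < 0 := mul_neg_of_pos_of_neg hq0 (by linarith)
    linarith
  rcases le_or_gt ℓ α with hl | hl
  · rw [max_eq_left (sub_nonneg.2 hl)]
    have hι : 0 ≤ 2 * D + (3 * q * μ - q + x) := by
      have e1 := mul_nonneg (show 0 ≤ 1 - 2 * μ by linarith) (show 0 ≤ N - q by linarith)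
      have e2 := mul_pos hq0 hμ0
      rw [hα] at hD
      linarith
    have key : 0 ≤ D ^ 2 - (max (D - ℓ) 0) ^ 2 + ℓ * ((3 * q * μ - q + x) + ℓ) := by
      rcases le_or_gt ℓ D with h | h
      · rw [max_eq_left (sub_nonneg.2 h)]
        have := mul_nonneg hℓ.le hι
        linarith
      · rw [max_eq_right (by linarith)]
        have := mul_nonneg hℓ.le hι
        linarith [sq_nonneg (D - ℓ)]
    rw [hkl, hkh] at hmax
    have hx' : x = α - β := by rw [hα, hβ]; ring
    rw [hkh]
    rw [hx'] at key
    linarith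
  · rw [max_eq_right (by linarith), max_eq_right (by linarith)]
    have h1 := high_area_pos hN hq0 hq1 hx0 hxX hμ0 hμ
    have h2 : ((N * (1 - 2 * μ) + x) / 2) ^ 2 ≤ D ^ 2 := by
      have e1 := mul_nonneg (show 0 ≤ 1 - 2 * μ by linarith) (show 0 ≤ N by linarith)
      refine pow_le_pow_left₀ (by linarith) ?_ 2
      rw [hα] at hD; linarith
    have hk0 : 0 ≤ kh := by
      rw [hkl] at hk
      have := mul_pos hq0 hμ0
      linarith
    have h3 := mul_le_mul_of_nonneg_left hl.le hk0
    rw [hkh, hβ] at h3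
    rw [hkh, hβ]
    rw [hα] at h3
    linarith

theorem strictAntiOn_of_left {f : ℝ → ℝ} (hf : ContinuousOn f (Ioi 0))
    (h : ∀ x, 0 < x → ∃ ε > 0, ∀ y, x - ε < y → y < x → 0 < y → f x < f y) :
    StrictAntiOn f (Ioi 0) := by
  intro x hx y hy hxy
  obtain ⟨z, hz, hmax⟩ := isCompact_Icc.exists_isMaxOn (nonempty_Icc.2 hxy.le)
    (hf.mono fun t ht => lt_of_lt_of_le hx ht.1)
  have hle : ∀ t ∈ Icc x y, f t ≤ f z := fun t ht => hmax ht
  have honly : ∀ t ∈ Icc x y, f t = f z → t = x := by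
    intro t ht he
    by_contra hne
    have hxt : x < t := lt_of_le_of_ne ht.1 (Ne.symm hne)
    obtain ⟨ε, hε, hlt⟩ := h t (lt_trans hx hxt)
    have := hlt (max x (t - ε / 2)) (lt_of_lt_of_le (by linarith) (le_max_right _ _))
      (max_lt hxt (by linarith)) (lt_of_lt_of_le hx (le_max_left _ _))
    have h2 := hle (max x (t - ε / 2)) ⟨le_max_left _ _, (max_le hxt.le (by linarith)).trans ht.2⟩
    linarith
  have hzx : z = x := honly z hz rfl
  refine lt_of_le_of_ne (hzx ▸ hle y ⟨hxy.le, le_rfl⟩) fun he => ?_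
  exact hxy.ne' (honly y ⟨hxy.le, le_rfl⟩ (he.trans (by rw [hzx])))

end Algebra

section Surplus

variable (E : Environment)

/-- Expected integral of the posterior mean below the state. -/
noncomputable def lowArea (P : Set ℝ) : ℝ := ∫ θ, (∫ t in (0:ℝ)..θ, E.postMean P t) ∂E.prior

/-- Expected integral of the posterior mean above the state. -/
noncomputable def highArea (P : Set ℝ) : ℝ := ∫ θ, (∫ t in θ..1, E.postMean P t) ∂E.prior

noncomputable def lowInf : ℝ := sInf (lowArea E '' {P | IsPoolingSet P})

noncomputable def highSup : ℝ := sSup (highArea E '' {P | IsPoolingSet P})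

/-- Weight of the state in the sender's marginal payoff from the decision. -/
noncomputable def wt : ℝ := 1 - E.c * E.a

/-- The sender's payoff when every decision is `ℓ` below the receiver's preferred one, the mean
decision area is `κ`, and the lowest state gets the payoff from the lowest decision. -/
noncomputable def guardLow (κ ℓ : ℝ) : ℝ :=
  E.uS (E.b - ℓ) 0 + wt E * (E.a * κ + (E.b - ℓ) * mean E)

noncomputable def guardHigh (κ ℓ : ℝ) : ℝ :=
  E.uS (E.a + E.b + ℓ) 1 - wt E * (E.a * κ + (E.b + ℓ) * (1 - mean E))

noncomputable def bestVal (θ₀ ℓ : ℝ) : ℝ :=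
  sSup (poolVal E (sbVal (E.a - 1) θ₀ (ℓ / (E.a - 1))) '' {P | IsPoolingSet P})

/-- The receiver's payoff from babbling. -/
noncomputable def babble : ℝ := E.uR (E.prefR (mean E)) (mean E)

/-- The largest surplus attainable with the enforcement radius `ℓ` for decisions. -/
noncomputable def maxSurplus (θ₀ ℓ : ℝ) : ℝ :=
  bestVal E θ₀ ℓ - min (guardLow E (lowInf E) ℓ) (guardHigh E (highSup E) ℓ) - babble E

variable {E} {θ₀ : ℝ}

theorem wt_pos : 0 < wt E := by
  have := E.a_lt
  rw [lt_div_iff₀ E.c_pos] at this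
  unfold wt; linarith

theorem wt_lt_one : wt E < 1 := by
  have := mul_pos E.c_pos E.a_pos
  unfold wt; linarith

theorem intervalIntegrable_postMean {P : Set ℝ} (hP : IsPoolingSet P) (x y : ℝ) :
    IntervalIntegrable (E.postMean P) volume x y := hP.postMean_mono.intervalIntegrable

theorem continuous_lowPrim {P : Set ℝ} (hP : IsPoolingSet P) :
    Continuous fun θ => ∫ t in (0:ℝ)..θ, E.postMean P t :=
  intervalIntegral.continuous_primitive (fun x y => intervalIntegrable_postMean hP x y) 0

theorem lowPrim_mem {P : Set ℝ} (hP : IsPoolingSet P) {θ : ℝ} (hθ : θ ∈ Icc (0:ℝ) 1) :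
    0 ≤ ∫ t in (0:ℝ)..θ, E.postMean P t :=
  intervalIntegral.integral_nonneg hθ.1 fun _ ht =>
    (hP.postMean_mem ⟨ht.1, ht.2.trans hθ.2⟩).1

theorem highPrim_eq {P : Set ℝ} (hP : IsPoolingSet P) (θ : ℝ) :
    ∫ t in θ..1, E.postMean P t =
      (∫ t in (0:ℝ)..1, E.postMean P t) - ∫ t in (0:ℝ)..θ, E.postMean P t := by
  rw [intervalIntegral.integral_interval_sub_left] <;> exact intervalIntegrable_postMean hP _ _

theorem highPrim_le {P : Set ℝ} (hP : IsPoolingSet P) {θ : ℝ} (hθ : θ ∈ Icc (0:ℝ) 1) :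
    ∫ t in θ..1, E.postMean P t ≤ 1 := by
  have : ∫ t in θ..1, E.postMean P t ≤ ∫ t in θ..1, (1:ℝ) :=
    intervalIntegral.integral_mono_on hθ.2 (intervalIntegrable_postMean hP _ _) (by simp) fun t ht =>
      (hP.postMean_mem ⟨hθ.1.trans ht.1, ht.2⟩).2
  simp at this
  linarith [hθ.1]

theorem lowArea_nonneg {P : Set ℝ} (hP : IsPoolingSet P) : 0 ≤ lowArea E P := by
  refine integral_nonneg_of_ae ?_
  filter_upwards [ae_mem E] with θ hθ
  exact lowPrim_mem hP hθ

theorem integrable_lowPrim {P : Set ℝ} (hP : IsPoolingSet P) :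
    Integrable (fun θ => ∫ t in (0:ℝ)..θ, E.postMean P t) E.prior :=
  integrable_of_continuous E (continuous_lowPrim hP)

theorem integrable_highPrim {P : Set ℝ} (hP : IsPoolingSet P) :
    Integrable (fun θ => ∫ t in θ..1, E.postMean P t) E.prior := by
  rw [funext (highPrim_eq hP)]
  exact (integrable_const _).sub (integrable_lowPrim hP)

theorem highArea_le {P : Set ℝ} (hP : IsPoolingSet P) : highArea E P ≤ 1 := by
  have : highArea E P ≤ ∫ _, (1:ℝ) ∂E.prior := by
    refine integral_mono_ae (integrable_highPrim hP) (integrable_const _) ?_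
    filter_upwards [ae_mem E] with θ hθ
    exact highPrim_le hP hθ
  simpa using this

theorem lowInf_le {P : Set ℝ} (hP : IsPoolingSet P) : lowInf E ≤ lowArea E P :=
  csInf_le ⟨0, by rintro _ ⟨Q, hQ, rfl⟩; exact lowArea_nonneg hQ⟩ ⟨P, hP, rfl⟩

theorem le_highSup {P : Set ℝ} (hP : IsPoolingSet P) : highArea E P ≤ highSup E :=
  le_csSup ⟨1, by rintro _ ⟨Q, hQ, rfl⟩; exact highArea_le hQ⟩ ⟨P, hP, rfl⟩

theorem exists_lowArea_lt {y : ℝ} (h : lowInf E < y) : ∃ P, IsPoolingSet P ∧ lowArea E P < y := by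
  obtain ⟨_, ⟨P, hP, rfl⟩, hlt⟩ := exists_lt_of_csInf_lt
    (s := lowArea E '' {P | IsPoolingSet P}) ⟨_, ∅, isPoolingSet_empty, rfl⟩ h
  exact ⟨P, hP, hlt⟩

theorem exists_lt_highArea {y : ℝ} (h : y < highSup E) : ∃ P, IsPoolingSet P ∧ y < highArea E P := by
  obtain ⟨_, ⟨P, hP, rfl⟩, hlt⟩ := exists_lt_of_lt_csSup
    (s := highArea E '' {P | IsPoolingSet P}) ⟨_, ∅, isPoolingSet_empty, rfl⟩ h
  exact ⟨P, hP, hlt⟩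

theorem poolVal_sbVal_le {N lam : ℝ} {P : Set ℝ} (hP : IsPoolingSet P) :
    poolVal E (sbVal N θ₀ lam) P ≤ 1 / 2 := by
  have : poolVal E (sbVal N θ₀ lam) P ≤ ∫ _, (1/2:ℝ) ∂E.prior := by
    refine integral_mono_ae (integrable_comp_postMean hP continuous_sbVal) (integrable_const _) ?_
    filter_upwards [ae_mem E] with θ hθ
    have hm := hP.postMean_mem (E := E) hθ
    refine (sbVal_le _).trans ?_
    have := pow_le_one₀ (n := 2) hm.1 hm.2
    linarith
  simpa using this

theorem le_bestVal (θ₀ ℓ : ℝ) {P : Set ℝ} (hP : IsPoolingSet P) :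
    poolVal E (sbVal (E.a - 1) θ₀ (ℓ / (E.a - 1))) P ≤ bestVal E θ₀ ℓ :=
  le_csSup ⟨1 / 2, by rintro _ ⟨Q, hQ, rfl⟩; exact poolVal_sbVal_le hQ⟩ ⟨P, hP, rfl⟩

theorem bestVal_le {ℓ y : ℝ} (h : ∀ P, IsPoolingSet P →
    poolVal E (sbVal (E.a - 1) θ₀ (ℓ / (E.a - 1))) P ≤ y) : bestVal E θ₀ ℓ ≤ y :=
  csSup_le ⟨_, ∅, isPoolingSet_empty, rfl⟩ (by rintro _ ⟨Q, hQ, rfl⟩; exact h Q hQ)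

theorem exists_lt_poolVal {ℓ y : ℝ} (h : y < bestVal E θ₀ ℓ) : ∃ P, IsPoolingSet P ∧
    y < poolVal E (sbVal (E.a - 1) θ₀ (ℓ / (E.a - 1))) P := by
  obtain ⟨_, ⟨P, hP, rfl⟩, hlt⟩ := exists_lt_of_lt_csSup
    (s := poolVal E (sbVal (E.a - 1) θ₀ (ℓ / (E.a - 1))) '' {P | IsPoolingSet P})
    ⟨_, ∅, isPoolingSet_empty, rfl⟩ h
  exact ⟨P, hP, hlt⟩

theorem integral_sq_le : ∫ θ, θ ^ 2 ∂E.prior ≤ mean E := by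
  refine integral_mono_ae (integrable_of_continuous E (by fun_prop)) integrable_id' ?_
  filter_upwards [ae_mem E] with θ hθ
  nlinarith [hθ.1, hθ.2]

theorem lowInf_le_mean : lowInf E ≤ mean E / 2 := by
  refine (lowInf_le isPoolingSet_empty).trans ?_
  have : lowArea E ∅ = (∫ θ, θ ^ 2 ∂E.prior) / 2 := by
    unfold lowArea
    simp only [postMean_of_notMem (E := E) (notMem_empty _), integral_id]
    rw [← integral_div]; congr 1; funext θ; ring
  rw [this]
  linarith [integral_sq_le (E := E)]

theorem le_highSup_mean : (1 - mean E) / 2 ≤ highSup E := by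
  refine le_trans ?_ (le_highSup isPoolingSet_empty)
  have : highArea E ∅ = (1 - ∫ θ, θ ^ 2 ∂E.prior) / 2 := by
    unfold highArea
    simp only [postMean_of_notMem (E := E) (notMem_empty _), integral_id]
    rw [integral_div, integral_sub (integrable_const _) (integrable_of_continuous E (by fun_prop))]
    simp
  rw [this]
  linarith [integral_sq_le (E := E)]

theorem guardLow_eq (κ ℓ : ℝ) : guardLow E κ ℓ =
    guardLow E κ 0 - (wt E * mean E - E.b) * ℓ - (1 - E.c) * ℓ ^ 2 / 2 := by
  unfold guardLow Environment.uS Environment.u Environment.uR wt; ring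

theorem guardHigh_eq (κ ℓ : ℝ) : guardHigh E κ ℓ =
    guardHigh E κ 0 - (wt E * (1 - mean E) + (E.a + E.b - 1)) * ℓ - (1 - E.c) * ℓ ^ 2 / 2 := by
  unfold guardHigh Environment.uS Environment.u Environment.uR wt; ring

theorem guardLow_zero (κ : ℝ) : E.uS (E.prefR (mean E)) (mean E) - guardLow E κ 0 =
    E.a * mean E * (-E.b - (1 - E.c) * E.a / 2 * mean E) + wt E * E.a * (mean E ^ 2 - κ) := by
  unfold guardLow Environment.uS Environment.u Environment.uR Environment.prefR wt; ring

theorem guardHigh_zero (κ : ℝ) : E.uS (E.prefR (mean E)) (mean E) - guardHigh E κ 0 =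
    E.a * (1 - mean E) * ((E.a + E.b - 1) - (1 - E.c) * E.a / 2 * (1 - mean E)) +
      wt E * E.a * (κ - mean E * (1 - mean E)) := by
  unfold guardHigh Environment.uS Environment.u Environment.uR Environment.prefR wt; ring

theorem sbVal_div {N : ℝ} (hN : 0 < N) (θ₀ ℓ x : ℝ) :
    sbVal N θ₀ (ℓ / N) x = x ^ 2 / 2 - (max (N * |x - θ₀| - ℓ) 0) ^ 2 / 2 := by
  unfold sbVal
  have : max (N * |x - θ₀| - ℓ) 0 = N * max (|x - θ₀| - ℓ / N) 0 := by
    rw [mul_max_of_nonneg _ _ hN.le, mul_zero, mul_sub, mul_div_cancel₀ _ hN.ne']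
  rw [this]; ring

/-- Standing assumptions on the environment. -/
structure Crossing (E : Environment) (θ₀ : ℝ) : Prop where
  ha : 2 < E.a
  hcross : E.a * θ₀ + E.b = θ₀
  h0 : θ₀ ∈ Ico (1 / 2 : ℝ) 1

namespace Crossing

variable (H : Crossing E θ₀)
include H

theorem hN : 1 < E.a - 1 := by linarith [H.ha]

theorem b_eq : -E.b = (E.a - 1) * θ₀ := by linarith [H.hcross]

theorem ab_eq : E.a + E.b - 1 = (E.a - 1) * (1 - θ₀) := by linarith [H.hcross]

theorem bestVal_mono {ℓ₁ ℓ₂ : ℝ} (h : ℓ₁ ≤ ℓ₂) : bestVal E θ₀ ℓ₁ ≤ bestVal E θ₀ ℓ₂ := by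
  have hN := H.hN
  refine bestVal_le fun P hP => le_trans ?_ (le_bestVal θ₀ ℓ₂ hP)
  refine integral_mono (integrable_comp_postMean hP continuous_sbVal)
    (integrable_comp_postMean hP continuous_sbVal) fun θ => ?_
  simp only [sbVal_div (show 0 < E.a - 1 by linarith)]
  have := pow_le_pow_left₀ (le_max_right _ _) (max_le_max (sub_le_sub_left h
    ((E.a - 1) * |E.postMean P θ - θ₀|)) (le_refl (0:ℝ))) 2
  linarith

theorem bestVal_drop {ℓ₁ ℓ₂ : ℝ} (h : ℓ₁ ≤ ℓ₂) : bestVal E θ₀ ℓ₂ -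
    (ℓ₂ - ℓ₁) * max (-E.b - ℓ₂) 0 - (ℓ₂ - ℓ₁) ^ 2 / 2 ≤ bestVal E θ₀ ℓ₁ := by
  have hN := H.hN
  rw [sub_sub, sub_le_iff_le_add]
  refine bestVal_le fun P hP => le_trans ?_ (add_le_add_left (le_bestVal θ₀ ℓ₁ hP) _)
  have hi := integrable_comp_postMean (E := E) hP (continuous_sbVal (N := E.a - 1) (θ₀ := θ₀)
    (lam := ℓ₁ / (E.a - 1)))
  have e : poolVal E (sbVal (E.a - 1) θ₀ (ℓ₁ / (E.a - 1))) P +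
      ((ℓ₂ - ℓ₁) * max (-E.b - ℓ₂) 0 + (ℓ₂ - ℓ₁) ^ 2 / 2) =
      ∫ θ, (sbVal (E.a - 1) θ₀ (ℓ₁ / (E.a - 1)) (E.postMean P θ) +
      ((ℓ₂ - ℓ₁) * max (-E.b - ℓ₂) 0 + (ℓ₂ - ℓ₁) ^ 2 / 2)) ∂E.prior := by
    rw [integral_add hi (integrable_const _), poolVal]; simp
  rw [e]
  refine integral_mono_ae (integrable_comp_postMean hP continuous_sbVal)
    (hi.add (integrable_const _)) ?_
  filter_upwards [ae_mem E] with θ hθ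
  have hm := hP.postMean_mem (E := E) hθ
  simp only [sbVal_div (show 0 < E.a - 1 by linarith)]
  set x := E.postMean P θ
  have hz : (E.a - 1) * |x - θ₀| ≤ -E.b := by
    rw [H.b_eq]
    refine mul_le_mul_of_nonneg_left (abs_le.2 ⟨by linarith [hm.1], ?_⟩) (by linarith)
    linarith [hm.2, H.h0.1]
  set z := (E.a - 1) * |x - θ₀|
  have h1 : max (z - ℓ₂) 0 ≤ max (-E.b - ℓ₂) 0 := max_le_max (by linarith) le_rfl
  have h2 : max (z - ℓ₁) 0 ≤ max (z - ℓ₂) 0 + (ℓ₂ - ℓ₁) := by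
    refine max_le ?_ (by linarith [le_max_right (z - ℓ₂) 0])
    linarith [le_max_left (z - ℓ₂) 0]
  have h3 := pow_le_pow_left₀ (le_max_right _ _) h2 2
  have h4 := mul_le_mul_of_nonneg_left h1 (sub_nonneg.2 h)
  linarith

theorem bestVal_lipschitz {ℓ₁ ℓ₂ : ℝ} (h0 : 0 ≤ ℓ₁) (h : ℓ₁ ≤ ℓ₂) :
    bestVal E θ₀ ℓ₂ - bestVal E θ₀ ℓ₁ ≤ (-E.b) * (ℓ₂ - ℓ₁) + (ℓ₂ - ℓ₁) ^ 2 / 2 := by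
  have h1 := H.bestVal_drop h
  have hb : 0 ≤ -E.b := by
    rw [H.b_eq]; exact mul_nonneg (by linarith [H.hN]) (by linarith [H.h0.1])
  have h2 : max (-E.b - ℓ₂) 0 ≤ -E.b := max_le (by linarith) hb
  have h3 := mul_le_mul_of_nonneg_left h2 (sub_nonneg.2 h)
  linarith

theorem continuousOn_bestVal : ContinuousOn (bestVal E θ₀) (Ioi 0) := by
  intro x hx
  have hx' : (0:ℝ) < x := hx
  have hb : ∀ᶠ y in 𝓝[Ioi 0] x, |bestVal E θ₀ y - bestVal E θ₀ x| ≤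
      (-E.b) * |y - x| + |y - x| ^ 2 / 2 := by
    filter_upwards [self_mem_nhdsWithin] with y hy
    have hy' : (0:ℝ) < y := hy
    rcases le_total x y with h | h
    · rw [abs_of_nonneg (sub_nonneg.2 (H.bestVal_mono h)), abs_of_nonneg (sub_nonneg.2 h)]
      exact H.bestVal_lipschitz hx'.le h
    · rw [abs_sub_comm, abs_of_nonneg (sub_nonneg.2 (H.bestVal_mono h)), abs_sub_comm,
        abs_of_nonneg (sub_nonneg.2 h)]
      exact H.bestVal_lipschitz hy'.le h
  rw [ContinuousWithinAt, tendsto_iff_norm_sub_tendsto_zero]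
  have hc : Continuous fun y : ℝ => (-E.b) * |y - x| + |y - x| ^ 2 / 2 := by fun_prop
  have ht := hc.tendsto x
  simp only [sub_self, abs_zero, mul_zero, ne_eq, OfNat.ofNat_ne_zero, not_false_eq_true, zero_pow,
    zero_div, add_zero] at ht
  exact squeeze_zero' (Eventually.of_forall fun _ => norm_nonneg _) hb (ht.mono_left nhdsWithin_le_nhds)

theorem pool_le_bestVal (ℓ : ℝ) : mean E ^ 2 / 2 -
    (max ((E.a - 1) * |mean E - θ₀| - ℓ) 0) ^ 2 / 2 ≤ bestVal E θ₀ ℓ := by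
  have := le_bestVal (E := E) θ₀ ℓ isPoolingSet_Icc
  rwa [poolVal_full, sbVal_div (by linarith [H.hN])] at this

theorem uS_pref : E.uS (E.prefR (mean E)) (mean E) = mean E ^ 2 / 2 -
    ((E.a - 1) * |mean E - θ₀|) ^ 2 / 2 - babble E := by
  have : (E.a * mean E + E.b - mean E) = (E.a - 1) * (mean E - θ₀) := by linarith [H.hcross]
  rw [mul_pow, sq_abs, ← mul_pow, ← this]
  unfold babble Environment.uS Environment.u Environment.prefR; ring

theorem low_pos : 0 < E.uS (E.prefR (mean E)) (mean E) - guardLow E (lowInf E) 0 := by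
  rw [guardLow_zero]
  have hμ := mean_mem (E := E)
  have hq := wt_pos (E := E)
  have hq1 := wt_lt_one (E := E)
  have ha := H.ha
  have h1 : 0 ≤ wt E * E.a * (mean E / 2 - lowInf E) :=
    mul_nonneg (mul_nonneg hq.le (by linarith)) (by linarith [lowInf_le_mean (E := E)])
  have h2 : 0 < E.a * mean E * ((E.a - 1 - wt E) / 2 * (1 - mean E)) :=
    mul_pos (mul_pos (by linarith) hμ.1) (mul_pos (by linarith) (by linarith [hμ.2]))
  have h3 : 0 ≤ E.a * mean E * (-E.b - (E.a - 1) / 2) := by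
    refine mul_nonneg (mul_nonneg (by linarith) hμ.1.le) ?_
    rw [H.b_eq]; nlinarith [H.h0.1]
  have hs : (1 - E.c) * E.a = E.a - 1 + wt E := by unfold wt; ring
  rw [hs]
  linear_combination h1 + h2 + h3

theorem high_ge : E.a * (1 - mean E) * (mean E * (E.a - 1 - wt E) - (E.a - 1) * (2 * θ₀ - 1)) / 2 ≤
    E.uS (E.prefR (mean E)) (mean E) - guardHigh E (highSup E) 0 := by
  rw [guardHigh_zero, H.ab_eq]
  have hq := wt_pos (E := E)
  have ha := H.ha
  have h1 : 0 ≤ wt E * E.a * (highSup E - (1 - mean E) / 2) :=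
    mul_nonneg (mul_nonneg hq.le (by linarith)) (by linarith [le_highSup_mean (E := E)])
  have hs : (1 - E.c) * E.a = E.a - 1 + wt E := by unfold wt; ring
  rw [hs]
  linear_combination h1

theorem maxSurplus_mono {ℓ₁ ℓ₂ : ℝ} (h0 : 0 ≤ ℓ₁) (h : ℓ₁ ≤ ℓ₂) :
    maxSurplus E θ₀ ℓ₁ ≤ maxSurplus E θ₀ ℓ₂ := by
  have h1 := H.bestVal_mono h
  have hμ := mean_mem (E := E)
  have hq := wt_pos (E := E)
  have hb : 0 ≤ -E.b := by
    rw [H.b_eq]; exact mul_nonneg (by linarith [H.hN]) (by linarith [H.h0.1])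
  have hab : 0 ≤ E.a + E.b - 1 := by
    rw [H.ab_eq]; exact mul_nonneg (by linarith [H.hN]) (by linarith [H.h0.2])
  have hc : 0 ≤ 1 - E.c := by linarith [E.c_le_one]
  have hsq : ℓ₁ ^ 2 ≤ ℓ₂ ^ 2 := pow_le_pow_left₀ h0 h 2
  have h4 := mul_le_mul_of_nonneg_left hsq hc
  have h2 : guardLow E (lowInf E) ℓ₂ ≤ guardLow E (lowInf E) ℓ₁ := by
    rw [guardLow_eq _ ℓ₁, guardLow_eq _ ℓ₂]
    have := mul_le_mul_of_nonneg_left h (show 0 ≤ wt E * mean E - E.b by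
      have := mul_pos hq hμ.1; linarith)
    linarith
  have h3 : guardHigh E (highSup E) ℓ₂ ≤ guardHigh E (highSup E) ℓ₁ := by
    rw [guardHigh_eq _ ℓ₁, guardHigh_eq _ ℓ₂]
    have := mul_le_mul_of_nonneg_left h (show 0 ≤ wt E * (1 - mean E) + (E.a + E.b - 1) by
      have := mul_pos hq (sub_pos.2 hμ.2); linarith)
    linarith
  have := min_le_min h2 h3
  unfold maxSurplus
  linarith

theorem maxSurplus_zero_pos : 0 < maxSurplus E θ₀ 0 := by
  have h1 := H.pool_le_bestVal 0
  have h2 := H.low_pos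
  rw [H.uS_pref] at h2
  rw [sub_zero, max_eq_left (mul_nonneg (by linarith [H.hN]) (abs_nonneg _))] at h1
  have := min_le_left (guardLow E (lowInf E) 0) (guardHigh E (highSup E) 0)
  unfold maxSurplus
  linarith

theorem maxSurplus_pos {ℓ : ℝ} (h : 0 ≤ ℓ) : 0 < maxSurplus E θ₀ ℓ :=
  H.maxSurplus_zero_pos.trans_le (H.maxSurplus_mono le_rfl h)

theorem continuousOn_maxSurplus : ContinuousOn (maxSurplus E θ₀) (Ioi 0) := by
  unfold maxSurplus
  have h1 : Continuous fun ℓ => guardLow E (lowInf E) ℓ := by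
    rw [funext (guardLow_eq (E := E) (lowInf E))]
    fun_prop
  have h2 : Continuous fun ℓ => guardHigh E (highSup E) ℓ := by
    rw [funext (guardHigh_eq (E := E) (highSup E))]
    fun_prop
  exact (H.continuousOn_bestVal.sub (h1.min h2).continuousOn).sub continuousOn_const

/-- The marginal condition behind `strictAntiOn_ratio`, for one of the two guard payoffs. -/
theorem ratio_left {g : ℝ → ℝ} {k : ℝ} (hg : ∀ ℓ, g ℓ = g 0 - k * ℓ - (1 - E.c) * ℓ ^ 2 / 2)
    (hle : ∀ ℓ, bestVal E θ₀ ℓ - g ℓ - babble E ≤ maxSurplus E θ₀ ℓ) {ℓ : ℝ} (hℓ : 0 < ℓ)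
    (he : maxSurplus E θ₀ ℓ = bestVal E θ₀ ℓ - g ℓ - babble E)
    (hB : 0 < (((E.a - 1) * |mean E - θ₀|) ^ 2 - (max ((E.a - 1) * |mean E - θ₀| - ℓ) 0) ^ 2) -
      ℓ * max (-E.b - ℓ) 0 + 2 * (E.uS (E.prefR (mean E)) (mean E) - g 0) + k * ℓ) :
    ∃ ε > 0, ∀ y, ℓ - ε < y → y < ℓ → 0 < y →
      maxSurplus E θ₀ ℓ / ℓ ^ 2 < maxSurplus E θ₀ y / y ^ 2 := by
  set B := (((E.a - 1) * |mean E - θ₀|) ^ 2 - (max ((E.a - 1) * |mean E - θ₀| - ℓ) 0) ^ 2) -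
      ℓ * max (-E.b - ℓ) 0 + 2 * (E.uS (E.prefR (mean E)) (mean E) - g 0) + k * ℓ with hBdef
  have hG := H.maxSurplus_pos hℓ.le
  set G := maxSurplus E θ₀ ℓ
  have hQ : 0 < G + ℓ ^ 2 / 2 := by positivity
  refine ⟨ℓ * B / (G + ℓ ^ 2 / 2), by positivity, fun y h1 h2 h3 => ?_⟩
  have hh : (ℓ - y) * (G + ℓ ^ 2 / 2) < ℓ * B := by
    rw [← lt_div_iff₀ hQ]; linarith
  have hv := H.bestVal_drop h2.le
  have hp := H.pool_le_bestVal ℓ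
  have hs := H.uS_pref
  have hy := hle y
  rw [hg y] at hy
  rw [hg ℓ] at he
  have hc : 0 ≤ 1 - E.c := by linarith [E.c_le_one]
  rw [div_lt_div_iff₀ (by positivity) (by positivity)]
  set m := max (-E.b - ℓ) 0
  set V := bestVal E θ₀ ℓ
  set Gy := maxSurplus E θ₀ y
  set Vy := bestVal E θ₀ y
  have d1 : -(ℓ - y) * (m + k + (1 - E.c) * ℓ) - (ℓ - y) ^ 2 / 2 ≤ Gy - G := by
    have := mul_nonneg hc (sq_nonneg (ℓ - y))
    linarith
  have d2 : B ≤ 2 * G - ℓ * (m + k + (1 - E.c) * ℓ) := by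
    rw [hBdef]; linarith
  have d3 := mul_le_mul_of_nonneg_left d1 (sq_nonneg ℓ)
  have hd : 0 < ℓ - y := by linarith
  have d4 := mul_le_mul_of_nonneg_left d2 (mul_nonneg hd.le hℓ.le)
  have d5 := mul_lt_mul_of_pos_left hh hd
  linarith

theorem strictAntiOn_ratio : StrictAntiOn (fun ℓ => maxSurplus E θ₀ ℓ / ℓ ^ 2) (Ioi 0) := by
  refine strictAntiOn_of_left (H.continuousOn_maxSurplus.div (by fun_prop) fun x hx =>
    (pow_pos (show (0:ℝ) < x from hx) 2).ne') fun ℓ hℓ => ?_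
  have hμ := mean_mem (E := E)
  have hq := wt_pos (E := E)
  have hq1 := wt_lt_one (E := E)
  have hN := H.hN
  have hb := H.b_eq
  have hab := H.ab_eq
  have hα : 0 ≤ -E.b := by rw [hb]; exact mul_nonneg (by linarith) (by linarith [H.h0.1])
  have hD : 0 ≤ (E.a - 1) * |mean E - θ₀| := mul_nonneg (by linarith) (abs_nonneg _)
  have hlow := H.low_pos
  have hmin1 := min_le_left (guardLow E (lowInf E) ℓ) (guardHigh E (highSup E) ℓ)
  rcases le_total (guardLow E (lowInf E) ℓ) (guardHigh E (highSup E) ℓ) with h | h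
  · refine H.ratio_left (g := guardLow E (lowInf E)) (guardLow_eq _) (fun x => ?_) hℓ ?_ ?_
    · have := min_le_left (guardLow E (lowInf E) x) (guardHigh E (highSup E) x)
      unfold maxSurplus; linarith
    · unfold maxSurplus; rw [min_eq_left h]
    · refine elasticity_low hα hD hℓ hlow ?_
      have := mul_pos hq hμ.1
      linarith
  · refine H.ratio_left (g := guardHigh E (highSup E)) (guardHigh_eq _) (fun x => ?_) hℓ ?_ ?_
    · have := min_le_right (guardLow E (lowInf E) x) (guardHigh E (highSup E) x)
      unfold maxSurplus; linarith
    · unfold maxSurplus; rw [min_eq_right h]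
    · have hge := H.high_ge
      have habs : (E.a - 1) * (θ₀ - mean E) ≤ (E.a - 1) * |mean E - θ₀| := by
        refine mul_le_mul_of_nonneg_left ?_ (by linarith)
        rw [abs_sub_comm]; exact le_abs_self _
      have habs' : (E.a - 1) * |mean E - θ₀| ≤ -E.b := by
        rw [hb]
        exact mul_le_mul_of_nonneg_left (abs_le.2 ⟨by linarith [hμ.1], by linarith [hμ.2, H.h0.1]⟩)
          (by linarith)
      refine elasticity_high (N := E.a - 1) (q := wt E) (x := (E.a - 1) * (2 * θ₀ - 1)) (μ := mean E)
        (α := -E.b) (β := E.a + E.b - 1) (Cl := E.uS (E.prefR (mean E)) (mean E) - guardLow E (lowInf E) 0)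
        (kl := wt E * mean E - E.b) hN hq hq1 (by rw [hb]; ring) (by rw [hab]; ring)
        (mul_nonneg (by linarith) (by linarith [H.h0.1])) hμ.1 hℓ (by rw [hb]; linarith) hD habs'
        (by ring) rfl hlow (by convert hge using 2; ring) ?_
      rw [guardLow_eq, guardHigh_eq] at h
      linarith

end Crossing

end Surplus

section Radius

variable {E : Environment} {θ₀ δ lam : ℝ}

theorem temptation_eq (d x : ℝ) : E.temptation d x = E.c * (d - E.prefR x) ^ 2 / 2 := by
  simp only [Environment.temptation, Environment.uR, Environment.prefR]; ring

namespace Crossing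

variable (H : Crossing E θ₀)
include H

theorem prefR_sub (x : ℝ) : E.prefR x - x = (E.a - 1) * (x - θ₀) := by
  unfold Environment.prefR; linarith [H.hcross]

theorem abs_prefR_sub (x : ℝ) : |x - E.prefR x| = (E.a - 1) * |x - θ₀| := by
  rw [abs_sub_comm, H.prefR_sub, abs_mul, abs_of_pos (by linarith [H.hN])]

theorem enforceable_iff (hl : 0 ≤ lam)
    (hs : surplus E δ = ((E.c * ((E.a - 1) * lam) ^ 2 / 2 : ℝ) : EReal)) (d x : ℝ) :
    Enforceable E δ d x ↔ |d - E.prefR x| ≤ (E.a - 1) * lam := by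
  have hN := H.hN
  have hc := E.c_pos
  rw [Enforceable, hs, EReal.coe_le_coe_iff, temptation_eq, div_le_div_iff_of_pos_right two_pos,
    mul_le_mul_iff_right₀ hc, sq_le_sq, abs_of_nonneg (mul_nonneg (by linarith : 0 ≤ E.a - 1) hl)]

theorem uStar_eq (hl : 0 ≤ lam)
    (hs : surplus E δ = ((E.c * ((E.a - 1) * lam) ^ 2 / 2 : ℝ) : EReal)) (x : ℝ) :
    uStar E δ x = sbVal (E.a - 1) θ₀ lam x := by
  have hN := H.hN
  have hiff := H.enforceable_iff hl hs
  have hN0 : 0 < E.a - 1 := by linarith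
  have hval : sbVal (E.a - 1) θ₀ lam x =
      x ^ 2 / 2 - (max (|x - E.prefR x| - (E.a - 1) * lam) 0) ^ 2 / 2 := by
    rw [H.abs_prefR_sub, ← sbVal_div hN0, mul_div_cancel_left₀ _ hN0.ne']
  have hu : ∀ d, E.u d x = x ^ 2 / 2 - (x - d) ^ 2 / 2 := fun d => by
    unfold Environment.u; ring
  refine IsGreatest.csSup_eq ⟨?_, ?_⟩
  · rw [hval]
    set ρ := E.prefR x
    set r := (E.a - 1) * lam
    have hr : 0 ≤ r := mul_nonneg hN0.le hl
    refine ⟨max (ρ - r) (min (ρ + r) x), (hiff _ _).2 (abs_le.2 ⟨?_, ?_⟩), ?_⟩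
    · linarith [le_max_left (ρ - r) (min (ρ + r) x)]
    · have := max_le (show ρ - r ≤ ρ + r by linarith) (min_le_left (ρ + r) x)
      linarith
    · rw [hu]
      congr 2
      rcases le_total x (ρ - r) with h | h
      · rw [min_eq_right (by linarith), max_eq_left h, abs_of_nonpos (by linarith),
          max_eq_left (by linarith)]; ring
      rcases le_total x (ρ + r) with h' | h'
      · rw [min_eq_right h', max_eq_right h, max_eq_right]
        · ring
        · have : |x - ρ| ≤ r := abs_le.2 ⟨by linarith, by linarith⟩
          linarith
      · rw [min_eq_left h', max_eq_right (show ρ - r ≤ ρ + r by linarith),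
          abs_of_nonneg (show 0 ≤ x - ρ by linarith), max_eq_left (by linarith)]; ring
  · rintro y ⟨d, hd, rfl⟩
    rw [hiff] at hd
    rw [hval, hu]
    have h1 : max (|x - E.prefR x| - (E.a - 1) * lam) 0 ≤ |x - d| := by
      refine max_le ?_ (abs_nonneg _)
      have := abs_sub_le x d (E.prefR x)
      linarith
    have h2 := pow_le_pow_left₀ (le_max_right _ _) h1 2
    rw [sq_abs] at h2
    linarith

theorem enforceable_of_le (hs : ((E.c * ((E.a - 1) * θ₀) ^ 2 / 2 : ℝ) : EReal) ≤ surplus E δ) {x : ℝ}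
    (hx : x ∈ Icc (0:ℝ) 1) : Enforceable E δ x x := by
  have hN := H.hN
  refine le_trans ?_ hs
  have hc := E.c_pos
  rw [EReal.coe_le_coe_iff, temptation_eq, div_le_div_iff_of_pos_right two_pos,
    mul_le_mul_iff_right₀ hc, sq_le_sq, H.abs_prefR_sub,
    abs_of_nonneg (mul_nonneg (by linarith : 0 ≤ E.a - 1) (by linarith [H.h0.1]))]
  exact mul_le_mul_of_nonneg_left (abs_le.2 ⟨by linarith [hx.1], by linarith [hx.2, H.h0.1]⟩)
    (by linarith)

theorem uStar_eq_of_le (hs : ((E.c * ((E.a - 1) * θ₀) ^ 2 / 2 : ℝ) : EReal) ≤ surplus E δ) {x : ℝ}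
    (hx : x ∈ Icc (0:ℝ) 1) : uStar E δ x = sbVal (E.a - 1) θ₀ θ₀ x := by
  rw [sbVal_mid (by linarith [hx.1]) (by linarith [hx.2, H.h0.1])]
  have hu : ∀ d, E.u d x = x ^ 2 / 2 - (x - d) ^ 2 / 2 := fun d => by
    unfold Environment.u; ring
  refine IsGreatest.csSup_eq ⟨⟨x, H.enforceable_of_le hs hx, by rw [hu]; ring⟩, ?_⟩
  rintro y ⟨d, -, rfl⟩
  rw [hu]; linarith [sq_nonneg (x - d)]

theorem extremeStates_eq (hl : 0 ≤ lam)
    (hs : surplus E δ = ((E.c * ((E.a - 1) * lam) ^ 2 / 2 : ℝ) : EReal)) :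
    extremeStates E δ = {θ | θ ∈ Icc (0:ℝ) 1 ∧ lam < |θ - θ₀|} := by
  ext θ
  have hN := H.hN
  simp only [extremeStates, Environment.prefFB, mem_ofPred_eq, H.enforceable_iff hl hs, not_le,
    H.abs_prefR_sub, mul_lt_mul_iff_right₀ (show 0 < E.a - 1 by linarith)]

end Crossing

theorem poolingPayoff_eq {w : ℝ → ℝ} (hu : ∀ x ∈ Icc (0:ℝ) 1, uStar E δ x = w x) {P : Set ℝ}
    (hP : IsPoolingSet P) : poolingPayoff E δ P = poolVal E w P := by
  refine integral_congr_ae ?_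
  filter_upwards [ae_mem E] with θ hθ
  exact hu _ (hP.postMean_mem hθ)

theorem isOptimalPooling_iff {w : ℝ → ℝ} (hu : ∀ x ∈ Icc (0:ℝ) 1, uStar E δ x = w x) {P : Set ℝ} :
    IsOptimalPooling E δ P ↔
      IsPoolingSet P ∧ ∀ Q, IsPoolingSet Q → poolVal E w Q ≤ poolVal E w P := by
  refine and_congr_right fun hP => forall₂_congr fun Q hQ => ?_
  rw [poolingPayoff_eq hu hP, poolingPayoff_eq hu hQ]

theorem IsUniqueOpt.isTheOptimalPooling {w : ℝ → ℝ}
    (hu : ∀ x ∈ Icc (0:ℝ) 1, uStar E δ x = w x) {P : Set ℝ} (h : IsUniqueOpt E w P) :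
    IsTheOptimalPooling E δ P :=
  ⟨(isOptimalPooling_iff hu).2 ⟨h.1, h.2.1⟩, fun Q hQ =>
    h.2.2 Q hQ.1 (((isOptimalPooling_iff hu).1 hQ).2 P h.1)⟩

/-- The radius of enforceable decisions (in units of the state) as a function of the discount
factor, and its inverse `ph`. -/
structure RadiusMap (E : Environment) (θ₀ : ℝ) (ph lam : ℝ → ℝ) : Prop where
  ph_mem : ∀ l ∈ Ioc 0 θ₀, ph l ∈ Ioo (0:ℝ) 1
  ph_mono : StrictMonoOn ph (Ioc 0 θ₀)
  lam_mem : ∀ δ ∈ Ioo 0 (ph θ₀), lam δ ∈ Ioo 0 θ₀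
  ph_lam : ∀ δ ∈ Ioo 0 (ph θ₀), ph (lam δ) = δ
  lam_zero : lam 0 = 0
  slope : ∃ k > 0, ∀ δ₁ δ₂, 0 < δ₁ → δ₁ < δ₂ → δ₂ < ph θ₀ → k * (δ₂ - δ₁) ≤ lam δ₂ - lam δ₁
  surplus_eq : ∀ δ ∈ Ico 0 (ph θ₀),
    surplus E δ = ((E.c * ((E.a - 1) * lam δ) ^ 2 / 2 : ℝ) : EReal)
  le_surplus : ∀ δ ∈ Ioo (ph θ₀) 1, ((E.c * ((E.a - 1) * θ₀) ^ 2 / 2 : ℝ) : EReal) ≤ surplus E δ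

variable (E) in
/-- The discount factor at which the enforcement radius for decisions is `ℓ`. -/
noncomputable def discountAt (θ₀ ℓ : ℝ) : ℝ :=
  E.c * ℓ ^ 2 / 2 / (E.c * ℓ ^ 2 / 2 + maxSurplus E θ₀ ℓ)

namespace Crossing

variable (H : Crossing E θ₀)
include H

theorem discountAt_mem {ℓ : ℝ} (h : 0 < ℓ) : discountAt E θ₀ ℓ ∈ Ioo (0:ℝ) 1 := by
  have hc := E.c_pos
  have hG := H.maxSurplus_pos h.le
  unfold discountAt
  exact ⟨by positivity, by rw [div_lt_one (by positivity)]; linarith⟩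

theorem discountAt_le_iff {ℓ : ℝ} (h : 0 < ℓ) (hδ : δ < 1) :
    discountAt E θ₀ ℓ ≤ δ ↔ E.c * ℓ ^ 2 / 2 ≤ δ / (1 - δ) * maxSurplus E θ₀ ℓ := by
  have hc := E.c_pos
  have hG := H.maxSurplus_pos h.le
  have h1 : 0 < 1 - δ := by linarith
  unfold discountAt
  rw [div_le_iff₀ (by positivity), div_mul_eq_mul_div, le_div_iff₀ h1]
  constructor <;> intro h <;> linarith

theorem discountAt_lt_iff {ℓ : ℝ} (h : 0 < ℓ) (hδ : δ < 1) :
    discountAt E θ₀ ℓ < δ ↔ E.c * ℓ ^ 2 / 2 < δ / (1 - δ) * maxSurplus E θ₀ ℓ := by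
  have hc := E.c_pos
  have hG := H.maxSurplus_pos h.le
  have h1 : 0 < 1 - δ := by linarith
  unfold discountAt
  rw [div_lt_iff₀ (by positivity), div_mul_eq_mul_div, lt_div_iff₀ h1]
  constructor <;> intro h <;> linarith

theorem discountAt_strictMono : StrictMonoOn (discountAt E θ₀) (Ioi 0) := by
  intro x hx y hy hxy
  have hx0 : (0:ℝ) < x := hx
  have hy0 : (0:ℝ) < y := hy
  have h := H.strictAntiOn_ratio hx hy hxy
  simp only at h
  have hc := E.c_pos
  have hG := H.maxSurplus_pos hx0.le
  have hG' := H.maxSurplus_pos hy0.le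
  rw [div_lt_div_iff₀ (by positivity) (by positivity)] at h
  unfold discountAt
  rw [div_lt_div_iff₀ (by positivity) (by positivity)]
  have := mul_lt_mul_of_pos_left h hc
  linarith

theorem continuousOn_discountAt : ContinuousOn (discountAt E θ₀) (Ioi 0) := by
  unfold discountAt
  refine ContinuousOn.div (by fun_prop) ((by fun_prop : ContinuousOn _ _).add H.continuousOn_maxSurplus)
    fun x hx => ?_
  have hx0 : (0:ℝ) < x := hx
  have hc := E.c_pos
  have hG := H.maxSurplus_pos hx0.le
  positivity

theorem exists_discountAt_eq {ℓ : ℝ} (hℓ : 0 < ℓ) (h0 : 0 < δ) (h : δ < discountAt E θ₀ ℓ) :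
    ∃ x ∈ Ioo 0 ℓ, discountAt E θ₀ x = δ := by
  have hc := E.c_pos
  have hG := H.maxSurplus_zero_pos
  have hδ1 : δ < 1 := h.trans (H.discountAt_mem hℓ).2
  set G := maxSurplus E θ₀ 0
  obtain ⟨ε, hε0, hεℓ, hε⟩ : ∃ ε, 0 < ε ∧ ε < ℓ ∧ discountAt E θ₀ ε < δ := by
    have hcont : Continuous fun x : ℝ => E.c * x ^ 2 / 2 := by fun_prop
    have hp : 0 < δ / (1 - δ) * G := mul_pos (div_pos h0 (by linarith)) hG
    have hev := (hcont.tendsto 0).eventually (eventually_lt_nhds (b := δ / (1 - δ) * G) (by simpa using hp))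
    obtain ⟨η, hη, hb⟩ := Metric.eventually_nhds_iff.1 hev
    have hpos : 0 < min (η / 2) (ℓ / 2) := lt_min (by linarith) (by linarith)
    refine ⟨min (η / 2) (ℓ / 2), hpos,
      (min_le_right _ _).trans_lt (by linarith), ?_⟩
    rw [H.discountAt_lt_iff hpos hδ1]
    refine (hb (y := min (η / 2) (ℓ / 2)) ?_).trans_le ?_
    · rw [Real.dist_eq, sub_zero, abs_of_pos hpos]
      exact (min_le_left _ _).trans_lt (by linarith)
    · exact mul_le_mul_of_nonneg_left (H.maxSurplus_mono le_rfl hpos.le)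
        (div_nonneg h0.le (by linarith))
  have hi := intermediate_value_Ioo hεℓ.le (H.continuousOn_discountAt.mono
    fun t ht => lt_of_lt_of_le hε0 ht.1)
  obtain ⟨x, hx, he⟩ := hi ⟨hε, h⟩
  exact ⟨x, ⟨hε0.trans hx.1, hx.2⟩, he⟩

theorem exists_radiusMap
    (hlow : ∀ δ ∈ Ioo (0:ℝ) 1, ∀ ℓ > 0, E.c * ℓ ^ 2 / 2 < δ / (1 - δ) * maxSurplus E θ₀ ℓ →
      ((E.c * ℓ ^ 2 / 2 : ℝ) : EReal) ≤ surplus E δ)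
    (hup : ∀ δ ∈ Ioo (0:ℝ) 1, ∀ L ≥ 0, (∀ ℓ ≥ 0, E.c * ℓ ^ 2 / 2 ≤ δ / (1 - δ) * maxSurplus E θ₀ ℓ →
      ℓ ≤ L) → surplus E δ ≤ ((E.c * L ^ 2 / 2 : ℝ) : EReal)) :
    ∃ ph lam, RadiusMap E θ₀ ph lam := by
  have hN := H.hN
  have hN0 : 0 < E.a - 1 := by linarith
  have hθ : 0 < θ₀ := by linarith [H.h0.1]
  have hc := E.c_pos
  have hex : ∀ δ, ∃ l, (δ ∈ Ioo 0 (discountAt E θ₀ ((E.a - 1) * θ₀)) →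
      l ∈ Ioo 0 θ₀ ∧ discountAt E θ₀ ((E.a - 1) * l) = δ) ∧ (δ = 0 → l = 0) := by
    intro δ
    by_cases h : δ ∈ Ioo 0 (discountAt E θ₀ ((E.a - 1) * θ₀))
    · obtain ⟨x, hx, he⟩ := H.exists_discountAt_eq (mul_pos hN0 hθ) h.1 h.2
      refine ⟨x / (E.a - 1), fun _ => ⟨⟨div_pos hx.1 hN0, ?_⟩, ?_⟩, fun h0 => absurd h.1 (by rw [h0]; exact lt_irrefl _)⟩
      · rw [div_lt_iff₀ hN0, mul_comm]; exact hx.2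
      · rw [mul_div_cancel₀ _ hN0.ne', he]
    · exact ⟨0, fun h' => absurd h' h, fun _ => rfl⟩
  choose lam hlam hlam0 using hex
  refine ⟨fun l => discountAt E θ₀ ((E.a - 1) * l), lam, fun l hl => H.discountAt_mem (mul_pos hN0 hl.1),
    fun x hx y hy h => H.discountAt_strictMono (mul_pos hN0 hx.1) (mul_pos hN0 hy.1)
      (mul_lt_mul_of_pos_left h hN0), fun δ hδ => (hlam δ hδ).1, fun δ hδ => (hlam δ hδ).2,
    hlam0 0 rfl, ?_, fun δ hδ => ?_, fun δ hδ => ?_⟩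
  · have hG := H.maxSurplus_zero_pos
    refine ⟨maxSurplus E θ₀ 0 / (E.c * (E.a - 1) ^ 2 * θ₀), by positivity, fun δ₁ δ₂ h1 h12 h2 => ?_⟩
    obtain ⟨m1, e1⟩ := hlam δ₁ ⟨h1, h12.trans h2⟩
    obtain ⟨m2, e2⟩ := hlam δ₂ ⟨h1.trans h12, h2⟩
    have p1 := mul_pos hN0 m1.1
    have p2 := mul_pos hN0 m2.1
    have hd2 : δ₂ < 1 := by rw [← e2]; exact (H.discountAt_mem p2).2
    have hd1 : δ₁ < 1 := h12.trans hd2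
    have hll : (E.a - 1) * lam δ₁ < (E.a - 1) * lam δ₂ := by
      rw [← H.discountAt_strictMono.lt_iff_lt p1 p2, e1, e2]; exact h12
    have f1 := e1
    have f2 := e2
    have g1 := H.maxSurplus_pos p1.le
    have g2 := H.maxSurplus_pos p2.le
    have g0 := H.maxSurplus_mono le_rfl p1.le
    have g12 := H.maxSurplus_mono p1.le hll.le
    unfold discountAt at f1 f2
    rw [div_eq_iff (by positivity)] at f1 f2
    set x := lam δ₁
    set y := lam δ₂
    set G0 := maxSurplus E θ₀ 0
    set G1 := maxSurplus E θ₀ ((E.a - 1) * x)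
    set G2 := maxSurplus E θ₀ ((E.a - 1) * y)
    set L1 := E.c * ((E.a - 1) * x) ^ 2 / 2 with hL1
    set L2 := E.c * ((E.a - 1) * y) ^ 2 / 2 with hL2
    have k1 : 0 < 1 - δ₁ := by linarith
    have k2 : 0 < 1 - δ₂ := by linarith
    have hL12 : L1 ≤ L2 := by rw [hL1, hL2]; gcongr
    have hL1p : 0 < L1 := by rw [hL1]; positivity
    have key : (δ₂ - δ₁) * G0 ≤ L2 - L1 := by
      have a1 : (1 - δ₁) * (L2 - L1) ≥ (δ₂ - δ₁) * (L2 + G2) := by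
        have := mul_le_mul_of_nonneg_left g12 h1.le
        linarith
      have a2 : (δ₂ - δ₁) * G0 ≤ (δ₂ - δ₁) * (L2 + G2) :=
        mul_le_mul_of_nonneg_left (by linarith) (by linarith)
      have a3 : (1 - δ₁) * (L2 - L1) ≤ L2 - L1 := by
        have := mul_nonneg h1.le (sub_nonneg.2 hL12)
        linarith
      linarith
    have hxy : x < y := lt_of_mul_lt_mul_left hll hN0.le
    rw [div_mul_eq_mul_div, div_le_iff₀ (by positivity)]
    have e3 : L2 - L1 = E.c * (E.a - 1) ^ 2 / 2 * ((y + x) * (y - x)) := by rw [hL1, hL2]; ring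
    have e4 : (y + x) * (y - x) ≤ 2 * θ₀ * (y - x) :=
      mul_le_mul_of_nonneg_right (by linarith [m1.2, m2.2]) (by linarith)
    have e5 := mul_le_mul_of_nonneg_left e4 (show 0 ≤ E.c * (E.a - 1) ^ 2 / 2 by positivity)
    linarith
  · rcases hδ.1.eq_or_lt with h | h
    · rw [← h, hlam0 0 rfl]; simp [surplus]
    · obtain ⟨m, e⟩ := hlam δ ⟨h, hδ.2⟩
      have p := mul_pos hN0 m.1
      have hd1 : δ < 1 := by rw [← e]; exact (H.discountAt_mem p).2
      refine le_antisymm (hup δ ⟨h, hd1⟩ _ p.le fun ℓ hℓ hle => ?_) ?_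
      · rcases hℓ.eq_or_lt with h0 | h0
        · rw [← h0]; exact p.le
        · rw [← H.discountAt_le_iff h0 hd1, ← e, H.discountAt_strictMono.le_iff_le h0 p] at hle
          exact hle
      · have hcont : Continuous fun x : ℝ => ((E.c * x ^ 2 / 2 : ℝ) : EReal) :=
          continuous_coe_real_ereal.comp (by fun_prop)
        refine le_of_tendsto ((hcont.tendsto ((E.a - 1) * lam δ)).mono_left
          (nhdsWithin_le_nhds (s := Iio ((E.a - 1) * lam δ)))) ?_
        filter_upwards [Ioo_mem_nhdsLT p] with x hx
        refine hlow δ ⟨h, hd1⟩ x hx.1 ?_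
        rw [← H.discountAt_lt_iff hx.1 hd1, ← e]
        exact H.discountAt_strictMono hx.1 p hx.2
  · have p := mul_pos hN0 hθ
    have hm := H.discountAt_mem p
    exact hlow δ ⟨hm.1.trans hδ.1, hδ.2⟩ _ p ((H.discountAt_lt_iff p hδ.2).1 hδ.1)

end Crossing

end Radius

section Statics

variable {E : Environment} {θ₀ δ : ℝ}

theorem slope_le_of_pairs {g : ℝ → ℝ} {x y k a : ℝ} (hy : a ∈ Ioo x y)
    (h : ∀ s t, x < s → s < t → t < y → g t - g s ≤ -k * (t - s)) :
    ∀ᶠ t in 𝓝[≠] a, slope g a t ≤ -k := by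
  filter_upwards [mem_nhdsWithin_of_mem_nhds (Ioo_mem_nhds hy.1 hy.2), self_mem_nhdsWithin] with t ht hne
  rw [slope_def_field]
  rcases lt_or_gt_of_ne (show t ≠ a from hne) with hlt | hlt
  · rw [div_le_iff_of_neg (by linarith)]
    linarith [h t a ht.1 hlt hy.2]
  · rw [div_le_iff₀ (by linarith)]
    exact h a t hy.1 hlt ht.2

theorem le_slope_of_pairs {g : ℝ → ℝ} {x y k a : ℝ} (hy : a ∈ Ioo x y)
    (h : ∀ s t, x < s → s < t → t < y → k * (t - s) ≤ g t - g s) :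
    ∀ᶠ t in 𝓝[≠] a, k ≤ slope g a t := by
  filter_upwards [mem_nhdsWithin_of_mem_nhds (Ioo_mem_nhds hy.1 hy.2), self_mem_nhdsWithin] with t ht hne
  rw [slope_def_field]
  rcases lt_or_gt_of_ne (show t ≠ a from hne) with hlt | hlt
  · rw [le_div_iff_of_neg (by linarith)]
    linarith [h t a ht.1 hlt hy.2]
  · rw [le_div_iff₀ (by linarith)]
    exact h a t hy.1 hlt ht.2

namespace RadiusMap

variable {ph lam : ℝ → ℝ} (R : RadiusMap E θ₀ ph lam)
include R

theorem strictMono {δ₁ δ₂ : ℝ} (h1 : 0 < δ₁) (h12 : δ₁ < δ₂) (h2 : δ₂ < ph θ₀) : lam δ₁ < lam δ₂ := by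
  obtain ⟨k, hk, hs⟩ := R.slope
  have := hs δ₁ δ₂ h1 h12 h2
  have := mul_pos hk (sub_pos.2 h12)
  linarith

theorem lam_lt {l : ℝ} (hl : l ∈ Ioc 0 θ₀) (hδ : δ ∈ Ioo 0 (ph θ₀)) (h : δ < ph l) : lam δ < l := by
  have m := R.lam_mem δ hδ
  rwa [← R.ph_mono.lt_iff_lt ⟨m.1, m.2.le⟩ hl, R.ph_lam δ hδ]

theorem lt_lam {l : ℝ} (hl : l ∈ Ioc 0 θ₀) (hδ : δ ∈ Ioo 0 (ph θ₀)) (h : ph l < δ) : l < lam δ := by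
  have m := R.lam_mem δ hδ
  rwa [← R.ph_mono.lt_iff_lt hl ⟨m.1, m.2.le⟩, R.ph_lam δ hδ]

theorem lam_ph {l : ℝ} (hl : l ∈ Ioo 0 θ₀) : lam (ph l) = l := by
  have hθ : 0 < θ₀ := hl.1.trans hl.2
  have hl' : l ∈ Ioc 0 θ₀ := ⟨hl.1, hl.2.le⟩
  have h1 : ph l ∈ Ioo 0 (ph θ₀) := ⟨(R.ph_mem l hl').1, R.ph_mono hl' ⟨hθ, le_rfl⟩ hl.2⟩
  have m := R.lam_mem _ h1
  exact R.ph_mono.injOn ⟨m.1, m.2.le⟩ hl' (R.ph_lam _ h1)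

end RadiusMap

set_option maxHeartbeats 1000000 in
theorem statics_of_radiusMap (H : Crossing E θ₀) {ph lam : ℝ → ℝ} (R : RadiusMap E θ₀ ph lam) :
    ∃ δA ∈ Set.Ioo (0 : ℝ) 1, ∃ δB ∈ Set.Ioo (0 : ℝ) 1, ∃ θL θH : ℝ → ℝ,
      (δB ≤ δA ∧ (δA = δB ↔ θ₀ = 1 / 2)) ∧
      (∀ δ ∈ Set.Ioo δA 1, extremeStates E δ = ∅) ∧
      (∀ δ ∈ Set.Ioo δB δA, θL δ ∈ Set.Ioo 0 1 ∧ extremeStates E δ = Set.Ico 0 (θL δ)) ∧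
      (∀ δ ∈ Set.Ioo 0 δB, θL δ ∈ Set.Ioo 0 1 ∧ θH δ ∈ Set.Ioo 0 1 ∧ θL δ < θH δ ∧
        extremeStates E δ = Set.Ico 0 (θL δ) ∪ Set.Ioc (θH δ) 1) ∧
      ∃ δB' ∈ Set.Ioo (0 : ℝ) 1, ∃ δC' ∈ Set.Ioo (0 : ℝ) 1, ∃ δD' ∈ Set.Ioo (0 : ℝ) 1,
      ∃ θL' θH' : ℝ → ℝ,
        ((δB ≤ δD' ∧ δD' = δC' ∧ δC' = δB' ∧ δB' < δA) ∨
          (δD' < δC' ∧ δC' < δB' ∧ δB' = δB)) ∧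
        (∀ δ ∈ Set.Ioo δA 1, IsTheOptimalPooling E δ ∅) ∧
        (∀ δ ∈ Set.Ioo δB' δA, θL' δ ∈ Set.Ioo (θL δ) 1 ∧
          IsTheOptimalPooling E δ (Set.Ico 0 (θL' δ))) ∧
        (δC' < δB' → δB' < δA → IsTheOptimalPooling E δB' (Set.Ico 0 (θL' δB'))) ∧
        (∀ δ ∈ Set.Ioo δC' δB',
          θL' δ ∈ Set.Ioo (θL δ) (θH δ) ∧ θH' δ ∈ Set.Ioo (θL δ) (θH δ) ∧ θL' δ < θH' δ ∧
          IsTheOptimalPooling E δ (Set.Ico 0 (θL' δ) ∪ Set.Ioc (θH' δ) 1)) ∧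
        (∀ δ ∈ Set.Ioo δD' δC',
          (∃ θM ∈ Set.Ioo (0 : ℝ) 1,
            IsOptimalPooling E δ (Set.Ico 0 θM ∪ Set.Ioc θM 1)) ∧
          ∀ P, IsOptimalPooling E δ P → ∃ θM ∈ Set.Ioo (0 : ℝ) 1,
            P ∩ Set.Ioo 0 1 = (Set.Ico 0 θM ∪ Set.Ioc θM 1) ∩ Set.Ioo 0 1) ∧
        (∀ δ ∈ Set.Ico 0 δD', IsTheOptimalPooling E δ (Set.Icc 0 1)) ∧
        StrictAntiOn θL' (Set.Ioo δC' δA) ∧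
        StrictMonoOn θH' (Set.Ioo δC' δB') ∧
        ((∃ K : ℝ, ∀ θ ∈ Set.Icc (0 : ℝ) 1, E.f θ ≤ K) →
          (∀ δ ∈ Set.Ioo δC' δA,
            ∃ r > 0, ∀ᶠ δ' in nhdsWithin δ {δ}ᶜ, slope θL' δ δ' ≤ -r) ∧
          (∀ δ ∈ Set.Ioo δC' δB',
            ∃ r > 0, ∀ᶠ δ' in nhdsWithin δ {δ}ᶜ, r ≤ slope θH' δ δ')) ∧
        ((∀ θ ∈ Set.Icc (0 : ℝ) 1, E.f θ = 1) → θ₀ = 1 / 2 →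
          ∀ δ ∈ Set.Ioo δD' δC', ∀ θM ∈ Set.Ioo (0 : ℝ) 1,
            IsOptimalPooling E δ (Set.Ico 0 θM ∪ Set.Ioc θM 1) → θM = 1 / 2) := by
  obtain ⟨lB, lC, lD, tL, tH, G⟩ := exists_regimes (E := E) H.hN H.h0
  have h0 := H.h0
  have hθ : 0 < θ₀ := by linarith [h0.1]
  have hpos := G.pos
  have hDC : lD ≤ lC := by rcases G.order with h | h <;> linarith [h.1, h.2.1]
  have hCB : lC ≤ lB := by
    rcases G.order with h | h
    · exact h.2.2.1.le
    · exact h.2.1.le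
  have mA : θ₀ ∈ Ioc 0 θ₀ := ⟨hθ, le_rfl⟩
  have m1 : 1 - θ₀ ∈ Ioc 0 θ₀ := ⟨by linarith [h0.2], by linarith [h0.1]⟩
  have mD : lD ∈ Ioc 0 θ₀ := ⟨hpos, by linarith [G.lt]⟩
  have mC : lC ∈ Ioc 0 θ₀ := ⟨by linarith, by linarith [G.lt]⟩
  have mB : lB ∈ Ioc 0 θ₀ := ⟨by linarith, G.lt⟩
  have phle : ∀ {x y}, x ∈ Ioc 0 θ₀ → y ∈ Ioc 0 θ₀ → (ph x ≤ ph y ↔ x ≤ y) :=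
    fun hx hy => R.ph_mono.le_iff_le hx hy
  have phlt : ∀ {x y}, x ∈ Ioc 0 θ₀ → y ∈ Ioc 0 θ₀ → (ph x < ph y ↔ x < y) :=
    fun hx hy => R.ph_mono.lt_iff_lt hx hy
  have phinj : ∀ {x y}, x ∈ Ioc 0 θ₀ → y ∈ Ioc 0 θ₀ → (ph x = ph y ↔ x = y) :=
    fun hx hy => R.ph_mono.injOn.eq_iff hx hy
  have pD := (R.ph_mem lD mD).1
  have pC := (R.ph_mem lC mC).1
  have pB := (R.ph_mem lB mB).1
  have p1 := (R.ph_mem _ m1).1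
  have lD' := (phle mD mA).2 mD.2
  have lC' := (phle mC mA).2 mC.2
  have lB' := (phle mB mA).2 mB.2
  have l1' := (phle m1 mA).2 m1.2
  have hlam0 : ∀ δ ∈ Ico 0 (ph θ₀), 0 ≤ lam δ := by
    intro δ hδ
    rcases hδ.1.eq_or_lt with h | h
    · rw [← h, R.lam_zero]
    · exact (R.lam_mem δ ⟨h, hδ.2⟩).1.le
  have hu : ∀ δ ∈ Ico 0 (ph θ₀), ∀ x ∈ Icc (0:ℝ) 1,
      uStar E δ x = sbVal (E.a - 1) θ₀ (lam δ) x := fun δ hδ x _ =>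
    H.uStar_eq (hlam0 δ hδ) (R.surplus_eq δ hδ) x
  have hX : ∀ δ ∈ Ico 0 (ph θ₀), extremeStates E δ = {θ | θ ∈ Icc (0:ℝ) 1 ∧ lam δ < |θ - θ₀|} :=
    fun δ hδ => H.extremeStates_eq (hlam0 δ hδ) (R.surplus_eq δ hδ)
  have hadj : ∀ δ ∈ Ioo (ph lD) (ph lC), δ ∈ Ico 0 (ph θ₀) ∧ lam δ ∈ Ioo lD lC := by
    intro δ hδ
    have hδ' : δ ∈ Ioo 0 (ph θ₀) := ⟨pD.trans hδ.1, hδ.2.trans_le lC'⟩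
    exact ⟨⟨hδ'.1.le, hδ'.2⟩, R.lt_lam mD hδ' hδ.1, R.lam_lt mC hδ' hδ.2⟩
  have hCA : ∀ δ, ph lC < δ → δ < ph θ₀ → δ ∈ Ioo 0 (ph θ₀) ∧ lC < lam δ ∧ lam δ < θ₀ := by
    intro δ h1 h2
    have hδ' : δ ∈ Ioo 0 (ph θ₀) := ⟨pC.trans h1, h2⟩
    exact ⟨hδ', R.lt_lam mC hδ' h1, (R.lam_mem δ hδ').2⟩
  obtain ⟨k, hk, hslope⟩ := R.slope
  refine ⟨ph θ₀, R.ph_mem _ mA, ph (1 - θ₀), R.ph_mem _ m1, fun δ => θ₀ - lam δ, fun δ => θ₀ + lam δ,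
    ⟨l1', ?_⟩, ?_, ?_, ?_, ph lB, R.ph_mem _ mB, ph lC, R.ph_mem _ mC, ph lD, R.ph_mem _ mD,
    fun δ => tL (lam δ), fun δ => tH (lam δ), ?_, ?_, ?_, ?_, ?_, ?_, ?_, ?_, ?_, ?_, ?_⟩
  · rw [phinj mA m1]
    constructor <;> intro h <;> linarith
  · intro δ hδ
    ext θ
    simp only [extremeStates, mem_ofPred_eq, mem_empty_iff_false, iff_false, not_and, not_not]
    exact fun hθ => H.enforceable_of_le (R.le_surplus δ hδ) hθ
  · intro δ hδ
    have hδ' : δ ∈ Ioo 0 (ph θ₀) := ⟨p1.trans hδ.1, hδ.2⟩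
    have m := R.lam_mem δ hδ'
    have h1 := R.lt_lam m1 hδ' hδ.1
    refine ⟨⟨by linarith [m.2], by linarith [m.1, h0.2]⟩, ?_⟩
    rw [hX δ ⟨hδ'.1.le, hδ'.2⟩]
    ext θ
    simp only [mem_ofPred_eq, mem_Icc, mem_Ico, lt_abs]
    constructor
    · rintro ⟨⟨a1, a2⟩, h | h⟩
      · linarith
      · exact ⟨a1, by linarith⟩
    · rintro ⟨a1, a2⟩
      exact ⟨⟨a1, by linarith [m.1, h0.2]⟩, Or.inr (by linarith)⟩
  · intro δ hδ
    have hδ' : δ ∈ Ioo 0 (ph θ₀) := ⟨hδ.1, hδ.2.trans_le l1'⟩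
    have m := R.lam_mem δ hδ'
    have h1 := R.lam_lt m1 hδ' hδ.2
    refine ⟨⟨by linarith [m.2], by linarith [m.1, h0.2]⟩, ⟨by linarith [m.1], by linarith⟩,
      by linarith [m.1], ?_⟩
    rw [hX δ ⟨hδ'.1.le, hδ'.2⟩]
    ext θ
    simp only [mem_ofPred_eq, mem_Icc, mem_Ico, mem_union, mem_Ioc, lt_abs]
    constructor
    · rintro ⟨⟨a1, a2⟩, h | h⟩
      · exact Or.inr ⟨by linarith, a2⟩
      · exact Or.inl ⟨a1, by linarith⟩
    · rintro (⟨a1, a2⟩ | ⟨a1, a2⟩)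
      · exact ⟨⟨a1, by linarith [m.1, h0.2]⟩, Or.inr (by linarith)⟩
      · exact ⟨⟨by linarith [m.1], a2⟩, Or.inl (by linarith)⟩
  · rcases G.order with ⟨a1, a2, a3, a4⟩ | ⟨a1, a2, a3⟩
    · exact Or.inl ⟨(phle m1 mD).2 a1, by rw [a2], by rw [a3], (phlt mB mA).2 a4⟩
    · exact Or.inr ⟨(phlt mD mC).2 a1, (phlt mC mB).2 a2, by rw [a3]⟩
  · intro δ hδ
    exact (G.empty θ₀ le_rfl).isTheOptimalPooling fun x hx => H.uStar_eq_of_le (R.le_surplus δ hδ) hx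
  · intro δ hδ
    have hδ' : δ ∈ Ioo 0 (ph θ₀) := ⟨pB.trans hδ.1, hδ.2⟩
    have h1 := R.lt_lam mB hδ' hδ.1
    obtain ⟨e1, e2⟩ := G.low (lam δ) ⟨h1, (R.lam_mem δ hδ').2⟩
    exact ⟨e1, e2.isTheOptimalPooling (hu δ ⟨hδ'.1.le, hδ'.2⟩)⟩
  · intro h1 h2
    have hlB : lB < θ₀ := (phlt mB mA).1 h2
    have := G.low_end ((phlt mC mB).1 h1) hlB
    have e := R.lam_ph (l := lB) ⟨mB.1, hlB⟩
    have hh := hu (ph lB) ⟨pB.le, h2⟩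
    rw [e] at hh
    simp only [e]
    exact this.isTheOptimalPooling hh
  · intro δ hδ
    obtain ⟨hδ', h1, h2⟩ := hCA δ hδ.1 (hδ.2.trans_le lB')
    obtain ⟨e1, e2, e3, e4⟩ := G.both (lam δ) ⟨h1, R.lam_lt mB hδ' hδ.2⟩
    exact ⟨e1, e2, e3, e4.isTheOptimalPooling (hu δ ⟨hδ'.1.le, hδ'.2⟩)⟩
  · intro δ hδ
    obtain ⟨hδ', hl⟩ := hadj δ hδ
    obtain ⟨⟨s, hs, e1⟩, e2⟩ := G.adjacent (lam δ) hl
    refine ⟨⟨s, hs, (isOptimalPooling_iff (hu δ hδ')).2 ⟨isPoolingSet_two hs.1.le hs.2.le, e1⟩⟩,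
      fun P hP => ?_⟩
    have := (isOptimalPooling_iff (hu δ hδ')).1 hP
    exact e2 P this.1 this.2
  · intro δ hδ
    have hδ' : δ ∈ Ico 0 (ph θ₀) := ⟨hδ.1, hδ.2.trans_le lD'⟩
    refine (G.full (lam δ) ⟨hlam0 δ hδ', ?_⟩).isTheOptimalPooling (hu δ hδ')
    rcases hδ.1.eq_or_lt with h | h
    · rw [← h, R.lam_zero]; exact hpos
    · exact R.lam_lt mD ⟨h, hδ'.2⟩ hδ.2
  · intro x hx y hy hxy
    obtain ⟨x1, x2, x3⟩ := hCA x hx.1 hx.2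
    obtain ⟨y1, y2, y3⟩ := hCA y hy.1 hy.2
    exact G.low_anti _ _ x2 (R.strictMono x1.1 hxy y1.2) y3
  · intro x hx y hy hxy
    obtain ⟨x1, x2, x3⟩ := hCA x hx.1 (hx.2.trans_le lB')
    obtain ⟨y1, y2, y3⟩ := hCA y hy.1 (hy.2.trans_le lB')
    exact G.high_mono _ _ x2 (R.strictMono x1.1 hxy y1.2) (R.lam_lt mB y1 hy.2)
  · intro hK
    constructor
    · intro δ hδ
      obtain ⟨e, he1, he2⟩ := exists_between hδ.2
      obtain ⟨z1, z2, z3⟩ := hCA e (hδ.1.trans he1) he2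
      obtain ⟨k', hk', hs⟩ := G.low_slope hK (lam e) ⟨z2, z3⟩
      refine ⟨k' * k, mul_pos hk' hk, slope_le_of_pairs (x := ph lC) (y := e) ⟨hδ.1, he1⟩ ?_⟩
      intro s t hs1 hst ht
      obtain ⟨x1, x2, x3⟩ := hCA s hs1 (hst.trans (ht.trans he2))
      obtain ⟨y1, y2, y3⟩ := hCA t (hs1.trans hst) (ht.trans he2)
      have e1 := hs (lam s) (lam t) x2 (R.strictMono x1.1 hst y1.2) (R.strictMono y1.1 ht he2).le
      have e2 := mul_le_mul_of_nonneg_left (hslope s t x1.1 hst y1.2) hk'.le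
      linarith
    · intro δ hδ
      obtain ⟨e, he1, he2⟩ := exists_between hδ.2
      obtain ⟨z1, z2, z3⟩ := hCA e (hδ.1.trans he1) (he2.trans_le lB')
      obtain ⟨k', hk', hs⟩ := G.high_slope hK (lam e) ⟨z2, R.lam_lt mB z1 he2⟩
      refine ⟨k' * k, mul_pos hk' hk, le_slope_of_pairs (x := ph lC) (y := e) ⟨hδ.1, he1⟩ ?_⟩
      intro s t hs1 hst ht
      obtain ⟨x1, x2, x3⟩ := hCA s hs1 (hst.trans (ht.trans z1.2))
      obtain ⟨y1, y2, y3⟩ := hCA t (hs1.trans hst) (ht.trans z1.2)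
      have e1 := hs (lam s) (lam t) x2 (R.strictMono x1.1 hst y1.2) (R.strictMono y1.1 ht z1.2).le
      have e2 := mul_le_mul_of_nonneg_left (hslope s t x1.1 hst y1.2) hk'.le
      linarith
  · intro hf hhalf δ hδ s hs hopt
    obtain ⟨hδ', hl⟩ := hadj δ hδ
    exact G.uniform hf hhalf (lam δ) hl s hs ((isOptimalPooling_iff (hu δ hδ')).1 hopt).2

end Statics

/-! ### Values of strategy profiles -/

section Values

variable {E : Environment} {δ : ℝ} {σ : Profile} {i : Player} {n : ℕ}

theorem measurable_extend : Measurable fun z : Hist n × Record => extend z.1 z.2 := by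
  refine measurable_pi_iff.2 fun j => ?_
  refine Fin.lastCases ?_ (fun j => ?_) j
  · simp only [extend, Fin.snoc_last]; exact measurable_snd
  · simp only [extend, Fin.snoc_castSucc]; exact (measurable_pi_apply j).comp measurable_fst

theorem measurable_fromInterimR (σ : Profile) (n : ℕ) :
    Measurable fun z : Hist n × (Pay × Pay) × Signal => σ.fromInterimR z.1 z.2.1 z.2.2 := by
  have hr := σ.R.interim_meas n
  let d := fun z : Hist n × (Pay × Pay) × Signal =>
    σ.R.decision n (z.1, z.2.1, z.2.2, σ.R.interim n z)
  have hd : Measurable d := (σ.R.decision_meas n).comp (by fun_prop)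
  let p := fun z => σ.S.exPost n (z.1, z.2.1, z.2.2, σ.R.interim n z, d z)
  have hp : Measurable p := (σ.S.exPost_meas n).comp (by fun_prop)
  let q := fun z => σ.R.exPost n (z.1, z.2.1, z.2.2, σ.R.interim n z, d z, p z)
  have hq : Measurable q := (σ.R.exPost_meas n).comp (by fun_prop)
  exact (by fun_prop : Measurable fun z => (z.2.1, z.2.2, σ.R.interim n z, d z, p z, q z))

theorem measurable_fromSignal (σ : Profile) (n : ℕ) :
    Measurable fun z : Hist n × (Pay × Pay) × ℝ => σ.fromSignal z.1 z.2.1 z.2.2 := by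
  have hs := σ.S.signal_meas n
  exact (measurable_fromInterimR σ n).comp
    (g := fun z : Hist n × (Pay × Pay) × Signal => σ.fromInterimR z.1 z.2.1 z.2.2)
    (f := fun z : Hist n × (Pay × Pay) × ℝ => (z.1, z.2.1, σ.S.signal n (z.1, z.2.1, z.2.2)))
    (by fun_prop)

theorem measurable_period (σ : Profile) (n : ℕ) :
    Measurable fun z : Hist n × ℝ => σ.period z.1 z.2 := by
  have h1 := σ.S.exAnte_meas n
  have h2 : Measurable fun z : Hist n × ℝ => σ.R.exAnte n (z.1, σ.S.exAnte n z.1) :=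
    (σ.R.exAnte_meas n).comp (by fun_prop)
  exact (measurable_fromSignal σ n).comp
    (g := fun z : Hist n × (Pay × Pay) × ℝ => σ.fromSignal z.1 z.2.1 z.2.2)
    (f := fun z : Hist n × ℝ =>
      (z.1, (σ.S.exAnte n z.1, σ.R.exAnte n (z.1, σ.S.exAnte n z.1)), z.2)) (by fun_prop)

theorem measurable_stagePayoff (i : Player) :
    Measurable fun z : ℝ × Record => stagePayoff E i z.1 z.2 := by
  unfold stagePayoff
  cases i <;>
  · simp only [Environment.util, netTotal, net, Environment.uS, Environment.u, Environment.uR]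
    fun_prop

/-- All payments in the record, and the decision, are bounded by `K`. -/
def BddRecord (K : ℝ≥0) (r : Record) : Prop :=
  r.1.1 ≤ (K, K) ∧ r.1.2 ≤ (K, K) ∧ r.2.1.2 ≤ (K, K) ∧ r.2.2.1 ≤ (K, K) ∧ |r.2.2.2.1| ≤ K ∧
    r.2.2.2.2.1 ≤ (K, K) ∧ r.2.2.2.2.2 ≤ (K, K)

theorem abs_net_le {K : ℝ≥0} {p p' : Pay} (h : p ≤ (K, K)) (h' : p' ≤ (K, K)) :
    |net p p'| ≤ 3 * K := by
  have a1 : (p.1 : ℝ) ≤ K := NNReal.coe_le_coe.2 h.1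
  have a2 : (p.2 : ℝ) ≤ K := NNReal.coe_le_coe.2 h.2
  have a3 : (p'.1 : ℝ) ≤ K := NNReal.coe_le_coe.2 h'.1
  have b1 := p.1.2
  have b2 := p.2.2
  have b3 := p'.1.2
  unfold net
  rw [abs_le]
  constructor <;> linarith [show (0:ℝ) ≤ p.1 from b1, show (0:ℝ) ≤ p.2 from b2,
    show (0:ℝ) ≤ p'.1 from b3]

theorem exists_stage_bound (E : Environment) (i : Player) (K : ℝ≥0) : ∃ B : ℝ, ∀ θ ∈ Icc (0:ℝ) 1,
    ∀ r, BddRecord K r → |stagePayoff E i θ r| ≤ B := by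
  have hc : Continuous fun z : ℝ × ℝ => E.util i z.1 z.2 := by
    cases i <;>
    · simp only [Environment.util, Environment.uS, Environment.u, Environment.uR]
      fun_prop
  obtain ⟨C, hC⟩ := (isCompact_Icc.prod isCompact_Icc).exists_bound_of_continuousOn
    (s := Icc (-(K:ℝ)) K ×ˢ Icc (0:ℝ) 1) hc.continuousOn
  refine ⟨C + 9 * K, fun θ hθ r hr => ?_⟩
  obtain ⟨h1, h2, h3, h4, h5, h6, h7⟩ := hr
  have hu := hC (r.2.2.2.1, θ) ⟨abs_le.1 h5, hθ⟩
  rw [Real.norm_eq_abs] at hu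
  have ht : |netTotal i r| ≤ 9 * K := by
    obtain ⟨x, s, r', d, y⟩ := r
    cases i
    · exact (abs_add_three _ _ _).trans
        (by linarith [abs_net_le h1 h2, abs_net_le h3 h4, abs_net_le h6 h7])
    · exact (abs_add_three _ _ _).trans
        (by linarith [abs_net_le h2 h1, abs_net_le h4 h3, abs_net_le h7 h6])
  exact (abs_sub _ _).trans (add_le_add hu ht)

theorem exists_bddRecord (σ : Profile) : ∃ K : ℝ≥0, (∀ n (h : Hist n) θ, BddRecord K (σ.period h θ)) ∧
    ∀ n (h : Hist n) x s, σ.R.interim n (h, x, s) ≤ (K, K) ∧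
      |(σ.fromInterimR h x s).2.2.2.1| ≤ K ∧
      (σ.fromInterimR h x s).2.2.2.2.1 ≤ (K, K) ∧ (σ.fromInterimR h x s).2.2.2.2.2 ≤ (K, K) ∧
      ∀ θ, (σ.S.signal n (h, x, θ)).2 ≤ (K, K) := by
  obtain ⟨K1, a1, a2, a3⟩ := σ.S.bounded
  obtain ⟨K2, b1, b2, b3, b4⟩ := σ.R.bounded
  have hk1 : ((K1, K1) : Pay) ≤ (max K1 K2, max K1 K2) := ⟨le_max_left _ _, le_max_left _ _⟩
  have hk2 : ((K2, K2) : Pay) ≤ (max K1 K2, max K1 K2) := ⟨le_max_right _ _, le_max_right _ _⟩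
  have hk3 : (K2 : ℝ) ≤ (max K1 K2 : ℝ≥0) := NNReal.coe_le_coe.2 (le_max_right _ _)
  exact ⟨max K1 K2, fun n h θ => ⟨(a1 _ _).trans hk1, (b1 _ _).trans hk2, (a2 _ _).trans hk1,
    (b2 _ _).trans hk2, (b3 _ _).trans hk3, (a3 _ _).trans hk1, (b4 _ _).trans hk2⟩,
    fun n h x s => ⟨(b2 _ _).trans hk2, (b3 _ _).trans hk3, (a3 _ _).trans hk1, (b4 _ _).trans hk2,
      fun θ => (a2 _ _).trans hk1⟩⟩

theorem exists_bddRecord_fromSignal (σ : Profile) (h : Hist n) (x : Pay × Pay) :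
    ∃ K : ℝ≥0, ∀ θ, BddRecord K (σ.fromSignal h x θ) := by
  obtain ⟨K, -, hK⟩ := exists_bddRecord σ
  set M := max K (max (max x.1.1 x.1.2) (max x.2.1 x.2.2))
  have hk : ((K, K) : Pay) ≤ (M, M) := ⟨le_max_left _ _, le_max_left _ _⟩
  have hM : max (max x.1.1 x.1.2) (max x.2.1 x.2.2) ≤ M := le_max_right _ _
  have hx1 : x.1 ≤ (M, M) := ⟨((le_max_left _ _).trans (le_max_left _ _)).trans hM,
    ((le_max_right _ _).trans (le_max_left _ _)).trans hM⟩
  have hx2 : x.2 ≤ (M, M) := ⟨((le_max_left _ _).trans (le_max_right _ _)).trans hM,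
    ((le_max_right _ _).trans (le_max_right _ _)).trans hM⟩
  refine ⟨M, fun θ => ?_⟩
  obtain ⟨h1, h2, h3, h4, h5⟩ := hK n h x (σ.S.signal n (h, x, θ))
  exact ⟨hx1, hx2, (h5 θ).trans hk, h1.trans hk, h2.trans (NNReal.coe_le_coe.2 hk.1),
    h3.trans hk, h4.trans hk⟩

theorem abs_integral_prior_le {g : ℝ → ℝ} {B : ℝ} (h : ∀ θ ∈ Icc (0:ℝ) 1, |g θ| ≤ B) :
    |∫ θ, g θ ∂E.prior| ≤ B := by
  have := norm_integral_le_of_norm_le_const (μ := E.prior) (f := g) (C := B) (by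
    filter_upwards [ae_mem E] with θ hθ
    exact h θ hθ)
  simpa using this

theorem exists_expStage_bound (E : Environment) (σ : Profile) (i : Player) :
    ∃ B, (∀ n (h : Hist n), ∀ θ ∈ Icc (0:ℝ) 1, |stagePayoff E i θ (σ.period h θ)| ≤ B) ∧
      ∀ k n (h : Hist n), |expStage E σ i k n h| ≤ B := by
  obtain ⟨K, hK, -⟩ := exists_bddRecord σ
  obtain ⟨B, hB⟩ := exists_stage_bound E i K
  refine ⟨B, fun n h θ hθ => hB θ hθ _ (hK n h θ), fun k => ?_⟩
  induction k with
  | zero => exact fun n h => abs_integral_prior_le fun θ hθ => hB θ hθ _ (hK n h θ)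
  | succ k ih => exact fun n h => abs_integral_prior_le fun θ _ => ih _ _

theorem measurable_expStage (σ : Profile) (i : Player) (k : ℕ) :
    ∀ n, Measurable (expStage E σ i k n) := by
  induction k with
  | zero =>
    intro n
    have h : Measurable fun z : Hist n × ℝ => stagePayoff E i z.2 (σ.period z.1 z.2) :=
      (measurable_stagePayoff i).comp (measurable_snd.prodMk (measurable_period σ n))
    exact (h.stronglyMeasurable.integral_prod_right' (ν := E.prior)).measurable
  | succ k ih =>
    intro n
    have h : Measurable fun z : Hist n × ℝ =>
        expStage E σ i k (n + 1) (extend z.1 (σ.period z.1 z.2)) :=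
      (ih (n + 1)).comp (measurable_extend.comp (measurable_fst.prodMk (measurable_period σ n)))
    exact (h.stronglyMeasurable.integral_prod_right' (ν := E.prior)).measurable

theorem summable_expStage (hδ : δ ∈ Ico (0:ℝ) 1) (h : Hist n) :
    Summable fun k => δ ^ k * expStage E σ i k n h := by
  obtain ⟨B, -, hB⟩ := exists_expStage_bound E σ i
  refine Summable.of_norm_bounded ((summable_geometric_of_lt_one hδ.1 hδ.2).mul_right B) fun k => ?_
  rw [norm_mul, Real.norm_eq_abs, Real.norm_eq_abs, abs_of_nonneg (pow_nonneg hδ.1 k)]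
  exact mul_le_mul_of_nonneg_left (hB k n h) (pow_nonneg hδ.1 k)

theorem exists_value_bound (E : Environment) (hδ : δ ∈ Ico (0:ℝ) 1) (σ : Profile) (i : Player) :
    ∃ B, ∀ n (h : Hist n), |value E δ σ i h| ≤ B := by
  obtain ⟨B, -, hB⟩ := exists_expStage_bound E σ i
  refine ⟨B, fun n h => ?_⟩
  have hs := (hasSum_geometric_of_lt_one hδ.1 hδ.2).mul_right B
  have h1 := tsum_of_norm_bounded hs (f := fun k => δ ^ k * expStage E σ i k n h) fun k => by
    rw [norm_mul, Real.norm_eq_abs, Real.norm_eq_abs, abs_of_nonneg (pow_nonneg hδ.1 k)]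
    exact mul_le_mul_of_nonneg_left (hB k n h) (pow_nonneg hδ.1 k)
  have h2 : 0 < 1 - δ := by linarith [hδ.2]
  rw [value, abs_mul, abs_of_pos h2]
  have := mul_le_mul_of_nonneg_left h1 h2.le
  rwa [← mul_assoc, mul_inv_cancel₀ h2.ne', one_mul] at this

theorem measurable_value (hδ : δ ∈ Ico (0:ℝ) 1) (σ : Profile) (i : Player) (n : ℕ) :
    Measurable fun h : Hist n => value E δ σ i h := by
  refine Measurable.const_mul ?_ _
  refine measurable_of_tendsto_metrizable (f := fun N (h : Hist n) =>
    ∑ k ∈ Finset.range N, δ ^ k * expStage E σ i k n h) (fun N => ?_) ?_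
  · exact Finset.measurable_sum _ fun k _ => (measurable_expStage σ i k n).const_mul _
  · exact tendsto_pi_nhds.2 fun h => (summable_expStage hδ h).hasSum.tendsto_sum_nat

theorem measurable_value_extend (hδ : δ ∈ Ico (0:ℝ) 1) (σ : Profile) (i : Player) (h : Hist n)
    {r : ℝ → Record} (hr : Measurable r) : Measurable fun θ => value E δ σ i (extend h (r θ)) :=
  (measurable_value hδ σ i (n + 1)).comp (measurable_extend.comp (measurable_const.prodMk hr))

theorem measurable_period_right (σ : Profile) (h : Hist n) : Measurable fun θ => σ.period h θ :=
  (measurable_period σ n).comp (measurable_const.prodMk measurable_id)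

theorem measurable_fromSignal_right (σ : Profile) (h : Hist n) (x : Pay × Pay) :
    Measurable fun θ => σ.fromSignal h x θ :=
  (measurable_fromSignal σ n).comp (measurable_const.prodMk (measurable_const.prodMk measurable_id))

theorem integrable_value_extend (hδ : δ ∈ Ico (0:ℝ) 1) (σ : Profile) (i : Player) (h : Hist n)
    {r : ℝ → Record} (hr : Measurable r) :
    Integrable (fun θ => value E δ σ i (extend h (r θ))) E.prior := by
  obtain ⟨B, hB⟩ := exists_value_bound E hδ σ i
  exact integrable_of_bdd E (measurable_value_extend hδ σ i h hr).aestronglyMeasurable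
    fun θ _ => hB _ _

theorem integrable_stage {K : ℝ≥0} {r : ℝ → Record} (hr : Measurable r) (hK : ∀ θ, BddRecord K (r θ)) :
    Integrable (fun θ => stagePayoff E i θ (r θ)) E.prior := by
  obtain ⟨B, hB⟩ := exists_stage_bound E i K
  exact integrable_of_bdd E ((measurable_stagePayoff i).comp
    (measurable_id.prodMk hr)).aestronglyMeasurable fun θ hθ => hB θ hθ _ (hK θ)

theorem integral_nodeValue (hδ : δ ∈ Ico (0:ℝ) 1) (σ : Profile) (i : Player) (h : Hist n)
    {K : ℝ≥0} {r : ℝ → Record} (hr : Measurable r) (hK : ∀ θ, BddRecord K (r θ)) :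
    ∫ θ, nodeValue E δ σ i h θ (r θ) ∂E.prior = (1 - δ) * ∫ θ, stagePayoff E i θ (r θ) ∂E.prior +
      δ * ∫ θ, value E δ σ i (extend h (r θ)) ∂E.prior := by
  unfold nodeValue
  rw [integral_add ((integrable_stage hr hK).const_mul _)
    ((integrable_value_extend hδ σ i h hr).const_mul _), integral_const_mul, integral_const_mul]

theorem integrable_nodeValue (hδ : δ ∈ Ico (0:ℝ) 1) (σ : Profile) (i : Player) (h : Hist n)
    {K : ℝ≥0} {r : ℝ → Record} (hr : Measurable r) (hK : ∀ θ, BddRecord K (r θ)) :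
    Integrable (fun θ => nodeValue E δ σ i h θ (r θ)) E.prior :=
  ((integrable_stage hr hK).const_mul _).add ((integrable_value_extend hδ σ i h hr).const_mul _)

/-- The value at a history is the expected node value of the current period. -/
theorem value_eq (hδ : δ ∈ Ico (0:ℝ) 1) (σ : Profile) (i : Player) (h : Hist n) :
    value E δ σ i h = ∫ θ, nodeValue E δ σ i h θ (σ.period h θ) ∂E.prior := by
  obtain ⟨K, hK, -⟩ := exists_bddRecord σ
  obtain ⟨B, -, hB⟩ := exists_expStage_bound E σ i
  rw [integral_nodeValue hδ σ i h (measurable_period_right σ h) (hK n h)]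
  have hsum : ∫ θ, value E δ σ i (extend h (σ.period h θ)) ∂E.prior =
      (1 - δ) * ∑' k, δ ^ k * expStage E σ i (k + 1) n h := by
    unfold value
    rw [integral_const_mul]
    congr 1
    have hm : ∀ k, Measurable fun θ => δ ^ k * expStage E σ i k (n + 1) (extend h (σ.period h θ)) :=
      fun k => ((measurable_expStage σ i k (n + 1)).comp (measurable_extend.comp
        (measurable_const.prodMk (measurable_period_right σ h)))).const_mul _
    have hb : ∀ k θ, ‖δ ^ k * expStage E σ i k (n + 1) (extend h (σ.period h θ))‖ ≤ δ ^ k * B := by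
      intro k θ
      rw [norm_mul, Real.norm_eq_abs, Real.norm_eq_abs, abs_of_nonneg (pow_nonneg hδ.1 k)]
      exact mul_le_mul_of_nonneg_left (hB k _ _) (pow_nonneg hδ.1 k)
    rw [← integral_tsum_of_summable_integral_norm]
    · congr 1; funext k
      rw [integral_const_mul]; rfl
    · exact fun k => integrable_of_bdd E (hm k).aestronglyMeasurable fun θ _ => hb k θ
    · refine Summable.of_nonneg_of_le (fun k => integral_nonneg fun θ => norm_nonneg _) (fun k => ?_)
        ((summable_geometric_of_lt_one hδ.1 hδ.2).mul_right B)
      have := abs_integral_prior_le (E := E) (g := fun θ =>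
        ‖δ ^ k * expStage E σ i k (n + 1) (extend h (σ.period h θ))‖) (B := δ ^ k * B)
        fun θ _ => by rw [abs_of_nonneg (norm_nonneg _)]; exact hb k θ
      exact (le_abs_self _).trans this
  rw [hsum, value, (summable_expStage hδ h).tsum_eq_zero_add, pow_zero, one_mul]
  simp only [pow_succ']
  simp_rw [mul_assoc]
  rw [tsum_mul_left]
  simp only [expStage]
  ring

/-- Profiles that agree from period `m` on. -/
def AgreeFrom (m : ℕ) (σ τ : Profile) : Prop :=
  ∀ n, m ≤ n → σ.S.exAnte n = τ.S.exAnte n ∧ σ.S.signal n = τ.S.signal n ∧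
    σ.S.exPost n = τ.S.exPost n ∧ σ.R.exAnte n = τ.R.exAnte n ∧ σ.R.interim n = τ.R.interim n ∧
    σ.R.decision n = τ.R.decision n ∧ σ.R.exPost n = τ.R.exPost n

theorem AgreeFrom.value_eq {m : ℕ} {σ τ : Profile} (hst : AgreeFrom m σ τ) (hn : m ≤ n) (h : Hist n) :
    value E δ σ i h = value E δ τ i h := by
  have hp : ∀ n, m ≤ n → ∀ h : Hist n, σ.period h = τ.period h := by
    intro n hn h
    obtain ⟨h1, h2, h3, h4, h5, h6, h7⟩ := hst n hn
    funext θ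
    simp only [Profile.period, Profile.fromExAnteR, Profile.fromSignal, Profile.fromInterimR,
      Profile.fromDecision, Profile.fromExPostS, Profile.fromExPostR, h1, h2, h3, h4, h5, h6, h7]
  have he : ∀ k n, m ≤ n → ∀ h : Hist n, expStage E σ i k n h = expStage E τ i k n h := by
    intro k
    induction k with
    | zero => intro n hn h; simp only [expStage, hp n hn h]
    | succ k ih =>
      intro n hn h
      simp only [expStage, hp n hn h]
      congr 1; funext θ
      exact ih _ (by omega) _
  unfold value
  congr 2; funext k
  rw [he k n hn h]

/-- One-step comparison of a subsolution with a supersolution of the value recursion. -/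
theorem le_of_step (hδ : δ ∈ Ico (0:ℝ) 1) {W V : ∀ n, Hist n → ℝ} {B C : ℝ}
    (hW : ∀ n, Measurable (W n)) (hV : ∀ n, Measurable (V n)) (hC : ∀ n h, |W n h| ≤ C)
    (hB : ∀ n h, |V n h| ≤ B)
    (hW' : ∀ n (h : Hist n), W n h ≤ ∫ θ, ((1 - δ) * stagePayoff E i θ (σ.period h θ) +
      δ * W (n + 1) (extend h (σ.period h θ))) ∂E.prior)
    (hV' : ∀ n (h : Hist n), ∫ θ, ((1 - δ) * stagePayoff E i θ (σ.period h θ) +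
      δ * V (n + 1) (extend h (σ.period h θ))) ∂E.prior ≤ V n h) (h : Hist n) :
    W n h ≤ V n h := by
  obtain ⟨K, hK, -⟩ := exists_bddRecord σ
  have hint : ∀ {U : ∀ n, Hist n → ℝ} {D : ℝ}, (∀ n, Measurable (U n)) → (∀ n h, |U n h| ≤ D) →
      ∀ n (h : Hist n), Integrable (fun θ => (1 - δ) * stagePayoff E i θ (σ.period h θ) +
        δ * U (n + 1) (extend h (σ.period h θ))) E.prior := by
    intro U D hU hD n h
    have hm := measurable_period_right σ h
    have i2 : Integrable (fun θ => U (n + 1) (extend h (σ.period h θ))) E.prior :=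
      integrable_of_bdd E ((hU (n + 1)).comp (measurable_extend.comp
        (measurable_const.prodMk hm))).aestronglyMeasurable fun θ _ => hD _ _
    exact ((integrable_stage hm (hK n h)).const_mul (1 - δ)).add (i2.const_mul δ)
  have key : ∀ N n (h : Hist n), W n h - V n h ≤ δ ^ N * (C + B) := by
    intro N
    induction N with
    | zero =>
      intro n h
      have := (abs_le.1 (hC n h)).2
      have := (abs_le.1 (hB n h)).1
      simp; linarith
    | succ N ih =>
      intro n h
      have i1 := hint hW hC n h
      have i3 := hint hV hB n h
      have h0 := hW' n h
      have h1 := hV' n h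
      have h2 := integral_mono (i1.sub i3) (integrable_const (δ ^ (N + 1) * (C + B))) fun θ => by
        have := mul_le_mul_of_nonneg_left (ih _ (extend h (σ.period h θ))) hδ.1
        simp only [pow_succ', Pi.sub_apply]
        linarith
      rw [integral_sub' i1 i3] at h2
      simp only [integral_const, probReal_univ, smul_eq_mul, one_mul] at h2
      linarith
  have ht : Tendsto (fun N => δ ^ N * (C + B)) atTop (𝓝 0) := by
    simpa using (tendsto_pow_atTop_nhds_zero_of_lt_one hδ.1 hδ.2).mul_const (C + B)
  have := ge_of_tendsto' ht fun N => key N n h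
  linarith

/-- One-step verification: an upper bound on the value. -/
theorem value_le_of_step (hδ : δ ∈ Ico (0:ℝ) 1) {V : ∀ n, Hist n → ℝ} {B : ℝ}
    (hV : ∀ n, Measurable (V n)) (hB : ∀ n h, |V n h| ≤ B)
    (hstep : ∀ n (h : Hist n), ∫ θ, ((1 - δ) * stagePayoff E i θ (σ.period h θ) +
      δ * V (n + 1) (extend h (σ.period h θ))) ∂E.prior ≤ V n h) (h : Hist n) :
    value E δ σ i h ≤ V n h := by
  obtain ⟨C, hC⟩ := exists_value_bound E hδ σ i
  exact le_of_step hδ (W := fun n h => value E δ σ i h) (measurable_value hδ σ i) hV hC hB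
    (fun n h => (value_eq hδ σ i h).le) hstep h

/-- One-step verification: a lower bound on the value. -/
theorem le_value_of_step (hδ : δ ∈ Ico (0:ℝ) 1) {V : ∀ n, Hist n → ℝ} {B : ℝ}
    (hV : ∀ n, Measurable (V n)) (hB : ∀ n h, |V n h| ≤ B)
    (hstep : ∀ n (h : Hist n), V n h ≤ ∫ θ, ((1 - δ) * stagePayoff E i θ (σ.period h θ) +
      δ * V (n + 1) (extend h (σ.period h θ))) ∂E.prior) (h : Hist n) :
    V n h ≤ value E δ σ i h := by
  obtain ⟨C, hC⟩ := exists_value_bound E hδ σ i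
  exact le_of_step hδ (V := fun n h => value E δ σ i h) hV (measurable_value hδ σ i) hB hC
    hstep (fun n h => (value_eq hδ σ i h).ge) h

end Values

/-! ### The pooling set of a monotone decision rule -/

section LevelPool

variable {E : Environment} {d : ℝ → ℝ}

/-- The states in `[0,1]` with decision `r`. -/
def levelSet (d : ℝ → ℝ) (r : ℝ) : Set ℝ := {t | t ∈ Icc (0:ℝ) 1 ∧ d t = r}

/-- The states around which the decision is constant. -/
def levelPool (d : ℝ → ℝ) : Set ℝ := ⋃ r, interior (levelSet d r)

theorem ordConnected_levelSet (hd : MonotoneOn d (Icc 0 1)) (r : ℝ) :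
    (levelSet d r).OrdConnected := by
  refine ⟨fun x hx y hy z hz => ?_⟩
  have hz' : z ∈ Icc (0:ℝ) 1 := ⟨hx.1.1.trans hz.1, hz.2.trans hy.1.2⟩
  refine ⟨hz', le_antisymm ?_ ?_⟩
  · rw [← hy.2]; exact hd hz' hy.1 hz.2
  · rw [← hx.2]; exact hd hx.1 hz' hz.1

theorem isPoolingSet_levelPool (d : ℝ → ℝ) : IsPoolingSet (levelPool d) := by
  refine ⟨levelPool d, isOpen_iUnion fun _ => isOpen_interior, ?_⟩
  rw [eq_comm, inter_eq_left]
  exact iUnion_subset fun r => interior_subset.trans fun t ht => ht.1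

theorem component_levelPool (hd : MonotoneOn d (Icc 0 1)) {r θ : ℝ}
    (h : θ ∈ interior (levelSet d r)) :
    connectedComponentIn (levelPool d) θ = interior (levelSet d r) := by
  apply Subset.antisymm
  · have hsub : connectedComponentIn (levelPool d) θ ⊆
        interior (levelSet d r) ∪ ⋃ r' ∈ ({r}ᶜ : Set ℝ), interior (levelSet d r') := by
      intro t ht
      obtain ⟨r', hr'⟩ := mem_iUnion.1 (connectedComponentIn_subset _ _ ht)
      by_cases hrr : r' = r
      · exact Or.inl (hrr ▸ hr')
      · exact Or.inr (mem_biUnion hrr hr')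
    refine IsPreconnected.subset_left_of_subset_union isOpen_interior
      (isOpen_biUnion fun _ _ => isOpen_interior) ?_ hsub
      ⟨θ, mem_connectedComponentIn (mem_iUnion.2 ⟨r, h⟩), h⟩ isPreconnected_connectedComponentIn
    rw [disjoint_left]
    intro t h1 h2
    obtain ⟨r', hr', h3⟩ := mem_iUnion₂.1 h2
    exact hr' ((interior_subset h3).2.symm.trans (interior_subset h1).2)
  · exact ((ordConnected_levelSet hd r).convex.interior.isPreconnected).subset_connectedComponentIn h
      (subset_iUnion (fun r => interior (levelSet d r)) r)

/-- States outside the pool that share their decision with another state. -/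
def levelEnds (d : ℝ → ℝ) : Set ℝ :=
  {θ | θ ∈ Icc (0:ℝ) 1 ∧ θ ∉ levelPool d ∧ ∃ t ∈ Icc (0:ℝ) 1, t ≠ θ ∧ d t = d θ}

theorem volume_levelEnds (hd : MonotoneOn d (Icc 0 1)) : volume (levelEnds d) = 0 := by
  have hR : {r | (interior (levelSet d r)).Nonempty}.Countable := by
    refine PairwiseDisjoint.countable_of_isOpen (s := fun r => interior (levelSet d r)) ?_
      (fun _ _ => isOpen_interior) fun r hr => hr
    exact fun r _ r' _ hne => disjoint_left.2 fun t ht ht' =>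
      hne ((interior_subset ht).2.symm.trans (interior_subset ht').2)
  refine measure_mono_null ?_ ((measure_biUnion_null_iff hR).2 fun r _ =>
    (ordConnected_levelSet hd r).convex.addHaar_frontier volume)
  rintro θ ⟨hθ, hP, t, ht, hne, he⟩
  have hsub : uIcc θ t ⊆ levelSet d (d θ) := (ordConnected_levelSet hd _).uIcc_subset ⟨hθ, rfl⟩ ⟨ht, he⟩
  refine mem_biUnion (x := d θ) ?_ ⟨subset_closure ⟨hθ, rfl⟩, fun h => hP (mem_iUnion.2 ⟨_, h⟩)⟩
  refine Nonempty.mono (interior_mono hsub) ?_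
  rw [uIcc, interior_Icc]
  exact nonempty_Ioo.2 (min_lt_max.2 hne.symm)

theorem levelSet_ae_eq (hd : MonotoneOn d (Icc 0 1)) {r : ℝ} (h : (interior (levelSet d r)).Nonempty) :
    (interior (levelSet d r) : Set ℝ) =ᵐ[E.prior] levelSet d r := by
  refine ae_eq_set.2 ⟨by rw [sdiff_eq_empty.2 interior_subset, measure_empty], ?_⟩
  refine measure_mono_null ?_ (prior_abs E (volume_levelEnds hd))
  rintro t ⟨ht, hti⟩
  refine ⟨ht.1, fun hP => ?_, ?_⟩
  · obtain ⟨r', hr'⟩ := mem_iUnion.1 hP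
    have := (interior_subset hr').2.symm.trans ht.2
    exact hti (this ▸ hr')
  · obtain ⟨t', ht'⟩ := h
    have h1 := interior_subset ht'
    exact ⟨t', h1.1, fun he => hti (he ▸ ht'), h1.2.trans ht.2.symm⟩

/-- If the decision is close to the receiver's preferred one at an estimate `q` of the state which
is correct on average on every level set, then it is close to it at the posterior mean. -/
theorem close_postMean (hd : MonotoneOn d (Icc 0 1)) {q : ℝ → ℝ} {ℓ : ℝ} (hq : Integrable q E.prior)
    (hclose : ∀ θ ∈ Icc (0:ℝ) 1, |d θ - E.prefR (q θ)| ≤ ℓ)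
    (havg : ∀ r, ∫ t in levelSet d r, q t ∂E.prior = ∫ t in levelSet d r, t ∂E.prior)
    (hsep : ∀ θ ∈ Icc (0:ℝ) 1, (∀ t ∈ Icc (0:ℝ) 1, d t = d θ → t = θ) → q θ = θ)
    {θ : ℝ} (hθ : θ ∈ Icc (0:ℝ) 1) (hend : θ ∉ levelEnds d) :
    |d θ - E.prefR (E.postMean (levelPool d) θ)| ≤ ℓ := by
  by_cases hP : θ ∈ levelPool d
  · obtain ⟨r, hr⟩ := mem_iUnion.1 hP
    have hm := (ordConnected_levelSet hd r).measurableSet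
    have hdr := (interior_subset hr).2
    have hpos : 0 < E.prior (levelSet d r) := by
      refine ((isPoolingSet_levelPool d).component_pos (E := E) hP).trans_le ?_
      rw [component_levelPool hd hr]
      exact measure_mono interior_subset
    rw [postMean_of_mem hP, component_levelPool hd hr, bar_congr (levelSet_ae_eq hd ⟨θ, hr⟩), hdr]
    have hr0 := real_pos hpos
    have hb := real_mul_bar hpos
    have h1 : ∀ s : ℝ, ∫ t in levelSet d r, s * (r - E.prefR (q t)) ∂E.prior =
        E.prior.real (levelSet d r) * (s * (r - E.prefR (bar E (levelSet d r)))) := by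
      intro s
      simp only [Environment.prefR]
      have e : ∀ t, s * (r - (E.a * q t + E.b)) = s * (r - E.b) + (-(s * E.a)) * q t := fun t => by ring
      rw [funext e, integral_add (integrable_const _) (hq.integrableOn.const_mul _),
        integral_const_mul (-(s * E.a)), havg, ← hb]
      simp only [integral_const, measureReal_restrict_apply_univ, smul_eq_mul]
      ring
    have h2 : ∀ s : ℝ, |s| = 1 → s * (r - E.prefR (bar E (levelSet d r))) ≤ ℓ := by
      intro s hs
      have h3 : ∫ t in levelSet d r, s * (r - E.prefR (q t)) ∂E.prior ≤
          ∫ t in levelSet d r, ℓ ∂E.prior := by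
        refine setIntegral_mono_on ?_ (integrable_const _).integrableOn hm fun t ht => ?_
        · refine Integrable.integrableOn (Integrable.const_mul ?_ _)
          exact (integrable_const _).sub ((hq.const_mul _).add (integrable_const _))
        · have := hclose t ht.1
          rw [ht.2] at this
          calc s * (r - E.prefR (q t)) ≤ |s * (r - E.prefR (q t))| := le_abs_self _
            _ ≤ ℓ := by rw [abs_mul, hs, one_mul]; exact this
      rw [h1] at h3
      simp only [integral_const, measureReal_restrict_apply_univ, smul_eq_mul] at h3
      exact le_of_mul_le_mul_left h3 hr0
    rw [abs_le]
    constructor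
    · linarith [h2 (-1) (by norm_num)]
    · linarith [h2 1 (by norm_num)]
  · rw [postMean_of_notMem hP]
    have := hclose θ hθ
    rwa [hsep θ hθ fun t ht he => by_contra fun hne => hend ⟨hθ, hP, t, ht, hne, he⟩] at this

theorem integral_eq_zero_of_components {P : Set ℝ} (hP : IsPoolingSet P) {g : ℝ → ℝ}
    (hg : Integrable g E.prior) (h1 : ∀ᵐ θ ∂E.prior, θ ∉ P → g θ = 0)
    (h2 : ∀ θ ∈ P, ∫ t in connectedComponentIn P θ, g t ∂E.prior = 0) : ∫ t, g t ∂E.prior = 0 := by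
  refine le_antisymm ?_ (integral_nonneg_of_components hP hg ?_ fun θ hθ => (h2 θ hθ).ge)
  · have := integral_nonneg_of_components hP (g := fun t => -g t) hg.neg
      (by filter_upwards [h1] with θ h h' using by rw [h h', neg_zero])
      fun θ hθ => by rw [integral_neg, h2 θ hθ, neg_zero]
    rw [integral_neg] at this
    linarith
  · filter_upwards [h1] with θ h h' using (h h').ge

/-- If the decision is constant on pools, its joint payoff depends on posterior means only. -/
theorem integral_u_eq_postMean {P : Set ℝ} (hP : IsPoolingSet P) {C : ℝ} (hm : Measurable d)
    (hC : ∀ θ ∈ Icc (0:ℝ) 1, |d θ| ≤ C)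
    (hconst : ∀ θ ∈ P, ∀ t ∈ connectedComponentIn P θ, d t = d θ) :
    ∫ θ, E.u (d θ) θ ∂E.prior = ∫ θ, E.u (d θ) (E.postMean P θ) ∂E.prior := by
  have hbd : ∀ {g : ℝ → ℝ}, Measurable g → (∀ θ ∈ Icc (0:ℝ) 1, g θ ∈ Icc (0:ℝ) 1) →
      Integrable (fun θ => d θ * g θ) E.prior := by
    intro g hg h
    refine integrable_of_bdd E (hm.mul hg).aestronglyMeasurable (C := C) fun θ hθ => ?_
    rw [abs_mul]
    have := mul_le_mul (hC θ hθ) (abs_le.2 ⟨by linarith [(h θ hθ).1], (h θ hθ).2⟩) (abs_nonneg _)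
      ((abs_nonneg _).trans (hC θ hθ))
    simpa using this
  have i1 : Integrable (fun θ => d θ * θ) E.prior := hbd measurable_id fun θ h => h
  have i2 := hbd (hP.postMean_measurable (E := E)) fun θ h => hP.postMean_mem h
  have i3 : Integrable (fun θ => d θ ^ 2 / 2) E.prior := by
    refine integrable_of_bdd E ((hm.pow_const 2).div_const 2).aestronglyMeasurable (C := C ^ 2 / 2)
      fun θ hθ => ?_
    rw [abs_of_nonneg (by positivity), ← sq_abs]
    gcongr
    exact hC θ hθ
  have key : ∫ θ, (d θ * θ - d θ * E.postMean P θ) ∂E.prior = 0 := by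
    refine integral_eq_zero_of_components hP (i1.sub i2) ?_ ?_
    · refine Eventually.of_forall fun θ h => ?_
      rw [postMean_of_notMem h]; simp
    · intro θ hθ
      have h0 : ∫ t in connectedComponentIn P θ, (d t * t - d t * E.postMean P t) ∂E.prior =
          ∫ t in connectedComponentIn P θ,
          (-(d θ * bar E (connectedComponentIn P θ)) + d θ * t) ∂E.prior := by
        refine setIntegral_congr_fun (measurableSet_component _ _) fun t ht => ?_
        rw [postMean_eq_of_mem ht, postMean_of_mem hθ, hconst θ hθ t ht]
        ring
      rw [h0, setIntegral_affine (hP.component_pos hθ)]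
      ring
  rw [integral_sub i1 i2] at key
  unfold Environment.u
  have e1 : ∀ θ, θ * d θ - d θ ^ 2 / 2 = d θ * θ - d θ ^ 2 / 2 := fun θ => by ring
  have e2 : ∀ θ, E.postMean P θ * d θ - d θ ^ 2 / 2 =
    d θ * E.postMean P θ - d θ ^ 2 / 2 := fun θ => by ring
  rw [funext e1, funext e2, integral_sub i1 i3, integral_sub i2 i3]
  linarith

theorem eq_of_mem_component_levelPool (hd : MonotoneOn d (Icc 0 1)) {θ t : ℝ} (hθ : θ ∈ levelPool d)
    (ht : t ∈ connectedComponentIn (levelPool d) θ) : d t = d θ := by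
  obtain ⟨r, hr⟩ := mem_iUnion.1 hθ
  rw [component_levelPool hd hr] at ht
  exact (interior_subset ht).2.trans (interior_subset hr).2.symm

end LevelPool

/-! ### Envelope formula -/

section Envelope

/-- A function with subgradient `k d` everywhere grows by the integral of `k d`. -/
theorem envelope {U d : ℝ → ℝ} {k x y : ℝ} (hk : 0 < k) (hxy : x ≤ y)
    (h : ∀ s ∈ Icc x y, ∀ t ∈ Icc x y, U s + k * d s * (t - s) ≤ U t) :
    k * (∫ t in x..y, d t) ≤ U y - U x := by
  have hd : MonotoneOn d (Icc x y) := by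
    intro s hs t ht hst
    rcases hst.eq_or_lt with rfl | hlt
    · rfl
    by_contra! hc
    have h1 := h s hs t ht
    have h2 := h t ht s hs
    nlinarith [mul_pos (mul_pos hk (sub_pos.2 hc)) (sub_pos.2 hlt)]
  have key : ∀ n : ℕ, k * (∫ t in x..y, d t) ≤
      U y - U x + k * (y - x) * (d y - d x) * (1 / ((n:ℝ) + 1)) := by
    intro n
    set N : ℝ := (n:ℝ) + 1 with hN
    have hN0 : 0 < N := by positivity
    set η : ℝ := (y - x) / N with hη
    have hη0 : 0 ≤ η := div_nonneg (by linarith) hN0.le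
    have hηN : η * N = y - x := by rw [hη]; field_simp
    have hmem : ∀ t ∈ Icc (0:ℝ) N, x + η * t ∈ Icc x y := by
      intro t ht
      have := mul_le_mul_of_nonneg_left ht.2 hη0
      exact ⟨by nlinarith [mul_nonneg hη0 ht.1], by linarith⟩
    have hmono : MonotoneOn (fun t => d (x + η * t)) (Icc (0:ℝ) (0 + ((n + 1 : ℕ) : ℝ))) := by
      intro s hs t ht hst
      have e : (0:ℝ) + ((n + 1 : ℕ) : ℝ) = N := by simp [hN]
      rw [e] at hs ht
      exact hd (hmem s hs) (hmem t ht) (by nlinarith)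
    have h1 := hmono.integral_le_sum
    have e : (0:ℝ) + ((n + 1 : ℕ) : ℝ) = N := by simp [hN]
    rw [e] at h1
    have h2 : ∫ t in x..y, d t = η * ∫ t in (0:ℝ)..N, d (x + η * t) := by
      have := intervalIntegral.smul_integral_comp_add_mul (a := (0:ℝ)) (b := N) d η x
      rw [smul_eq_mul] at this
      rw [this, hηN]; simp
    have h3 : ∑ i ∈ Finset.range (n + 1), d (x + η * (0 + ((i + 1 : ℕ) : ℝ))) =
        (∑ i ∈ Finset.range (n + 1), d (x + η * (i:ℝ))) + (d y - d x) := by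
      have h4 := Finset.sum_range_sub (fun i : ℕ => d (x + η * (i:ℝ))) (n + 1)
      have e1 : x + η * ((n + 1 : ℕ) : ℝ) = y := by
        have : ((n + 1 : ℕ) : ℝ) = N := by simp [hN]
        rw [this, hηN]; ring
      rw [e1, Finset.sum_sub_distrib] at h4
      simp only [Nat.cast_zero, mul_zero, add_zero, zero_add] at h4 ⊢
      linarith
    have h5 : ∑ i ∈ Finset.range (n + 1), k * (η * d (x + η * (i:ℝ))) ≤ U y - U x := by
      have h6 := Finset.sum_range_sub (fun i : ℕ => U (x + η * (i:ℝ))) (n + 1)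
      have e1 : x + η * ((n + 1 : ℕ) : ℝ) = y := by
        have : ((n + 1 : ℕ) : ℝ) = N := by simp [hN]
        rw [this, hηN]; ring
      rw [e1] at h6
      simp only [Nat.cast_zero, mul_zero, add_zero] at h6
      rw [← h6]
      refine Finset.sum_le_sum fun i hi => ?_
      have hi' : ((i + 1 : ℕ) : ℝ) ≤ N := by
        rw [hN]; exact_mod_cast Finset.mem_range.1 hi
      have := h _ (hmem (i:ℝ) ⟨by positivity, by push_cast at hi'; linarith⟩) _
        (hmem ((i + 1 : ℕ) : ℝ) ⟨by positivity, hi'⟩)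
      push_cast at this ⊢
      linarith [show k * d (x + η * (i:ℝ)) * (x + η * ((i:ℝ) + 1) - (x + η * (i:ℝ))) =
        k * (η * d (x + η * (i:ℝ))) by ring]
    rw [h3] at h1
    rw [← Finset.mul_sum, ← Finset.mul_sum] at h5
    rw [h2]
    have h7 := mul_le_mul_of_nonneg_left h1 (mul_nonneg hk.le hη0)
    have h8 : k * (y - x) * (d y - d x) * (1 / N) = k * η * (d y - d x) := by
      rw [hη]; field_simp
    rw [h8]
    linarith
  have ht : Tendsto (fun n : ℕ => U y - U x + k * (y - x) * (d y - d x) * (1 / ((n:ℝ) + 1))) atTop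
      (𝓝 (U y - U x + k * (y - x) * (d y - d x) * 0)) :=
    (tendsto_one_div_add_atTop_nhds_zero_nat.const_mul _).const_add _
  have := ge_of_tendsto' ht key
  simpa using this

end Envelope

/-! ### Mean beliefs -/

section Beliefs

variable {E : Environment} {δ : ℝ} {σ : Profile} {β : Beliefs} {n : ℕ}

/-- The mean state believed after a signal. -/
noncomputable def meanBelief (β : Beliefs) {n : ℕ} (h : Hist n) (x : Pay × Pay) (s : Signal) : ℝ :=
  ∫ θ, θ ∂(β n h x s)

theorem Consistent.ae_mem (hβ : Consistent E σ β) (h : Hist n) (x : Pay × Pay) (s : Signal) :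
    ∀ᵐ θ ∂(β n h x s), θ ∈ Icc (0:ℝ) 1 := by
  have := hβ.prob n h x s
  exact (mem_ae_iff_prob_eq_one measurableSet_Icc).2 (hβ.support n h x s)

theorem Consistent.integrable (hβ : Consistent E σ β) (h : Hist n) (x : Pay × Pay) (s : Signal) :
    Integrable (fun t : ℝ => t) (β n h x s) := by
  have := hβ.prob n h x s
  refine Integrable.of_bound measurable_id.aestronglyMeasurable 1 ?_
  filter_upwards [hβ.ae_mem h x s] with t ht
  rw [Real.norm_eq_abs, abs_of_nonneg ht.1]
  exact ht.2

theorem integral_stage_receiver {μ : Measure ℝ} [IsProbabilityMeasure μ]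
    (hμ : Integrable (fun t : ℝ => t) μ) (r : Record) (k K : ℝ) :
    ∫ t, (k * stagePayoff E .receiver t r + K) ∂μ =
      k * stagePayoff E .receiver (∫ t, t ∂μ) r + K := by
  have e : ∀ t, k * stagePayoff E .receiver t r + K =
      (k * (E.c * (E.b * r.2.2.2.1 - r.2.2.2.1 ^ 2 / 2) - netTotal .receiver r) + K) +
        k * (E.c * E.a * r.2.2.2.1) * t := by
    intro t
    simp only [stagePayoff, Environment.util, Environment.uR]; ring
  rw [funext e, e, integral_add (integrable_const _) (hμ.const_mul _), integral_const_mul]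
  simp

theorem Consistent.meanBelief_mem (hβ : Consistent E σ β) (h : Hist n) (x : Pay × Pay) (s : Signal) :
    meanBelief β h x s ∈ Icc (0:ℝ) 1 := by
  have := hβ.prob n h x s
  constructor
  · refine integral_nonneg_of_ae ?_
    filter_upwards [hβ.ae_mem h x s] with θ hθ using hθ.1
  · have : meanBelief β h x s ≤ ∫ _, (1:ℝ) ∂(β n h x s) := by
      refine integral_mono_ae (hβ.integrable h x s) (integrable_const _) ?_
      filter_upwards [hβ.ae_mem h x s] with θ hθ using hθ.2
    simpa using this

theorem measurable_meanBelief (β : Beliefs) (h : Hist n) (x : Pay × Pay) :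
    Measurable (meanBelief β h x) :=
  (StronglyMeasurable.integral_kernel (κ := β n h x) (f := fun θ : ℝ => θ)
    measurable_id.stronglyMeasurable).measurable

theorem measurable_signal_right (σ : Profile) (h : Hist n) (x : Pay × Pay) :
    Measurable fun θ => σ.S.signal n (h, x, θ) :=
  (σ.S.signal_meas n).comp (measurable_const.prodMk (measurable_const.prodMk measurable_id))

theorem Consistent.integrable_meanBelief (hβ : Consistent E σ β) (h : Hist n) (x : Pay × Pay) :
    Integrable (fun θ => meanBelief β h x (σ.S.signal n (h, x, θ))) E.prior := by
  refine integrable_of_bdd E ((measurable_meanBelief β h x).comp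
    (measurable_signal_right σ h x)).aestronglyMeasurable (C := 1) fun θ _ => ?_
  have := hβ.meanBelief_mem h x (σ.S.signal n (h, x, θ))
  rw [abs_of_nonneg this.1]
  exact this.2

/-- Mean beliefs are correct on average given any event about the signal. -/
theorem Consistent.setIntegral_meanBelief (hβ : Consistent E σ β) (h : Hist n) (x : Pay × Pay)
    {A : Set Signal} (hA : MeasurableSet A) :
    ∫ θ in {θ | σ.S.signal n (h, x, θ) ∈ A}, meanBelief β h x (σ.S.signal n (h, x, θ)) ∂E.prior =
      ∫ θ in {θ | σ.S.signal n (h, x, θ) ∈ A}, θ ∂E.prior := by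
  have hs := measurable_signal_right σ h x
  have hM : IsMarkovKernel (β n h x) := ⟨fun s => hβ.prob n h x s⟩
  have hp : Measurable fun θ => (σ.S.signal n (h, x, θ), θ) := hs.prodMk measurable_id
  have hb := hβ.bayes n h x
  have hi : Integrable (fun z : Signal × ℝ => z.2)
      ((E.prior.map fun θ => σ.S.signal n (h, x, θ)) ⊗ₘ (β n h x)) := by
    rw [← hb, integrable_map_measure measurable_snd.aestronglyMeasurable hp.aemeasurable]
    exact integrable_id'
  have h1 := Measure.setIntegral_compProd (μ := E.prior.map fun θ => σ.S.signal n (h, x, θ))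
    (κ := β n h x) (f := fun z : Signal × ℝ => z.2) hA MeasurableSet.univ hi.integrableOn
  rw [← hb, setIntegral_map (hA.prod MeasurableSet.univ) measurable_snd.aestronglyMeasurable
    hp.aemeasurable] at h1
  simp only [Measure.restrict_univ] at h1
  change _ = ∫ s in A, meanBelief β h x s ∂(E.prior.map fun θ => σ.S.signal n (h, x, θ)) at h1
  rw [setIntegral_map hA (measurable_meanBelief β h x).aestronglyMeasurable hs.aemeasurable] at h1
  have e : (fun θ => (σ.S.signal n (h, x, θ), θ)) ⁻¹' A ×ˢ (univ : Set ℝ) =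
      {θ | σ.S.signal n (h, x, θ) ∈ A} := by
    ext θ; simp
  rw [e] at h1
  exact h1.symm

/-- The decision taken after a signal. -/
def Profile.decisionAt (σ : Profile) {n : ℕ} (h : Hist n) (x : Pay × Pay) (s : Signal) : ℝ :=
  σ.R.decision n (h, x, s, σ.R.interim n (h, x, s))

theorem measurable_decisionAt (σ : Profile) (h : Hist n) (x : Pay × Pay) :
    Measurable (σ.decisionAt h x) := by
  have h1 : Measurable fun s => σ.R.interim n (h, x, s) :=
    (σ.R.interim_meas n).comp (measurable_const.prodMk (measurable_const.prodMk measurable_id))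
  exact (σ.R.decision_meas n).comp
    (measurable_const.prodMk (measurable_const.prodMk (measurable_id.prodMk h1)))

/-- In the states where nobody else gets the same decision, the belief is degenerate. -/
theorem Consistent.meanBelief_eq_of_separated (hβ : Consistent E σ β) (h : Hist n) (x : Pay × Pay)
    {θ : ℝ} (hθ : θ ∈ Icc (0:ℝ) 1) (hsep : ∀ t ∈ Icc (0:ℝ) 1,
      σ.decisionAt h x (σ.S.signal n (h, x, t)) = σ.decisionAt h x (σ.S.signal n (h, x, θ)) → t = θ) :
    meanBelief β h x (σ.S.signal n (h, x, θ)) = θ := by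
  have hp := hβ.prob n h x (σ.S.signal n (h, x, θ))
  have h1 : β n h x (σ.S.signal n (h, x, θ)) {θ} = 1 := by
    refine le_antisymm prob_le_one ?_
    rw [← hβ.fiber n h x θ hθ]
    refine measure_mono ?_
    rintro t ⟨ht, he⟩
    exact hsep t ht (by rw [he])
  have h2 : ∀ᵐ t ∂(β n h x (σ.S.signal n (h, x, θ))), t = θ :=
    (mem_ae_iff_prob_eq_one (measurableSet_singleton θ)).2 h1
  rw [meanBelief, integral_congr_ae (g := fun _ => θ) h2]
  simp

/-- Enforceable decisions under a consistent belief system with an increasing decision rule are close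
to the receiver's preferred decisions at the posterior means of a pooling set. -/
theorem Consistent.close_postMean (hβ : Consistent E σ β) (h : Hist n) (x : Pay × Pay) {ℓ : ℝ}
    (hd : MonotoneOn (fun θ => σ.decisionAt h x (σ.S.signal n (h, x, θ))) (Icc 0 1))
    (hclose : ∀ s, |σ.decisionAt h x s - E.prefR (meanBelief β h x s)| ≤ ℓ)
    {θ : ℝ} (hθ : θ ∈ Icc (0:ℝ) 1)
    (hend : θ ∉ levelEnds fun θ => σ.decisionAt h x (σ.S.signal n (h, x, θ))) :
    |σ.decisionAt h x (σ.S.signal n (h, x, θ)) - E.prefR (E.postMean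
      (levelPool fun θ => σ.decisionAt h x (σ.S.signal n (h, x, θ))) θ)| ≤ ℓ := by
  refine RelComm.close_postMean (d := fun θ => σ.decisionAt h x (σ.S.signal n (h, x, θ))) hd
    (hβ.integrable_meanBelief h x) (fun θ _ => hclose _) (fun r => ?_)
    (fun θ hθ hs => hβ.meanBelief_eq_of_separated h x hθ hs) hθ hend
  have h1 := hβ.setIntegral_meanBelief h x (measurable_decisionAt σ h x (measurableSet_singleton r))
  have e : (levelSet (fun θ => σ.decisionAt h x (σ.S.signal n (h, x, θ))) r : Set ℝ) =ᵐ[E.prior]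
      {θ | σ.S.signal n (h, x, θ) ∈ σ.decisionAt h x ⁻¹' {r}} := by
    filter_upwards [RelComm.ae_mem E] with θ hθ
    exact propext ⟨fun h => h.2, fun h => ⟨hθ, h⟩⟩
  rw [setIntegral_congr_set e, setIntegral_congr_set e]
  exact h1

end Beliefs

/-! ### Deviations and the constraints they impose on equilibria -/

section Deviations

variable {E : Environment} {δ : ℝ} {σ : Profile} {β : Beliefs} {n : ℕ}

/-- In period `m`, send the signal `B`, if given, and omit the ex-ante payment if `a` and the ex-post
payment if `c`. -/
def SenderStrategy.modify (S : SenderStrategy) (m : ℕ) (a : Bool) (B : Option Signal) (c : Bool) :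
    SenderStrategy where
  exAnte n z := if n = m ∧ a then 0 else S.exAnte n z
  signal n z := if n = m then B.getD (S.signal n z) else S.signal n z
  exPost n z := if n = m ∧ c then 0 else S.exPost n z
  exAnte_meas n := by
    split_ifs
    exacts [measurable_const, S.exAnte_meas n]
  signal_meas n := by
    split_ifs
    · cases B
      exacts [S.signal_meas n, measurable_const]
    · exact S.signal_meas n
  exPost_meas n := by
    split_ifs
    exacts [measurable_const, S.exPost_meas n]
  bounded := by
    obtain ⟨K, h1, h2, h3⟩ := S.bounded
    set b := (B.getD 0).2
    set M := max K (max b.1 b.2)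
    have hK : ((K, K) : Pay) ≤ (M, M) := ⟨le_max_left _ _, le_max_left _ _⟩
    have hb : max b.1 b.2 ≤ M := le_max_right _ _
    refine ⟨M, fun n z => ?_, fun n z => ?_, fun n z => ?_⟩
    · split_ifs
      exacts [zero_le, (h1 n z).trans hK]
    · split_ifs
      · cases B with
        | none => exact (h2 n z).trans hK
        | some p => exact ⟨(le_max_left _ _).trans hb, (le_max_right _ _).trans hb⟩
      · exact (h2 n z).trans hK
    · split_ifs
      exacts [zero_le, (h3 n z).trans hK]

/-- In period `m`, take the decision `d` and make no ex-post payment. -/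
noncomputable def ReceiverStrategy.modify (R : ReceiverStrategy) (m : ℕ) (d : ℝ) : ReceiverStrategy where
  exAnte := R.exAnte
  interim := R.interim
  decision n z := if n = m then d else R.decision n z
  exPost n z := if n = m then 0 else R.exPost n z
  exAnte_meas := R.exAnte_meas
  interim_meas := R.interim_meas
  decision_meas n := by
    have := R.decision_meas n
    split_ifs <;> fun_prop
  exPost_meas n := by
    have := R.exPost_meas n
    split_ifs <;> fun_prop
  bounded := by
    obtain ⟨K, h1, h2, h3, h4⟩ := R.bounded
    have hK : ((K, K) : Pay) ≤ (max K |d|.toNNReal, max K |d|.toNNReal) :=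
      ⟨le_max_left _ _, le_max_left _ _⟩
    refine ⟨max K |d|.toNNReal, fun n z => (h1 n z).trans hK, fun n z => (h2 n z).trans hK,
      fun n z => ?_, fun n z => ?_⟩
    · split_ifs
      · refine (Real.le_coe_toNNReal |d|).trans (NNReal.coe_le_coe.2 (le_max_right _ _))
      · exact (h3 n z).trans (NNReal.coe_le_coe.2 (le_max_left _ _))
    · split_ifs
      · exact zero_le
      · exact (h4 n z).trans hK

theorem agreeFrom_modify_sender (σ : Profile) (m : ℕ) (a : Bool) (B : Option Signal)
    (c : Bool) : AgreeFrom (m + 1) ⟨σ.S.modify m a B c, σ.R⟩ σ := by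
  intro n hn
  have : n ≠ m := by omega
  simp [SenderStrategy.modify, this]

theorem agreeFrom_modify_receiver (σ : Profile) (m : ℕ) (d : ℝ) :
    AgreeFrom (m + 1) ⟨σ.S, σ.R.modify m d⟩ σ := by
  intro n hn
  have : n ≠ m := by omega
  simp [ReceiverStrategy.modify, this]

/-- Never pay, and always take the decision `d`. -/
def passive (d : ℝ) : ReceiverStrategy where
  exAnte _ _ := 0
  interim _ _ := 0
  decision _ _ := d
  exPost _ _ := 0
  exAnte_meas _ := measurable_const
  interim_meas _ := measurable_const
  decision_meas _ := measurable_const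
  exPost_meas _ := measurable_const
  bounded := ⟨|d|.toNNReal, fun _ _ => zero_le, fun _ _ => zero_le,
    fun _ _ => Real.le_coe_toNNReal |d|, fun _ _ => zero_le⟩

theorem integral_uR (E : Environment) (d : ℝ) : ∫ θ, E.uR d θ ∂E.prior = E.uR d (mean E) := by
  have e : ∀ θ, E.uR d θ = E.c * (E.b * d - d ^ 2 / 2) + E.c * E.a * d * θ := fun θ => by
    unfold Environment.uR; ring
  rw [funext e, integral_add (integrable_const _) (integrable_id'.const_mul _),
    integral_const_mul (E.c * E.a * d)]
  rw [show ∫ θ, θ ∂E.prior = mean E from rfl]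
  simp

theorem net_zero_le (p : Pay) : net 0 p ≤ 0 := by
  have : (0:ℝ) ≤ p.1 := p.1.2
  simp [net]

theorem net_add_net_nonneg (p q : Pay) : 0 ≤ net p q + net q p := by
  have h1 : (0:ℝ) ≤ p.2 := p.2.2
  have h2 : (0:ℝ) ≤ q.2 := q.2.2
  unfold net; linarith

theorem babble_le_value (hδ : δ ∈ Ico (0:ℝ) 1) (hσ : IsPBE E δ σ β) (h : Hist n) :
    babble E ≤ value E δ σ .receiver h := by
  have h1 := hσ.receiver_exAnte n h (σ.S.exAnte n h) (passive (E.prefR (mean E)))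
  have h2 := value_eq (E := E) hδ σ .receiver h
  have h3 := value_eq (E := E) hδ ⟨σ.S, passive (E.prefR (mean E))⟩ .receiver h
  refine le_trans ?_ ((h3.trans_le h1).trans h2.ge)
  obtain ⟨K, hK, -⟩ := exists_bddRecord ⟨σ.S, passive (E.prefR (mean E))⟩
  refine le_value_of_step hδ (V := fun _ _ => babble E) (B := |babble E|) (fun _ => measurable_const)
    (fun _ _ => le_rfl) (fun n h => ?_) h
  have hm := measurable_period_right ⟨σ.S, passive (E.prefR (mean E))⟩ h
  rw [integral_add ((integrable_stage hm (hK n h)).const_mul _) (integrable_const _), integral_const_mul]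
  have h4 : babble E ≤ ∫ θ, stagePayoff E .receiver θ
      (Profile.period ⟨σ.S, passive (E.prefR (mean E))⟩ h θ) ∂E.prior := by
    rw [babble, ← integral_uR]
    refine integral_mono (integrable_of_continuous E (by unfold Environment.uR; fun_prop))
      (integrable_stage hm (hK n h)) fun θ => ?_
    have hn : netTotal .receiver (Profile.period ⟨σ.S, passive (E.prefR (mean E))⟩ h θ) ≤ 0 :=
      add_nonpos (add_nonpos (net_zero_le _) (net_zero_le _)) (net_zero_le _)
    have : E.uR (E.prefR (mean E)) θ ≤ E.uR (E.prefR (mean E)) θ -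
      netTotal .receiver (Profile.period ⟨σ.S, passive (E.prefR (mean E))⟩ h θ) := by linarith
    exact this
  simp only [integral_const, probReal_univ, smul_eq_mul, one_mul]
  have := mul_le_mul_of_nonneg_left h4 (show 0 ≤ 1 - δ by linarith [hδ.2])
  linarith

theorem Consistent.integral_nodeValue (hβ : Consistent E σ β) (h : Hist n) (x : Pay × Pay)
    (s : Signal) (τ : Profile) (r : Record) :
    ∫ θ, nodeValue E δ τ .receiver h θ r ∂(β n h x s) =
      nodeValue E δ τ .receiver h (meanBelief β h x s) r := by
  have := hβ.prob n h x s
  exact integral_stage_receiver (hβ.integrable h x s) r _ _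

/-- The temptation of the receiver is bounded by the discounted surplus. -/
theorem temptation_le (hδ : δ ∈ Ico (0:ℝ) 1) (hσ : IsPBE E δ σ β) {I J : ℝ}
    (hI : ∀ n (h : Hist n), I ≤ value E δ σ .sender h)
    (hJ : ∀ n (h : Hist n), value E δ σ .sender h + value E δ σ .receiver h ≤ J)
    (h : Hist n) (x : Pay × Pay) (s : Signal) :
    (1 - δ) * E.temptation (σ.decisionAt h x s) (meanBelief β h x s) ≤ δ * (J - I - babble E) := by
  set r := σ.R.interim n (h, x, s)
  set d := σ.R.decision n (h, x, s, r) with hd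
  set y := meanBelief β h x s
  have hβ := hσ.consistent
  have hδ1 : 0 ≤ 1 - δ := by linarith [hδ.2]
  have h1 := hσ.receiver_decision n h x s r (σ.R.modify n (E.prefR y))
  rw [hβ.integral_nodeValue, hβ.integral_nodeValue] at h1
  have h2 := hσ.sender_exPost n h x s r d (σ.S.modify n false none true) 0 (by simp)
  have h3 : nodeValue E δ σ .sender h 0 (σ.fromExPostS h x s r d) = (1 - δ) * (E.uS d 0 -
      (net x.1 x.2 + net s.2 r + net (σ.S.exPost n (h, x, s, r, d))
        (σ.R.exPost n (h, x, s, r, d, σ.S.exPost n (h, x, s, r, d))))) +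
      δ * value E δ σ .sender (extend h (σ.fromExPostS h x s r d)) := rfl
  have h4 : nodeValue E δ σ .receiver h y (σ.fromDecision h x s r) = (1 - δ) * (E.uR d y -
      (net x.2 x.1 + net r s.2 + net (σ.R.exPost n (h, x, s, r, d, σ.S.exPost n (h, x, s, r, d)))
        (σ.S.exPost n (h, x, s, r, d)))) +
      δ * value E δ σ .receiver (extend h (σ.fromExPostS h x s r d)) := rfl
  have h5 : (1 - δ) * (E.uS d 0 - (net x.1 x.2 + net s.2 r)) + δ * I ≤
      nodeValue E δ ⟨σ.S.modify n false none true, σ.R⟩ .sender h 0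
        (Profile.fromExPostS ⟨σ.S.modify n false none true, σ.R⟩ h x s r d) := by
    have e : Profile.fromExPostS ⟨σ.S.modify n false none true, σ.R⟩ h x s r d =
        (x, s, r, d, (0, σ.R.exPost n (h, x, s, r, d, 0))) := by
      simp [Profile.fromExPostS, Profile.fromExPostR, SenderStrategy.modify]
    rw [e, nodeValue, (agreeFrom_modify_sender σ n false none true).value_eq le_rfl]
    have a1 := net_zero_le (σ.R.exPost n (h, x, s, r, d, 0))
    have a2 : stagePayoff E .sender 0 (x, s, r, d, (0, σ.R.exPost n (h, x, s, r, d, 0))) =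
      E.uS d 0 - (net x.1 x.2 + net s.2 r + net 0 (σ.R.exPost n (h, x, s, r, d, 0))) := rfl
    rw [a2]
    refine add_le_add (mul_le_mul_of_nonneg_left (by linarith) hδ1)
      (mul_le_mul_of_nonneg_left (hI _ _) hδ.1)
  have h6 : (1 - δ) * (E.uR (E.prefR y) y - (net x.2 x.1 + net r s.2)) + δ * babble E ≤
      nodeValue E δ ⟨σ.S, σ.R.modify n (E.prefR y)⟩ .receiver h y
        (Profile.fromDecision ⟨σ.S, σ.R.modify n (E.prefR y)⟩ h x s r) := by
    have e : Profile.fromDecision ⟨σ.S, σ.R.modify n (E.prefR y)⟩ h x s r =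
        (x, s, r, E.prefR y, (σ.S.exPost n (h, x, s, r, E.prefR y), 0)) := by
      simp [Profile.fromDecision, Profile.fromExPostS, Profile.fromExPostR, ReceiverStrategy.modify]
    rw [e, nodeValue, (agreeFrom_modify_receiver σ n _).value_eq le_rfl]
    have a1 := net_zero_le (σ.S.exPost n (h, x, s, r, E.prefR y))
    have a2 : stagePayoff E .receiver y (x, s, r, E.prefR y, (σ.S.exPost n (h, x, s, r, E.prefR y), 0)) =
      E.uR (E.prefR y) y - (net x.2 x.1 + net r s.2 +
        net 0 (σ.S.exPost n (h, x, s, r, E.prefR y))) := rfl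
    rw [a2]
    refine add_le_add (mul_le_mul_of_nonneg_left (by linarith) hδ1)
      (mul_le_mul_of_nonneg_left (babble_le_value hδ hσ _) hδ.1)
  have h7 := mul_le_mul_of_nonneg_left (hJ _ (extend h (σ.fromExPostS h x s r d))) hδ.1
  have h8 := mul_le_mul_of_nonneg_left (net_add_net_nonneg (σ.S.exPost n (h, x, s, r, d))
    (σ.R.exPost n (h, x, s, r, d, σ.S.exPost n (h, x, s, r, d)))) hδ1
  have h9 := (h5.trans h2).trans h3.le
  have h10 := (h6.trans h1).trans h4.le
  change (1 - δ) * (E.uR (E.prefR y) y - E.uR d y) ≤ _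
  nlinarith

/-- Incentive compatibility of the sender's signals. -/
theorem signal_incentive (hσ : IsPBE E δ σ β) (h : Hist n) (x : Pay × Pay)
    {θ' θ : ℝ} (hθ : θ ∈ Icc (0:ℝ) 1) :
    nodeValue E δ σ .sender h θ' (σ.fromSignal h x θ') +
      (1 - δ) * wt E * σ.decisionAt h x (σ.S.signal n (h, x, θ')) * (θ - θ') ≤
      nodeValue E δ σ .sender h θ (σ.fromSignal h x θ) := by
  refine le_trans (le_of_eq ?_)
    (hσ.sender_signal n h x (σ.S.modify n false (some (σ.S.signal n (h, x, θ'))) false) θ hθ)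
  have e : Profile.fromSignal ⟨σ.S.modify n false (some (σ.S.signal n (h, x, θ'))) false, σ.R⟩ h x θ =
      σ.fromSignal h x θ' := by
    simp [Profile.fromSignal, Profile.fromInterimR, Profile.fromDecision, Profile.fromExPostS,
      Profile.fromExPostR, SenderStrategy.modify]
  rw [e, nodeValue, nodeValue, (agreeFrom_modify_sender σ n _ _ _).value_eq le_rfl]
  have e1 : ∀ t, stagePayoff E .sender t (σ.fromSignal h x θ') =
    E.uS (σ.decisionAt h x (σ.S.signal n (h, x, θ'))) t - netTotal .sender (σ.fromSignal h x θ') :=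
    fun t => rfl
  rw [e1, e1]
  unfold wt Environment.uS Environment.u Environment.uR
  ring

/-- The sender can always stay silent and pay nothing. -/
theorem silence_incentive (hδ : δ ∈ Ico (0:ℝ) 1) (hσ : IsPBE E δ σ β) {I : ℝ}
    (hI : ∀ n (h : Hist n), I ≤ value E δ σ .sender h) (h : Hist n) (p : Pay)
    {θ : ℝ} (hθ : θ ∈ Icc (0:ℝ) 1) :
    (1 - δ) * E.uS (σ.decisionAt h (0, p) 0) θ + δ * I ≤
      nodeValue E δ σ .sender h θ (σ.fromSignal h (0, p) θ) := by
  have hδ1 : 0 ≤ 1 - δ := by linarith [hδ.2]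
  refine le_trans ?_ (hσ.sender_signal n h (0, p) (σ.S.modify n false (some 0) true) θ hθ)
  set r := σ.R.interim n (h, (0, p), 0)
  set d := σ.R.decision n (h, (0, p), 0, r)
  have e : Profile.fromSignal ⟨σ.S.modify n false (some 0) true, σ.R⟩ h (0, p) θ =
      ((0, p), 0, r, d, (0, σ.R.exPost n (h, (0, p), 0, r, d, 0))) := by
    simp [Profile.fromSignal, Profile.fromInterimR, Profile.fromDecision, Profile.fromExPostS,
      Profile.fromExPostR, SenderStrategy.modify, r, d]
  rw [e, nodeValue, (agreeFrom_modify_sender σ n _ _ _).value_eq le_rfl]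
  have a2 : stagePayoff E .sender θ ((0, p), 0, r, d, (0, σ.R.exPost n (h, (0, p), 0, r, d, 0))) =
      E.uS d θ - (net 0 p + net 0 r + net 0 (σ.R.exPost n (h, (0, p), 0, r, d, 0))) := rfl
  rw [a2]
  have a1 := net_zero_le (σ.R.exPost n (h, (0, p), 0, r, d, 0))
  have a3 := net_zero_le p
  have a4 := net_zero_le r
  exact add_le_add (mul_le_mul_of_nonneg_left (by change E.uS d θ ≤ _; linarith) hδ1)
    (mul_le_mul_of_nonneg_left (hI _ _) hδ.1)

/-- The sender can always refuse to make an ex-ante payment. -/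
theorem exAnte_incentive (hδ : δ ∈ Ico (0:ℝ) 1) (hσ : IsPBE E δ σ β) (h : Hist n) :
    ∫ θ, nodeValue E δ σ .sender h θ (σ.fromSignal h (0, σ.R.exAnte n (h, 0)) θ) ∂E.prior ≤
      value E δ σ .sender h := by
  refine le_trans (le_of_eq ?_) (hσ.sender_exAnte n h (σ.S.modify n true none false))
  rw [value_eq hδ]
  congr 1; funext θ
  have e : Profile.period ⟨σ.S.modify n true none false, σ.R⟩ h θ =
      σ.fromSignal h (0, σ.R.exAnte n (h, 0)) θ := by
    simp [Profile.period, Profile.fromExAnteR, Profile.fromSignal, Profile.fromInterimR,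
      Profile.fromDecision, Profile.fromExPostS, Profile.fromExPostR, SenderStrategy.modify]
  rw [e, nodeValue, nodeValue, (agreeFrom_modify_sender σ n _ _ _).value_eq le_rfl]

end Deviations

/-! ### The upper bound on the surplus -/

section UpperBound

variable {E : Environment} {δ : ℝ} {σ : Profile} {β : Beliefs} {n : ℕ} {θ₀ : ℝ}

theorem envelope_left {U d : ℝ → ℝ} {k x y : ℝ} (hk : 0 < k) (hxy : x ≤ y)
    (h : ∀ s ∈ Icc x y, ∀ t ∈ Icc x y, U s + k * d s * (t - s) ≤ U t) :
    U y - U x ≤ k * (∫ t in x..y, d t) := by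
  have h1 := envelope (U := fun t => U (-t)) (d := fun t => -d (-t)) (x := -y) (y := -x) hk
    (by linarith) fun s hs t ht => by
      have := h (-s) ⟨by linarith [hs.2], by linarith [hs.1]⟩ (-t) ⟨by linarith [ht.2], by linarith [ht.1]⟩
      linarith
  rw [intervalIntegral.integral_neg, intervalIntegral.integral_comp_neg] at h1
  simp only [neg_neg] at h1
  linarith

/-- The sender's equilibrium payoff after the ex-ante payments `x` when the state is `θ`. -/
noncomputable def interimValue (E : Environment) (δ : ℝ) (σ : Profile) {n : ℕ} (h : Hist n)
    (x : Pay × Pay) (θ : ℝ) : ℝ :=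
  nodeValue E δ σ .sender h θ (σ.fromSignal h x θ)

/-- The equilibrium decision after the ex-ante payments `x` when the state is `θ`. -/
def decisionRule (σ : Profile) {n : ℕ} (h : Hist n) (x : Pay × Pay) (θ : ℝ) : ℝ :=
  σ.decisionAt h x (σ.S.signal n (h, x, θ))

theorem interimValue_incentive (hσ : IsPBE E δ σ β) (h : Hist n) (x : Pay × Pay) :
    ∀ s, ∀ t ∈ Icc (0:ℝ) 1, interimValue E δ σ h x s +
      (1 - δ) * wt E * decisionRule σ h x s * (t - s) ≤ interimValue E δ σ h x t :=
  fun _ _ ht => signal_incentive hσ h x ht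

theorem monotoneOn_decisionRule (hδ : δ ∈ Ico (0:ℝ) 1) (hσ : IsPBE E δ σ β) (h : Hist n)
    (x : Pay × Pay) : MonotoneOn (decisionRule σ h x) (Icc 0 1) := by
  intro s hs t ht hst
  have hk : 0 < (1 - δ) * wt E := mul_pos (by linarith [hδ.2]) wt_pos
  rcases hst.eq_or_lt with rfl | hlt
  · rfl
  by_contra! hc
  have h1 := interimValue_incentive hσ h x s t ht
  have h2 := interimValue_incentive hσ h x t s hs
  nlinarith [mul_pos (mul_pos hk (sub_pos.2 hc)) (sub_pos.2 hlt)]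

theorem measurable_decisionRule (σ : Profile) (h : Hist n) (x : Pay × Pay) :
    Measurable (decisionRule σ h x) :=
  (measurable_decisionAt σ h x).comp (measurable_signal_right σ h x)

theorem integrable_interimValue (hδ : δ ∈ Ico (0:ℝ) 1) (σ : Profile) (h : Hist n) (x : Pay × Pay) :
    Integrable (interimValue E δ σ h x) E.prior := by
  obtain ⟨K, hK⟩ := exists_bddRecord_fromSignal σ h x
  exact integrable_nodeValue hδ σ .sender h (measurable_fromSignal_right σ h x) hK

theorem ae_restrict_notMem_levelEnds {d : ℝ → ℝ} (hd : MonotoneOn d (Icc 0 1)) {s : Set ℝ} :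
    ∀ᵐ t ∂(volume.restrict s), t ∉ levelEnds d :=
  ae_restrict_of_ae (measure_eq_zero_iff_ae_notMem.1 (volume_levelEnds hd))

theorem intervalIntegrable_of_monotoneOn {d : ℝ → ℝ} (hd : MonotoneOn d (Icc 0 1)) {x y : ℝ}
    (hx : 0 ≤ x) (hxy : x ≤ y) (hy : y ≤ 1) : IntervalIntegrable d volume x y :=
  MonotoneOn.intervalIntegrable (hd.mono (by rw [uIcc_of_le hxy]; exact Icc_subset_Icc hx hy))

theorem intervalIntegral_prefR_postMean {P : Set ℝ} (hP : IsPoolingSet P) (x y k : ℝ) :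
    ∫ t in x..y, (E.prefR (E.postMean P t) + k) =
      E.a * (∫ t in x..y, E.postMean P t) + (E.b + k) * (y - x) := by
  have e : ∀ t, E.prefR (E.postMean P t) + k = E.a * E.postMean P t + (E.b + k) := fun t => by
    unfold Environment.prefR; ring
  rw [funext e, intervalIntegral.integral_add ((intervalIntegrable_postMean hP x y).const_mul _)
    (by simp), intervalIntegral.integral_const_mul]
  simp; ring

/-- The lower guarantee for the sender's interim payoff. -/
theorem interimValue_ge_low (hδ : δ ∈ Ico (0:ℝ) 1) (hσ : IsPBE E δ σ β) {ℓ : ℝ} (h : Hist n)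
    (x : Pay × Pay) (hclose : ∀ s, |σ.decisionAt h x s - E.prefR (meanBelief β h x s)| ≤ ℓ) :
    interimValue E δ σ h x 0 + (1 - δ) * wt E * (E.a * lowInf E + (E.b - ℓ) * mean E) ≤
      ∫ θ, interimValue E δ σ h x θ ∂E.prior := by
  have hk : 0 < (1 - δ) * wt E := mul_pos (by linarith [hδ.2]) wt_pos
  have hd := monotoneOn_decisionRule hδ hσ h x
  set P := levelPool (decisionRule σ h x) with hPdef
  have hP : IsPoolingSet P := isPoolingSet_levelPool _
  have h1 : ∀ θ ∈ Icc (0:ℝ) 1, interimValue E δ σ h x 0 + (1 - δ) * wt E *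
      (E.a * (∫ t in (0:ℝ)..θ, E.postMean P t) + (E.b - ℓ) * θ) ≤ interimValue E δ σ h x θ := by
    intro θ hθ
    have h2 := envelope hk hθ.1 fun s _ t ht =>
      interimValue_incentive hσ h x s t ⟨ht.1, ht.2.trans hθ.2⟩
    have h3 : ∫ t in (0:ℝ)..θ, (E.prefR (E.postMean P t) + -ℓ) ≤
        ∫ t in (0:ℝ)..θ, decisionRule σ h x t := by
      refine intervalIntegral.integral_mono_ae_restrict hθ.1 ?_
        (intervalIntegrable_of_monotoneOn hd le_rfl hθ.1 hθ.2) ?_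
      · exact (((intervalIntegrable_postMean hP 0 θ).const_mul E.a).add (by simp)).add (by simp)
      · filter_upwards [ae_restrict_notMem_levelEnds hd, ae_restrict_mem measurableSet_Icc] with t ht hti
        have := (abs_le.1 (hσ.consistent.close_postMean h x hd hclose ⟨hti.1, hti.2.trans hθ.2⟩ ht)).1
        change E.prefR (E.postMean P t) + -ℓ ≤ σ.decisionAt h x (σ.S.signal n (h, x, t))
        change -ℓ ≤ σ.decisionAt h x (σ.S.signal n (h, x, t)) - E.prefR (E.postMean P t) at this
        linarith
    rw [intervalIntegral_prefR_postMean hP] at h3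
    have := mul_le_mul_of_nonneg_left h3 hk.le
    simp only [sub_zero] at this
    rw [sub_eq_add_neg]
    linarith
  have i1 : Integrable (fun θ => E.a * (∫ t in (0:ℝ)..θ, E.postMean P t) + (E.b - ℓ) * θ) E.prior :=
    ((integrable_lowPrim hP).const_mul _).add (integrable_id'.const_mul _)
  have h2 := integral_mono_ae ((integrable_const (interimValue E δ σ h x 0)).add
    (i1.const_mul ((1 - δ) * wt E))) (integrable_interimValue (E := E) hδ σ h x)
    (by filter_upwards [ae_mem E] with θ hθ using h1 θ hθ)
  rw [integral_add' (integrable_const _) (i1.const_mul _), integral_const_mul,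
    integral_add ((integrable_lowPrim hP).const_mul _) (integrable_id'.const_mul _),
    integral_const_mul, integral_const_mul] at h2
  refine le_trans ?_ h2
  simp only [integral_const, probReal_univ, smul_eq_mul, one_mul]
  have h3 := mul_le_mul_of_nonneg_left (lowInf_le (E := E) hP) E.a_pos.le
  have h4 := mul_le_mul_of_nonneg_left h3 hk.le
  change _ ≤ _ + _ * (E.a * lowArea E P + (E.b - ℓ) * mean E)
  linarith

/-- The upper guarantee for the sender's interim payoff. -/
theorem interimValue_ge_high (hδ : δ ∈ Ico (0:ℝ) 1) (hσ : IsPBE E δ σ β) {ℓ : ℝ} (h : Hist n)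
    (x : Pay × Pay) (hclose : ∀ s, |σ.decisionAt h x s - E.prefR (meanBelief β h x s)| ≤ ℓ) :
    interimValue E δ σ h x 1 - (1 - δ) * wt E * (E.a * highSup E + (E.b + ℓ) * (1 - mean E)) ≤
      ∫ θ, interimValue E δ σ h x θ ∂E.prior := by
  have hk : 0 < (1 - δ) * wt E := mul_pos (by linarith [hδ.2]) wt_pos
  have hd := monotoneOn_decisionRule hδ hσ h x
  set P := levelPool (decisionRule σ h x) with hPdef
  have hP : IsPoolingSet P := isPoolingSet_levelPool _
  have h1 : ∀ θ ∈ Icc (0:ℝ) 1, interimValue E δ σ h x 1 - (1 - δ) * wt E *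
      (E.a * (∫ t in θ..1, E.postMean P t) + (E.b + ℓ) * (1 - θ)) ≤ interimValue E δ σ h x θ := by
    intro θ hθ
    have h2 := envelope_left hk hθ.2 fun s _ t ht =>
      interimValue_incentive hσ h x s t ⟨hθ.1.trans ht.1, ht.2⟩
    have h3 : ∫ t in θ..1, decisionRule σ h x t ≤
        ∫ t in θ..1, (E.prefR (E.postMean P t) + ℓ) := by
      refine intervalIntegral.integral_mono_ae_restrict hθ.2
        (intervalIntegrable_of_monotoneOn hd hθ.1 hθ.2 le_rfl) ?_ ?_
      · exact (((intervalIntegrable_postMean hP θ 1).const_mul E.a).add (by simp)).add (by simp)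
      · filter_upwards [ae_restrict_notMem_levelEnds hd, ae_restrict_mem measurableSet_Icc] with t ht hti
        have := (abs_le.1 (hσ.consistent.close_postMean h x hd hclose ⟨hθ.1.trans hti.1, hti.2⟩ ht)).2
        change σ.decisionAt h x (σ.S.signal n (h, x, t)) ≤ E.prefR (E.postMean P t) + ℓ
        change σ.decisionAt h x (σ.S.signal n (h, x, t)) - E.prefR (E.postMean P t) ≤ ℓ at this
        linarith
    rw [intervalIntegral_prefR_postMean hP] at h3
    have := mul_le_mul_of_nonneg_left h3 hk.le
    linarith
  have i0 : Integrable (fun θ : ℝ => 1 - θ) E.prior := (integrable_const _).sub integrable_id'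
  have i1 : Integrable (fun θ => E.a * (∫ t in θ..1, E.postMean P t) + (E.b + ℓ) * (1 - θ)) E.prior :=
    ((integrable_highPrim hP).const_mul _).add (i0.const_mul _)
  have h2 := integral_mono_ae ((integrable_const (interimValue E δ σ h x 1)).sub
    (i1.const_mul ((1 - δ) * wt E))) (integrable_interimValue (E := E) hδ σ h x)
    (by filter_upwards [ae_mem E] with θ hθ using h1 θ hθ)
  rw [integral_sub' (integrable_const _) (i1.const_mul _), integral_const_mul,
    integral_add ((integrable_highPrim hP).const_mul _) (i0.const_mul _),
    integral_const_mul, integral_const_mul, integral_sub (integrable_const _) integrable_id'] at h2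
  refine le_trans ?_ h2
  simp only [integral_const, probReal_univ, smul_eq_mul, one_mul]
  have h3 := mul_le_mul_of_nonneg_left (le_highSup (E := E) hP) E.a_pos.le
  have h4 := mul_le_mul_of_nonneg_left h3 hk.le
  change _ ≤ _ - _ * (E.a * highArea E P + (E.b + ℓ) * (1 - mean E))
  linarith

/-- One of the two end states gives the sender his guarantee, whatever decision silence leads to. -/
theorem Crossing.silence_dichotomy (H : Crossing E θ₀) {y ℓ : ℝ} (hℓ : 0 ≤ ℓ) (h1 : E.b - ℓ ≤ y)
    (h2 : y ≤ E.a + E.b + ℓ) :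
    E.uS (E.b - ℓ) 0 ≤ E.uS y 0 ∨ E.uS (E.a + E.b + ℓ) 1 ≤ E.uS y 1 := by
  by_contra! hc
  obtain ⟨c1, c2⟩ := hc
  have ha := H.ha
  have hc0 := E.c_pos
  have hc1 := E.c_le_one
  simp only [Environment.uS, Environment.u, Environment.uR] at c1 c2
  have k1 : 0 < (y - (E.b - ℓ)) * (E.c * E.b + (1 - E.c) * (y + (E.b - ℓ)) / 2) := by
    nlinarith
  have k2 : 0 < (E.a + E.b + ℓ - y) *
      (1 - E.c * E.a - E.c * E.b - (1 - E.c) * (y + (E.a + E.b + ℓ)) / 2) := by nlinarith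
  have k3 := lt_of_mul_lt_mul_left ((mul_zero _).trans_lt k1) (by linarith)
  have k4 := lt_of_mul_lt_mul_left ((mul_zero _).trans_lt k2) (by linarith)
  nlinarith [mul_nonneg (sub_nonneg.2 hc1) hℓ]

/-- The sender's equilibrium payoff at any history is at least his guarantee. -/
theorem guard_le_value (H : Crossing E θ₀) (hδ : δ ∈ Ico (0:ℝ) 1) (hσ : IsPBE E δ σ β) {ℓ I : ℝ}
    (hℓ : 0 ≤ ℓ) (hI : ∀ n (h : Hist n), I ≤ value E δ σ .sender h) (h : Hist n)
    (hclose : ∀ x s, |σ.decisionAt h x s - E.prefR (meanBelief β h x s)| ≤ ℓ) :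
    (1 - δ) * min (guardLow E (lowInf E) ℓ) (guardHigh E (highSup E) ℓ) + δ * I ≤
      value E δ σ .sender h := by
  have hδ1 : 0 ≤ 1 - δ := by linarith [hδ.2]
  refine le_trans ?_ (exAnte_incentive hδ hσ h)
  set p := σ.R.exAnte n (h, 0)
  set y := σ.decisionAt h (0, p) 0
  have hm := hσ.consistent.meanBelief_mem h (0, p) 0
  have hy := abs_le.1 (hclose (0, p) 0)
  unfold Environment.prefR at hy
  have ha := E.a_pos
  have hy1 : E.b - ℓ ≤ y := by nlinarith [mul_nonneg ha.le hm.1]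
  have hy2 : y ≤ E.a + E.b + ℓ := by nlinarith [mul_le_mul_of_nonneg_left hm.2 ha.le]
  change _ ≤ ∫ θ, interimValue E δ σ h (0, p) θ ∂E.prior
  rcases H.silence_dichotomy hℓ hy1 hy2 with h1 | h1
  · have h2 := interimValue_ge_low hδ hσ h (0, p) (hclose _)
    have h3 := silence_incentive hδ hσ hI h p (θ := 0) (by simp)
    have h4 := mul_le_mul_of_nonneg_left h1 hδ1
    have h5 := mul_le_mul_of_nonneg_left
      (min_le_left (guardLow E (lowInf E) ℓ) (guardHigh E (highSup E) ℓ)) hδ1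
    have h6 : (1 - δ) * guardLow E (lowInf E) ℓ = (1 - δ) * E.uS (E.b - ℓ) 0 +
      (1 - δ) * wt E * (E.a * lowInf E + (E.b - ℓ) * mean E) := by unfold guardLow; ring
    change _ ≤ interimValue E δ σ h (0, p) 0 at h3
    linarith
  · have h2 := interimValue_ge_high hδ hσ h (0, p) (hclose _)
    have h3 := silence_incentive hδ hσ hI h p (θ := 1) (by simp)
    have h4 := mul_le_mul_of_nonneg_left h1 hδ1
    have h5 := mul_le_mul_of_nonneg_left
      (min_le_right (guardLow E (lowInf E) ℓ) (guardHigh E (highSup E) ℓ)) hδ1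
    have h6 : (1 - δ) * guardHigh E (highSup E) ℓ = (1 - δ) * E.uS (E.a + E.b + ℓ) 1 -
      (1 - δ) * wt E * (E.a * highSup E + (E.b + ℓ) * (1 - mean E)) := by unfold guardHigh; ring
    change _ ≤ interimValue E δ σ h (0, p) 1 at h3
    linarith

theorem Crossing.u_le_sbVal (H : Crossing E θ₀) {ℓ d m : ℝ} (h : |d - E.prefR m| ≤ ℓ) :
    E.u d m ≤ sbVal (E.a - 1) θ₀ (ℓ / (E.a - 1)) m := by
  have ha := H.ha
  rw [sbVal_div (by linarith)]
  have h1 : (E.a - 1) * |m - θ₀| ≤ |d - m| + ℓ := by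
    rw [← abs_of_pos (show 0 < E.a - 1 by linarith), ← abs_mul, ← H.prefR_sub]
    calc |E.prefR m - m| = |(d - m) - (d - E.prefR m)| := by congr 1; ring
      _ ≤ |d - m| + |d - E.prefR m| := abs_sub _ _
      _ ≤ _ := by linarith
  have h2 : max ((E.a - 1) * |m - θ₀| - ℓ) 0 ≤ |d - m| := max_le (by linarith) (abs_nonneg _)
  have h3 := pow_le_pow_left₀ (le_max_right _ _) h2 2
  rw [sq_abs] at h3
  unfold Environment.u
  nlinarith

theorem netTotal_add_nonneg (r : Record) : 0 ≤ netTotal .sender r + netTotal .receiver r := by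
  obtain ⟨x, s, p, d, y⟩ := r
  simp only [netTotal]
  linarith [net_add_net_nonneg x.1 x.2, net_add_net_nonneg s.2 p, net_add_net_nonneg y.1 y.2]

/-- The joint payoff at any history is bounded by the best pooling payoff. -/
theorem value_add_le (H : Crossing E θ₀) (hδ : δ ∈ Ico (0:ℝ) 1) (hσ : IsPBE E δ σ β) {ℓ J : ℝ}
    (hJ : ∀ n (h : Hist n), value E δ σ .sender h + value E δ σ .receiver h ≤ J) (h : Hist n)
    (hclose : ∀ x s, |σ.decisionAt h x s - E.prefR (meanBelief β h x s)| ≤ ℓ) :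
    value E δ σ .sender h + value E δ σ .receiver h ≤ (1 - δ) * bestVal E θ₀ ℓ + δ * J := by
  have hδ1 : 0 ≤ 1 - δ := by linarith [hδ.2]
  obtain ⟨K, hK, hK'⟩ := exists_bddRecord σ
  set x : Pay × Pay := (σ.S.exAnte n h, σ.R.exAnte n (h, σ.S.exAnte n h)) with hx
  have hd := monotoneOn_decisionRule hδ hσ h x
  have hC : ∀ θ ∈ Icc (0:ℝ) 1, |decisionRule σ h x θ| ≤ K := fun θ _ => (hK' n h x _).2.1
  have hdm := measurable_decisionRule σ h x
  set P := levelPool (decisionRule σ h x) with hPdef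
  have hP : IsPoolingSet P := isPoolingSet_levelPool _
  have iu : ∀ {g : ℝ → ℝ}, Measurable g → (∀ θ ∈ Icc (0:ℝ) 1, g θ ∈ Icc (0:ℝ) 1) →
      Integrable (fun θ => E.u (decisionRule σ h x θ) (g θ)) E.prior := by
    intro g hg hg1
    refine integrable_of_bdd E (by unfold Environment.u; fun_prop) (C := 1 * K + K ^ 2 / 2)
      fun θ hθ => ?_
    unfold Environment.u
    refine (abs_sub _ _).trans (add_le_add ?_ ?_)
    · rw [abs_mul]
      exact mul_le_mul (abs_le.2 ⟨by linarith [(hg1 θ hθ).1], (hg1 θ hθ).2⟩) (hC θ hθ)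
        (abs_nonneg _) zero_le_one
    · rw [abs_of_nonneg (by positivity), ← sq_abs]
      have := pow_le_pow_left₀ (abs_nonneg _) (hC θ hθ) 2
      linarith
  have h1 : ∫ θ, E.u (decisionRule σ h x θ) θ ∂E.prior ≤ bestVal E θ₀ ℓ := by
    rw [integral_u_eq_postMean hP hdm hC fun θ hθ t ht => eq_of_mem_component_levelPool hd hθ ht]
    refine le_trans ?_ (le_bestVal θ₀ ℓ hP)
    refine integral_mono_ae (iu hP.postMean_measurable fun θ hθ => hP.postMean_mem hθ)
      (integrable_comp_postMean hP continuous_sbVal) ?_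
    filter_upwards [ae_mem E, measure_eq_zero_iff_ae_notMem.1 (prior_abs E (volume_levelEnds hd))] with θ hθ ht
    exact H.u_le_sbVal (hσ.consistent.close_postMean h x hd (hclose x) hθ ht)
  have hm := measurable_period_right σ h
  rw [value_eq hδ σ .sender h, value_eq hδ σ .receiver h, ← integral_add
    (integrable_nodeValue hδ σ _ h hm (hK n h)) (integrable_nodeValue hδ σ _ h hm (hK n h))]
  have h2 := integral_mono ((integrable_nodeValue (E := E) hδ σ .sender h hm (hK n h)).add
    (integrable_nodeValue hδ σ .receiver h hm (hK n h)))
    (((iu measurable_id fun θ hθ => hθ).const_mul (1 - δ)).add (integrable_const (δ * J))) fun θ => by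
      have a1 : stagePayoff E .sender θ (σ.period h θ) =
        E.uS (decisionRule σ h x θ) θ - netTotal .sender (σ.period h θ) := rfl
      have a2 : stagePayoff E .receiver θ (σ.period h θ) =
        E.uR (decisionRule σ h x θ) θ - netTotal .receiver (σ.period h θ) := rfl
      have a3 := mul_le_mul_of_nonneg_left (hJ _ (extend h (σ.period h θ))) hδ.1
      have a4 := mul_nonneg hδ1 (netTotal_add_nonneg (σ.period h θ))
      have a5 : E.uS (decisionRule σ h x θ) θ = E.u (decisionRule σ h x θ) θ -
        E.uR (decisionRule σ h x θ) θ := rfl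
      simp only [Pi.add_apply, nodeValue, id]
      rw [a1, a2, a5]
      linarith
  refine h2.trans ?_
  rw [integral_add' ((iu measurable_id fun θ hθ => hθ).const_mul (1 - δ)) (integrable_const _),
    integral_const_mul]
  simp only [integral_const, probReal_univ, smul_eq_mul, one_mul]
  have := mul_le_mul_of_nonneg_left h1 hδ1
  simp only [id]
  linarith

/-- The surplus spanned by two equilibria. -/
theorem surplus_pair_le (H : Crossing E θ₀) (hδ : δ ∈ Ioo (0:ℝ) 1) {L : ℝ}
    (hL : ∀ ℓ ≥ 0, E.c * ℓ ^ 2 / 2 ≤ δ / (1 - δ) * maxSurplus E θ₀ ℓ → ℓ ≤ L)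
    {σ : Bool → Profile} {β : Bool → Beliefs} (hσ : ∀ k, IsPBE E δ (σ k) (β k)) (h₀ : Hist n) :
    δ / (1 - δ) * (value E δ (σ true) .sender h₀ + value E δ (σ true) .receiver h₀ -
      value E δ (σ false) .sender h₀ - babble E) ≤ E.c * L ^ 2 / 2 := by
  have hδ' : δ ∈ Ico (0:ℝ) 1 := ⟨hδ.1.le, hδ.2⟩
  have hδ1 : 0 < 1 - δ := by linarith [hδ.2]
  have hc := E.c_pos
  choose BS hBS using fun k => exists_value_bound E hδ' (σ k) .sender
  choose BR hBR using fun k => exists_value_bound E hδ' (σ k) .receiver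
  have hbool : ∀ (f : Bool → ℝ) k, f k ≤ max (f true) (f false) := fun f k => by
    cases k <;> simp
  let ι := Bool × (Σ n, Hist n)
  let vS : ι → ℝ := fun z => value E δ (σ z.1) .sender z.2.2
  let vR : ι → ℝ := fun z => value E δ (σ z.1) .receiver z.2.2
  have bI : BddBelow (range vS) := by
    refine ⟨-max (BS true) (BS false), ?_⟩
    rintro _ ⟨⟨k, n, h⟩, rfl⟩
    have := (abs_le.1 (hBS k n h)).1
    have := hbool BS k
    change _ ≤ value E δ (σ k) .sender h
    linarith
  have bJ : BddAbove (range fun z => vS z + vR z) := by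
    refine ⟨max (BS true) (BS false) + max (BR true) (BR false), ?_⟩
    rintro _ ⟨⟨k, n, h⟩, rfl⟩
    have := (abs_le.1 (hBS k n h)).2
    have := (abs_le.1 (hBR k n h)).2
    have := hbool BS k
    have := hbool BR k
    change value E δ (σ k) .sender h + value E δ (σ k) .receiver h ≤ _
    linarith
  have : Nonempty ι := ⟨(true, ⟨n, h₀⟩)⟩
  set I := ⨅ z, vS z
  set J := ⨆ z, (vS z + vR z)
  have hI : ∀ k n (h : Hist n), I ≤ value E δ (σ k) .sender h := fun k n h => ciInf_le bI (k, ⟨n, h⟩)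
  have hJ : ∀ k n (h : Hist n), value E δ (σ k) .sender h + value E δ (σ k) .receiver h ≤ J :=
    fun k n h => le_ciSup bJ (k, ⟨n, h⟩)
  have hpos : 0 ≤ J - I - babble E := by
    linarith [hI true n h₀, hJ true n h₀, babble_le_value hδ' (hσ true) h₀]
  set Lf := δ / (1 - δ) * (J - I - babble E) with hLf
  have hLf0 : 0 ≤ Lf := mul_nonneg (div_nonneg hδ.1.le hδ1.le) hpos
  set ℓ := Real.sqrt (2 * Lf / E.c) with hℓ
  have hℓ0 : 0 ≤ ℓ := Real.sqrt_nonneg _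
  have hℓ2 : E.c * ℓ ^ 2 / 2 = Lf := by
    rw [hℓ, Real.sq_sqrt (by positivity)]; field_simp
  have hclose : ∀ k n (h : Hist n) x s,
      |(σ k).decisionAt h x s - E.prefR (meanBelief (β k) h x s)| ≤ ℓ := by
    intro k n h x s
    have h1 := temptation_le hδ' (hσ k) (hI k) (hJ k) h x s
    have h2 : E.temptation ((σ k).decisionAt h x s) (meanBelief (β k) h x s) ≤ Lf := by
      rw [hLf, div_mul_eq_mul_div, le_div_iff₀ hδ1]; linarith
    rw [temptation_eq, ← hℓ2] at h2
    refine abs_le_of_sq_le_sq ?_ hℓ0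
    nlinarith
  have hI' : min (guardLow E (lowInf E) ℓ) (guardHigh E (highSup E) ℓ) ≤ I := by
    have : (1 - δ) * min (guardLow E (lowInf E) ℓ) (guardHigh E (highSup E) ℓ) + δ * I ≤ I :=
      le_ciInf fun z => guard_le_value H hδ' (hσ z.1) hℓ0 (hI z.1) z.2.2 (hclose z.1 _ _)
    nlinarith
  have hJ' : J ≤ bestVal E θ₀ ℓ := by
    have : J ≤ (1 - δ) * bestVal E θ₀ ℓ + δ * J :=
      ciSup_le fun z => value_add_le H hδ' (hσ z.1) (hJ z.1) z.2.2 (hclose z.1 _ _)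
    nlinarith
  have hle : ℓ ≤ L := by
    refine hL ℓ hℓ0 ?_
    rw [hℓ2, hLf]
    refine mul_le_mul_of_nonneg_left ?_ (div_nonneg hδ.1.le hδ1.le)
    unfold maxSurplus; linarith
  calc _ ≤ Lf := by
        refine mul_le_mul_of_nonneg_left ?_ (div_nonneg hδ.1.le hδ1.le)
        linarith [hI false n h₀, hJ true n h₀]
    _ = E.c * ℓ ^ 2 / 2 := hℓ2.symm
    _ ≤ _ := by
        have := pow_le_pow_left₀ hℓ0 hle 2
        nlinarith

theorem surplus_le (H : Crossing E θ₀) (hδ : δ ∈ Ioo (0:ℝ) 1) {L : ℝ}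
    (hL : ∀ ℓ ≥ 0, E.c * ℓ ^ 2 / 2 ≤ δ / (1 - δ) * maxSurplus E θ₀ ℓ → ℓ ≤ L) :
    surplus E δ ≤ ((E.c * L ^ 2 / 2 : ℝ) : EReal) := by
  have hδ1 : 0 < 1 - δ := by linarith [hδ.2]
  have hκ : 0 < δ / (1 - δ) := div_pos hδ.1 hδ1
  set M := E.c * L ^ 2 / 2
  have hpair : ∀ v ∈ equilibriumPayoffs E δ, ∀ w ∈ equilibriumPayoffs E δ,
      v.1 + v.2 - w.1 - babble E ≤ M / (δ / (1 - δ)) := by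
    rintro v ⟨σ, β, hσ, rfl⟩ w ⟨σ', β', hσ', rfl⟩
    rw [le_div_iff₀' hκ]
    exact surplus_pair_le H hδ hL (σ := fun k => if k then σ else σ') (β := fun k => if k then β else β')
      (fun k => by cases k <;> simpa) (Fin.elim0 : Hist 0)
  have hR : ((babble E : ℝ) : EReal) ≤ worstReceiver E δ := by
    refine le_iInf₂ ?_
    rintro v ⟨σ, β, hσ, rfl⟩
    exact EReal.coe_le_coe_iff.2 (babble_le_value ⟨hδ.1.le, hδ.2⟩ hσ _)
  have key : bestJoint E δ - worstSender E δ - worstReceiver E δ ≤ ((M / (δ / (1 - δ)) : ℝ) : EReal) := by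
    by_cases hne : (equilibriumPayoffs E δ).Nonempty
    · obtain ⟨v, hv⟩ := hne
      have h1 : ∀ u ∈ equilibriumPayoffs E δ,
          ((u.1 + u.2 - babble E - M / (δ / (1 - δ)) : ℝ) : EReal) ≤ worstSender E δ := by
        intro u hu
        refine le_iInf₂ fun w hw => EReal.coe_le_coe_iff.2 ?_
        linarith [hpair u hu w hw]
      have h2 : worstSender E δ ≤ ((v.1 : ℝ) : EReal) := iInf₂_le v hv
      obtain ⟨ws, hws⟩ : ∃ ws : ℝ, worstSender E δ = ws :=
        ⟨(worstSender E δ).toReal, (EReal.coe_toReal (ne_top_of_le_ne_top (EReal.coe_ne_top _) h2)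
          (ne_bot_of_le_ne_bot (EReal.coe_ne_bot _) (h1 v hv))).symm⟩
      have h3 : bestJoint E δ ≤ ((ws + babble E + M / (δ / (1 - δ)) : ℝ) : EReal) := by
        refine iSup₂_le fun u hu => EReal.coe_le_coe_iff.2 ?_
        have := h1 u hu
        rw [hws, EReal.coe_le_coe_iff] at this
        linarith
      rw [hws]
      refine (EReal.sub_le_sub (EReal.sub_le_sub h3 le_rfl) hR).trans ?_
      rw [← EReal.coe_sub, ← EReal.coe_sub, EReal.coe_le_coe_iff]
      linarith
    · rw [not_nonempty_iff_eq_empty] at hne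
      have : bestJoint E δ = ⊥ := by simp [bestJoint, hne]
      rw [this, EReal.bot_sub, EReal.bot_sub]
      exact bot_le
  unfold surplus
  refine (mul_le_mul_of_nonneg_left key (EReal.coe_nonneg.2 hκ.le)).trans ?_
  rw [← EReal.coe_mul, mul_div_cancel₀ _ hκ.ne']

end UpperBound

/-! ### Equilibria with one cooperative and one babbling phase -/

/-- One period of play after the ex-ante payments: the sender's signal, the receiver's decision and
the beliefs that support it.  No other payments are made. -/
structure Mode (E : Environment) where
  sig : ℝ → Signal
  act : Signal → ℝ
  bel : Kernel Signal ℝ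
  sig_meas : Measurable sig
  act_meas : Measurable act
  bounded : ∃ K : ℝ≥0, (∀ θ, (sig θ).2 ≤ (K, K)) ∧ ∀ s, |act s| ≤ K
  prob : ∀ s, IsProbabilityMeasure (bel s)
  support : ∀ s, bel s (Icc 0 1) = 1
  bayes : E.prior.map (fun θ => (sig θ, θ)) = (E.prior.map sig).compProd bel
  fiber : ∀ θ ∈ Icc (0 : ℝ) 1, bel (sig θ) {θ' | θ' ∈ Icc (0 : ℝ) 1 ∧ sig θ' = sig θ} = 1
  ic : ∀ s, ∀ θ ∈ Icc (0 : ℝ) 1, E.uS (act s) θ - (s.2.1 + s.2.2) ≤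
    E.uS (act (sig θ)) θ - ((sig θ).2.1 + (sig θ).2.2)

section Modes

variable {E : Environment} {δ : ℝ}

/-- The record of a period in which a mode is played. -/
def Mode.record (M : Mode E) (θ : ℝ) : Record := (0, M.sig θ, 0, M.act (M.sig θ), 0)

noncomputable def Mode.pay (M : Mode E) (i : Player) : ℝ :=
  ∫ θ, stagePayoff E i θ (M.record θ) ∂E.prior

noncomputable def Mode.mean (M : Mode E) (s : Signal) : ℝ := ∫ θ, θ ∂M.bel s

theorem Mode.integrable_stage (M : Mode E) (i : Player) :
    Integrable (fun θ => stagePayoff E i θ (M.record θ)) E.prior := by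
  obtain ⟨K, h1, h2⟩ := M.bounded
  have := M.sig_meas
  have := M.act_meas
  refine RelComm.integrable_stage (K := K) (by unfold Mode.record; fun_prop) fun θ => ?_
  exact ⟨zero_le, zero_le, h1 θ, zero_le, h2 _, zero_le, zero_le⟩

theorem Mode.integrable_step (M : Mode E) (i : Player) (m k K : ℝ) :
    Integrable (fun θ => m * (stagePayoff E i θ (M.record θ) - k) + K) E.prior :=
  (((M.integrable_stage i).sub (integrable_const k)).const_mul m).add (integrable_const K)

theorem Mode.integral_step (M : Mode E) (i : Player) (m k K : ℝ) :
    ∫ θ, (m * (stagePayoff E i θ (M.record θ) - k) + K) ∂E.prior = m * (M.pay i - k) + K := by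
  have h : Integrable (fun θ => stagePayoff E i θ (M.record θ) - k) E.prior :=
    (M.integrable_stage i).sub (integrable_const k)
  rw [integral_add (h.const_mul m) (integrable_const K), integral_const_mul,
    integral_sub (M.integrable_stage i) (integrable_const k)]
  simp [Mode.pay]

theorem Mode.integrable_bel (M : Mode E) (s : Signal) : Integrable (fun t : ℝ => t) (M.bel s) := by
  have := M.prob s
  refine Integrable.of_bound measurable_id.aestronglyMeasurable 1 ?_
  filter_upwards [(mem_ae_iff_prob_eq_one measurableSet_Icc).2 (M.support s)] with t ht
  rw [Real.norm_eq_abs, abs_of_nonneg ht.1]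
  exact ht.2

theorem Mode.integral_mono (M : Mode E) {F G : Signal × ℝ → ℝ} (hF : Measurable F) (hG : Measurable G)
    (iF : Integrable (fun θ => F (M.sig θ, θ)) E.prior)
    (iG : Integrable (fun θ => G (M.sig θ, θ)) E.prior)
    (h : ∀ s, ∫ t, F (s, t) ∂M.bel s ≤ ∫ t, G (s, t) ∂M.bel s) :
    ∫ θ, F (M.sig θ, θ) ∂E.prior ≤ ∫ θ, G (M.sig θ, θ) ∂E.prior := by
  have hM : IsMarkovKernel M.bel := ⟨M.prob⟩
  have hp : Measurable fun θ => (M.sig θ, θ) := M.sig_meas.prodMk measurable_id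
  have key : ∀ {F : Signal × ℝ → ℝ}, Measurable F → Integrable (fun θ => F (M.sig θ, θ)) E.prior →
      Integrable F ((E.prior.map M.sig) ⊗ₘ M.bel) ∧
      ∫ θ, F (M.sig θ, θ) ∂E.prior = ∫ s, ∫ t, F (s, t) ∂M.bel s ∂(E.prior.map M.sig) := by
    intro F hF iF
    have hi : Integrable F ((E.prior.map M.sig) ⊗ₘ M.bel) := by
      rw [← M.bayes, integrable_map_measure hF.aestronglyMeasurable hp.aemeasurable]
      exact iF
    refine ⟨hi, ?_⟩
    rw [← Measure.integral_compProd hi, ← M.bayes,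
      integral_map hp.aemeasurable hF.aestronglyMeasurable]
  obtain ⟨a1, a2⟩ := key hF iF
  obtain ⟨b1, b2⟩ := key hG iG
  rw [a2, b2]
  have int : ∀ {F : Signal × ℝ → ℝ}, Integrable F ((E.prior.map M.sig) ⊗ₘ M.bel) →
      Integrable (fun s => ∫ t, F (s, t) ∂M.bel s) (E.prior.map M.sig) := fun hi => by
    simpa using Integrable.integral_compProd (κ := Kernel.const Unit (E.prior.map M.sig))
      (η := Kernel.prodMkLeft Unit M.bel) (a := ()) hi
  exact MeasureTheory.integral_mono (int a1) (int b1) h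

/-- The data of an equilibrium: in the cooperative phase the sender pays `T` and `C` is played, and
`C'` is played if he does not; a deviation from the decision starts the phase `N`. -/
structure Design (E : Environment) (δ : ℝ) where
  N : Mode E
  C : Mode E
  C' : Mode E
  T : ℝ≥0
  hδ : δ ∈ Ico (0 : ℝ) 1
  indiff : C.pay .sender = C'.pay .sender + T
  static : ∀ s, N.act s = E.prefR (N.mean s)
  enforce : ∀ s, (1 - δ) * E.temptation (C.act s) (C.mean s) ≤
    δ * (C.pay .receiver + T - N.pay .receiver)
  enforce' : ∀ s, (1 - δ) * E.temptation (C'.act s) (C'.mean s) ≤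
    δ * (C.pay .receiver + T - N.pay .receiver)

namespace Design

variable (A : Design E δ) (c : Prop) {n : ℕ}

open Classical in
/-- The mode played, given the phase and the sender's ex-ante payment. -/
noncomputable def mode (c : Prop) (p : Pay) : Mode E :=
  if c then if p = (A.T, 0) then A.C else A.C' else A.N

/-- Whether play is in the cooperative phase, when it starts in the phase `c`. -/
def coop : ∀ n, Hist n → Prop
  | 0, _ => c
  | n + 1, h => coop n (Fin.init (α := fun _ => Record) h) ∧ (h (Fin.last n)).2.2.2.1 =
      (A.mode (coop n (Fin.init (α := fun _ => Record) h)) (h (Fin.last n)).1.1).act (h (Fin.last n)).2.1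

open Classical in
/-- Values of the two phases. -/
noncomputable def val : Player → Prop → ℝ
  | .sender, c => if c then A.C'.pay .sender else A.N.pay .sender
  | .receiver, c => if c then A.C.pay .receiver + A.T else A.N.pay .receiver

variable {c} in
theorem val_receiver_pos (hc : c) : A.val .receiver c = A.C.pay .receiver + A.T := if_pos hc

variable {c} in
theorem val_receiver_neg (hc : ¬ c) : A.val .receiver c = A.N.pay .receiver := if_neg hc

variable {c} in
theorem val_sender_pos (hc : c) : A.val .sender c = A.C'.pay .sender := if_pos hc

variable {c} in
theorem val_sender_neg (hc : ¬ c) : A.val .sender c = A.N.pay .sender := if_neg hc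

theorem coop_extend (h : Hist n) (r : Record) : A.coop c (n + 1) (extend h r) ↔
    A.coop c n h ∧ r.2.2.2.1 = (A.mode (A.coop c n h) r.1.1).act r.2.1 := by
  simp only [coop, extend, Fin.init_snoc, Fin.snoc_last]

theorem measurable_mode {α γ : Type*} [MeasurableSpace α] [MeasurableSpace γ] {f : Mode E → α → γ}
    (hf : ∀ M, Measurable (f M)) {c : α → Prop} (hc : MeasurableSet {z | c z}) {p : α → Pay}
    (hp : Measurable p) : Measurable fun z => f (A.mode (c z) (p z)) z := by
  classical
  have e : (fun z => f (A.mode (c z) (p z)) z) = fun z =>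
      if c z then if p z = (A.T, 0) then f A.C z else f A.C' z else f A.N z := by
    funext z; unfold mode; split_ifs <;> rfl
  rw [e]
  exact Measurable.ite hc (Measurable.ite (hp (measurableSet_singleton _)) (hf _) (hf _)) (hf _)

theorem measurableSet_coop : ∀ n, MeasurableSet {h : Hist n | A.coop c n h}
  | 0 => MeasurableSet.const c
  | n + 1 => by
    have hi : Measurable fun h : Hist (n + 1) => Fin.init (α := fun _ => Record) h :=
      measurable_pi_iff.2 fun j => measurable_pi_apply _
    have hl : Measurable fun h : Hist (n + 1) => h (Fin.last n) := measurable_pi_apply _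
    have hc := hi (measurableSet_coop n)
    refine hc.inter (measurableSet_eq_fun (by fun_prop) ?_)
    exact A.measurable_mode (f := fun M (h : Hist (n + 1)) => M.act (h (Fin.last n)).2.1)
      (fun M => M.act_meas.comp (by fun_prop)) hc (by fun_prop)

theorem exists_mode_bound : ∃ K : ℝ≥0, ∀ c p, (∀ θ, ((A.mode c p).sig θ).2 ≤ (K, K)) ∧
    ∀ s, |(A.mode c p).act s| ≤ K := by
  obtain ⟨K1, a1, a2⟩ := A.N.bounded
  obtain ⟨K2, b1, b2⟩ := A.C.bounded
  obtain ⟨K3, c1, c2⟩ := A.C'.bounded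
  have key : ∀ {K : ℝ≥0}, K ≤ max K1 (max K2 K3) →
      ((K, K) : Pay) ≤ (max K1 (max K2 K3), max K1 (max K2 K3)) := fun h => ⟨h, h⟩
  refine ⟨max K1 (max K2 K3), fun c p => ?_⟩
  have h1 : K1 ≤ max K1 (max K2 K3) := le_max_left _ _
  have h2 : K2 ≤ max K1 (max K2 K3) := (le_max_left _ _).trans (le_max_right _ _)
  have h3 : K3 ≤ max K1 (max K2 K3) := (le_max_right _ _).trans (le_max_right _ _)
  unfold mode
  split_ifs
  · exact ⟨fun θ => (b1 θ).trans (key h2), fun s => (b2 s).trans (NNReal.coe_le_coe.2 h2)⟩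
  · exact ⟨fun θ => (c1 θ).trans (key h3), fun s => (c2 s).trans (NNReal.coe_le_coe.2 h3)⟩
  · exact ⟨fun θ => (a1 θ).trans (key h1), fun s => (a2 s).trans (NNReal.coe_le_coe.2 h1)⟩

open Classical in
/-- The sender's equilibrium strategy. -/
noncomputable def senderPlay : SenderStrategy where
  exAnte n h := if A.coop c n h then (A.T, 0) else 0
  signal n z := (A.mode (A.coop c n z.1) z.2.1.1).sig z.2.2
  exPost _ _ := 0
  exAnte_meas n := Measurable.ite (A.measurableSet_coop c n) measurable_const measurable_const
  signal_meas n := A.measurable_mode (f := fun M (z : Hist n × (Pay × Pay) × ℝ) => M.sig z.2.2)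
    (fun M => M.sig_meas.comp (by fun_prop)) (measurable_fst (A.measurableSet_coop c n)) (by fun_prop)
  exPost_meas _ := measurable_const
  bounded := by
    obtain ⟨K, hK⟩ := A.exists_mode_bound
    refine ⟨max K A.T, fun n z => ?_, fun n z => ((hK _ _).1 _).trans ⟨le_max_left _ _, le_max_left _ _⟩,
      fun _ _ => zero_le⟩
    split_ifs
    · exact ⟨le_max_right _ _, zero_le⟩
    · exact zero_le

/-- The receiver's equilibrium strategy. -/
noncomputable def receiverPlay : ReceiverStrategy where
  exAnte _ _ := 0
  interim _ _ := 0
  decision n z := (A.mode (A.coop c n z.1) z.2.1.1).act z.2.2.1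
  exPost _ _ := 0
  exAnte_meas _ := measurable_const
  interim_meas _ := measurable_const
  decision_meas n := A.measurable_mode
    (f := fun M (z : Hist n × (Pay × Pay) × Signal × Pay) => M.act z.2.2.1)
    (fun M => M.act_meas.comp (by fun_prop)) (measurable_fst (A.measurableSet_coop c n)) (by fun_prop)
  exPost_meas _ := measurable_const
  bounded := by
    obtain ⟨K, hK⟩ := A.exists_mode_bound
    exact ⟨K, fun _ _ => zero_le, fun _ _ => zero_le, fun _ _ => (hK _ _).2 _, fun _ _ => zero_le⟩

noncomputable def play : Profile := ⟨A.senderPlay c, A.receiverPlay c⟩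

noncomputable def beliefs : Beliefs := fun n h x => (A.mode (A.coop c n h) x.1).bel

theorem consistent : Consistent E (A.play c) (A.beliefs c) where
  prob n h x s := (A.mode (A.coop c n h) x.1).prob s
  support n h x s := (A.mode (A.coop c n h) x.1).support s
  bayes n h x := (A.mode (A.coop c n h) x.1).bayes
  fiber n h x := (A.mode (A.coop c n h) x.1).fiber

theorem measurable_val (i : Player) (n : ℕ) : Measurable fun h : Hist n => A.val i (A.coop c n h) := by
  cases i <;>
  exact Measurable.ite (A.measurableSet_coop c n) measurable_const measurable_const

theorem exists_val_bound (i : Player) : ∃ B, ∀ c, |A.val i c| ≤ B := by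
  refine ⟨max |A.val i True| |A.val i False|, fun c => ?_⟩
  by_cases h : c <;> simp [h]

theorem static_le (c : Prop) (p : Pay) (s : Signal) (d : ℝ) :
    (1 - δ) * E.uR d ((A.mode c p).mean s) + δ * A.val .receiver (c ∧ d = (A.mode c p).act s) ≤
      (1 - δ) * E.uR ((A.mode c p).act s) ((A.mode c p).mean s) + δ * A.val .receiver c := by
  have hδ1 : 0 ≤ 1 - δ := by linarith [A.hδ.2]
  by_cases hc : c
  · by_cases hd : d = (A.mode c p).act s
    · rw [show (c ∧ d = (A.mode c p).act s) = c from propext (and_iff_left hd), ← hd]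
    · have h1 : (1 - δ) * E.temptation ((A.mode c p).act s) ((A.mode c p).mean s) ≤
          δ * (A.C.pay .receiver + A.T - A.N.pay .receiver) := by
        unfold mode; rw [if_pos hc]
        split_ifs
        exacts [A.enforce s, A.enforce' s]
      have h2 := mul_le_mul_of_nonneg_left (E.uR_le_prefR d ((A.mode c p).mean s)) hδ1
      unfold Environment.temptation at h1
      rw [A.val_receiver_pos hc, A.val_receiver_neg fun h => hd h.2]
      linarith
  · have h1 : (A.mode c p).act s = E.prefR ((A.mode c p).mean s) := by
      unfold mode; rw [if_neg hc]; exact A.static s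
    have h2 := mul_le_mul_of_nonneg_left (E.uR_le_prefR d ((A.mode c p).mean s)) hδ1
    rw [A.val_receiver_neg hc, A.val_receiver_neg fun h => hc h.1, h1]
    linarith

section Sender

variable (S' : SenderStrategy) (h : Hist n)

theorem coop_fromSignal (x : Pay × Pay) (θ : ℝ) :
    A.coop c (n + 1) (extend h (Profile.fromSignal ⟨S', A.receiverPlay c⟩ h x θ)) ↔ A.coop c n h := by
  rw [coop_extend]
  exact and_iff_left rfl

theorem net_zero_zero : net 0 0 = 0 := by simp [net]

theorem net_zero_right (p : Pay) : net p 0 = p.1 + p.2 := by simp [net]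

theorem net_zero_right_nonneg (p : Pay) : 0 ≤ net p 0 := by
  rw [net_zero_right]; positivity

theorem stage_sender_record (M : Mode E) (θ : ℝ) : stagePayoff E .sender θ (M.record θ) =
    E.uS (M.act (M.sig θ)) θ - ((M.sig θ).2.1 + (M.sig θ).2.2) := by
  have : stagePayoff E .sender θ (M.record θ) =
    E.uS (M.act (M.sig θ)) θ - (net 0 0 + net (M.sig θ).2 0 + net 0 0) := rfl
  rw [this, net_zero_zero, net_zero_right]; ring

theorem stage_sender_le (x : Pay × Pay) {θ : ℝ} (hθ : θ ∈ Icc (0:ℝ) 1) :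
    stagePayoff E .sender θ (Profile.fromSignal ⟨S', A.receiverPlay c⟩ h x θ) ≤
      stagePayoff E .sender θ ((A.mode (A.coop c n h) x.1).record θ) - net x.1 x.2 := by
  set M := A.mode (A.coop c n h) x.1
  set s := S'.signal n (h, x, θ)
  obtain ⟨y, hy⟩ : ∃ y, stagePayoff E .sender θ (Profile.fromSignal ⟨S', A.receiverPlay c⟩ h x θ) =
    E.uS (M.act s) θ - (net x.1 x.2 + net s.2 0 + net y 0) := ⟨_, rfl⟩
  rw [hy, stage_sender_record, net_zero_right s.2]
  linarith [M.ic s θ hθ, net_zero_right_nonneg y]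

theorem stage_sender_eq (x : Pay × Pay) (θ : ℝ) :
    stagePayoff E .sender θ ((A.play c).fromSignal h x θ) =
      stagePayoff E .sender θ ((A.mode (A.coop c n h) x.1).record θ) - net x.1 x.2 := by
  have : stagePayoff E .sender θ ((A.play c).fromSignal h x θ) =
    E.uS ((A.mode (A.coop c n h) x.1).act ((A.mode (A.coop c n h) x.1).sig θ)) θ -
      (net x.1 x.2 + net ((A.mode (A.coop c n h) x.1).sig θ).2 0 + net 0 0) := rfl
  rw [this, stage_sender_record, net_zero_right, net_zero_zero]; ring

theorem pay_sender_le (c : Prop) (p : Pay) :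
    (A.mode c p).pay .sender - net p 0 ≤ A.val .sender c := by
  have h0 := net_zero_right_nonneg p
  by_cases hc : c
  · rw [A.val_sender_pos hc, mode, if_pos hc]
    split_ifs with hp
    · rw [hp, net_zero_right, A.indiff]; simp
    · linarith
  · rw [A.val_sender_neg hc, mode, if_neg hc]
    linarith

theorem value_sender_le : value E δ ⟨S', A.receiverPlay c⟩ .sender h ≤ A.val .sender (A.coop c n h) := by
  obtain ⟨B, hB⟩ := A.exists_val_bound .sender
  refine value_le_of_step A.hδ (V := fun n h => A.val .sender (A.coop c n h))
    (A.measurable_val c .sender) (fun n h => hB _) (fun n h => ?_) h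
  have hδ1 : 0 ≤ 1 - δ := by linarith [A.hδ.2]
  obtain ⟨K, hK, -⟩ := exists_bddRecord ⟨S', A.receiverPlay c⟩
  set x : Pay × Pay := (S'.exAnte n h, 0)
  have e : ∀ θ, A.val .sender (A.coop c (n + 1)
      (extend h (Profile.period ⟨S', A.receiverPlay c⟩ h θ))) = A.val .sender (A.coop c n h) :=
    fun θ => congrArg _ (propext (A.coop_fromSignal c S' h x θ))
  simp only [e]
  set M := A.mode (A.coop c n h) x.1
  have h1 := integral_mono_ae (μ := E.prior)
    (((integrable_stage (E := E) (i := .sender) (measurable_period_right ⟨S', A.receiverPlay c⟩ h)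
      (hK n h)).const_mul (1 - δ)).add (integrable_const (δ * A.val .sender (A.coop c n h))))
    (M.integrable_step .sender (1 - δ) (net x.1 x.2) (δ * A.val .sender (A.coop c n h))) (by
        filter_upwards [ae_mem E] with θ hθ
        exact add_le_add_left (mul_le_mul_of_nonneg_left (A.stage_sender_le c S' h x hθ) hδ1) _)
  refine h1.trans ?_
  rw [M.integral_step]
  have := mul_le_mul_of_nonneg_left (A.pay_sender_le (A.coop c n h) x.1) hδ1
  change (1 - δ) * (M.pay .sender - net x.1 0) + _ ≤ _
  linarith

theorem value_sender : value E δ (A.play c) .sender h = A.val .sender (A.coop c n h) := by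
  refine le_antisymm (A.value_sender_le c _ h) ?_
  obtain ⟨B, hB⟩ := A.exists_val_bound .sender
  refine le_value_of_step A.hδ (V := fun n h => A.val .sender (A.coop c n h))
    (A.measurable_val c .sender) (fun n h => hB _) (fun n h => ?_) h
  set x : Pay × Pay := ((A.play c).S.exAnte n h, 0) with hx
  have e : ∀ θ, A.val .sender (A.coop c (n + 1)
      (extend h ((A.play c).period h θ))) = A.val .sender (A.coop c n h) :=
    fun θ => congrArg _ (propext (A.coop_fromSignal c _ h x θ))
  have e' : ∀ θ, stagePayoff E .sender θ ((A.play c).period h θ) = _ := A.stage_sender_eq c h x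
  simp only [e, e']
  set M := A.mode (A.coop c n h) x.1 with hM
  rw [M.integral_step]
  have h1 : M.pay .sender - net x.1 0 = A.val .sender (A.coop c n h) := by
    by_cases hc : A.coop c n h
    · have : x.1 = (A.T, 0) := by simp [hx, play, senderPlay, hc]
      rw [hM, this]
      simp [mode, hc, val, A.indiff, net_zero_right]
    · have : x.1 = 0 := by simp [hx, play, senderPlay, hc]
      rw [hM, this]
      simp [mode, hc, val, net_zero_zero]
  change _ ≤ (1 - δ) * (M.pay .sender - net x.1 0) + _
  rw [h1]
  linarith

end Sender

section Receiver

variable (R' : ReceiverStrategy) (h : Hist n)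

theorem decision_le (x : Pay × Pay) (s : Signal) (r : Pay) :
    (1 - δ) * stagePayoff E .receiver ((A.mode (A.coop c n h) x.1).mean s)
        (Profile.fromDecision ⟨A.senderPlay c, R'⟩ h x s r) +
      δ * A.val .receiver (A.coop c (n + 1)
        (extend h (Profile.fromDecision ⟨A.senderPlay c, R'⟩ h x s r))) ≤
    (1 - δ) * (E.uR ((A.mode (A.coop c n h) x.1).act s) ((A.mode (A.coop c n h) x.1).mean s) -
      (net x.2 x.1 + net r s.2)) + δ * A.val .receiver (A.coop c n h) := by
  have hδ1 : 0 ≤ 1 - δ := by linarith [A.hδ.2]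
  obtain ⟨y, hy⟩ : ∃ y, Profile.fromDecision ⟨A.senderPlay c, R'⟩ h x s r =
    (x, s, r, R'.decision n (h, x, s, r), (0, y)) := ⟨_, rfl⟩
  rw [hy]
  have e : stagePayoff E .receiver ((A.mode (A.coop c n h) x.1).mean s)
      (x, s, r, R'.decision n (h, x, s, r), (0, y)) = E.uR (R'.decision n (h, x, s, r))
      ((A.mode (A.coop c n h) x.1).mean s) - (net x.2 x.1 + net r s.2 + net y 0) := rfl
  rw [e, propext (A.coop_extend c h _)]
  have h1 := A.static_le (A.coop c n h) x.1 s (R'.decision n (h, x, s, r))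
  have h2 := mul_nonneg hδ1 (net_zero_right_nonneg y)
  linarith

theorem decision_eq (x : Pay × Pay) (s : Signal) (r : Pay) (θ : ℝ) :
    (1 - δ) * stagePayoff E .receiver θ ((A.play c).fromDecision h x s r) +
      δ * A.val .receiver (A.coop c (n + 1) (extend h ((A.play c).fromDecision h x s r))) =
    (1 - δ) * (E.uR ((A.mode (A.coop c n h) x.1).act s) θ -
      (net x.2 x.1 + net r s.2)) + δ * A.val .receiver (A.coop c n h) := by
  have e : stagePayoff E .receiver θ ((A.play c).fromDecision h x s r) =
    E.uR ((A.mode (A.coop c n h) x.1).act s) θ - (net x.2 x.1 + net r s.2 + net 0 0) := rfl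
  have e' : A.coop c (n + 1) (extend h ((A.play c).fromDecision h x s r)) ↔ A.coop c n h := by
    rw [coop_extend]; exact and_iff_left rfl
  rw [e, propext e', net_zero_zero, add_zero]

theorem net_ge (p q : Pay) : net 0 q ≤ net p q := by
  have h1 : (0:ℝ) ≤ p.1 := p.1.2
  have h2 : (0:ℝ) ≤ p.2 := p.2.2
  simp only [net, Prod.fst_zero, Prod.snd_zero, NNReal.coe_zero]; linarith

theorem exAnte_receiver_le (p : Pay) :
    ∫ θ, ((1 - δ) * stagePayoff E .receiver θ (Profile.fromExAnteR ⟨A.senderPlay c, R'⟩ h p θ) +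
      δ * A.val .receiver (A.coop c (n + 1)
        (extend h (Profile.fromExAnteR ⟨A.senderPlay c, R'⟩ h p θ)))) ∂E.prior ≤
    (1 - δ) * ((A.mode (A.coop c n h) p).pay .receiver - net 0 p) +
      δ * A.val .receiver (A.coop c n h) := by
  have hδ1 : 0 ≤ 1 - δ := by linarith [A.hδ.2]
  set M := A.mode (A.coop c n h) p with hM
  set τ : Profile := ⟨A.senderPlay c, R'⟩ with hτ
  set x : Pay × Pay := (p, R'.exAnte n (h, p)) with hx
  let F : Signal × ℝ → ℝ := fun z => (1 - δ) * stagePayoff E .receiver z.2 (τ.fromInterimR h x z.1) +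
    δ * A.val .receiver (A.coop c (n + 1) (extend h (τ.fromInterimR h x z.1)))
  let G : Signal × ℝ → ℝ := fun z => (1 - δ) * stagePayoff E .receiver z.2
    (((p, 0), z.1, 0, M.act z.1, 0) : Record) + δ * A.val .receiver (A.coop c n h)
  have hr : Measurable fun s : Signal => τ.fromInterimR h x s :=
    (measurable_fromInterimR τ n).comp (measurable_const.prodMk (measurable_const.prodMk measurable_id))
  have hr' : Measurable fun s : Signal => (((p, 0), s, 0, M.act s, 0) : Record) := by
    have := M.act_meas
    fun_prop
  have hv : Measurable fun s : Signal =>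
      A.val .receiver (A.coop c (n + 1) (extend h (τ.fromInterimR h x s))) :=
    (A.measurable_val c .receiver (n + 1)).comp (measurable_extend.comp (measurable_const.prodMk hr))
  have hF : Measurable F := (((measurable_stagePayoff .receiver).comp
    (measurable_snd.prodMk (hr.comp measurable_fst))).const_mul _).add
    ((hv.comp measurable_fst).const_mul _)
  have hG : Measurable G := (((measurable_stagePayoff .receiver).comp
    (measurable_snd.prodMk (hr'.comp measurable_fst))).const_mul _).add measurable_const
  obtain ⟨B, hB⟩ := A.exists_val_bound .receiver
  obtain ⟨K, hK⟩ := exists_bddRecord_fromSignal τ h x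
  have iF : Integrable (fun θ => F (M.sig θ, θ)) E.prior := by
    refine ((integrable_stage (measurable_fromSignal_right τ h x) hK).const_mul _).add
      (Integrable.const_mul ?_ _)
    exact integrable_of_bdd E (hv.comp M.sig_meas).aestronglyMeasurable fun θ _ => hB _
  have e : ∀ θ, stagePayoff E .receiver θ (((p, 0), M.sig θ, 0, M.act (M.sig θ), 0) : Record) =
      stagePayoff E .receiver θ (M.record θ) - net 0 p := by
    intro θ
    have e1 : stagePayoff E .receiver θ (((p, 0), M.sig θ, 0, M.act (M.sig θ), 0) : Record) =
      E.uR (M.act (M.sig θ)) θ - (net 0 p + net 0 (M.sig θ).2 + net 0 0) := rfl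
    have e2 : stagePayoff E .receiver θ (M.record θ) =
      E.uR (M.act (M.sig θ)) θ - (net 0 0 + net 0 (M.sig θ).2 + net 0 0) := rfl
    rw [e1, e2, net_zero_zero]; ring
  have iG : Integrable (fun θ => G (M.sig θ, θ)) E.prior := by
    simp only [G, e]
    exact M.integrable_step ..
  have h1 := M.integral_mono hF hG iF iG fun s => by
    have := M.prob s
    simp only [F, G]
    rw [integral_stage_receiver (M.integrable_bel s), integral_stage_receiver (M.integrable_bel s)]
    refine (A.decision_le c R' h x s (R'.interim n (h, x, s))).trans ?_
    have e1 : stagePayoff E .receiver (∫ t, t ∂M.bel s) (((p, 0), s, 0, M.act s, 0) : Record) =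
      E.uR (M.act s) (M.mean s) - (net 0 p + net 0 s.2 + net 0 0) := rfl
    rw [e1, net_zero_zero]
    have h2 := net_ge x.2 p
    have h3 := net_ge (R'.interim n (h, x, s)) s.2
    refine add_le_add_left (mul_le_mul_of_nonneg_left ?_ hδ1) _
    change E.uR (M.act s) (M.mean s) - (net x.2 p + net (R'.interim n (h, x, s)) s.2) ≤ _
    linarith
  refine h1.trans (le_of_eq ?_)
  simp only [G, e]
  exact M.integral_step ..

theorem exAnte_receiver_eq (p : Pay) :
    ∫ θ, ((1 - δ) * stagePayoff E .receiver θ ((A.play c).fromExAnteR h p θ) +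
      δ * A.val .receiver (A.coop c (n + 1) (extend h ((A.play c).fromExAnteR h p θ)))) ∂E.prior =
    (1 - δ) * ((A.mode (A.coop c n h) p).pay .receiver - net 0 p) +
      δ * A.val .receiver (A.coop c n h) := by
  set M := A.mode (A.coop c n h) p with hM
  have e : ∀ θ, (1 - δ) * stagePayoff E .receiver θ ((A.play c).fromExAnteR h p θ) +
      δ * A.val .receiver (A.coop c (n + 1) (extend h ((A.play c).fromExAnteR h p θ))) =
      (1 - δ) * (stagePayoff E .receiver θ (M.record θ) - net 0 p) +
        δ * A.val .receiver (A.coop c n h) := by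
    intro θ
    refine (A.decision_eq c h (p, 0) (M.sig θ) 0 θ).trans ?_
    have e2 : stagePayoff E .receiver θ (M.record θ) =
      E.uR (M.act (M.sig θ)) θ - (net 0 0 + net 0 (M.sig θ).2 + net 0 0) := rfl
    rw [e2, net_zero_zero]
    change (1 - δ) * (E.uR (M.act (M.sig θ)) θ - (net 0 p + net 0 (M.sig θ).2)) + _ = _
    ring
  rw [funext e]
  exact M.integral_step ..

theorem pay_receiver : (A.mode (A.coop c n h) ((A.play c).S.exAnte n h)).pay .receiver -
    net 0 ((A.play c).S.exAnte n h) = A.val .receiver (A.coop c n h) := by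
  by_cases hc : A.coop c n h
  · have : (A.play c).S.exAnte n h = (A.T, 0) := by simp [play, senderPlay, hc]
    rw [this]
    simp [mode, hc, val, net]
  · have : (A.play c).S.exAnte n h = 0 := by simp [play, senderPlay, hc]
    rw [this]
    simp [mode, hc, val, net_zero_zero]

theorem value_receiver_le :
    value E δ ⟨A.senderPlay c, R'⟩ .receiver h ≤ A.val .receiver (A.coop c n h) := by
  obtain ⟨B, hB⟩ := A.exists_val_bound .receiver
  refine value_le_of_step A.hδ (V := fun n h => A.val .receiver (A.coop c n h))
    (A.measurable_val c .receiver) (fun n h => hB _) (fun n h => ?_) h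
  refine (A.exAnte_receiver_le c R' h ((A.play c).S.exAnte n h)).trans (le_of_eq ?_)
  rw [A.pay_receiver]; ring

theorem value_receiver : value E δ (A.play c) .receiver h = A.val .receiver (A.coop c n h) := by
  refine le_antisymm (A.value_receiver_le c _ h) ?_
  obtain ⟨B, hB⟩ := A.exists_val_bound .receiver
  refine le_value_of_step A.hδ (V := fun n h => A.val .receiver (A.coop c n h))
    (A.measurable_val c .receiver) (fun n h => hB _) (fun n h => ?_) h
  refine le_of_eq (Eq.trans ?_ (A.exAnte_receiver_eq c h ((A.play c).S.exAnte n h)).symm)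
  rw [A.pay_receiver]; ring

end Receiver

theorem nodeValue_receiver_le (R' : ReceiverStrategy) (h : Hist n) (θ : ℝ) (r : Record) :
    nodeValue E δ ⟨A.senderPlay c, R'⟩ .receiver h θ r ≤ (1 - δ) * stagePayoff E .receiver θ r +
      δ * A.val .receiver (A.coop c (n + 1) (extend h r)) :=
  add_le_add_right (mul_le_mul_of_nonneg_left (A.value_receiver_le c R' _) A.hδ.1) _

theorem nodeValue_receiver (h : Hist n) (θ : ℝ) (r : Record) :
    nodeValue E δ (A.play c) .receiver h θ r = (1 - δ) * stagePayoff E .receiver θ r +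
      δ * A.val .receiver (A.coop c (n + 1) (extend h r)) := by
  rw [nodeValue, A.value_receiver]

theorem nodeValue_sender_le (S' : SenderStrategy) (h : Hist n) (θ : ℝ) (r : Record) :
    nodeValue E δ ⟨S', A.receiverPlay c⟩ .sender h θ r ≤ (1 - δ) * stagePayoff E .sender θ r +
      δ * A.val .sender (A.coop c (n + 1) (extend h r)) :=
  add_le_add_right (mul_le_mul_of_nonneg_left (A.value_sender_le c S' _) A.hδ.1) _

theorem nodeValue_sender (h : Hist n) (θ : ℝ) (r : Record) :
    nodeValue E δ (A.play c) .sender h θ r = (1 - δ) * stagePayoff E .sender θ r +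
      δ * A.val .sender (A.coop c (n + 1) (extend h r)) := by
  rw [nodeValue, A.value_sender]

theorem isPBE : IsPBE E δ (A.play c) (A.beliefs c) := by
  have hδ1 : 0 ≤ 1 - δ := by linarith [A.hδ.2]
  have hβ := A.consistent c
  refine ⟨hβ, fun n h S' => ?_, fun n h p R' => ?_, fun n h x S' θ hθ => ?_, fun n h x s R' => ?_,
    fun n h x s r R' => ?_, fun n h x s r d S' θ _ => ?_, fun n h x s r d p R' => ?_⟩
  · rw [A.value_sender]; exact A.value_sender_le c S' h
  · simp only [A.nodeValue_receiver]
    rw [A.exAnte_receiver_eq]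
    refine le_trans ?_ (A.exAnte_receiver_le c R' h p)
    set τ : Profile := ⟨A.senderPlay c, R'⟩
    obtain ⟨K, hK⟩ := exists_bddRecord_fromSignal τ h (p, R'.exAnte n (h, p))
    have hm := measurable_fromSignal_right τ h (p, R'.exAnte n (h, p))
    obtain ⟨B, hB⟩ := A.exists_val_bound .receiver
    refine integral_mono (integrable_nodeValue A.hδ τ .receiver h hm hK)
      (((integrable_stage hm hK).const_mul _).add (Integrable.const_mul (integrable_of_bdd E
        ((A.measurable_val c .receiver (n + 1)).comp (measurable_extend.comp
          (measurable_const.prodMk hm))).aestronglyMeasurable fun θ _ => hB _) _))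
      fun θ => A.nodeValue_receiver_le c R' h θ _
  · rw [A.nodeValue_sender]
    refine (A.nodeValue_sender_le c S' h θ _).trans ?_
    have e : A.coop c (n + 1) (extend h ((A.play c).fromSignal h x θ)) ↔ A.coop c n h :=
      A.coop_fromSignal c (A.senderPlay c) h x θ
    have e' : A.coop c (n + 1) (extend h (Profile.fromSignal ⟨S', (A.play c).R⟩ h x θ)) ↔
      A.coop c n h := A.coop_fromSignal c S' h x θ
    rw [propext e, propext e', A.stage_sender_eq]
    exact add_le_add_left (mul_le_mul_of_nonneg_left (A.stage_sender_le c S' h x hθ) hδ1) _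
  · rw [hβ.integral_nodeValue, hβ.integral_nodeValue, A.nodeValue_receiver]
    refine (A.nodeValue_receiver_le c R' h _ _).trans ?_
    refine (A.decision_le c R' h x s (R'.interim n (h, x, s))).trans ?_
    refine le_trans ?_ (A.decision_eq c h x s 0 _).ge
    refine add_le_add_left (mul_le_mul_of_nonneg_left ?_ hδ1) _
    have := net_ge (R'.interim n (h, x, s)) s.2
    change E.uR _ (meanBelief (A.beliefs c) h x s) - _ ≤ _
    linarith
  · rw [hβ.integral_nodeValue, hβ.integral_nodeValue, A.nodeValue_receiver]
    refine (A.nodeValue_receiver_le c R' h _ _).trans ?_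
    exact (A.decision_le c R' h x s r).trans (A.decision_eq c h x s r _).ge
  · rw [A.nodeValue_sender]
    refine (A.nodeValue_sender_le c S' h θ _).trans ?_
    rw [propext (A.coop_extend c h _), propext (A.coop_extend c h _)]
    refine add_le_add_left (mul_le_mul_of_nonneg_left ?_ hδ1) _
    change E.uS d θ - (net x.1 x.2 + net s.2 r + net _ 0) ≤
      E.uS d θ - (net x.1 x.2 + net s.2 r + net 0 0)
    have := net_ge (S'.exPost n (h, x, s, r, d)) 0
    linarith
  · rw [hβ.integral_nodeValue, hβ.integral_nodeValue, A.nodeValue_receiver]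
    refine (A.nodeValue_receiver_le c R' h _ _).trans ?_
    rw [propext (A.coop_extend c h _), propext (A.coop_extend c h _)]
    refine add_le_add_left (mul_le_mul_of_nonneg_left ?_ hδ1) _
    change E.uR d (meanBelief (A.beliefs c) h x s) - (net x.2 x.1 + net r s.2 + net _ p) ≤
      E.uR d (meanBelief (A.beliefs c) h x s) - (net x.2 x.1 + net r s.2 + net 0 p)
    have := net_ge (R'.exPost n (h, x, s, r, d, p)) p
    linarith

/-- The payoffs supported by the design bound the surplus from below. -/
theorem le_surplus : ((δ / (1 - δ) * (A.C.pay .sender + A.C.pay .receiver - A.C'.pay .sender -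
    A.N.pay .receiver) : ℝ) : EReal) ≤ surplus E δ := by
  have hκ : 0 ≤ δ / (1 - δ) := div_nonneg A.hδ.1 (by linarith [A.hδ.2])
  have hmem : ∀ c : Prop, (A.val .sender c, A.val .receiver c) ∈ equilibriumPayoffs E δ := fun c =>
    ⟨A.play c, A.beliefs c, A.isPBE c, by rw [A.value_sender, A.value_receiver]; rfl⟩
  have h1 : ((A.C.pay .sender + A.C.pay .receiver : ℝ) : EReal) ≤ bestJoint E δ := by
    have := le_iSup₂ (f := fun v (_ : v ∈ equilibriumPayoffs E δ) => ((v.1 + v.2 : ℝ) : EReal)) _ (hmem True)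
    refine le_trans (EReal.coe_le_coe_iff.2 ?_) this
    simp only [val, if_true, A.indiff]
    linarith
  have h2 : worstSender E δ ≤ ((A.C'.pay .sender : ℝ) : EReal) := by
    have := iInf₂_le (f := fun v (_ : v ∈ equilibriumPayoffs E δ) => ((v.1 : ℝ) : EReal)) _ (hmem True)
    rwa [A.val_sender_pos trivial] at this
  have h3 : worstReceiver E δ ≤ ((A.N.pay .receiver : ℝ) : EReal) := by
    have := iInf₂_le (f := fun v (_ : v ∈ equilibriumPayoffs E δ) => ((v.2 : ℝ) : EReal)) _ (hmem False)
    rwa [A.val_receiver_neg not_false] at this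
  unfold surplus
  rw [EReal.coe_mul]
  refine mul_le_mul_of_nonneg_left ?_ (EReal.coe_nonneg.2 hκ)
  rw [EReal.coe_sub, EReal.coe_sub]
  exact EReal.sub_le_sub (EReal.sub_le_sub h1 h2) h3

end Design

end Modes

/-! ### Babbling and monotone pooling as modes of play -/

section BeliefKernel

variable {E : Environment} {P : Set ℝ}

open Classical in
/-- The conditional distribution of the state given the posterior mean `m`. -/
noncomputable def condMean (E : Environment) (P : Set ℝ) (m : ℝ) : Measure ℝ :=
  if m ∈ P ∧ E.postMean P m = m then E.prior[|connectedComponentIn P m] else Measure.dirac m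

theorem countable_means (hP : IsPoolingSet P) : {m | m ∈ P ∧ E.postMean P m = m}.Countable := by
  refine ((countable_components hP).image fun C => bar E C).mono ?_
  rintro m ⟨h, h'⟩
  exact ⟨_, ⟨m, h, rfl⟩, (postMean_of_mem h).symm.trans h'⟩

theorem measurable_condMean (hP : IsPoolingSet P) : Measurable (condMean E P) := by
  refine Measure.measurable_of_measurable_coe _ fun B hB => ?_
  refine ((Measure.measurable_coe hB).comp Measure.measurable_dirac).measurable_of_countable_ne
    ((countable_means (E := E) hP).mono fun m hm => ?_)
  by_contra h
  exact hm (by rw [condMean, if_neg (show ¬ (m ∈ P ∧ E.postMean P m = m) from h)]; rfl)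

theorem condMean_pos {m : ℝ} (h : m ∈ P ∧ E.postMean P m = m) :
    condMean E P m = E.prior[|connectedComponentIn P m] := if_pos h

theorem condMean_neg {m : ℝ} (h : ¬ (m ∈ P ∧ E.postMean P m = m)) :
    condMean E P m = Measure.dirac m := if_neg h

instance isProbabilityMeasure_condMean [hP : Fact (IsPoolingSet P)] (m : ℝ) :
    IsProbabilityMeasure (condMean E P m) := by
  by_cases h : m ∈ P ∧ E.postMean P m = m
  · rw [condMean_pos h]
    exact cond_isProbabilityMeasure (hP.out.component_pos h.1).ne'
  · rw [condMean_neg h]; infer_instance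

theorem condMean_fiber (hP : IsPoolingSet P) {m : ℝ} (hm : m ∈ Icc (0:ℝ) 1) (h : E.postMean P m = m) :
    condMean E P m {t | t ∈ Icc (0:ℝ) 1 ∧ E.postMean P t = m} = 1 := by
  have := Fact.mk hP
  refine le_antisymm prob_le_one ?_
  by_cases hmP : m ∈ P
  · have h1 : condMean E P m (connectedComponentIn P m) = 1 := by
      rw [condMean_pos ⟨hmP, h⟩]
      exact cond_apply_self (hP.component_pos hmP).ne' (measure_ne_top _ _)
    rw [← h1]
    exact measure_mono fun t ht => ⟨hP.component_subset m ht, by rw [postMean_eq_of_mem ht, h]⟩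
  · rw [condMean_neg fun h => hmP h.1]
    exact (Measure.dirac_apply_of_mem (show m ∈ {t | t ∈ Icc (0:ℝ) 1 ∧ E.postMean P t = m} from
      ⟨hm, h⟩)).ge

theorem integral_condMean (m : ℝ) (h : E.postMean P m = m) :
    ∫ t, t ∂(condMean E P m) = m := by
  by_cases hmP : m ∈ P
  · rw [condMean_pos ⟨hmP, h⟩, ProbabilityTheory.cond, integral_smul_measure]
    conv_rhs => rw [← h, postMean_of_mem hmP, bar]
    rw [smul_eq_mul, ENNReal.toReal_inv, inv_mul_eq_div]
    rfl
  · rw [condMean_neg fun h => hmP h.1, integral_dirac]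

/-- The conditional distributions given the posterior mean average out to the prior. -/
theorem lintegral_condMean (hP : IsPoolingSet P) {S T : Set ℝ} (hS : MeasurableSet S)
    (hT : MeasurableSet T) :
    ∫⁻ θ in E.postMean P ⁻¹' S, condMean E P (E.postMean P θ) T ∂E.prior =
      E.prior (E.postMean P ⁻¹' S ∩ T) := by
  have := Fact.mk hP
  have hm := hP.postMean_measurable (E := E)
  have hB := hm hS
  have hk : Measurable fun θ => (condMean E P (E.postMean P θ)).real T :=
    ((Measure.measurable_coe hT).comp ((measurable_condMean hP).comp hm)).ennreal_toReal
  have ik : Integrable (fun θ => (condMean E P (E.postMean P θ)).real T) E.prior :=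
    integrable_of_bdd E hk.aestronglyMeasurable (C := 1) fun θ _ => by
      rw [abs_of_nonneg measureReal_nonneg]; exact measureReal_le_one
  have iT : Integrable (T.indicator fun _ => (1:ℝ)) E.prior := (integrable_const _).indicator hT
  have ig := (ik.sub iT).indicator hB
  have hz := integral_eq_zero_of_components hP ig
    (Eventually.of_forall fun θ hθ => by
      have e : (condMean E P (E.postMean P θ)).real T = T.indicator (fun _ => (1:ℝ)) θ := by
        rw [postMean_of_notMem hθ, condMean_neg fun h => hθ h.1, measureReal_def,
          Measure.dirac_apply' _ hT]
        by_cases h : θ ∈ T <;> simp [h]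
      by_cases hb : θ ∈ E.postMean P ⁻¹' S
      · rw [indicator_of_mem hb, Pi.sub_apply, e, sub_self]
      · rw [indicator_of_notMem hb])
    fun θ hθ => by
      have hC := measurableSet_component P θ
      have hpos := hP.component_pos (E := E) hθ
      by_cases hb : E.postMean P θ ∈ S
      · have e : ∀ t ∈ connectedComponentIn P θ, (E.postMean P ⁻¹' S).indicator
            ((fun θ => (condMean E P (E.postMean P θ)).real T) - T.indicator fun _ => (1:ℝ)) t =
            (condMean E P (E.postMean P θ)).real T - T.indicator (fun _ => (1:ℝ)) t := by
          intro t ht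
          have := postMean_eq_of_mem (E := E) ht
          rw [indicator_of_mem (show t ∈ E.postMean P ⁻¹' S by rw [mem_preimage, this]; exact hb),
            Pi.sub_apply, this]
        have hmem : E.postMean P θ ∈ connectedComponentIn P θ := by
          rw [postMean_of_mem hθ]; exact hP.bar_mem hθ
        rw [setIntegral_congr_fun hC e, integral_sub (integrable_const _) iT.integrableOn,
          condMean_pos ⟨connectedComponentIn_subset _ _ hmem, hP.postMean_postMean θ⟩,
          component_eq hmem, integral_indicator hT, Measure.restrict_restrict hT, measureReal_def,
          cond_apply hC, ENNReal.toReal_mul, ENNReal.toReal_inv]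
        simp only [integral_const, measureReal_restrict_apply_univ, smul_eq_mul, mul_one]
        have := (real_pos hpos).ne'
        simp only [measureReal_def] at this ⊢
        rw [mul_inv_cancel_left₀ this, inter_comm, sub_self]
      · refine setIntegral_eq_zero_of_forall_eq_zero fun t ht => indicator_of_notMem ?_ _
        rw [mem_preimage, postMean_eq_of_mem ht]
        exact hb
  rw [integral_indicator hB, integral_sub' ik.integrableOn iT.integrableOn, integral_indicator hT,
    Measure.restrict_restrict hT, sub_eq_zero] at hz
  simp only [integral_const, measureReal_restrict_apply_univ, smul_eq_mul, mul_one] at hz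
  have h1 : ∀ θ, condMean E P (E.postMean P θ) T =
      ENNReal.ofReal ((condMean E P (E.postMean P θ)).real T) := fun θ => by
    rw [measureReal_def, ENNReal.ofReal_toReal (measure_ne_top _ _)]
  simp only [h1]
  rw [← ofReal_integral_eq_lintegral_ofReal ik.integrableOn (Eventually.of_forall fun θ =>
    measureReal_nonneg), hz, measureReal_def, ENNReal.ofReal_toReal (measure_ne_top _ _), inter_comm]

end BeliefKernel

section Babbling

variable {E : Environment}

/-- The uninformative mode. -/
noncomputable def babbleMode (E : Environment) : Mode E where
  sig _ := 0
  act _ := E.prefR (mean E)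
  bel := Kernel.const _ E.prior
  sig_meas := measurable_const
  act_meas := measurable_const
  bounded := ⟨|E.prefR (mean E)|.toNNReal, fun _ => zero_le, fun _ => Real.le_coe_toNNReal _⟩
  prob _ := isProbabilityMeasure_prior E
  support _ := prior_Icc E
  bayes := by
    rw [Measure.compProd_const, Measure.map_const, measure_univ, one_smul, Measure.dirac_prod]
  fiber θ _ := by
    simp only [and_true]; exact prior_Icc E
  ic s θ _ := by
    have h1 : (0:ℝ) ≤ s.2.1 := s.2.1.2
    have h2 : (0:ℝ) ≤ s.2.2 := s.2.2.2
    simp; linarith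

theorem babbleMode_pay : (babbleMode E).pay .receiver = babble E := by
  have e : ∀ θ, stagePayoff E .receiver θ ((babbleMode E).record θ) = E.uR (E.prefR (mean E)) θ := by
    intro θ
    have : stagePayoff E .receiver θ ((babbleMode E).record θ) =
      E.uR (E.prefR (mean E)) θ - (net 0 0 + net 0 0 + net 0 0) := rfl
    rw [this]; simp [net]
  rw [Mode.pay, funext e, integral_uR]; rfl

end Babbling

section Pooling

/-- A monotone pooling rule and a decision for each posterior mean within `ℓ` of the receiver's
preferred one. -/
structure PoolRule (E : Environment) where
  P : Set ℝ
  isPool : IsPoolingSet P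
  dec : ℝ → ℝ
  mono : Monotone dec
  ℓ : ℝ
  nonneg : 0 ≤ ℓ
  close : ∀ x, |dec x - E.prefR x| ≤ ℓ

namespace PoolRule

variable {E : Environment} (A : PoolRule E)

/-- The decision in each state. -/
noncomputable def rule (t : ℝ) : ℝ := A.dec (E.postMean A.P t)

noncomputable def area (θ : ℝ) : ℝ := ∫ t in (0:ℝ)..θ, A.rule t

/-- The sender's interim payoff in the state `0`: the lower of the payoffs that make the worst
off-path decisions unattractive. -/
noncomputable def base : ℝ :=
  min (E.uS (E.b - A.ℓ) 0) (E.uS (E.a + E.b + A.ℓ) 1 - wt E * A.area 1)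

/-- The sender's interim payoff. -/
noncomputable def interim (θ : ℝ) : ℝ := A.base + wt E * A.area θ

/-- The sender's payment when he reveals the mean state `m`. -/
noncomputable def fee (m : ℝ) : ℝ≥0 := (E.uS (A.dec m) m - A.interim m).toNNReal

theorem rule_mono : Monotone A.rule := A.mono.comp A.isPool.postMean_mono

theorem integrable_rule (x y : ℝ) : IntervalIntegrable A.rule volume x y := A.rule_mono.intervalIntegrable

theorem area_sub (x y : ℝ) : A.area y - A.area x = ∫ t in x..y, A.rule t :=
  intervalIntegral.integral_interval_sub_left (A.integrable_rule _ _) (A.integrable_rule _ _)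

theorem continuous_area : Continuous A.area :=
  intervalIntegral.continuous_primitive (fun x y => A.integrable_rule x y) 0

theorem area_tangent (x y : ℝ) : A.rule x * (y - x) ≤ A.area y - A.area x := by
  rw [A.area_sub]
  rcases le_total x y with h | h
  · have := intervalIntegral.integral_mono_on h (by simp) (A.integrable_rule x y)
      (f := fun _ => A.rule x) fun t ht => A.rule_mono ht.1
    simp at this; linarith
  · have := intervalIntegral.integral_mono_on h (A.integrable_rule y x) (by simp)
      (g := fun _ => A.rule x) fun t ht => A.rule_mono ht.2
    rw [intervalIntegral.integral_symm]
    simp at this; linarith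

theorem rule_mem {t : ℝ} (ht : t ∈ Icc (0:ℝ) 1) :
    E.b - A.ℓ ≤ A.rule t ∧ A.rule t ≤ E.a + E.b + A.ℓ := by
  have h1 := abs_le.1 (A.close (E.postMean A.P t))
  have h2 := A.isPool.postMean_mem (E := E) ht
  have ha := E.a_pos
  unfold Environment.prefR at h1
  unfold rule
  constructor <;> nlinarith [mul_nonneg ha.le h2.1, mul_le_mul_of_nonneg_left h2.2 ha.le]

theorem area_zero : A.area 0 = 0 := intervalIntegral.integral_same

theorem uS_sub (y s t : ℝ) : E.uS y t - E.uS y s = wt E * y * (t - s) := by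
  unfold Environment.uS Environment.u Environment.uR wt; ring

theorem fee_eq {θ₀ : ℝ} (H : Crossing E θ₀) {m : ℝ} (hm : m ∈ Icc (0:ℝ) 1) (h : E.postMean A.P m = m) :
    (A.fee m : ℝ) = E.uS (A.dec m) m - A.interim m := by
  refine Real.coe_toNNReal _ (sub_nonneg.2 ?_)
  have hr : A.rule m = A.dec m := by rw [rule, h]
  have hw := wt_pos (E := E)
  obtain ⟨b1, b2⟩ := A.rule_mem hm
  have t1 := mul_le_mul_of_nonneg_left (A.area_tangent m 0) hw.le
  have t2 := mul_le_mul_of_nonneg_left (A.area_tangent m 1) hw.le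
  rw [A.area_zero] at t1
  rw [hr] at b1 b2 t1 t2
  unfold interim base
  rcases H.silence_dichotomy A.nonneg b1 b2 with h1 | h1
  · have := min_le_left (E.uS (E.b - A.ℓ) 0) (E.uS (E.a + E.b + A.ℓ) 1 - wt E * A.area 1)
    linarith [uS_sub (E := E) (A.dec m) 0 m]
  · have := min_le_right (E.uS (E.b - A.ℓ) 0) (E.uS (E.a + E.b + A.ℓ) 1 - wt E * A.area 1)
    linarith [uS_sub (E := E) (A.dec m) 1 m]

/-- The signals sent on the path. -/
def onPath : Set Signal :=
  {s | s.1 ∈ Icc (0:ℝ) 1 ∧ E.postMean A.P s.1 = s.1 ∧ s.2 = (A.fee s.1, 0)}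

theorem measurable_fee : Measurable A.fee := by
  have h1 := A.mono.measurable
  have h2 := A.continuous_area.measurable
  unfold fee interim Environment.uS Environment.u Environment.uR
  fun_prop

theorem measurableSet_onPath : MeasurableSet A.onPath := by
  have h1 := A.isPool.postMean_measurable (E := E)
  have h2 := A.measurable_fee
  exact (measurable_fst measurableSet_Icc).inter ((measurableSet_eq_fun (by fun_prop)
    (by fun_prop)).inter (measurableSet_eq_fun (by fun_prop) (by fun_prop)))

/-- The posterior mean in the state closest to `θ`. -/
noncomputable def msg (θ : ℝ) : ℝ := E.postMean A.P (max 0 (min θ 1))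

theorem msg_eq {θ : ℝ} (h : θ ∈ Icc (0:ℝ) 1) : A.msg θ = E.postMean A.P θ := by
  rw [msg, min_eq_left h.2, max_eq_right h.1]

theorem msg_mem (θ : ℝ) : A.msg θ ∈ Icc (0:ℝ) 1 :=
  A.isPool.postMean_mem ⟨le_max_left _ _, max_le zero_le_one (min_le_right _ _)⟩

theorem measurable_msg : Measurable A.msg :=
  (A.isPool.postMean_measurable (E := E)).comp (by fun_prop)

theorem postMean_msg (θ : ℝ) : E.postMean A.P (A.msg θ) = A.msg θ := A.isPool.postMean_postMean _

noncomputable def sig (θ : ℝ) : Signal := (A.msg θ, (A.fee (A.msg θ), 0))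

theorem sig_mem (θ : ℝ) : A.sig θ ∈ A.onPath := ⟨A.msg_mem θ, A.postMean_msg θ, rfl⟩

open Classical in
/-- The belief and the decision after signals that are never sent. -/
noncomputable def punish : ℝ × ℝ :=
  if E.uS (E.b - A.ℓ) 0 ≤ E.uS (E.a + E.b + A.ℓ) 1 - wt E * A.area 1 then (0, E.b - A.ℓ)
  else (1, E.a + E.b + A.ℓ)

theorem punish_mem : A.punish.1 ∈ Icc (0:ℝ) 1 := by unfold punish; split_ifs <;> simp

theorem punish_close : |A.punish.2 - E.prefR A.punish.1| ≤ A.ℓ := by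
  unfold punish Environment.prefR
  split_ifs
  · simp [abs_of_nonneg A.nonneg]
  · rw [show E.a + E.b + A.ℓ - (E.a * 1 + E.b) = A.ℓ by ring, abs_of_nonneg A.nonneg]

theorem punish_le {θ : ℝ} (hθ : θ ∈ Icc (0:ℝ) 1) : E.uS A.punish.2 θ ≤ A.interim θ := by
  have hw := wt_pos (E := E)
  unfold punish interim base
  split_ifs with h
  · rw [min_eq_left h]
    have h1 := intervalIntegral.integral_mono_on hθ.1 (by simp) (A.integrable_rule 0 θ)
      (f := fun _ => E.b - A.ℓ) fun t ht => (A.rule_mem ⟨ht.1, ht.2.trans hθ.2⟩).1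
    simp only [intervalIntegral.integral_const, smul_eq_mul, sub_zero] at h1
    have h2 := mul_le_mul_of_nonneg_left h1 hw.le
    have := uS_sub (E := E) (E.b - A.ℓ) 0 θ
    change _ ≤ _ + wt E * ∫ t in (0:ℝ)..θ, A.rule t
    linarith
  · rw [min_eq_right (not_le.1 h).le]
    have h1 := intervalIntegral.integral_mono_on hθ.2 (A.integrable_rule θ 1) (by simp)
      (g := fun _ => E.a + E.b + A.ℓ) fun t ht => (A.rule_mem ⟨hθ.1.trans ht.1, ht.2⟩).2
    rw [← A.area_sub] at h1
    simp only [intervalIntegral.integral_const, smul_eq_mul] at h1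
    have h2 := mul_le_mul_of_nonneg_left h1 hw.le
    have := uS_sub (E := E) (E.a + E.b + A.ℓ) 1 θ
    change E.uS (E.a + E.b + A.ℓ) θ ≤ _
    linarith

open Classical in
noncomputable def act (s : Signal) : ℝ := if s ∈ A.onPath then A.dec s.1 else A.punish.2

theorem act_of_mem {s : Signal} (h : s ∈ A.onPath) : A.act s = A.dec s.1 := if_pos h

theorem signal_payoff {θ₀ : ℝ} (H : Crossing E θ₀) {s : Signal} (hs : s ∈ A.onPath) (θ : ℝ) :
    E.uS (A.act s) θ - (s.2.1 + s.2.2) = A.interim s.1 + wt E * A.rule s.1 * (θ - s.1) := by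
  obtain ⟨h1, h2, h3⟩ := hs
  have hr : A.rule s.1 = A.dec s.1 := by rw [rule, h2]
  rw [A.act_of_mem ⟨h1, h2, h3⟩, h3, hr]
  simp only [NNReal.coe_zero, add_zero]
  rw [A.fee_eq H h1 h2]
  linarith [uS_sub (E := E) (A.dec s.1) s.1 θ]

theorem interim_tangent (x y : ℝ) : A.interim x + wt E * A.rule x * (y - x) ≤ A.interim y := by
  have := mul_le_mul_of_nonneg_left (A.area_tangent x y) (wt_pos (E := E)).le
  unfold interim; linarith

theorem sig_payoff {θ₀ : ℝ} (H : Crossing E θ₀) {θ : ℝ} (hθ : θ ∈ Icc (0:ℝ) 1) :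
    E.uS (A.act (A.sig θ)) θ - ((A.sig θ).2.1 + (A.sig θ).2.2) = A.interim θ := by
  rw [A.signal_payoff H (A.sig_mem θ)]
  have h1 := A.interim_tangent (A.msg θ) θ
  have h2 := A.interim_tangent θ (A.msg θ)
  have h3 : A.rule (A.msg θ) = A.rule θ := by rw [rule, rule, A.postMean_msg, A.msg_eq hθ]
  rw [← h3] at h2
  change A.interim (A.msg θ) + wt E * A.rule (A.msg θ) * (θ - A.msg θ) = _
  linarith

open Classical in
noncomputable def bel : Kernel Signal ℝ :=
  Kernel.piecewise A.measurableSet_onPath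
    (Kernel.comap ⟨condMean E A.P, measurable_condMean A.isPool⟩ Prod.fst measurable_fst)
    (Kernel.const _ (Measure.dirac A.punish.1))

theorem bel_of_mem {s : Signal} (h : s ∈ A.onPath) : A.bel s = condMean E A.P s.1 := by
  classical
  rw [bel, Kernel.piecewise_apply, if_pos h]; rfl

theorem bel_of_notMem {s : Signal} (h : s ∉ A.onPath) : A.bel s = Measure.dirac A.punish.1 := by
  classical
  rw [bel, Kernel.piecewise_apply, if_neg h]; rfl

theorem measurable_sig : Measurable A.sig :=
  A.measurable_msg.prodMk ((A.measurable_fee.comp A.measurable_msg).prodMk measurable_const)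

theorem prob_bel (s : Signal) : IsProbabilityMeasure (A.bel s) := by
  have := Fact.mk A.isPool
  by_cases h : s ∈ A.onPath
  · rw [A.bel_of_mem h]; infer_instance
  · rw [A.bel_of_notMem h]; infer_instance

theorem bayes_bel : E.prior.map (fun θ => (A.sig θ, θ)) = (E.prior.map A.sig).compProd A.bel := by
  have hM : IsMarkovKernel A.bel := ⟨A.prob_bel⟩
  have hs := A.measurable_sig
  have hp : Measurable fun θ => (A.sig θ, θ) := hs.prodMk measurable_id
  have : IsProbabilityMeasure (E.prior.map fun θ => (A.sig θ, θ)) :=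
    Measure.isProbabilityMeasure_map hp.aemeasurable
  refine Measure.ext_prod fun {S T} hS hT => ?_
  rw [Measure.compProd_apply_prod hS hT, Measure.map_apply hp (hS.prod hT),
    Measure.restrict_map hs hS, lintegral_map (A.bel.measurable_coe hT) hs]
  have hS' : MeasurableSet {m : ℝ | (m, ((A.fee m, 0) : Pay)) ∈ S} :=
    (measurable_id.prodMk (A.measurable_fee.prodMk measurable_const)) hS
  have h1 := lintegral_condMean (E := E) A.isPool hS' hT
  have e : (A.sig ⁻¹' S : Set ℝ) =ᵐ[E.prior]
      E.postMean A.P ⁻¹' {m : ℝ | (m, ((A.fee m, 0) : Pay)) ∈ S} := by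
    filter_upwards [ae_mem E] with θ hθ
    refine propext ?_
    change (A.msg θ, (A.fee (A.msg θ), 0)) ∈ S ↔ _
    rw [A.msg_eq hθ]; rfl
  rw [Measure.restrict_congr_set e]
  have e2 : ∫⁻ θ in E.postMean A.P ⁻¹' {m : ℝ | (m, ((A.fee m, 0) : Pay)) ∈ S}, A.bel (A.sig θ) T ∂E.prior =
      ∫⁻ θ in E.postMean A.P ⁻¹' {m : ℝ | (m, ((A.fee m, 0) : Pay)) ∈ S},
        condMean E A.P (E.postMean A.P θ) T ∂E.prior := by
    refine lintegral_congr_ae (ae_restrict_of_ae ?_)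
    filter_upwards [ae_mem E] with θ hθ
    rw [A.bel_of_mem (A.sig_mem θ), ← A.msg_eq hθ]; rfl
  rw [e2, h1]
  exact measure_congr (e.inter (ae_eq_refl T))

/-- The pooling rule as a mode of play. -/
noncomputable def toMode {θ₀ : ℝ} (H : Crossing E θ₀) : Mode E where
  sig := A.sig
  act := A.act
  bel := A.bel
  sig_meas := A.measurable_sig
  act_meas := Measurable.ite A.measurableSet_onPath (A.mono.measurable.comp measurable_fst)
    measurable_const
  bounded := by
    have hc : Continuous A.interim := (A.continuous_area.const_mul _).const_add _
    obtain ⟨C, hC⟩ := isCompact_Icc.exists_bound_of_continuousOn (s := Icc (0:ℝ) 1) hc.continuousOn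
    have hD : ∀ m ∈ Icc (0:ℝ) 1, |A.dec m| ≤ |A.dec 0| + |A.dec 1| := fun m hm => by
      have h1 := A.mono hm.1
      have h2 := A.mono hm.2
      rw [abs_le]
      constructor
      · linarith [neg_abs_le (A.dec 0), abs_nonneg (A.dec 1)]
      · linarith [le_abs_self (A.dec 1), abs_nonneg (A.dec 0)]
    obtain ⟨B, hB⟩ := exists_stage_bound E .sender (|A.dec 0| + |A.dec 1|).toNNReal
    refine ⟨max (B + C).toNNReal (|A.dec 0| + |A.dec 1| + |A.punish.2|).toNNReal,
      fun θ => ⟨?_, zero_le⟩, fun s => ?_⟩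
    · refine le_trans (Real.toNNReal_le_toNNReal ?_) (le_max_left _ _)
      have h1 := hB (A.msg θ) (A.msg_mem θ) (0, 0, 0, A.dec (A.msg θ), 0)
        ⟨zero_le, zero_le, zero_le, zero_le, (hD _ (A.msg_mem θ)).trans (Real.le_coe_toNNReal _),
          zero_le, zero_le⟩
      have h2 := hC (A.msg θ) (A.msg_mem θ)
      have e : stagePayoff E .sender (A.msg θ) (0, 0, 0, A.dec (A.msg θ), 0) =
        E.uS (A.dec (A.msg θ)) (A.msg θ) - (net 0 0 + net 0 0 + net 0 0) := rfl
      rw [e, Design.net_zero_zero] at h1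
      rw [Real.norm_eq_abs] at h2
      linarith [(abs_le.1 h1).2, (abs_le.1 h2).1]
    · refine le_trans ?_ ((Real.le_coe_toNNReal _).trans (NNReal.coe_le_coe.2 (le_max_right _ _)))
      unfold act
      split_ifs with h
      · exact (hD _ h.1).trans (by linarith [abs_nonneg A.punish.2])
      · linarith [abs_nonneg (A.dec 0), abs_nonneg (A.dec 1)]
  prob := A.prob_bel
  support s := by
    have := A.prob_bel s
    refine le_antisymm prob_le_one ?_
    by_cases h : s ∈ A.onPath
    · rw [A.bel_of_mem h, ← condMean_fiber A.isPool h.1 h.2.1]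
      exact measure_mono fun t ht => ht.1
    · rw [A.bel_of_notMem h]
      exact (Measure.dirac_apply_of_mem A.punish_mem).ge
  bayes := A.bayes_bel
  fiber θ hθ := by
    have := A.prob_bel (A.sig θ)
    refine le_antisymm prob_le_one ?_
    rw [A.bel_of_mem (A.sig_mem θ), ← condMean_fiber A.isPool (A.msg_mem θ) (A.postMean_msg θ)]
    refine measure_mono ?_
    rintro t ⟨ht, he⟩
    refine ⟨ht, ?_⟩
    rw [sig, sig, A.msg_eq ht, he]
  ic s θ hθ := by
    rw [A.sig_payoff H hθ]
    by_cases h : s ∈ A.onPath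
    · rw [A.signal_payoff H h]; exact A.interim_tangent _ _
    · have h1 : (0:ℝ) ≤ s.2.1 := s.2.1.2
      have h2 : (0:ℝ) ≤ s.2.2 := s.2.2.2
      have := A.punish_le hθ
      rw [act, if_neg h]; linarith

variable {θ₀ : ℝ} (H : Crossing E θ₀)

theorem toMode_close (s : Signal) : |(A.toMode H).act s - E.prefR ((A.toMode H).mean s)| ≤ A.ℓ := by
  by_cases h : s ∈ A.onPath
  · have e : (A.toMode H).mean s = s.1 := by
      change ∫ t, t ∂A.bel s = _
      rw [A.bel_of_mem h]; exact integral_condMean _ h.2.1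
    rw [e]
    change |A.act s - _| ≤ _
    rw [A.act_of_mem h]; exact A.close _
  · have e : (A.toMode H).mean s = A.punish.1 := by
      change ∫ t, t ∂A.bel s = _
      rw [A.bel_of_notMem h, integral_dirac]
    rw [e]
    change |A.act s - _| ≤ _
    rw [act, if_neg h]; exact A.punish_close

theorem toMode_pay_sender : (A.toMode H).pay .sender = A.base + wt E * ∫ θ, A.area θ ∂E.prior := by
  have h1 : (A.toMode H).pay .sender = ∫ θ, A.interim θ ∂E.prior := by
    refine integral_congr_ae ?_
    filter_upwards [ae_mem E] with θ hθ
    rw [Design.stage_sender_record]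
    exact A.sig_payoff H hθ
  rw [h1]
  unfold interim
  rw [integral_add (integrable_const _) ((integrable_of_continuous E A.continuous_area).const_mul _),
    integral_const_mul]
  simp

theorem toMode_pay_add : (A.toMode H).pay .sender + (A.toMode H).pay .receiver =
    ∫ θ, E.u (A.rule θ) (E.postMean A.P θ) ∂E.prior := by
  rw [← integral_u_eq_postMean A.isPool A.rule_mono.measurable
    (C := max |E.b - A.ℓ| |E.a + E.b + A.ℓ|)
    (fun θ hθ => abs_le_max_abs_abs (A.rule_mem hθ).1 (A.rule_mem hθ).2)
    (fun θ _ t ht => by rw [rule, rule, postMean_eq_of_mem ht]), Mode.pay, Mode.pay,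
    ← integral_add ((A.toMode H).integrable_stage _) ((A.toMode H).integrable_stage _)]
  refine integral_congr_ae ?_
  filter_upwards [ae_mem E] with θ hθ
  have e1 : stagePayoff E .receiver θ ((A.toMode H).record θ) = E.uR (A.act (A.sig θ)) θ -
    (net 0 0 + net 0 (A.sig θ).2 + net 0 0) := rfl
  have e2 : A.act (A.sig θ) = A.rule θ := by
    rw [A.act_of_mem (A.sig_mem θ), rule, ← A.msg_eq hθ]; rfl
  rw [Design.stage_sender_record, e1]
  change E.uS (A.act (A.sig θ)) θ - ((A.sig θ).2.1 + (A.sig θ).2.2) + _ = _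
  rw [e2]
  have e3 : (A.sig θ).2.2 = 0 := rfl
  rw [e3]
  simp only [net, Environment.uS, Prod.fst_zero, Prod.snd_zero, NNReal.coe_zero]
  ring

end PoolRule

end Pooling

/-! ### The lower bound on the surplus -/

section LowerBound

variable {E : Environment} {δ θ₀ : ℝ}

/-- The second-best decision: the closest one to `x` within `ℓ` of the receiver's preferred one. -/
noncomputable def clipRule (P : Set ℝ) (hP : IsPoolingSet P) {ℓ : ℝ} (hℓ : 0 ≤ ℓ) : PoolRule E where
  P := P
  isPool := hP
  dec x := max (E.prefR x - ℓ) (min (E.prefR x + ℓ) x)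
  mono := by
    have h : Monotone E.prefR := fun x y hxy => by
      unfold Environment.prefR; nlinarith [E.a_pos]
    exact (h.add_const (-ℓ)).max ((h.add_const ℓ).min monotone_id)
  ℓ := ℓ
  nonneg := hℓ
  close x := by
    rw [abs_le]
    constructor
    · linarith [le_max_left (E.prefR x - ℓ) (min (E.prefR x + ℓ) x)]
    · linarith [max_le (by linarith : E.prefR x - ℓ ≤ E.prefR x + ℓ) (min_le_left (E.prefR x + ℓ) x)]

/-- The decision differs from the receiver's preferred one by the constant `k`. -/
noncomputable def shiftRule (P : Set ℝ) (hP : IsPoolingSet P) (k : ℝ) : PoolRule E where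
  P := P
  isPool := hP
  dec x := E.prefR x + k
  mono x y hxy := by
    simp only [Environment.prefR]; nlinarith [E.a_pos]
  ℓ := |k|
  nonneg := abs_nonneg k
  close x := by simp

theorem clipRule_pay (H : Crossing E θ₀) {P : Set ℝ} (hP : IsPoolingSet P) {ℓ : ℝ} (hℓ : 0 ≤ ℓ) :
    ((clipRule P hP hℓ).toMode H).pay .sender + ((clipRule P hP hℓ).toMode H).pay .receiver =
      poolVal E (sbVal (E.a - 1) θ₀ (ℓ / (E.a - 1))) P := by
  have ha := H.ha
  rw [PoolRule.toMode_pay_add, poolVal]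
  congr 1; funext θ
  change E.u (max (E.prefR (E.postMean P θ) - ℓ) (min (E.prefR (E.postMean P θ) + ℓ) (E.postMean P θ)))
    (E.postMean P θ) = _
  generalize E.postMean P θ = x
  rw [sbVal_div (by linarith), ← abs_of_pos (show 0 < E.a - 1 by linarith), ← abs_mul, ← H.prefR_sub]
  generalize E.prefR x = y
  unfold Environment.u
  rcases le_total (y + ℓ) x with h | h
  · rw [min_eq_left h, max_eq_right (by linarith), abs_of_nonpos (by linarith),
      max_eq_left (by linarith)]
    ring
  · rw [min_eq_right h]
    rcases le_total (y - ℓ) x with h' | h'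
    · rw [max_eq_right h', max_eq_right (by rw [sub_nonpos, abs_le]; constructor <;> linarith)]
      ring
    · rw [max_eq_left h', abs_of_nonneg (by linarith), max_eq_left (by linarith)]
      ring

theorem shiftRule_area {P : Set ℝ} (hP : IsPoolingSet P) (k θ : ℝ) :
    (shiftRule (E := E) P hP k).area θ = E.a * (∫ t in (0:ℝ)..θ, E.postMean P t) + (E.b + k) * θ := by
  have := intervalIntegral_prefR_postMean (E := E) hP 0 θ k
  rw [sub_zero] at this
  exact this

theorem integral_shiftRule_area {P : Set ℝ} (hP : IsPoolingSet P) (k : ℝ) :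
    ∫ θ, (shiftRule (E := E) P hP k).area θ ∂E.prior = E.a * lowArea E P + (E.b + k) * mean E := by
  rw [funext (shiftRule_area hP k), integral_add ((integrable_lowPrim hP).const_mul _)
    (integrable_id'.const_mul _), integral_const_mul, integral_const_mul]
  rfl

theorem shiftRule_pay_low (H : Crossing E θ₀) {P : Set ℝ} (hP : IsPoolingSet P) {ℓ : ℝ} (hℓ : 0 ≤ ℓ) :
    ((shiftRule P hP (-ℓ)).toMode H).pay .sender ≤ guardLow E (lowArea E P) ℓ := by
  rw [PoolRule.toMode_pay_sender, integral_shiftRule_area]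
  have h : (shiftRule (E := E) P hP (-ℓ)).ℓ = ℓ := by
    change |-ℓ| = ℓ; rw [abs_neg, abs_of_nonneg hℓ]
  have := min_le_left (E.uS (E.b - (shiftRule (E := E) P hP (-ℓ)).ℓ) 0)
    (E.uS (E.a + E.b + (shiftRule (E := E) P hP (-ℓ)).ℓ) 1 - wt E * (shiftRule (E := E) P hP (-ℓ)).area 1)
  rw [h] at this
  unfold PoolRule.base guardLow
  rw [h, sub_eq_add_neg E.b]
  rw [sub_eq_add_neg E.b] at this
  linarith

theorem shiftRule_pay_high (H : Crossing E θ₀) {P : Set ℝ} (hP : IsPoolingSet P) {ℓ : ℝ} (hℓ : 0 ≤ ℓ) :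
    ((shiftRule P hP ℓ).toMode H).pay .sender ≤ guardHigh E (highArea E P) ℓ := by
  rw [PoolRule.toMode_pay_sender, integral_shiftRule_area]
  have h : (shiftRule (E := E) P hP ℓ).ℓ = ℓ := abs_of_nonneg hℓ
  have := min_le_right (E.uS (E.b - (shiftRule (E := E) P hP ℓ).ℓ) 0)
    (E.uS (E.a + E.b + (shiftRule (E := E) P hP ℓ).ℓ) 1 - wt E * (shiftRule (E := E) P hP ℓ).area 1)
  have e : highArea E P = (∫ t in (0:ℝ)..1, E.postMean P t) - lowArea E P := by
    unfold highArea
    rw [funext (highPrim_eq hP), integral_sub (integrable_const _) (integrable_lowPrim hP)]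
    simp [lowArea]
  rw [h, shiftRule_area] at this
  unfold PoolRule.base guardHigh
  rw [h, e, shiftRule_area]
  linarith

/-- Modes that almost attain the sender's worst payoff. -/
theorem exists_punishing_mode (H : Crossing E θ₀) {ℓ ε : ℝ} (hℓ : 0 ≤ ℓ) (hε : 0 < ε) :
    ∃ M : Mode E, (∀ s, |M.act s - E.prefR (M.mean s)| ≤ ℓ) ∧
      M.pay .sender ≤ min (guardLow E (lowInf E) ℓ) (guardHigh E (highSup E) ℓ) + ε := by
  have hwa : 0 < wt E * E.a := mul_pos wt_pos E.a_pos
  have hη : wt E * E.a * (ε / (wt E * E.a)) = ε := mul_div_cancel₀ _ hwa.ne'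
  have hη0 : 0 < ε / (wt E * E.a) := div_pos hε hwa
  rcases le_total (guardLow E (lowInf E) ℓ) (guardHigh E (highSup E) ℓ) with h | h
  · rw [min_eq_left h]
    obtain ⟨Q, hQ, hlt⟩ := exists_lowArea_lt (show lowInf E < lowInf E + ε / (wt E * E.a) by linarith)
    refine ⟨(shiftRule Q hQ (-ℓ)).toMode H, fun s => ?_, (shiftRule_pay_low H hQ hℓ).trans ?_⟩
    · have := (shiftRule Q hQ (-ℓ)).toMode_close H s
      rwa [show (shiftRule (E := E) Q hQ (-ℓ)).ℓ = ℓ from by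
        change |-ℓ| = ℓ; rw [abs_neg, abs_of_nonneg hℓ]] at this
    · have := mul_le_mul_of_nonneg_left hlt.le hwa.le
      unfold guardLow
      linarith
  · rw [min_eq_right h]
    obtain ⟨Q, hQ, hlt⟩ := exists_lt_highArea (show highSup E - ε / (wt E * E.a) < highSup E by linarith)
    refine ⟨(shiftRule Q hQ ℓ).toMode H, fun s => ?_, (shiftRule_pay_high H hQ hℓ).trans ?_⟩
    · have := (shiftRule Q hQ ℓ).toMode_close H s
      rwa [show (shiftRule (E := E) Q hQ ℓ).ℓ = ℓ from abs_of_nonneg hℓ] at this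
    · have := mul_le_mul_of_nonneg_left hlt.le hwa.le
      unfold guardHigh
      linarith

theorem le_surplus (H : Crossing E θ₀) (hδ : δ ∈ Ioo (0:ℝ) 1) {ℓ : ℝ} (hℓ : 0 < ℓ)
    (hlt : E.c * ℓ ^ 2 / 2 < δ / (1 - δ) * maxSurplus E θ₀ ℓ) :
    ((E.c * ℓ ^ 2 / 2 : ℝ) : EReal) ≤ surplus E δ := by
  have hδ1 : 0 < 1 - δ := by linarith [hδ.2]
  have hκ : 0 < δ / (1 - δ) := div_pos hδ.1 hδ1
  set g := min (guardLow E (lowInf E) ℓ) (guardHigh E (highSup E) ℓ) with hg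
  set ε := (maxSurplus E θ₀ ℓ - E.c * ℓ ^ 2 / 2 / (δ / (1 - δ))) / 2 with hεdef
  have hε : 0 < ε := by
    rw [← div_lt_iff₀' hκ] at hlt
    rw [hεdef]; linarith
  obtain ⟨P, hP, hPv⟩ := exists_lt_poolVal (E := E) (θ₀ := θ₀) (ℓ := ℓ)
    (show bestVal E θ₀ ℓ - ε < bestVal E θ₀ ℓ by linarith)
  obtain ⟨M, hM, hMv⟩ := exists_punishing_mode H hℓ.le hε
  have hC := (clipRule P hP hℓ.le).toMode_close H
  have hJ := clipRule_pay H hP hℓ.le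
  set C := (clipRule P hP hℓ.le).toMode H
  obtain ⟨C', hC', hle, hC'v⟩ : ∃ C' : Mode E, (∀ s, |C'.act s - E.prefR (C'.mean s)| ≤ ℓ) ∧
      C'.pay .sender ≤ C.pay .sender ∧ C'.pay .sender ≤ g + ε := by
    rcases le_total (M.pay .sender) (C.pay .sender) with h | h
    · exact ⟨M, hM, h, hMv⟩
    · exact ⟨C, hC, le_rfl, h.trans hMv⟩
  have hgap : E.c * ℓ ^ 2 / 2 ≤ δ / (1 - δ) *
      (C.pay .sender + C.pay .receiver - C'.pay .sender - (babbleMode E).pay .receiver) := by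
    rw [← div_le_iff₀' hκ, hJ, babbleMode_pay]
    have : maxSurplus E θ₀ ℓ = bestVal E θ₀ ℓ - g - babble E := rfl
    have h2 : E.c * ℓ ^ 2 / 2 / (δ / (1 - δ)) = maxSurplus E θ₀ ℓ - 2 * ε := by rw [hεdef]; ring
    rw [h2, this]
    linarith
  have hT : ((C.pay .sender - C'.pay .sender).toNNReal : ℝ) = C.pay .sender - C'.pay .sender :=
    Real.coe_toNNReal _ (by linarith)
  have henf : ∀ d m : ℝ, |d - E.prefR m| ≤ ℓ → (1 - δ) * E.temptation d m ≤ δ * (C.pay .receiver +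
      ((C.pay .sender - C'.pay .sender).toNNReal : ℝ) - (babbleMode E).pay .receiver) := by
    intro d m h
    rw [temptation_eq, hT]
    have h1 := pow_le_pow_left₀ (abs_nonneg _) h 2
    rw [sq_abs] at h1
    have h2 := mul_le_mul_of_nonneg_left h1 E.c_pos.le
    rw [div_mul_eq_mul_div, le_div_iff₀ hδ1] at hgap
    nlinarith
  let A : Design E δ :=
    { N := babbleMode E
      C := C
      C' := C'
      T := (C.pay .sender - C'.pay .sender).toNNReal
      hδ := ⟨hδ.1.le, hδ.2⟩
      indiff := by rw [hT]; ring
      static := fun s => rfl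
      enforce := fun s => henf _ _ (hC s)
      enforce' := fun s => henf _ _ (hC' s) }
  exact (EReal.coe_le_coe_iff.2 hgap).trans A.le_surplus

end LowerBound

end RelComm

theorem proposition7 (E : RelComm.Environment) (hresp : E.HighlyResponsive)
    (θ₀ : ℝ) (hθ₀ : θ₀ ∈ Set.Ico (1 / 2 : ℝ) 1) (hcross : E.prefR θ₀ = E.prefFB θ₀) :
    ∃ δA ∈ Set.Ioo (0 : ℝ) 1, ∃ δB ∈ Set.Ioo (0 : ℝ) 1, ∃ θL θH : ℝ → ℝ,
      -- the structure of the set of extreme states, which determines `δA` and `δB`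
      (δB ≤ δA ∧ (δA = δB ↔ θ₀ = 1 / 2)) ∧
      (∀ δ ∈ Set.Ioo δA 1, RelComm.extremeStates E δ = ∅) ∧
      (∀ δ ∈ Set.Ioo δB δA, θL δ ∈ Set.Ioo 0 1 ∧
        RelComm.extremeStates E δ = Set.Ico 0 (θL δ)) ∧
      (∀ δ ∈ Set.Ioo 0 δB, θL δ ∈ Set.Ioo 0 1 ∧ θH δ ∈ Set.Ioo 0 1 ∧ θL δ < θH δ ∧
        RelComm.extremeStates E δ = Set.Ico 0 (θL δ) ∪ Set.Ioc (θH δ) 1) ∧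
      -- the thresholds and the optimal pooling set
      ∃ δB' ∈ Set.Ioo (0 : ℝ) 1, ∃ δC' ∈ Set.Ioo (0 : ℝ) 1, ∃ δD' ∈ Set.Ioo (0 : ℝ) 1,
      ∃ θL' θH' : ℝ → ℝ,
        ((δB ≤ δD' ∧ δD' = δC' ∧ δC' = δB' ∧ δB' < δA) ∨
          (δD' < δC' ∧ δC' < δB' ∧ δB' = δB)) ∧
        (∀ δ ∈ Set.Ioo δA 1, RelComm.IsTheOptimalPooling E δ ∅) ∧
        (∀ δ ∈ Set.Ioo δB' δA, θL' δ ∈ Set.Ioo (θL δ) 1 ∧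
          RelComm.IsTheOptimalPooling E δ (Set.Ico 0 (θL' δ))) ∧
        (δC' < δB' → δB' < δA → RelComm.IsTheOptimalPooling E δB' (Set.Ico 0 (θL' δB'))) ∧
        (∀ δ ∈ Set.Ioo δC' δB',
          θL' δ ∈ Set.Ioo (θL δ) (θH δ) ∧ θH' δ ∈ Set.Ioo (θL δ) (θH δ) ∧ θL' δ < θH' δ ∧
          RelComm.IsTheOptimalPooling E δ (Set.Ico 0 (θL' δ) ∪ Set.Ioc (θH' δ) 1)) ∧
        (∀ δ ∈ Set.Ioo δD' δC',
          (∃ θM ∈ Set.Ioo (0 : ℝ) 1,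
            RelComm.IsOptimalPooling E δ (Set.Ico 0 θM ∪ Set.Ioc θM 1)) ∧
          ∀ P, RelComm.IsOptimalPooling E δ P → ∃ θM ∈ Set.Ioo (0 : ℝ) 1,
            P ∩ Set.Ioo 0 1 = (Set.Ico 0 θM ∪ Set.Ioc θM 1) ∩ Set.Ioo 0 1) ∧
        (∀ δ ∈ Set.Ico 0 δD', RelComm.IsTheOptimalPooling E δ (Set.Icc 0 1)) ∧
        -- comparative statics of the two interior thresholds
        StrictAntiOn θL' (Set.Ioo δC' δA) ∧
        StrictMonoOn θH' (Set.Ioo δC' δB') ∧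
        ((∃ K : ℝ, ∀ θ ∈ Set.Icc (0 : ℝ) 1, E.f θ ≤ K) →
          (∀ δ ∈ Set.Ioo δC' δA,
            ∃ r > 0, ∀ᶠ δ' in nhdsWithin δ {δ}ᶜ, slope θL' δ δ' ≤ -r) ∧
          (∀ δ ∈ Set.Ioo δC' δB',
            ∃ r > 0, ∀ᶠ δ' in nhdsWithin δ {δ}ᶜ, r ≤ slope θH' δ δ')) ∧
        -- the jump to complete pooling in the symmetric uniform case
        ((∀ θ ∈ Set.Icc (0 : ℝ) 1, E.f θ = 1) → θ₀ = 1 / 2 →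
          ∀ δ ∈ Set.Ioo δD' δC', ∀ θM ∈ Set.Ioo (0 : ℝ) 1,
            RelComm.IsOptimalPooling E δ (Set.Ico 0 θM ∪ Set.Ioc θM 1) → θM = 1 / 2) := by
  have hfb : deriv E.prefFB θ₀ = 1 := by
    rw [show E.prefFB = fun θ => θ from rfl]; exact deriv_id θ₀
  have hr : deriv E.prefR θ₀ = E.a := by
    rw [show E.prefR = fun θ => E.a * θ + E.b from rfl]; simp
  have h2 := hresp θ₀ ⟨by linarith [hθ₀.1], hθ₀.2.le⟩
  rw [hfb, hr] at h2
  have H : RelComm.Crossing E θ₀ := ⟨by linarith, hcross, hθ₀⟩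
  obtain ⟨ph, lam, R⟩ := H.exists_radiusMap (fun δ hδ ℓ hℓ h => RelComm.le_surplus H hδ hℓ h)
    fun δ hδ L _ hL => RelComm.surplus_le H hδ hL
  exact RelComm.statics_of_radiusMap H R
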